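/- Let $q\in\mathbb{C}$ with $0<|q|<1$. **Oscillators.** The Bose $q$-oscillator is generated by $a^\pm$ and $N$ with $a^+a^-=1-q^{2N}$, $a^-a^+=1-q^{2N+2}$, $[N,a^\pm]=\pm a^\pm$, $k=q^N$. It acts either in the Fock representation ($\mathrm{Spec}\,N=\{0,1,2,\dots\}$, $a^-|0\rangle=0$) or in the anti-Fock representation ($\mathrm{Spec}\,N=\{-1,-2,\dots\}$, $a^+|-1\rangle=0$). The Fermi oscillator is $f^+f^-+f^-f^+=1-q^2$, $(f^\pm)^2=0$, $[M,f^\pm]=\pm f^\pm$, $\mathrm{Spec}\,M=\{0,1\}$, $k=q^M$, acting in its two-dimensional Fock space; $f^\pm$ at different sites anticommute, and Bose operators commute with all operators at other sites. For $\lambda,\mu\in\mathbb{C}^\times$ put $$X[\mathcal A(q)]=\begin{pmatrix}\lambda k&a^+\\ \lambda\mu a^-&-q\mu k\end{pmatrix},\quad X[\mathcal A(q^{-1})]=\begin{pmatrix}q\lambda k&a^-\\ \lambda\mu a^+&-\mu k\end{pmatrix},$$ $$X[\mathcal F(q)]=\begin{pmatrix}\lambda k&f^+\\ \lambda\mu f^-&-q\mu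 k^{-1}\end{pmatrix},\quad X[\mathcal F(q^{-1})]=\begin{pmatrix}q^{-1}\lambda k&q^{-1}f^-\\ -q^{-1}\lambda\mu f^+&-\mu k^{-1}\end{pmatrix}.$$ Let $X_{\alpha\beta},X_{\alpha\gamma},X_{\beta\gamma}$ be the $3\times3$ operator matrices obtained by placing $X$ in the indicated $2\times2$ block of $\alpha\oplus\beta\oplus\gamma$ and completing by $1$. Oscillators $\mathcal C_1,\mathcal C_2,\mathcal C_3$ sit in the three factors of a tensor product, with parameters $\lambda_j,\mu_j\ne0$; put $u=\lambda_3/\lambda_2$, $v=\lambda_1\mu_3$, $w=\mu_1/\mu_2$. Let $\mathcal N_j=N_j,-N_j,M_j,-M_j$ for $\mathcal C_j=\mathcal A(q),\mathcal A(q^{-1}),\mathcal F(q),\mathcal F(q^{-1})$ respectively. **Constant operators.** With $K_j=q^{N_j}$, $$\mathsf R_{FFA}=(1-M_1)(1-M_2)+qM_1(1-M_2)K_3-(1-M_1)M_2K_3-M_1M_2+\frac{f_1^+f_2^-a_3^--f_1^-f_2^+a_3^+}{1-q^2},$$ $$\mathsf R_{AFF}=(1-M_2)(1-M_3)-qK_1M_2(1-M_3)+K_1(1-M_2)M_3-M_2M_3+\frac{a_1^-f_2^+f_3^--a_1^+f_2^-f_3^+}{1-q^2},$$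 $$\mathsf R_{FAF}=(-q)^{-N_2}\Bigl((1-M_1)K_2(1-M_3)+q^{-1}M_1(1-M_3)+(1-M_1)M_3+M_1K_2M_3+\frac{q^{-1}f_1^+a_2^-f_3^--f_1^-a_2^+f_3^+}{1-q^2}\Bigr),$$ $$\mathsf R_{AAA}=R_0(N_1,N_2,N_3)+\sum_{k\ge1}\bigl(R_k(N_1,N_2,N_3)(a_1^-a_2^+a_3^-)^k+(a_1^+a_2^-a_3^+)^kR_k(N_1,N_2,N_3)\bigr),$$ the last one being understood through its matrix elements in the occupation number basis. The $R_k$ are given by the following three generating functions, where $(x;q^2)_\infty=\prod_{i\ge0}(1-xq^{2i})$: $$\mathrm{Tr}_1\bigl(z^{N_1}(a_1^-)^k(a_1^+)^kR_k\bigr)=G_k(N_2,N_3;z),\qquad \mathrm{Tr}_3\bigl(z^{N_3}(a_3^-)^k(a_3^+)^kR_k\bigr)=G_k(N_2,N_1;z),$$ $$G_k(m,n;z)=z^{m-k}\frac{(q^{n-m+k+2}z^{-1};q^2)_\infty\,(q^{n+m+k+2}z;q^2)_\infty}{(q^{n+m-k+2}z^{-1};q^2)_\infty\,(q^{n-m+k}z;q^2)_\infty},$$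 $$\mathrm{Tr}_2\bigl(z^{N_2}(a_2^-)^kR_k(a_2^+)^k\bigr)=q^{N_1N_3}\frac{(-q^{1-N_1-N_3}z;q^2)_\infty(-q^{3+N_1+N_3+2k}z;q^2)_\infty}{(-q^{1-N_1+N_3}z;q^2)_\infty(-q^{1+N_1-N_3}z;q^2)_\infty}.$$ Each identity is imposed for all $k\ge0$ and all occupation numbers of the two untraced sites for which $N_1+k$, $N_2-k$, $N_3+k$ (those of the two untraced sites) again lie in the spectra. The trace over site $j$ denotes the expansion near $z=0$, $F(z)=\sum_{n\ge0}z^n(\cdots)$, if site $j$ is in the Fock representation, and the expansion near $z=\infty$, $F(z)=-\sum_{n<0}z^n(\cdots)$, if it is in the anti-Fock representation. **Claims.** For every choice of Fock or anti-Fock representation of each Bose factor: 1. A family $(R_k)_{k\ge0}$ satisfying the first generating function identity exists, and for every family $(R_k)$ the three generating function identities are equivalent to each other. 2. For all $\lambda_j,\mu_j\neq0$, the operator $R=v^{\mathcal N_2}\,\mathsf R\,u^{\mathcal N_1}w^{\mathcal N_3}$ satisfies $$X_{\alpha\beta}[\mathcal C_1]X_{\alpha\gamma}[\mathcal C_2]X_{\beta\gamma}[\mathcal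 C_3]\,R=R\,X_{\beta\gamma}[\mathcal C_3]X_{\alpha\gamma}[\mathcal C_2]X_{\alpha\beta}[\mathcal C_1]$$ in each of the eight cases (underlined lines are odd) | pattern | $(\mathcal C_1,\mathcal C_2,\mathcal C_3)$ | $\mathsf R$ | |---|---|---| | $\alpha\beta\gamma$ | $\mathcal A(q),\mathcal A(q),\mathcal A(q)$ | $\mathsf R_{AAA}$ | | $\underline{\alpha\beta\gamma}$ | $\mathcal A(q^{-1}),\mathcal A(q^{-1}),\mathcal A(q^{-1})$ | $\mathsf R_{AAA}$ | | $\underline\alpha\beta\gamma$ | $\mathcal F(q^{-1}),\mathcal F(q^{-1}),\mathcal A(q)$ | $\mathsf R_{FFA}$ | | $\alpha\underline{\beta\gamma}$ | $\mathcal F(q),\mathcal F(q),\mathcal A(q^{-1})$ | $\mathsf R_{FFA}$ | | $\alpha\beta\underline\gamma$ | $\mathcal A(q),\mathcal F(q),\mathcal F(q)$ | $\mathsf R_{AFF}$ | | $\underline{\alpha\beta}\gamma$ | $\mathcal A(q^{-1}),\mathcal F(q^{-1}),\mathcal F(q^{-1})$ | $\mathsf R_{AFF}$ | | $\alpha\underline\beta\gamma$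 | $\mathcal F(q),\mathcal A(q),\mathcal F(q^{-1})$ | $\mathsf R_{FAF}$ | | $\underline\alpha\beta\underline\gamma$ | $\mathcal F(q^{-1}),\mathcal A(q^{-1}),\mathcal F(q)$ | $\mathsf R_{FAF}$ | 3. In the patterns $\alpha\beta\gamma$, $\underline\alpha\beta\gamma$, $\alpha\beta\underline\gamma$ and $\alpha\underline\beta\gamma$ the intertwiner is unique up to a scalar factor (among all infinite matrices in the occupation number basis in the first pattern, among all linear operators on the tensor product of Fock spaces in the other three). 4. $\mathsf R_{FFA}^2=\mathsf R_{AFF}^2=\mathsf R_{FAF}^2=1$, and $\mathsf R_{AAA}^2=1$ (as a product of infinite matrices) whenever the representation in the second factor coincides with that in the first or with that in the third factor. -/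

import Mathlib

open scoped Matrix

/-- The two representations of the Bose `q`-oscillator: the Fock one (occupation numbers
`0, 1, 2, …`, vacuum killed by `a⁻`) and the anti-Fock one (occupation numbers `-1, -2, -3, …`,
anti-vacuum killed by `a⁺`). -/
inductive BoseRep
  | fock
  | antiFock

/-- The kind of oscillator sitting at a tensor factor. -/
inductive Osc
  | bose (r : BoseRep)
  | fermi

/-- The spectrum of the occupation number operator. -/
def Osc.spectrum : Osc → Set ℤ
  | .bose .fock => {n | 0 ≤ n}
  | .bose .antiFock => {n | n < 0}
  | .fermi => {n | n = 0 ∨ n = 1}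

/-- Basis states `|n₁, n₂, n₃⟩` of the triple tensor product. -/
abbrev State (c : Fin 3 → Osc) : Type := {n : Fin 3 → ℤ // ∀ j, n j ∈ (c j).spectrum}

/-- The triple tensor product of Fock spaces: finite combinations of the basis states. -/
abbrev FockSpace (c : Fin 3 → Osc) : Type := State c →₀ ℂ

/-- The algebra of linear operators on the triple tensor product. -/
abbrev Op (c : Fin 3 → Osc) : Type := Module.End ℂ (FockSpace c)

noncomputable section

namespace Tetra

variable {c : Fin 3 → Osc}

/-- The matrix element `⟨n| A |m⟩`. -/
def matEl (A : Op c) (n m : State c) : ℂ := A (Finsupp.single m 1) n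

/-- The diagonal operator `|n⟩ ↦ f n • |n⟩`. -/
def diagOp (f : State c → ℂ) : Op c :=
  Finsupp.linearCombination ℂ fun n => Finsupp.single n (f n)

open Classical in
/-- The operator `|n⟩ ↦ f n • |n + d e_j⟩`, read as `0` if `n_j + d` is not in the spectrum at site `j`. -/
def shiftOp (j : Fin 3) (d : ℤ) (f : State c → ℂ) : Op c :=
  Finsupp.linearCombination ℂ fun n =>
    if h : ∀ i, (n.1 + (Pi.single j d : Fin 3 → ℤ)) i ∈ (c i).spectrum then
      Finsupp.single ⟨n.1 + (Pi.single j d : Fin 3 → ℤ), h⟩ (f n)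
    else 0

/-- The state obtained from `n` by replacing the occupation number at site `j` by `x`. -/
def setAt (n : State c) (j : Fin 3) (x : (c j).spectrum) : State c :=
  ⟨Function.update n.1 j x, fun i => by
    by_cases h : i = j
    · subst h
      simp
    · simpa [h] using n.2 i⟩

/-- The sign `∏ (-1)^{M_i}` over the Fermi sites `i < j`. It makes odd operators at different
Fermi sites anticommute, while Bose operators commute with everything at other sites. -/
def oddSign (j : Fin 3) (n : State c) : ℂ :=
  ∏ i : Fin 3, if i < j then
    (match c i with
      | .fermi => (-1 : ℂ) ^ (n.1 i)
      | .bose _ => 1)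
    else 1

/-- The creation operator at site `j`: `a⁺|n⟩ = (1 - q^{2n+2})|n+1⟩` at a Bose site and
`f⁺|0⟩ = |1⟩`, `f⁺|1⟩ = 0` (with the sign above) at a Fermi site. -/
def up (q : ℂ) (j : Fin 3) : Op c :=
  shiftOp j 1 fun n =>
    match c j with
      | .bose _ => 1 - q ^ (2 * n.1 j + 2)
      | .fermi => oddSign j n

/-- The annihilation operator at site `j`: `a⁻|n⟩ = |n-1⟩` at a Bose site (`0` on the Fock
vacuum) and `f⁻|1⟩ = (1 - q²)|0⟩`, `f⁻|0⟩ = 0` (with the sign above) at a Fermi site. -/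
def dn (q : ℂ) (j : Fin 3) : Op c :=
  shiftOp j (-1) fun n =>
    match c j with
      | .bose _ => 1
      | .fermi => oddSign j n * (1 - q ^ 2)

/-- The occupation number operator at site `j` (`N_j` or `M_j`). -/
def num (j : Fin 3) : Op c := diagOp fun n => (n.1 j : ℂ)

/-- The operator `x ^ N_j` (or `x ^ M_j`). -/
def pw (x : ℂ) (j : Fin 3) : Op c := diagOp fun n => x ^ (n.1 j)

/-- `X[A(q)]` at site `j` with parameters `l = λ_j`, `m = μ_j`; here `k = q ^ N_j`. -/
def XA (q l m : ℂ) (j : Fin 3) : Matrix (Fin 2) (Fin 2) (Op c) :=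
  !![l • pw q j, up q j; (l * m) • dn q j, (-(q * m)) • pw q j]

/-- `X[A(q⁻¹)]` at site `j`. -/
def XA' (q l m : ℂ) (j : Fin 3) : Matrix (Fin 2) (Fin 2) (Op c) :=
  !![(q * l) • pw q j, dn q j; (l * m) • up q j, (-m) • pw q j]

/-- `X[F(q)]` at site `j`; here `k⁻¹ = (q⁻¹) ^ M_j`. -/
def XF (q l m : ℂ) (j : Fin 3) : Matrix (Fin 2) (Fin 2) (Op c) :=
  !![l • pw q j, up q j; (l * m) • dn q j, (-(q * m)) • pw q⁻¹ j]

/-- `X[F(q⁻¹)]` at site `j`. -/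
def XF' (q l m : ℂ) (j : Fin 3) : Matrix (Fin 2) (Fin 2) (Op c) :=
  !![(q⁻¹ * l) • pw q j, q⁻¹ • dn q j; (-(q⁻¹ * l * m)) • up q j, (-m) • pw q⁻¹ j]

/-- The block embedding `X_{αβ}` into `α ⊕ β ⊕ γ`, completed by the unit in `γ`. -/
def embAB (x : Matrix (Fin 2) (Fin 2) (Op c)) : Matrix (Fin 3) (Fin 3) (Op c) :=
  !![x 0 0, x 0 1, 0; x 1 0, x 1 1, 0; 0, 0, 1]

/-- The block embedding `X_{αγ}`. -/
def embAC (x : Matrix (Fin 2) (Fin 2) (Op c)) : Matrix (Fin 3) (Fin 3) (Op c) :=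
  !![x 0 0, 0, x 0 1; 0, 1, 0; x 1 0, 0, x 1 1]

/-- The block embedding `X_{βγ}`. -/
def embBC (x : Matrix (Fin 2) (Fin 2) (Op c)) : Matrix (Fin 3) (Fin 3) (Op c) :=
  !![1, 0, 0; 0, x 0 0, x 0 1; 0, x 1 0, x 1 1]

/-- `X_{αβ}[C₁] X_{αγ}[C₂] X_{βγ}[C₃]`. -/
def lhsX (x₁ x₂ x₃ : Matrix (Fin 2) (Fin 2) (Op c)) : Matrix (Fin 3) (Fin 3) (Op c) :=
  embAB x₁ * embAC x₂ * embBC x₃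

/-- `X_{βγ}[C₃] X_{αγ}[C₂] X_{αβ}[C₁]`. -/
def rhsX (x₁ x₂ x₃ : Matrix (Fin 2) (Fin 2) (Op c)) : Matrix (Fin 3) (Fin 3) (Op c) :=
  embBC x₃ * embAC x₂ * embAB x₁

/-- The intertwining relation `X₁ X₂ X₃ R = R X₃ X₂ X₁` for an operator `R`. -/
def Intertwines (x₁ x₂ x₃ : Matrix (Fin 2) (Fin 2) (Op c)) (R : Op c) : Prop :=
  ∀ i j, lhsX x₁ x₂ x₃ i j * R = R * rhsX x₁ x₂ x₃ i j

/-- The same relation for `R` given by an infinite matrix `⟨n|R|m⟩ = R n m`. -/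
def KernelIntertwines (x₁ x₂ x₃ : Matrix (Fin 2) (Fin 2) (Op c))
    (R : State c → State c → ℂ) : Prop :=
  ∀ i j n m, ∃ s : ℂ,
    HasSum (fun l => matEl (lhsX x₁ x₂ x₃ i j) n l * R l m) s ∧
    HasSum (fun l => R n l * matEl (rhsX x₁ x₂ x₃ i j) l m) s

/-! ### The fermionic constant `R`-operators -/

/-- Two Fermi oscillators at sites 1, 2 and a Bose oscillator at site 3. -/
abbrev cFFA (b : BoseRep) : Fin 3 → Osc := ![.fermi, .fermi, .bose b]

/-- A Bose oscillator at site 1 and two Fermi oscillators at sites 2, 3. -/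
abbrev cAFF (b : BoseRep) : Fin 3 → Osc := ![.bose b, .fermi, .fermi]

/-- Fermi oscillators at sites 1, 3 and a Bose oscillator at site 2. -/
abbrev cFAF (b : BoseRep) : Fin 3 → Osc := ![.fermi, .bose b, .fermi]

def RFFA (q : ℂ) (b : BoseRep) : Op (cFFA b) :=
  (1 - num 0) * (1 - num 1) + q • (num 0 * (1 - num 1) * pw q 2)
    - (1 - num 0) * num 1 * pw q 2 - num 0 * num 1
    + (1 - q ^ 2)⁻¹ • (up q 0 * dn q 1 * dn q 2 - dn q 0 * up q 1 * up q 2)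

def RAFF (q : ℂ) (b : BoseRep) : Op (cAFF b) :=
  (1 - num 1) * (1 - num 2) - q • (pw q 0 * num 1 * (1 - num 2))
    + pw q 0 * (1 - num 1) * num 2 - num 1 * num 2
    + (1 - q ^ 2)⁻¹ • (dn q 0 * up q 1 * dn q 2 - up q 0 * dn q 1 * up q 2)

def RFAF (q : ℂ) (b : BoseRep) : Op (cFAF b) :=
  pw (-q)⁻¹ 1 *
    ((1 - num 0) * pw q 1 * (1 - num 2) + q⁻¹ • (num 0 * (1 - num 2))
      + (1 - num 0) * num 2 + num 0 * pw q 1 * num 2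
      + (1 - q ^ 2)⁻¹ • (q⁻¹ • (up q 0 * dn q 1 * dn q 2) - dn q 0 * up q 1 * up q 2))

/-- The spectral-parameter dressing `v ^ (s₂ N₂) · R · u ^ (s₁ N₁) w ^ (s₃ N₃)` with
`u = λ₃ / λ₂`, `v = λ₁ μ₃`, `w = μ₁ / μ₂` and signs `s`. -/
def dress (lam mu : Fin 3 → ℂ) (s : Fin 3 → ℤ) (R : Op c) : Op c :=
  pw ((lam 0 * mu 2) ^ s 1) 1 * R * pw ((lam 2 / lam 1) ^ s 0) 0 * pw ((mu 0 / mu 1) ^ s 2) 2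

/-! ### The purely bosonic constant `R`-operator -/

/-- Three Bose oscillators, each in one of the two representations. -/
abbrev cAAA (r : Fin 3 → BoseRep) : Fin 3 → Osc := fun j => .bose (r j)

/-- The infinite matrix of
`R₀(N) + ∑_{k ≥ 1} (R_k(N) (a₁⁻ a₂⁺ a₃⁻)^k + (a₁⁺ a₂⁻ a₃⁺)^k R_k(N))`. For given states at most
one term of the series has a non-zero matrix element. -/
def kernelAAA (q : ℂ) (r : Fin 3 → BoseRep) (Rk : ℕ → State (cAAA r) → ℂ)
    (n m : State (cAAA r)) : ℂ :=
  matEl (diagOp (Rk 0)) n m +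
    ∑' k : ℕ,
      (matEl (diagOp (Rk (k + 1)) * (dn q 0 * up q 1 * dn q 2) ^ (k + 1)) n m +
        matEl ((up q 0 * dn q 1 * up q 2) ^ (k + 1) * diagOp (Rk (k + 1))) n m)

/-- The spectral-parameter dressing of an infinite matrix. -/
def dressKernel (lam mu : Fin 3 → ℂ) (s : Fin 3 → ℤ) (R : State c → State c → ℂ)
    (n m : State c) : ℂ :=
  ((lam 0 * mu 2) ^ s 1) ^ (n.1 1) * R n m *
    ((lam 2 / lam 1) ^ s 0) ^ (m.1 0) * ((mu 0 / mu 1) ^ s 2) ^ (m.1 2)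

/-- `(x; q²)_∞ = ∏_{k ≥ 0} (1 - x q^{2k})`. -/
def qPoch (q x : ℂ) : ℂ := ∏' k : ℕ, (1 - x * q ^ (2 * k))

/-- Numerator of the generating function for the trace over the first (`N = N₃`) or the third
(`N = N₁`) oscillator. -/
def outerNum (q : ℂ) (k : ℕ) (N₂ N : ℤ) (z : ℂ) : ℂ :=
  z ^ (N₂ - k) * qPoch q (q ^ (N - N₂ + k + 2) * z⁻¹) * qPoch q (q ^ (N + N₂ + k + 2) * z)

/-- Denominator of the same generating function. -/
def outerDen (q : ℂ) (k : ℕ) (N₂ N : ℤ) (z : ℂ) : ℂ :=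
  qPoch q (q ^ (N + N₂ - k + 2) * z⁻¹) * qPoch q (q ^ (N - N₂ + k) * z)

/-- Numerator of the generating function for the trace over the second oscillator. -/
def midNum (q : ℂ) (k : ℕ) (N₁ N₃ : ℤ) (z : ℂ) : ℂ :=
  q ^ (N₁ * N₃) * qPoch q (-q ^ (1 - N₁ - N₃) * z) * qPoch q (-q ^ (3 + N₁ + N₃ + 2 * k) * z)

/-- Denominator of the same generating function. -/
def midDen (q : ℂ) (_k : ℕ) (N₁ N₃ : ℤ) (z : ℂ) : ℂ :=
  qPoch q (-q ^ (1 - N₁ + N₃) * z) * qPoch q (-q ^ (1 + N₁ - N₃) * z)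

/-- The region of expansion: near `z = 0` for the Fock representation, near `z = ∞` for the
anti-Fock one. -/
def _root_.BoseRep.near : BoseRep → ℝ → ℂ → Prop
  | .fock, ρ, z => 0 < ‖z‖ ∧ ‖z‖ < ρ
  | .antiFock, ρ, z => ρ < ‖z‖

/-- The sign of the expansion: `F(z) = ∑_{n ≥ 0} zⁿ f(n)` near `z = 0`, but
`F(z) = -∑_{n < 0} zⁿ f(n)` near `z = ∞`. -/
def _root_.BoseRep.sign : BoseRep → ℂ
  | .fock => 1
  | .antiFock => -1

/-- The partial trace over site `j` of `z ^ N_j D`, the occupation numbers at the other sites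
being those of `n`, is given by the expansion of `F(z) = nu z / de z` (at those `z` of the region
of expansion at which the infinite products in the denominator do not vanish). -/
def HasGenFun {r : Fin 3 → BoseRep} (j : Fin 3) (D : Op (cAAA r)) (n : State (cAAA r))
    (nu de : ℂ → ℂ) : Prop :=
  ∃ ρ : ℝ, 0 < ρ ∧ ∀ z : ℂ, (r j).near ρ z → de z ≠ 0 →
    HasSum
      (fun x : (cAAA r j).spectrum =>
        matEl (pw z j * D) (setAt n j x) (setAt n j x))
      ((r j).sign * (nu z / de z))

/-- The generating function of `R_k` for the trace over the first oscillator, at all occupation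
numbers `N₂, N₃` at which `R_k` enters the operator series. -/
def GenFun₁ (q : ℂ) {r : Fin 3 → BoseRep} (Rk : ℕ → State (cAAA r) → ℂ) : Prop :=
  ∀ (k : ℕ) (n : State (cAAA r)),
    n.1 1 - k ∈ (cAAA r 1).spectrum → n.1 2 + k ∈ (cAAA r 2).spectrum →
    HasGenFun 0 (dn q 0 ^ k * up q 0 ^ k * diagOp (Rk k)) n
      (outerNum q k (n.1 1) (n.1 2)) (outerDen q k (n.1 1) (n.1 2))

/-- The generating function for the trace over the second oscillator. -/
def GenFun₂ (q : ℂ) {r : Fin 3 → BoseRep} (Rk : ℕ → State (cAAA r) → ℂ) : Prop :=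
  ∀ (k : ℕ) (n : State (cAAA r)),
    n.1 0 + k ∈ (cAAA r 0).spectrum → n.1 2 + k ∈ (cAAA r 2).spectrum →
    HasGenFun 1 (dn q 1 ^ k * diagOp (Rk k) * up q 1 ^ k) n
      (midNum q k (n.1 0) (n.1 2)) (midDen q k (n.1 0) (n.1 2))

/-- The generating function for the trace over the third oscillator. -/
def GenFun₃ (q : ℂ) {r : Fin 3 → BoseRep} (Rk : ℕ → State (cAAA r) → ℂ) : Prop :=
  ∀ (k : ℕ) (n : State (cAAA r)),
    n.1 0 + k ∈ (cAAA r 0).spectrum → n.1 1 - k ∈ (cAAA r 1).spectrum →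
    HasGenFun 2 (dn q 2 ^ k * up q 2 ^ k * diagOp (Rk k)) n
      (outerNum q k (n.1 1) (n.1 0)) (outerDen q k (n.1 1) (n.1 0))

open Classical in
/-- An infinite matrix whose square (as a convergent matrix product) is the identity. -/
def KernelSqOne (R : State c → State c → ℂ) : Prop :=
  ∀ n m, HasSum (fun l => R n l * R l m) (if n = m then 1 else 0)

end Tetra

end

noncomputable section

namespace Tetra

open Filter Topology Bornology

/-! ### Monomial operators on the occupation number basis. -/

variable {c : Fin 3 → Osc}

/-! All operators in sight are sums of monomials, which shift the occupation numbers by a fixed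
vector and multiply by a function of them. The intertwining relation is therefore equivalent to nine
scalar recurrences `Rels` for the matrix elements, extended by zero outside the spectra
(`kernelIntertwines_iff`). Each recurrence is homogeneous in the spectral parameters, so the
dressing by powers of u, v, w removes them (`rels_dressExt_iff`), and everything reduces to constant
operators.

Three Bose oscillators. An identity between the values of a generating function at z, qz, q²z,
possibly multiplied by z, is the same as a recurrence between its coefficients, because a one-sided
Laurent expansion determines its coefficients (`Expands.unique`). The quotients of infinite products
satisfy such identities, checked by cancelling common products, and they give all recurrences of
`CoefRels`. Among these only two, `MidRels`, are needed to compute every R_k from the values of R₀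
at the vacuum of the second site (`MidRels.ext`). The outer and the middle generating functions both
imply `MidRels` and the same vacuum values. Both are rational functions of z, so coefficients
realizing each of them exist, and uniqueness turns the implications into equivalences
(`outerGen_iff`, `midGen_iff`). The data `MidRels` plus vacuum values are symmetric under exchange
of sites 1 and 3, which brings in the third trace.

The recurrences for R_k and for its mirror image under that exchange are the intertwining relations
written on the halves of the matrix that lower or raise the first occupation number
(`rels_bose_of_coefRels`, `rels_boseInv_of_coefRels`). Conversely, for an arbitrary intertwiner the
diagonal entries force conservation of N₁+N₂ and N₂+N₃, both halves satisfy `MidRels`, and the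
vacuum values are proportional to the prescribed ones. Both halves share the diagonal, hence one
scalar (`exists_eq_smul_kernelAAA`).

For the square, the matrices X for q⁻¹ are, up to scalars, transposes of those for q with the two
sides of the relation exchanged. An operator T intertwining both families has a square commuting
with all entries. These entries connect all basis states, and T acts by ±1 on suitable vacuum
states, so T² = 1 (`kernelSqOne_kernelAAA`). The condition on the representations makes the columns
of the matrix finite, so that T is a genuine operator.

One Bose and two Fermi oscillators. The constant operators preserve subspaces spanned by one or two
basis vectors, so R² = 1 and the relation for one pattern of each pair are finite checks on basis
vectors. The other pattern follows from R² = 1 and the same transposition symmetry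
(`TransposeRel.intertwines`). If R' is another intertwiner, then R'R commutes with all entries of
X₁X₂X₃. Some basis vectors are determined by the eigenvalues of the two diagonal entries, and the
remaining entries connect them to all others, so R'R is a scalar (`FFA_eq_smul_one` and its
analogues), and R' is this scalar times R (`dress_unique`). -/

/-- The integers `a, b, d` are admissible occupation numbers at the three sites. -/
def Adm (c : Fin 3 → Osc) (a b d : ℤ) : Prop :=
  a ∈ (c 0).spectrum ∧ b ∈ (c 1).spectrum ∧ d ∈ (c 2).spectrum

/-- The basis state with given admissible occupation numbers. -/
def mkState (a b d : ℤ) (h : Adm c a b d) : State c :=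
  ⟨![a, b, d], fun j => by
    fin_cases j
    · exact h.1
    · exact h.2.1
    · exact h.2.2⟩

theorem adm_state (n : State c) : Adm c (n.1 0) (n.1 1) (n.1 2) := ⟨n.2 0, n.2 1, n.2 2⟩

theorem State.ext_iff' (n m : State c) :
    n = m ↔ n.1 0 = m.1 0 ∧ n.1 1 = m.1 1 ∧ n.1 2 = m.1 2 := by
  constructor
  · rintro rfl; exact ⟨rfl, rfl, rfl⟩
  · rintro ⟨h0, h1, h2⟩
    apply Subtype.ext
    funext j
    fin_cases j
    · exact h0
    · exact h1
    · exact h2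

@[simp] theorem mkState_zero (a b d : ℤ) (h : Adm c a b d) : (mkState a b d h).1 0 = a := rfl
@[simp] theorem mkState_one (a b d : ℤ) (h : Adm c a b d) : (mkState a b d h).1 1 = b := rfl
@[simp] theorem mkState_two (a b d : ℤ) (h : Adm c a b d) : (mkState a b d h).1 2 = d := rfl

@[simp] theorem mkState_eta (n : State c) : mkState (n.1 0) (n.1 1) (n.1 2) (adm_state n) = n := by
  rw [State.ext_iff']; exact ⟨rfl, rfl, rfl⟩

open Classical in
/-- The basis vector with given occupation numbers, `0` if they are not admissible. -/
def ket (a b d : ℤ) : FockSpace c :=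
  if h : Adm c a b d then Finsupp.single (mkState a b d h) 1 else 0

open Classical in
/-- The zero extension of an infinite matrix to all triples of integers. -/
def kerExt (R : State c → State c → ℂ) (a b d x y z : ℤ) : ℂ :=
  if h : Adm c a b d ∧ Adm c x y z then R (mkState a b d h.1) (mkState x y z h.2) else 0

theorem kerExt_state (R : State c → State c → ℂ) (n m : State c) :
    kerExt R (n.1 0) (n.1 1) (n.1 2) (m.1 0) (m.1 1) (m.1 2) = R n m := by
  rw [kerExt, dif_pos ⟨(adm_state n), (adm_state m)⟩, mkState_eta, mkState_eta]

theorem kerExt_mkState (R : State c → State c → ℂ) {a b d x y z : ℤ} (h : Adm c a b d)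
    (h' : Adm c x y z) : kerExt R a b d x y z = R (mkState a b d h) (mkState x y z h') := by
  rw [kerExt, dif_pos ⟨h, h'⟩]

theorem kerExt_of_not_left (R : State c → State c → ℂ) {a b d x y z : ℤ} (h : ¬ Adm c a b d) :
    kerExt R a b d x y z = 0 := by
  rw [kerExt, dif_neg (fun h' => h h'.1)]

theorem kerExt_of_not_right (R : State c → State c → ℂ) {a b d x y z : ℤ} (h : ¬ Adm c x y z) :
    kerExt R a b d x y z = 0 := by
  rw [kerExt, dif_neg (fun h' => h h'.2)]

/-- The monomial operator `|n⟩ ↦ f n • |n + (d, e, g)⟩`. -/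
def mono (d e g : ℤ) (f : ℤ → ℤ → ℤ → ℂ) : Op c :=
  Finsupp.linearCombination ℂ fun n : State c =>
    f (n.1 0) (n.1 1) (n.1 2) • ket (n.1 0 + d) (n.1 1 + e) (n.1 2 + g)

theorem mono_single (d e g : ℤ) (f : ℤ → ℤ → ℤ → ℂ) (n : State c) :
    mono d e g f (Finsupp.single n 1) =
      f (n.1 0) (n.1 1) (n.1 2) • ket (n.1 0 + d) (n.1 1 + e) (n.1 2 + g) := by
  simp [mono, Finsupp.linearCombination_single]

theorem ket_of_adm {a b d : ℤ} (h : Adm c a b d) :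
    ket a b d = Finsupp.single (mkState a b d h) 1 := dif_pos h

theorem ket_of_not_adm {a b d : ℤ} (h : ¬ Adm c a b d) : (ket a b d : FockSpace c) = 0 :=
  dif_neg h

open Classical in
theorem ket_apply (a b d : ℤ) (n : State c) :
    (ket a b d : FockSpace c) n = if n.1 0 = a ∧ n.1 1 = b ∧ n.1 2 = d then 1 else 0 := by
  by_cases h : Adm c a b d
  · rw [ket_of_adm h, Finsupp.single_apply]
    congr 1
    rw [State.ext_iff', mkState_zero, mkState_one, mkState_two]
    simp only [eq_comm]
  · rw [ket_of_not_adm h, if_neg, Finsupp.zero_apply]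
    rintro ⟨rfl, rfl, rfl⟩
    exact h (adm_state n)

theorem ket_state (n : State c) : ket (n.1 0) (n.1 1) (n.1 2) = Finsupp.single n 1 := by
  rw [ket_of_adm (adm_state n), mkState_eta]

theorem mono_ket (d e g : ℤ) (f : ℤ → ℤ → ℤ → ℂ) {a b k : ℤ} (h : Adm c a b k) :
    mono d e g f (ket a b k : FockSpace c) = f a b k • ket (a + d) (b + e) (k + g) := by
  rw [ket_of_adm h, mono_single]; rfl

theorem Op.ext_ket {A B : Op c} (h : ∀ a b d, Adm c a b d → A (ket a b d) = B (ket a b d)) :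
    A = B := by
  apply Finsupp.lhom_ext'
  intro n
  apply LinearMap.ext_ring
  have := h _ _ _ (adm_state n)
  rw [ket_state] at this
  simpa using this

open Classical in
theorem matEl_mono (d e g : ℤ) (f : ℤ → ℤ → ℤ → ℂ) (n m : State c) :
    matEl (mono d e g f) n m =
      if n.1 0 = m.1 0 + d ∧ n.1 1 = m.1 1 + e ∧ n.1 2 = m.1 2 + g
        then f (m.1 0) (m.1 1) (m.1 2) else 0 := by
  rw [matEl, mono_single, Finsupp.smul_apply, ket_apply]
  split_ifs <;> simp

theorem matEl_add (A B : Op c) (n m : State c) :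
    matEl (A + B) n m = matEl A n m + matEl B n m := by
  simp [matEl]

theorem Op.ext_matEl {A B : Op c} (h : ∀ n m, matEl A n m = matEl B n m) : A = B := by
  apply Finsupp.lhom_ext'
  intro m
  apply LinearMap.ext_ring
  apply Finsupp.ext
  intro n
  simpa [matEl] using h n m

/-- When no site is moved by both factors, each occupation number of the intermediate state is
either the initial or the final one. A product of shifts thus vanishes exactly when its result is
inadmissible, and no indicator of the intermediate state is needed. -/
theorem mono_mul_mono {d e g d' e' g' : ℤ} (f f' : ℤ → ℤ → ℤ → ℂ)
    (h0 : d = 0 ∨ d' = 0) (h1 : e = 0 ∨ e' = 0) (h2 : g = 0 ∨ g' = 0) :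
    (mono d e g f * mono d' e' g' f' : Op c) =
      mono (d' + d) (e' + e) (g' + g)
        (fun a b k => f (a + d') (b + e') (k + g') * f' a b k) := by
  apply Op.ext_ket
  intro a b k h
  rw [Module.End.mul_apply, mono_ket _ _ _ _ h, mono_ket _ _ _ _ h, map_smul]
  by_cases h' : Adm c (a + d') (b + e') (k + g')
  · rw [mono_ket _ _ _ _ h', smul_smul, mul_comm, add_assoc, add_assoc, add_assoc]
  · rw [ket_of_not_adm h', map_zero, smul_zero, ket_of_not_adm, smul_zero]
    intro h''
    apply h'
    refine ⟨?_, ?_, ?_⟩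
    · rcases h0 with rfl | rfl
      · simpa using h''.1
      · simpa using h.1
    · rcases h1 with rfl | rfl
      · simpa using h''.2.1
      · simpa using h.2.1
    · rcases h2 with rfl | rfl
      · simpa using h''.2.2
      · simpa using h.2.2

theorem smul_mono (t : ℂ) (d e g : ℤ) (f : ℤ → ℤ → ℤ → ℂ) :
    (t • mono d e g f : Op c) = mono d e g (fun a b k => t * f a b k) := by
  apply Op.ext_ket
  intro a b k h
  rw [LinearMap.smul_apply, mono_ket _ _ _ _ h, mono_ket _ _ _ _ h, smul_smul]

theorem diagOp_eq_mono (f : ℤ → ℤ → ℤ → ℂ) :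
    (diagOp (fun n => f (n.1 0) (n.1 1) (n.1 2)) : Op c) = mono 0 0 0 f := by
  apply Finsupp.lhom_ext'
  intro n
  apply LinearMap.ext_ring
  simp only [LinearMap.comp_apply, Finsupp.lsingle_apply, mono_single, add_zero, ket_state]
  simp [diagOp]

theorem one_eq_mono : (1 : Op c) = mono 0 0 0 (fun _ _ _ => 1) := by
  apply Op.ext_ket
  intro a b k h
  rw [mono_ket _ _ _ _ h]; simp

theorem shiftOp_eq_mono (j : Fin 3) (d : ℤ) (f : ℤ → ℤ → ℤ → ℂ) :
    (shiftOp j d (fun n => f (n.1 0) (n.1 1) (n.1 2)) : Op c) =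
      mono ((Pi.single j d : Fin 3 → ℤ) 0) ((Pi.single j d : Fin 3 → ℤ) 1)
        ((Pi.single j d : Fin 3 → ℤ) 2) f := by
  apply Finsupp.lhom_ext'
  intro n
  apply LinearMap.ext_ring
  simp only [LinearMap.comp_apply, Finsupp.lsingle_apply, mono_single]
  rw [shiftOp, Finsupp.linearCombination_single, one_smul]
  split_ifs with h
  · have h' : Adm c (n.1 0 + (Pi.single j d : Fin 3 → ℤ) 0) (n.1 1 + (Pi.single j d : Fin 3 → ℤ) 1)
        (n.1 2 + (Pi.single j d : Fin 3 → ℤ) 2) := ⟨h 0, h 1, h 2⟩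
    rw [ket_of_adm h', Finsupp.smul_single, smul_eq_mul, mul_one]
    congr 1
    rw [State.ext_iff']
    exact ⟨rfl, rfl, rfl⟩
  · rw [ket_of_not_adm, smul_zero]
    intro h'
    apply h
    intro i
    fin_cases i
    · exact h'.1
    · exact h'.2.1
    · exact h'.2.2

/-- A row of a monomial operator has at most one nonzero entry, so the matrix product is a single
term. If its index leaves the spectrum, the zero extension `kerExt` supplies the missing value 0. -/
theorem hasSum_row_mono (d e g : ℤ) (f : ℤ → ℤ → ℤ → ℂ) (R : State c → State c → ℂ)
    (n m : State c) :
    HasSum (fun l => matEl (mono d e g f) n l * R l m)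
      (f (n.1 0 - d) (n.1 1 - e) (n.1 2 - g) *
        kerExt R (n.1 0 - d) (n.1 1 - e) (n.1 2 - g) (m.1 0) (m.1 1) (m.1 2)) := by
  by_cases h : Adm c (n.1 0 - d) (n.1 1 - e) (n.1 2 - g)
  · have := hasSum_single (f := fun l => matEl (mono d e g f) n l * R l m) (mkState _ _ _ h) ?_
    · convert this using 1
      rw [kerExt_mkState R h (adm_state m), mkState_eta, matEl_mono, if_pos]
      · simp
      · simp
    · intro l hl
      rw [matEl_mono, if_neg, zero_mul]
      rintro ⟨h0, h1, h2⟩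
      apply hl
      rw [State.ext_iff']
      simp only [mkState_zero, mkState_one, mkState_two]
      omega
  · rw [kerExt_of_not_left R h, mul_zero]
    convert hasSum_zero using 2 with l
    rw [matEl_mono, if_neg, zero_mul]
    rintro ⟨h0, h1, h2⟩
    apply h
    rw [h0, h1, h2]
    simpa using (adm_state l)

theorem hasSum_col_mono (d e g : ℤ) (f : ℤ → ℤ → ℤ → ℂ) (R : State c → State c → ℂ)
    (n m : State c) :
    HasSum (fun l => R n l * matEl (mono d e g f) l m)
      (f (m.1 0) (m.1 1) (m.1 2) *
        kerExt R (n.1 0) (n.1 1) (n.1 2) (m.1 0 + d) (m.1 1 + e) (m.1 2 + g)) := by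
  by_cases h : Adm c (m.1 0 + d) (m.1 1 + e) (m.1 2 + g)
  · have := hasSum_single (f := fun l => R n l * matEl (mono d e g f) l m) (mkState _ _ _ h) ?_
    · convert this using 1
      rw [kerExt_mkState R (adm_state n) h, mkState_eta, matEl_mono, if_pos, mul_comm]
      simp
    · intro l hl
      rw [matEl_mono, if_neg, mul_zero]
      rintro ⟨h0, h1, h2⟩
      apply hl
      rw [State.ext_iff']
      exact ⟨h0, h1, h2⟩
  · rw [kerExt_of_not_right R h, mul_zero]
    convert hasSum_zero using 2 with l
    rw [matEl_mono, if_neg, mul_zero]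
    rintro ⟨h0, h1, h2⟩
    apply h
    rw [← h0, ← h1, ← h2]
    exact (adm_state l)

/-! ### The intertwining relation as nine scalar relations. -/

/-- Coefficients of a matrix `X` whose off-diagonal entries shift the occupation number of a site
by `± s`. -/
structure LData where
  s : ℤ
  A : ℤ → ℤ → ℤ → ℂ
  B : ℤ → ℤ → ℤ → ℂ
  C : ℤ → ℤ → ℤ → ℂ
  D : ℤ → ℤ → ℤ → ℂ

/-- The matrix with coefficients `X` at the site `j`. -/
def LData.toMatrix (X : LData) (j : Fin 3) : Matrix (Fin 2) (Fin 2) (Op c) :=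
  !![mono 0 0 0 X.A,
     mono ((Pi.single j X.s : Fin 3 → ℤ) 0) ((Pi.single j X.s : Fin 3 → ℤ) 1)
      ((Pi.single j X.s : Fin 3 → ℤ) 2) X.B;
     mono ((Pi.single j (-X.s) : Fin 3 → ℤ) 0) ((Pi.single j (-X.s) : Fin 3 → ℤ) 1)
      ((Pi.single j (-X.s) : Fin 3 → ℤ) 2) X.C,
     mono 0 0 0 X.D]

/-- The rescaling by the spectral parameters. -/
def LData.scale (l m : ℂ) (X : LData) : LData where
  s := X.s
  A a b d := l * X.A a b d
  B := X.B
  C a b d := l * m * X.C a b d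
  D a b d := m * X.D a b d

/-- The entries of the intertwining relation on the matrix elements of `K`. -/
structure Rels (X Y Z : LData) (T : ℤ → ℤ → ℤ → Prop) (K : ℤ → ℤ → ℤ → ℤ → ℤ → ℤ → ℂ) :
    Prop where
  e00 : ∀ a b d x y z, T a b d → T x y z →
    X.A a b d * Y.A a b d * K a b d x y z = Y.A x y z * X.A x y z * K a b d x y z
  e01 : ∀ a b d x y z, T a b d → T x y z →
    X.B (a - X.s) b d * Z.A (a - X.s) b d * K (a - X.s) b d x y z +
      X.A a b d * Y.B a (b - Y.s) d * Z.C a (b - Y.s) (d + Z.s) *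
        K a (b - Y.s) (d + Z.s) x y z =
    Y.A (x + X.s) y z * X.B x y z * K a b d (x + X.s) y z
  e02 : ∀ a b d x y z, T a b d → T x y z →
    X.B (a - X.s) b d * Z.B (a - X.s) b (d - Z.s) * K (a - X.s) b (d - Z.s) x y z +
      X.A a b d * Y.B a (b - Y.s) d * Z.D a (b - Y.s) d * K a (b - Y.s) d x y z =
    Y.B x y z * K a b d x (y + Y.s) z
  e10 : ∀ a b d x y z, T a b d → T x y z →
    X.C (a + X.s) b d * Y.A (a + X.s) b d * K (a + X.s) b d x y z =
    Z.B x (y - Y.s) z * Y.C x y z * X.A x y z * K a b d x (y - Y.s) (z + Z.s) +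
      Z.A (x - X.s) y z * X.C x y z * K a b d (x - X.s) y z
  e11 : ∀ a b d x y z, T a b d → T x y z →
    X.D a b d * Z.A a b d * K a b d x y z +
      X.C (a + X.s) b d * Y.B (a + X.s) (b - Y.s) d * Z.C (a + X.s) (b - Y.s) (d + Z.s) *
        K (a + X.s) (b - Y.s) (d + Z.s) x y z =
    Z.B (x + X.s) (y - Y.s) z * Y.C (x + X.s) y z * X.B x y z *
        K a b d (x + X.s) (y - Y.s) (z + Z.s) +
      Z.A x y z * X.D x y z * K a b d x y z
  e12 : ∀ a b d x y z, T a b d → T x y z →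
    X.D a b d * Z.B a b (d - Z.s) * K a b (d - Z.s) x y z +
      X.C (a + X.s) b d * Y.B (a + X.s) (b - Y.s) d * Z.D (a + X.s) (b - Y.s) d *
        K (a + X.s) (b - Y.s) d x y z =
    Z.B x y z * Y.D x y z * K a b d x y (z + Z.s)
  e20 : ∀ a b d x y z, T a b d → T x y z →
    Y.C a (b + Y.s) d * K a (b + Y.s) d x y z =
    Z.D x (y - Y.s) z * Y.C x y z * X.A x y z * K a b d x (y - Y.s) z +
      Z.C (x - X.s) y z * X.C x y z * K a b d (x - X.s) y (z - Z.s)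
  e21 : ∀ a b d x y z, T a b d → T x y z →
    Y.D a b d * Z.C a b (d + Z.s) * K a b (d + Z.s) x y z =
    Z.D (x + X.s) (y - Y.s) z * Y.C (x + X.s) y z * X.B x y z * K a b d (x + X.s) (y - Y.s) z +
      Z.C x y z * X.D x y z * K a b d x y (z - Z.s)
  e22 : ∀ a b d x y z, T a b d → T x y z →
    Y.D a b d * Z.D a b d * K a b d x y z = Z.D x y z * Y.D x y z * K a b d x y z

section Entries

variable (x₁ x₂ x₃ : Matrix (Fin 2) (Fin 2) (Op c))

theorem lhsX_eq : lhsX x₁ x₂ x₃ =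
    !![x₁ 0 0 * x₂ 0 0, x₁ 0 1 * x₃ 0 0 + x₁ 0 0 * x₂ 0 1 * x₃ 1 0,
        x₁ 0 1 * x₃ 0 1 + x₁ 0 0 * x₂ 0 1 * x₃ 1 1;
      x₁ 1 0 * x₂ 0 0, x₁ 1 1 * x₃ 0 0 + x₁ 1 0 * x₂ 0 1 * x₃ 1 0,
        x₁ 1 1 * x₃ 0 1 + x₁ 1 0 * x₂ 0 1 * x₃ 1 1;
      x₂ 1 0, x₂ 1 1 * x₃ 1 0, x₂ 1 1 * x₃ 1 1] := by
  ext i j : 2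
  fin_cases i <;> fin_cases j <;>
    simp [lhsX, embAB, embAC, embBC, Matrix.mul_apply, Fin.sum_univ_three]

theorem rhsX_eq : rhsX x₁ x₂ x₃ =
    !![x₂ 0 0 * x₁ 0 0, x₂ 0 0 * x₁ 0 1, x₂ 0 1;
      x₃ 0 1 * x₂ 1 0 * x₁ 0 0 + x₃ 0 0 * x₁ 1 0,
        x₃ 0 1 * x₂ 1 0 * x₁ 0 1 + x₃ 0 0 * x₁ 1 1, x₃ 0 1 * x₂ 1 1;
      x₃ 1 1 * x₂ 1 0 * x₁ 0 0 + x₃ 1 0 * x₁ 1 0,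
        x₃ 1 1 * x₂ 1 0 * x₁ 0 1 + x₃ 1 0 * x₁ 1 1, x₃ 1 1 * x₂ 1 1] := by
  ext i j : 2
  fin_cases i <;> fin_cases j <;>
    simp [rhsX, embAB, embAC, embBC, Matrix.mul_apply, Fin.sum_univ_three]

end Entries

theorem hasSum_row_add {A B : Op c} {R : State c → State c → ℂ} {n m : State c} {s t : ℂ}
    (hA : HasSum (fun l => matEl A n l * R l m) s) (hB : HasSum (fun l => matEl B n l * R l m) t) :
    HasSum (fun l => matEl (A + B) n l * R l m) (s + t) := by
  simpa only [matEl_add, add_mul] using hA.add hB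

theorem hasSum_col_add {A B : Op c} {R : State c → State c → ℂ} {n m : State c} {s t : ℂ}
    (hA : HasSum (fun l => R n l * matEl A l m) s) (hB : HasSum (fun l => R n l * matEl B l m) t) :
    HasSum (fun l => R n l * matEl (A + B) l m) (s + t) := by
  simpa only [matEl_add, mul_add] using hA.add hB

theorem hasSum_pair_iff {f g : State c → ℂ} {s t : ℂ} (hf : HasSum f s) (hg : HasSum g t) :
    (∃ u, HasSum f u ∧ HasSum g u) ↔ s = t := by
  constructor
  · rintro ⟨u, h1, h2⟩
    rw [hf.unique h1, hg.unique h2]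
  · rintro rfl
    exact ⟨s, hf, hg⟩

theorem forall_state_iff {P : ℤ → ℤ → ℤ → ℤ → ℤ → ℤ → Prop} :
    (∀ n m : State c, P (n.1 0) (n.1 1) (n.1 2) (m.1 0) (m.1 1) (m.1 2)) ↔
      ∀ a b d x y z, Adm c a b d → Adm c x y z → P a b d x y z :=
  ⟨fun h a b d x y z h1 h2 => h (mkState a b d h1) (mkState x y z h2),
    fun h n m => h _ _ _ _ _ _ (adm_state n) (adm_state m)⟩

/-- Reduction of the intertwining relation to identities between matrix elements. -/
theorem kernelIntertwines_iff (X Y Z : LData) (R : State c → State c → ℂ) :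
    KernelIntertwines (X.toMatrix 0) (Y.toMatrix 1) (Z.toMatrix 2) R ↔
      Rels X Y Z (Adm c) (kerExt R) := by
  -- The sums on both sides have explicit values `P` and `Q`, coming from one or two monomials, so a
  -- common sum exists iff these values agree.
  have key : ∀ (i j : Fin 3) (P Q : ℤ → ℤ → ℤ → ℤ → ℤ → ℤ → ℂ),
      (∀ n m : State c, HasSum
        (fun l => matEl (lhsX (X.toMatrix 0) (Y.toMatrix 1) (Z.toMatrix 2) i j) n l * R l m)
        (P (n.1 0) (n.1 1) (n.1 2) (m.1 0) (m.1 1) (m.1 2))) →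
      (∀ n m : State c, HasSum
        (fun l => R n l * matEl (rhsX (X.toMatrix 0) (Y.toMatrix 1) (Z.toMatrix 2) i j) l m)
        (Q (n.1 0) (n.1 1) (n.1 2) (m.1 0) (m.1 1) (m.1 2))) →
      ((∀ n m : State c, ∃ s,
        HasSum (fun l => matEl (lhsX (X.toMatrix 0) (Y.toMatrix 1) (Z.toMatrix 2) i j) n l * R l m)
          s ∧
        HasSum (fun l => R n l * matEl (rhsX (X.toMatrix 0) (Y.toMatrix 1) (Z.toMatrix 2) i j) l m)
          s) ↔
      ∀ a b d x y z, Adm c a b d → Adm c x y z → P a b d x y z = Q a b d x y z) := by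
    intro i j P Q hP hQ
    rw [← forall_state_iff]
    exact forall_congr' fun n => forall_congr' fun m => hasSum_pair_iff (hP n m) (hQ n m)
  have k00 := key 0 0
    (fun a b d x y z => X.A a b d * Y.A a b d * kerExt R a b d x y z)
    (fun a b d x y z => Y.A x y z * X.A x y z * kerExt R a b d x y z)
    (fun n m => by
      rw [lhsX_eq]
      simpa [LData.toMatrix, mono_mul_mono] using
        hasSum_row_mono 0 0 0 (fun a b d => X.A a b d * Y.A a b d) R n m)
    (fun n m => by
      rw [rhsX_eq]
      simpa [LData.toMatrix, mono_mul_mono] using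
        hasSum_col_mono 0 0 0 (fun a b d => Y.A a b d * X.A a b d) R n m)
  have k01 := key 0 1
    (fun a b d x y z =>
    X.B (a - X.s) b d * Z.A (a - X.s) b d * kerExt R (a - X.s) b d x y z +
      X.A a b d * Y.B a (b - Y.s) d * Z.C a (b - Y.s) (d + Z.s) *
        kerExt R a (b - Y.s) (d + Z.s) x y z)
    (fun a b d x y z => Y.A (x + X.s) y z * X.B x y z * kerExt R a b d (x + X.s) y z)
    (fun n m => by
      rw [lhsX_eq]
      refine hasSum_row_add ?_ ?_
      · simpa [LData.toMatrix, mono_mul_mono] using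
          hasSum_row_mono X.s 0 0 (fun a b d => X.B a b d * Z.A a b d) R n m
      · simpa [LData.toMatrix, mono_mul_mono] using
          hasSum_row_mono 0 Y.s (-Z.s)
            (fun a b d => X.A a (b + Y.s) (d + -Z.s) * Y.B a b (d + -Z.s) * Z.C a b d) R n m)
    (fun n m => by
      rw [rhsX_eq]
      simpa [LData.toMatrix, mono_mul_mono] using
        hasSum_col_mono X.s 0 0 (fun a b d => Y.A (a + X.s) b d * X.B a b d) R n m)
  have k02 := key 0 2
    (fun a b d x y z =>
    X.B (a - X.s) b d * Z.B (a - X.s) b (d - Z.s) * kerExt R (a - X.s) b (d - Z.s) x y z +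
      X.A a b d * Y.B a (b - Y.s) d * Z.D a (b - Y.s) d * kerExt R a (b - Y.s) d x y z)
    (fun a b d x y z => Y.B x y z * kerExt R a b d x (y + Y.s) z)
    (fun n m => by
      rw [lhsX_eq]
      refine hasSum_row_add ?_ ?_
      · simpa [LData.toMatrix, mono_mul_mono] using
          hasSum_row_mono X.s 0 Z.s (fun a b d => X.B a b (d + Z.s) * Z.B a b d) R n m
      · simpa [LData.toMatrix, mono_mul_mono] using
          hasSum_row_mono 0 Y.s 0
            (fun a b d => X.A a (b + Y.s) d * Y.B a b d * Z.D a b d) R n m)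
    (fun n m => by
      rw [rhsX_eq]
      simpa [LData.toMatrix, mono_mul_mono] using
        hasSum_col_mono 0 Y.s 0 Y.B R n m)
  have k10 := key 1 0
    (fun a b d x y z =>
      X.C (a + X.s) b d * Y.A (a + X.s) b d * kerExt R (a + X.s) b d x y z)
    (fun a b d x y z =>
      Z.B x (y - Y.s) z * Y.C x y z * X.A x y z * kerExt R a b d x (y - Y.s) (z + Z.s) +
      Z.A (x - X.s) y z * X.C x y z * kerExt R a b d (x - X.s) y z)
    (fun n m => by
      rw [lhsX_eq]
      simpa [LData.toMatrix, mono_mul_mono] using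
        hasSum_row_mono (-X.s) 0 0 (fun a b d => X.C a b d * Y.A a b d) R n m)
    (fun n m => by
      rw [rhsX_eq]
      refine hasSum_col_add ?_ ?_
      · simpa [LData.toMatrix, mono_mul_mono, sub_eq_add_neg] using
          hasSum_col_mono 0 (-Y.s) Z.s
            (fun a b d => Z.B a (b - Y.s) d * Y.C a b d * X.A a b d) R n m
      · simpa [LData.toMatrix, mono_mul_mono, sub_eq_add_neg] using
          hasSum_col_mono (-X.s) 0 0 (fun a b d => Z.A (a - X.s) b d * X.C a b d) R n m)
  have k11 := key 1 1
    (fun a b d x y z => X.D a b d * Z.A a b d * kerExt R a b d x y z +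
      X.C (a + X.s) b d * Y.B (a + X.s) (b - Y.s) d * Z.C (a + X.s) (b - Y.s) (d + Z.s) *
        kerExt R (a + X.s) (b - Y.s) (d + Z.s) x y z)
    (fun a b d x y z =>
      Z.B (x + X.s) (y - Y.s) z * Y.C (x + X.s) y z * X.B x y z *
        kerExt R a b d (x + X.s) (y - Y.s) (z + Z.s) +
      Z.A x y z * X.D x y z * kerExt R a b d x y z)
    (fun n m => by
      rw [lhsX_eq]
      refine hasSum_row_add ?_ ?_
      · simpa [LData.toMatrix, mono_mul_mono] using
          hasSum_row_mono 0 0 0 (fun a b d => X.D a b d * Z.A a b d) R n m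
      · simpa [LData.toMatrix, mono_mul_mono] using
          hasSum_row_mono (-X.s) Y.s (-Z.s)
            (fun a b d => X.C a (b + Y.s) (d + -Z.s) * Y.B a b (d + -Z.s) * Z.C a b d) R n m)
    (fun n m => by
      rw [rhsX_eq]
      refine hasSum_col_add ?_ ?_
      · simpa [LData.toMatrix, mono_mul_mono, sub_eq_add_neg] using
          hasSum_col_mono X.s (-Y.s) Z.s
            (fun a b d => Z.B (a + X.s) (b - Y.s) d * Y.C (a + X.s) b d * X.B a b d) R n m
      · simpa [LData.toMatrix, mono_mul_mono] using
          hasSum_col_mono 0 0 0 (fun a b d => Z.A a b d * X.D a b d) R n m)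
  have k12 := key 1 2
    (fun a b d x y z => X.D a b d * Z.B a b (d - Z.s) * kerExt R a b (d - Z.s) x y z +
      X.C (a + X.s) b d * Y.B (a + X.s) (b - Y.s) d * Z.D (a + X.s) (b - Y.s) d *
        kerExt R (a + X.s) (b - Y.s) d x y z)
    (fun a b d x y z => Z.B x y z * Y.D x y z * kerExt R a b d x y (z + Z.s))
    (fun n m => by
      rw [lhsX_eq]
      refine hasSum_row_add ?_ ?_
      · simpa [LData.toMatrix, mono_mul_mono] using
          hasSum_row_mono 0 0 Z.s (fun a b d => X.D a b (d + Z.s) * Z.B a b d) R n m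
      · simpa [LData.toMatrix, mono_mul_mono] using
          hasSum_row_mono (-X.s) Y.s 0
            (fun a b d => X.C a (b + Y.s) d * Y.B a b d * Z.D a b d) R n m)
    (fun n m => by
      rw [rhsX_eq]
      simpa [LData.toMatrix, mono_mul_mono] using
        hasSum_col_mono 0 0 Z.s (fun a b d => Z.B a b d * Y.D a b d) R n m)
  have k20 := key 2 0
    (fun a b d x y z => Y.C a (b + Y.s) d * kerExt R a (b + Y.s) d x y z)
    (fun a b d x y z =>
      Z.D x (y - Y.s) z * Y.C x y z * X.A x y z * kerExt R a b d x (y - Y.s) z +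
      Z.C (x - X.s) y z * X.C x y z * kerExt R a b d (x - X.s) y (z - Z.s))
    (fun n m => by
      rw [lhsX_eq]
      simpa [LData.toMatrix, mono_mul_mono] using
        hasSum_row_mono 0 (-Y.s) 0 Y.C R n m)
    (fun n m => by
      rw [rhsX_eq]
      refine hasSum_col_add ?_ ?_
      · simpa [LData.toMatrix, mono_mul_mono, sub_eq_add_neg] using
          hasSum_col_mono 0 (-Y.s) 0
            (fun a b d => Z.D a (b - Y.s) d * Y.C a b d * X.A a b d) R n m
      · simpa [LData.toMatrix, mono_mul_mono, sub_eq_add_neg] using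
          hasSum_col_mono (-X.s) 0 (-Z.s) (fun a b d => Z.C (a - X.s) b d * X.C a b d) R n m)
  have k21 := key 2 1
    (fun a b d x y z => Y.D a b d * Z.C a b (d + Z.s) * kerExt R a b (d + Z.s) x y z)
    (fun a b d x y z =>
      Z.D (x + X.s) (y - Y.s) z * Y.C (x + X.s) y z * X.B x y z *
        kerExt R a b d (x + X.s) (y - Y.s) z +
      Z.C x y z * X.D x y z * kerExt R a b d x y (z - Z.s))
    (fun n m => by
      rw [lhsX_eq]
      simpa [LData.toMatrix, mono_mul_mono, sub_eq_add_neg] using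
        hasSum_row_mono 0 0 (-Z.s) (fun a b d => Y.D a b (d - Z.s) * Z.C a b d) R n m)
    (fun n m => by
      rw [rhsX_eq]
      refine hasSum_col_add ?_ ?_
      · simpa [LData.toMatrix, mono_mul_mono, sub_eq_add_neg] using
          hasSum_col_mono X.s (-Y.s) 0
            (fun a b d => Z.D (a + X.s) (b - Y.s) d * Y.C (a + X.s) b d * X.B a b d) R n m
      · simpa [LData.toMatrix, mono_mul_mono, sub_eq_add_neg] using
          hasSum_col_mono 0 0 (-Z.s) (fun a b d => Z.C a b d * X.D a b d) R n m)
  have k22 := key 2 2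
    (fun a b d x y z => Y.D a b d * Z.D a b d * kerExt R a b d x y z)
    (fun a b d x y z => Z.D x y z * Y.D x y z * kerExt R a b d x y z)
    (fun n m => by
      rw [lhsX_eq]
      simpa [LData.toMatrix, mono_mul_mono] using
        hasSum_row_mono 0 0 0 (fun a b d => Y.D a b d * Z.D a b d) R n m)
    (fun n m => by
      rw [rhsX_eq]
      simpa [LData.toMatrix, mono_mul_mono] using
        hasSum_col_mono 0 0 0 (fun a b d => Z.D a b d * Y.D a b d) R n m)
  constructor
  · intro h
    exact ⟨k00.1 (h 0 0), k01.1 (h 0 1), k02.1 (h 0 2), k10.1 (h 1 0), k11.1 (h 1 1),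
      k12.1 (h 1 2), k20.1 (h 2 0), k21.1 (h 2 1), k22.1 (h 2 2)⟩
  · intro h i j
    fin_cases i <;> fin_cases j
    · exact k00.2 h.e00
    · exact k01.2 h.e01
    · exact k02.2 h.e02
    · exact k10.2 h.e10
    · exact k11.2 h.e11
    · exact k12.2 h.e12
    · exact k20.2 h.e20
    · exact k21.2 h.e21
    · exact k22.2 h.e22

theorem matEl_mul (A B : Op c) (n m : State c) :
    matEl (A * B) n m = ∑ l ∈ (B (Finsupp.single m 1)).support, matEl A n l * matEl B l m := by
  have : B (Finsupp.single m 1) =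
      ∑ l ∈ (B (Finsupp.single m 1)).support, (B (Finsupp.single m 1)) l • Finsupp.single l 1 := by
    conv_lhs => rw [← Finsupp.sum_single (B (Finsupp.single m 1))]
    simp [Finsupp.sum]
  rw [matEl, Module.End.mul_apply]
  conv_lhs => rw [this]
  rw [map_sum, Finsupp.finsetSum_apply]
  refine Finset.sum_congr rfl fun l _ => ?_
  rw [map_smul, Finsupp.smul_apply, smul_eq_mul, mul_comm]
  rfl

theorem hasSum_matEl_mul (A B : Op c) (n m : State c) :
    HasSum (fun l => matEl A n l * matEl B l m) (matEl (A * B) n m) := by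
  rw [matEl_mul]
  apply hasSum_sum_of_ne_finset_zero
  intro l hl
  rw [Finsupp.notMem_support_iff] at hl
  rw [matEl, matEl, hl, mul_zero]

/-- Columns of a genuine operator are finite, so the matrix products always converge to the matrix
of the product, and operators become a special case of infinite matrices. -/
theorem intertwines_iff (x₁ x₂ x₃ : Matrix (Fin 2) (Fin 2) (Op c)) (R : Op c) :
    Intertwines x₁ x₂ x₃ R ↔ KernelIntertwines x₁ x₂ x₃ (matEl R) := by
  refine forall_congr' fun i => forall_congr' fun j => ?_
  have : (∀ n m, ∃ s, HasSum (fun l => matEl (lhsX x₁ x₂ x₃ i j) n l * matEl R l m) s ∧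
      HasSum (fun l => matEl R n l * matEl (rhsX x₁ x₂ x₃ i j) l m) s) ↔
      ∀ n m, matEl (lhsX x₁ x₂ x₃ i j * R) n m = matEl (R * rhsX x₁ x₂ x₃ i j) n m :=
    forall_congr' fun n => forall_congr' fun m =>
      hasSum_pair_iff (hasSum_matEl_mul _ _ n m) (hasSum_matEl_mul _ _ n m)
  rw [this]
  exact ⟨fun h n m => by rw [h], Op.ext_matEl⟩

theorem matEl_mul_mono (A : Op c) (d e g : ℤ) (f : ℤ → ℤ → ℤ → ℂ) (n m : State c) :
    matEl (A * mono d e g f) n m = f (m.1 0) (m.1 1) (m.1 2) *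
      kerExt (matEl A) (n.1 0) (n.1 1) (n.1 2) (m.1 0 + d) (m.1 1 + e) (m.1 2 + g) :=
  (hasSum_matEl_mul _ _ n m).unique (hasSum_col_mono d e g f _ n m)

theorem matEl_mono_mul (A : Op c) (d e g : ℤ) (f : ℤ → ℤ → ℤ → ℂ) (n m : State c) :
    matEl (mono d e g f * A) n m = f (n.1 0 - d) (n.1 1 - e) (n.1 2 - g) *
      kerExt (matEl A) (n.1 0 - d) (n.1 1 - e) (n.1 2 - g) (m.1 0) (m.1 1) (m.1 2) :=
  (hasSum_matEl_mul _ _ n m).unique (hasSum_row_mono d e g f _ n m)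

/-! ### Removal of the spectral parameters. -/

/-- The dressing of a matrix by powers of `u, v, w`. -/
def dressExt (u v w : ℂ) (K : ℤ → ℤ → ℤ → ℤ → ℤ → ℤ → ℂ) (a b d x y z : ℤ) : ℂ :=
  v ^ b * K a b d x y z * u ^ x * w ^ z

/-- Shifting `b`, `x` or `z` by the step of its site changes the dressing factor by λ₁μ₃, λ₃/λ₂ or
μ₁/μ₂. These ratios are exactly what makes all terms of each relation carry the same monomial in λ
and μ, which cancels. The three power hypotheses treat both signs of the steps at once. -/
theorem rels_dressExt_iff (X Y Z : LData) (T : ℤ → ℤ → ℤ → Prop)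
    (K : ℤ → ℤ → ℤ → ℤ → ℤ → ℤ → ℂ) {lam mu : Fin 3 → ℂ} (hl : ∀ j, lam j ≠ 0)
    (hm : ∀ j, mu j ≠ 0) {u v w : ℂ} (hu0 : u ≠ 0) (hv0 : v ≠ 0) (hw0 : w ≠ 0)
    (hu : u ^ X.s = lam 2 / lam 1) (hv : v ^ Y.s = lam 0 * mu 2) (hw : w ^ Z.s = mu 0 / mu 1) :
    Rels (X.scale (lam 0) (mu 0)) (Y.scale (lam 1) (mu 1)) (Z.scale (lam 2) (mu 2)) T
      (dressExt u v w K) ↔ Rels X Y Z T K := by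
  have l0 := hl 0
  have l1 := hl 1
  have l2 := hl 2
  have m0 := hm 0
  have m1 := hm 1
  have m2 := hm 2
  have hF : ∀ b x z : ℤ, v ^ b * u ^ x * w ^ z ≠ 0 := fun b x z =>
    mul_ne_zero (mul_ne_zero (zpow_ne_zero _ hv0) (zpow_ne_zero _ hu0)) (zpow_ne_zero _ hw0)
  -- `F` is the common monomial in λ, μ of the relation at hand; its value for each of the nine
  -- entries is supplied below.
  have key : ∀ (F : ℂ) (b x z : ℤ) {L R L' R' : ℂ}, F ≠ 0 →
      L' = F * (v ^ b * u ^ x * w ^ z) * L → R' = F * (v ^ b * u ^ x * w ^ z) * R →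
      (L' = R' ↔ L = R) := by
    rintro F b x z L R L' R' h rfl rfl
    exact mul_right_inj' (mul_ne_zero h (hF b x z))
  have hvs : ∀ b : ℤ, v ^ (b - Y.s) = v ^ b / (lam 0 * mu 2) := fun b => by
    rw [zpow_sub₀ hv0, hv]
  have hva : ∀ b : ℤ, v ^ (b + Y.s) = v ^ b * (lam 0 * mu 2) := fun b => by
    rw [zpow_add₀ hv0, hv]
  have hus : ∀ b : ℤ, u ^ (b - X.s) = u ^ b * (lam 1 / lam 2) := fun b => by
    rw [zpow_sub₀ hu0, hu]; field_simp
  have hua : ∀ b : ℤ, u ^ (b + X.s) = u ^ b * (lam 2 / lam 1) := fun b => by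
    rw [zpow_add₀ hu0, hu]
  have hws : ∀ b : ℤ, w ^ (b - Z.s) = w ^ b * (mu 1 / mu 0) := fun b => by
    rw [zpow_sub₀ hw0, hw]; field_simp
  have hwa : ∀ b : ℤ, w ^ (b + Z.s) = w ^ b * (mu 0 / mu 1) := fun b => by
    rw [zpow_add₀ hw0, hw]
  refine ⟨fun h => ⟨fun a b d x y z ha hx => (key (lam 0 * lam 1) b x z ?_ ?_ ?_).1
      (h.e00 a b d x y z ha hx),
    fun a b d x y z ha hx => (key (lam 2) b x z ?_ ?_ ?_).1
      (h.e01 a b d x y z ha hx),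
    fun a b d x y z ha hx => (key (1) b x z ?_ ?_ ?_).1
      (h.e02 a b d x y z ha hx),
    fun a b d x y z ha hx => (key (lam 0 * lam 1 * mu 0) b x z ?_ ?_ ?_).1
      (h.e10 a b d x y z ha hx),
    fun a b d x y z ha hx => (key (mu 0 * lam 2) b x z ?_ ?_ ?_).1
      (h.e11 a b d x y z ha hx),
    fun a b d x y z ha hx => (key (mu 0) b x z ?_ ?_ ?_).1
      (h.e12 a b d x y z ha hx),
    fun a b d x y z ha hx => (key (lam 0 * lam 1 * mu 1 * mu 2) b x z ?_ ?_ ?_).1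
      (h.e20 a b d x y z ha hx),
    fun a b d x y z ha hx => (key (mu 1 * lam 2 * mu 2) b x z ?_ ?_ ?_).1
      (h.e21 a b d x y z ha hx),
    fun a b d x y z ha hx => (key (mu 1 * mu 2) b x z ?_ ?_ ?_).1
      (h.e22 a b d x y z ha hx)⟩,
    fun h => ⟨fun a b d x y z ha hx => (key (lam 0 * lam 1) b x z ?_ ?_ ?_).2
      (h.e00 a b d x y z ha hx),
    fun a b d x y z ha hx => (key (lam 2) b x z ?_ ?_ ?_).2
      (h.e01 a b d x y z ha hx),
    fun a b d x y z ha hx => (key (1) b x z ?_ ?_ ?_).2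
      (h.e02 a b d x y z ha hx),
    fun a b d x y z ha hx => (key (lam 0 * lam 1 * mu 0) b x z ?_ ?_ ?_).2
      (h.e10 a b d x y z ha hx),
    fun a b d x y z ha hx => (key (mu 0 * lam 2) b x z ?_ ?_ ?_).2
      (h.e11 a b d x y z ha hx),
    fun a b d x y z ha hx => (key (mu 0) b x z ?_ ?_ ?_).2
      (h.e12 a b d x y z ha hx),
    fun a b d x y z ha hx => (key (lam 0 * lam 1 * mu 1 * mu 2) b x z ?_ ?_ ?_).2
      (h.e20 a b d x y z ha hx),
    fun a b d x y z ha hx => (key (mu 1 * lam 2 * mu 2) b x z ?_ ?_ ?_).2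
      (h.e21 a b d x y z ha hx),
    fun a b d x y z ha hx => (key (mu 1 * mu 2) b x z ?_ ?_ ?_).2
      (h.e22 a b d x y z ha hx)⟩⟩
  all_goals first
    | exact one_ne_zero
    | simp only [ne_eq, mul_eq_zero, hl, hm, or_self, not_false_eq_true]
    | (simp only [LData.scale, dressExt, hvs, hva, hus, hua, hws, hwa]
       first | done | ring1 | (field_simp; done) | (field_simp; ring1))

/-! ### Coefficients of the oscillator matrices X. -/

/-- The occupation number at the site `j`. -/
def sel (j : Fin 3) (a b d : ℤ) : ℤ := ![a, b, d] j

@[simp] theorem sel_zero (a b d : ℤ) : sel 0 a b d = a := rfl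
@[simp] theorem sel_one (a b d : ℤ) : sel 1 a b d = b := rfl
@[simp] theorem sel_two (a b d : ℤ) : sel 2 a b d = d := rfl

theorem sel_state (j : Fin 3) (n : State c) : sel j (n.1 0) (n.1 1) (n.1 2) = n.1 j := by
  fin_cases j <;> rfl

/-- The coefficients of `X[A(q)]`. -/
def LData.bose (q : ℂ) (j : Fin 3) : LData where
  s := 1
  A a b d := q ^ sel j a b d
  B a b d := 1 - q ^ (2 * sel j a b d + 2)
  C _ _ _ := 1
  D a b d := -(q * q ^ sel j a b d)

/-- The coefficients of `X[A(q⁻¹)]`. -/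
def LData.boseInv (q : ℂ) (j : Fin 3) : LData where
  s := -1
  A a b d := q * q ^ sel j a b d
  B _ _ _ := 1
  C a b d := 1 - q ^ (2 * sel j a b d + 2)
  D a b d := -q ^ sel j a b d

/-- The coefficients of `X[F(q)]`, with sign function `ε`. -/
def LData.fermi (q : ℂ) (j : Fin 3) (ε : ℤ → ℤ → ℤ → ℂ) : LData where
  s := 1
  A a b d := q ^ sel j a b d
  B a b d := ε a b d
  C a b d := ε a b d * (1 - q ^ 2)
  D a b d := -(q * q⁻¹ ^ sel j a b d)

/-- The coefficients of `X[F(q⁻¹)]`, with sign function `ε`. -/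
def LData.fermiInv (q : ℂ) (j : Fin 3) (ε : ℤ → ℤ → ℤ → ℂ) : LData where
  s := -1
  A a b d := q⁻¹ * q ^ sel j a b d
  B a b d := q⁻¹ * (ε a b d * (1 - q ^ 2))
  C a b d := -(q⁻¹ * ε a b d)
  D a b d := -q⁻¹ ^ sel j a b d

theorem pw_eq_mono (x : ℂ) (j : Fin 3) :
    (pw x j : Op c) = mono 0 0 0 (fun a b d => x ^ sel j a b d) := by
  rw [← diagOp_eq_mono, pw]
  simp only [sel_state]

theorem num_eq_mono (j : Fin 3) :
    (num j : Op c) = mono 0 0 0 (fun a b d => (sel j a b d : ℂ)) := by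
  rw [← diagOp_eq_mono, num]
  simp only [sel_state]

theorem up_bose_eq_mono (q : ℂ) {j : Fin 3} {r : BoseRep} (hj : c j = .bose r) :
    (up q j : Op c) = mono ((Pi.single j 1 : Fin 3 → ℤ) 0) ((Pi.single j 1 : Fin 3 → ℤ) 1)
        ((Pi.single j 1 : Fin 3 → ℤ) 2) (fun a b d => 1 - q ^ (2 * sel j a b d + 2)) := by
  rw [← shiftOp_eq_mono, up]
  simp only [sel_state, hj]

theorem dn_bose_eq_mono (q : ℂ) {j : Fin 3} {r : BoseRep} (hj : c j = .bose r) :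
    (dn q j : Op c) = mono ((Pi.single j (-1) : Fin 3 → ℤ) 0) ((Pi.single j (-1) : Fin 3 → ℤ) 1)
        ((Pi.single j (-1) : Fin 3 → ℤ) 2) (fun _ _ _ => 1) := by
  rw [← shiftOp_eq_mono, dn]
  simp only [hj]

theorem up_fermi_eq_mono (q : ℂ) {j : Fin 3} (hj : c j = .fermi) {ε : ℤ → ℤ → ℤ → ℂ}
    (hε : ∀ n : State c, oddSign j n = ε (n.1 0) (n.1 1) (n.1 2)) :
    (up q j : Op c) = mono ((Pi.single j 1 : Fin 3 → ℤ) 0) ((Pi.single j 1 : Fin 3 → ℤ) 1)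
        ((Pi.single j 1 : Fin 3 → ℤ) 2) ε := by
  rw [← shiftOp_eq_mono, up]
  simp only [hj, hε]

theorem dn_fermi_eq_mono (q : ℂ) {j : Fin 3} (hj : c j = .fermi) {ε : ℤ → ℤ → ℤ → ℂ}
    (hε : ∀ n : State c, oddSign j n = ε (n.1 0) (n.1 1) (n.1 2)) :
    (dn q j : Op c) = mono ((Pi.single j (-1) : Fin 3 → ℤ) 0) ((Pi.single j (-1) : Fin 3 → ℤ) 1)
        ((Pi.single j (-1) : Fin 3 → ℤ) 2) (fun a b d => ε a b d * (1 - q ^ 2)) := by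
  rw [← shiftOp_eq_mono (f := fun a b d => ε a b d * (1 - q ^ 2)), dn]
  simp only [hj, hε]

theorem XA_eq (q l m : ℂ) {j : Fin 3} {r : BoseRep} (hj : c j = .bose r) :
    (XA q l m j : Matrix _ _ (Op c)) = ((LData.bose q j).scale l m).toMatrix j := by
  simp only [XA, LData.toMatrix, LData.scale, LData.bose, pw_eq_mono, up_bose_eq_mono q hj,
    dn_bose_eq_mono q hj, smul_mono]
  congr! 6
  funext a b d
  ring

theorem XA'_eq (q l m : ℂ) {j : Fin 3} {r : BoseRep} (hj : c j = .bose r) :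
    (XA' q l m j : Matrix _ _ (Op c)) = ((LData.boseInv q j).scale l m).toMatrix j := by
  simp only [XA', LData.toMatrix, LData.scale, LData.boseInv, pw_eq_mono, up_bose_eq_mono q hj,
    dn_bose_eq_mono q hj, smul_mono, neg_neg]
  congr! 6 <;> ring_nf

theorem XF_eq (q l m : ℂ) {j : Fin 3} (hj : c j = .fermi) {ε : ℤ → ℤ → ℤ → ℂ}
    (hε : ∀ n : State c, oddSign j n = ε (n.1 0) (n.1 1) (n.1 2)) :
    (XF q l m j : Matrix _ _ (Op c)) = ((LData.fermi q j ε).scale l m).toMatrix j := by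
  simp only [XF, LData.toMatrix, LData.scale, LData.fermi, pw_eq_mono, up_fermi_eq_mono q hj hε,
    dn_fermi_eq_mono q hj hε, smul_mono, neg_neg]
  congr! 6
  funext a b d
  ring

theorem XF'_eq (q l m : ℂ) {j : Fin 3} (hj : c j = .fermi) {ε : ℤ → ℤ → ℤ → ℂ}
    (hε : ∀ n : State c, oddSign j n = ε (n.1 0) (n.1 1) (n.1 2)) :
    (XF' q l m j : Matrix _ _ (Op c)) = ((LData.fermiInv q j ε).scale l m).toMatrix j := by
  simp only [XF', LData.toMatrix, LData.scale, LData.fermiInv, pw_eq_mono,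
    up_fermi_eq_mono q hj hε, dn_fermi_eq_mono q hj hε, smul_mono, neg_neg]
  congr! 6 <;> ring_nf

theorem kerExt_dressKernel (lam mu : Fin 3 → ℂ) (s : Fin 3 → ℤ) (R : State c → State c → ℂ) :
    kerExt (dressKernel lam mu s R) =
      dressExt ((lam 2 / lam 1) ^ s 0) ((lam 0 * mu 2) ^ s 1) ((mu 0 / mu 1) ^ s 2)
        (kerExt R) := by
  funext a b d x y z
  simp only [dressExt, kerExt]
  split_ifs with h
  · rfl
  · simp

/-- The exponents of the dressing are the signs of the steps, and raising the dressing parameters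
once more to these signs restores the ratios of spectral parameters, as each sign squares to 1. -/
theorem kernelIntertwines_dress_iff (X Y Z : LData) (R : State c → State c → ℂ)
    {lam mu : Fin 3 → ℂ} (hl : ∀ j, lam j ≠ 0) (hm : ∀ j, mu j ≠ 0) (s : Fin 3 → ℤ)
    (h0 : s 0 = X.s) (h1 : s 1 = Y.s) (h2 : s 2 = Z.s) (hX : X.s * X.s = 1) (hY : Y.s * Y.s = 1)
    (hZ : Z.s * Z.s = 1) :
    KernelIntertwines ((X.scale (lam 0) (mu 0)).toMatrix 0) ((Y.scale (lam 1) (mu 1)).toMatrix 1)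
      ((Z.scale (lam 2) (mu 2)).toMatrix 2) (dressKernel lam mu s R) ↔
      Rels X Y Z (Adm c) (kerExt R) := by
  rw [kernelIntertwines_iff, kerExt_dressKernel]
  have hu := div_ne_zero (hl 2) (hl 1)
  have hv := mul_ne_zero (hl 0) (hm 2)
  have hw := div_ne_zero (hm 0) (hm 1)
  apply rels_dressExt_iff X Y Z _ _ hl hm (zpow_ne_zero _ hu) (zpow_ne_zero _ hv)
    (zpow_ne_zero _ hw)
  · rw [← zpow_mul, h0, hX, zpow_one]
  · rw [← zpow_mul, h1, hY, zpow_one]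
  · rw [← zpow_mul, h2, hZ, zpow_one]

/-- Dressing is invertible, which lets uniqueness be proved for constant matrices only. -/
theorem exists_eq_dressKernel {lam mu : Fin 3 → ℂ} (hl : ∀ j, lam j ≠ 0) (hm : ∀ j, mu j ≠ 0)
    (s : Fin 3 → ℤ) (R' : State c → State c → ℂ) : ∃ R, R' = dressKernel lam mu s R := by
  have hu := div_ne_zero (hl 2) (hl 1)
  have hv := mul_ne_zero (hl 0) (hm 2)
  have hw := div_ne_zero (hm 0) (hm 1)
  refine ⟨fun n m => R' n m / (((lam 0 * mu 2) ^ s 1) ^ (n.1 1) *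
    ((lam 2 / lam 1) ^ s 0) ^ (m.1 0) * ((mu 0 / mu 1) ^ s 2) ^ (m.1 2)), ?_⟩
  funext n m
  have h1 := zpow_ne_zero (n.1 1) (zpow_ne_zero (s 1) hv)
  have h2 := zpow_ne_zero (m.1 0) (zpow_ne_zero (s 0) hu)
  have h3 := zpow_ne_zero (m.1 2) (zpow_ne_zero (s 2) hw)
  rw [dressKernel]
  generalize ((lam 0 * mu 2) ^ s 1) ^ (n.1 1) = v at *
  generalize ((lam 2 / lam 1) ^ s 0) ^ (m.1 0) = u at *
  generalize ((mu 0 / mu 1) ^ s 2) ^ (m.1 2) = w at *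
  field_simp

theorem dressKernel_smul (lam mu : Fin 3 → ℂ) (s : Fin 3 → ℤ) (t : ℂ)
    (R : State c → State c → ℂ) :
    dressKernel lam mu s (t • R) = t • dressKernel lam mu s R := by
  funext n m
  simp only [dressKernel, Pi.smul_apply, smul_eq_mul]
  ring

theorem matEl_dress (lam mu : Fin 3 → ℂ) (s : Fin 3 → ℤ) (R : Op c) :
    matEl (dress lam mu s R) = dressKernel lam mu s (matEl R) := by
  funext n m
  rw [dress, dressKernel, pw_eq_mono, pw_eq_mono, pw_eq_mono, matEl_mul_mono]
  simp only [add_zero, kerExt_state]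
  rw [matEl_mul_mono]
  simp only [add_zero, kerExt_state]
  rw [matEl_mono_mul]
  simp only [sub_zero, kerExt_state, sel_state]
  ring

/-! ### Infinite products -/

theorem summable_qPoch {q : ℂ} (hq1 : ‖q‖ < 1) (x : ℂ) :
    Summable fun k : ℕ => ‖-(x * q ^ (2 * k))‖ := by
  have h2 : ‖q ^ 2‖ < 1 := by
    rw [norm_pow]; exact pow_lt_one₀ (norm_nonneg _) hq1 two_ne_zero
  have := ((summable_geometric_of_norm_lt_one h2).mul_left x).norm
  simpa only [norm_neg, pow_mul] using this

theorem multipliable_qPoch {q : ℂ} (hq1 : ‖q‖ < 1) (x : ℂ) :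
    Multipliable fun k : ℕ => (1 - x * q ^ (2 * k)) := by
  simpa only [sub_eq_add_neg] using multipliable_one_add_of_summable (summable_qPoch hq1 x)

theorem qPoch_eq {q : ℂ} (hq1 : ‖q‖ < 1) (x : ℂ) : qPoch q x = (1 - x) * qPoch q (x * q ^ 2) := by
  have h : ∀ k : ℕ, 1 - x * q ^ 2 * q ^ (2 * k) = 1 - x * q ^ (2 * (k + 1)) := fun k => by ring
  have hm := multipliable_qPoch hq1 (x * q ^ 2)
  simp only [h] at hm
  have e : qPoch q x = (1 - x * q ^ (2 * 0)) * ∏' k : ℕ, (1 - x * q ^ (2 * (k + 1))) :=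
    tprod_eq_zero_mul' (f := fun k : ℕ => 1 - x * q ^ (2 * k)) hm
  rw [e, mul_zero, pow_zero, mul_one]
  simp only [qPoch, h]

theorem qPoch_eq_prod {q : ℂ} (hq1 : ‖q‖ < 1) (x : ℂ) (n : ℕ) :
    qPoch q x = (∏ i ∈ Finset.range n, (1 - x * q ^ (2 * i))) * qPoch q (x * q ^ (2 * n)) := by
  induction n with
  | zero => simp
  | succ n ih =>
    rw [ih, Finset.prod_range_succ, qPoch_eq hq1 (x * q ^ (2 * n)),
      show x * q ^ (2 * n) * q ^ 2 = x * q ^ (2 * (n + 1)) by ring, mul_assoc]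

theorem qPoch_ne_zero {q x : ℂ} (hq1 : ‖q‖ < 1) (h : ∀ k : ℕ, x * q ^ (2 * k) ≠ 1) :
    qPoch q x ≠ 0 := by
  rw [qPoch]
  simp only [sub_eq_add_neg]
  refine tprod_one_add_ne_zero_of_summable (fun k => ?_) (summable_qPoch hq1 x)
  rw [← sub_eq_add_neg, sub_ne_zero]
  exact (h k).symm

/-! ### Laurent expansions -/

/-- The punctured neighbourhoods of `0` or of `∞`. -/
def _root_.BoseRep.lim : BoseRep → Filter ℂ
  | .fock => 𝓝[≠] 0
  | .antiFock => cobounded ℂ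

/-- Replaces an explicit region of expansion by a filter, so that finitely many regions can be
intersected and rescaled without bookkeeping of radii. -/
theorem exists_near_iff (b : BoseRep) (P : ℂ → Prop) :
    (∃ ρ : ℝ, 0 < ρ ∧ ∀ z, b.near ρ z → P z) ↔ ∀ᶠ z in b.lim, P z := by
  cases b with
  | fock =>
    simp only [BoseRep.near, BoseRep.lim, eventually_nhdsWithin_iff, Metric.eventually_nhds_iff,
      dist_zero_right, Set.mem_compl_iff, Set.mem_singleton_iff, norm_pos_iff]
    exact exists_congr fun ρ => and_congr_right fun _ => forall_congr' fun z => by tauto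
  | antiFock =>
    simp only [BoseRep.near, BoseRep.lim]
    rw [(atTop_basis_Ioi (α := ℝ)).cobounded_of_norm.eventually_iff]
    constructor
    · rintro ⟨ρ, -, h⟩
      exact ⟨ρ, trivial, fun {z} hz => h z hz⟩
    · rintro ⟨ρ, -, h⟩
      exact ⟨max ρ 1, lt_max_of_lt_right one_pos, fun z hz => h (lt_of_le_of_lt (le_max_left _ _) hz)⟩

theorem eventually_lim_ne_zero (b : BoseRep) : ∀ᶠ z in b.lim, z ≠ 0 := by
  cases b with
  | fock => exact eventually_mem_nhdsWithin
  | antiFock =>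
    rw [← exists_near_iff]
    exact ⟨1, one_pos, fun z hz h => by
      have : (1 : ℝ) < ‖z‖ := hz
      rw [h, norm_zero] at this
      linarith⟩

theorem tendsto_mul_lim (b : BoseRep) {t : ℂ} (ht : t ≠ 0) : Tendsto (t * ·) b.lim b.lim := by
  cases b with
  | fock =>
    refine tendsto_nhdsWithin_iff.2 ⟨?_, ?_⟩
    · have : Tendsto (t * ·) (𝓝 (0 : ℂ)) (𝓝 (t * 0)) := (continuous_const_mul t).tendsto 0
      rw [mul_zero] at this
      exact this.mono_left nhdsWithin_le_nhds
    · exact (eventually_lim_ne_zero .fock).mono fun z hz => mul_ne_zero ht hz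
  | antiFock => exact tendsto_mul_left_cobounded ht

/-- Points that avoid the zeros of all infinite products in use. -/
def Gen (q z : ℂ) : Prop := ∀ m : ℤ, ‖z‖ ≠ ‖q‖ ^ m

theorem Gen.mul {q z : ℂ} (hq : q ≠ 0) (h : Gen q z) (j : ℤ) : Gen q (q ^ j * z) := by
  have hq' := norm_ne_zero_iff.2 hq
  intro m hm
  apply h (m - j)
  rw [zpow_sub₀ hq', ← hm, norm_mul, norm_zpow, mul_div_cancel_left₀ _ (zpow_ne_zero _ hq')]

theorem Gen.inv {q z : ℂ} (h : Gen q z) : Gen q z⁻¹ := fun m hm => h (-m) (by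
  rw [zpow_neg, ← hm, norm_inv, inv_inv])

/-- The modulus √|q| is not an integer power of |q|, since squaring would give 1 = 2m. -/
theorem exists_gen {q : ℂ} (hq0 : 0 < ‖q‖) (hq1 : ‖q‖ < 1) : ∃ t : ℂ, t ≠ 0 ∧ Gen q t := by
  have hs : 0 < √‖q‖ := Real.sqrt_pos.2 hq0
  refine ⟨(√‖q‖ : ℝ), by exact_mod_cast hs.ne', fun m hm => ?_⟩
  rw [Complex.norm_real, Real.norm_eq_abs, abs_of_pos hs] at hm
  have h2 : ‖q‖ ^ (1 : ℤ) = ‖q‖ ^ (2 * m) := by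
    rw [zpow_one, mul_comm, zpow_mul, ← hm]
    exact (Real.sq_sqrt hq0.le).symm
  have := zpow_right_injective₀ hq0 hq1.ne h2
  omega

/-- Genericity is invariant under multiplication by powers of q and under inversion, so the points
qⁿt accumulate at 0 and their inverses at ∞. -/
theorem frequently_gen {q : ℂ} (hq0 : 0 < ‖q‖) (hq1 : ‖q‖ < 1) (b : BoseRep) :
    ∃ᶠ z in b.lim, Gen q z := by
  obtain ⟨t, ht, hg⟩ := exists_gen hq0 hq1
  have hq : q ≠ 0 := norm_pos_iff.1 hq0
  have h0 : Tendsto (fun n : ℕ => q ^ (n : ℤ) * t) atTop (𝓝[≠] 0) := by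
    refine tendsto_nhdsWithin_iff.2 ⟨?_, Eventually.of_forall fun n =>
      mul_ne_zero (zpow_ne_zero _ hq) ht⟩
    simpa using (tendsto_pow_atTop_nhds_zero_of_norm_lt_one hq1).mul_const t
  cases b with
  | fock => exact h0.frequently (Frequently.of_forall fun n => hg.mul hq n)
  | antiFock =>
    have h1 : Tendsto (fun n : ℕ => (q ^ (n : ℤ) * t)⁻¹) atTop (cobounded ℂ) :=
      (tendsto_inv₀_nhdsNE_zero (α := ℂ)).comp h0
    exact h1.frequently (Frequently.of_forall fun n => (hg.mul hq n).inv)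

/-- Convergence at a single nonzero point gives a positive radius. The sum is then analytic at 0
with zeros accumulating there, hence vanishes identically. -/
theorem coeff_eq_zero_of_frequently {a : ℕ → ℂ}
    (h : ∃ᶠ z in 𝓝[≠] (0 : ℂ), HasSum (fun n => z ^ n * a n) 0) (n : ℕ) : a n = 0 := by
  set p := FormalMultilinearSeries.ofScalars ℂ a with hp
  obtain ⟨z₀, hz₀, hs⟩ := (h.and_eventually eventually_mem_nhdsWithin).exists.imp
    fun z hz => And.intro hz.2 hz.1
  have hrad : (‖z₀‖₊ : ENNReal) ≤ p.radius := by
    apply FormalMultilinearSeries.le_radius_of_tendsto (l := 0)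
    have := (tendsto_zero_iff_norm_tendsto_zero.1 hs.summable.tendsto_atTop_zero)
    convert this using 2 with n
    rw [hp, FormalMultilinearSeries.ofScalars_norm, norm_mul, norm_pow, mul_comm]
    rfl
  have hpos : 0 < p.radius := lt_of_lt_of_le (by simpa using hz₀) hrad
  have hball := p.hasFPowerSeriesOnBall hpos
  have hfreq : ∃ᶠ z in 𝓝[≠] (0 : ℂ), p.sum z = 0 := by
    have hev : ∀ᶠ z in 𝓝[≠] (0 : ℂ), z ∈ Metric.eball 0 p.radius :=
      mem_nhdsWithin_of_mem_nhds (Metric.eball_mem_nhds 0 hpos)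
    refine (h.and_eventually hev).mono fun z hz => ?_
    have h1 := hball.hasSum hz.2
    rw [zero_add] at h1
    have e : (fun n => (p n) fun _ => z) = fun n => z ^ n * a n := by
      funext n
      rw [hp, FormalMultilinearSeries.ofScalars_apply_eq, smul_eq_mul, mul_comm]
    rw [e] at h1
    exact h1.unique hz.1
  have hz : p = 0 := hball.hasFPowerSeriesAt.eq_zero_of_eventually
    (hball.analyticAt.frequently_zero_iff_eventually_zero.1 hfreq)
  have := (FormalMultilinearSeries.ofScalars_series_eq_zero (𝕜 := ℂ) (E := ℂ)).1 hz
  rw [this]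
  rfl

/-- `f` is the sequence of coefficients of the expansion of `F` near `0` or (with a minus sign)
near `∞`. -/
def Expands (q : ℂ) (b : BoseRep) (f : ℤ → ℂ) (F : ℂ → ℂ) : Prop :=
  ∀ᶠ z in b.lim, Gen q z → HasSum (fun n : ℤ => z ^ n * f n) (b.sign * F z)

/-- The sequence `f` vanishes far on the side that does not belong to the spectrum. -/
def BddSupp (b : BoseRep) (f : ℤ → ℂ) : Prop :=
  match b with
  | .fock => ∃ N : ℤ, ∀ n < N, f n = 0
  | .antiFock => ∃ N : ℤ, ∀ n > N, f n = 0

/-- Support bounded on one side makes the Laurent series a power series in z or z⁻¹ after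
multiplication by a power of z. Vanishing at generic points suffices because these accumulate at the
centre of expansion. -/
theorem Expands.eq_zero {q : ℂ} (hq0 : 0 < ‖q‖) (hq1 : ‖q‖ < 1) {b : BoseRep} {f : ℤ → ℂ}
    {F : ℂ → ℂ} (hf : Expands q b f F) (hb : BddSupp b f)
    (hF : ∀ᶠ z in b.lim, Gen q z → F z = 0) : f = 0 := by
  have hfr : ∃ᶠ z in b.lim, z ≠ 0 ∧ HasSum (fun n : ℤ => z ^ n * f n) 0 := by
    refine ((frequently_gen hq0 hq1 b).and_eventually
      ((hf.and hF).and (eventually_lim_ne_zero b))).mono fun z hz => ⟨hz.2.2, ?_⟩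
    have := hz.2.1.1 hz.1
    rwa [hz.2.1.2 hz.1, mul_zero] at this
  cases b with
  | fock =>
    obtain ⟨N, hN⟩ := hb
    have hinj : Function.Injective fun i : ℕ => N + (i : ℤ) := fun i j h => by
      simpa using h
    have h0 : ∀ i : ℕ, f (N + i) = 0 := by
      apply coeff_eq_zero_of_frequently (a := fun i : ℕ => f (N + i))
      refine Frequently.mono hfr fun z hz => ?_
      have h1 := (hinj.hasSum_iff (f := fun n : ℤ => z ^ n * f n) (a := 0) ?_).2 hz.2
      · have h2 := h1.mul_left (z ^ (-N))
        rw [mul_zero] at h2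
        refine h2.congr_fun fun i => ?_
        simp only [Function.comp]
        rw [← mul_assoc, ← zpow_add₀ hz.1, neg_add_cancel_left, zpow_natCast]
      · intro n hn
        rw [hN, mul_zero]
        by_contra hlt
        exact hn ⟨(n - N).toNat, by simp only; omega⟩
    funext n
    by_cases hn : n < N
    · exact hN n hn
    · have := h0 (n - N).toNat
      rwa [show N + ((n - N).toNat : ℤ) = n by omega] at this
  | antiFock =>
    obtain ⟨N, hN⟩ := hb
    have hinj : Function.Injective fun i : ℕ => N - (i : ℤ) := fun i j h => by
      simpa using h
    have h0 : ∀ i : ℕ, f (N - i) = 0 := by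
      apply coeff_eq_zero_of_frequently (a := fun i : ℕ => f (N - i))
      -- The inversion carries the points near ∞ to points near 0, where the series is one in
      -- nonnegative powers.
      refine (tendsto_inv₀_cobounded' (α := ℂ)).frequently (Frequently.mono hfr fun z hz => ?_)
      have h1 := (hinj.hasSum_iff (f := fun n : ℤ => z ^ n * f n) (a := 0) ?_).2 hz.2
      · have h2 := h1.mul_left (z ^ (-N))
        rw [mul_zero] at h2
        refine h2.congr_fun fun i => ?_
        simp only [Function.comp]
        rw [← mul_assoc, ← zpow_add₀ hz.1, inv_pow, ← zpow_natCast, ← zpow_neg]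
        congr 2
        ring
      · intro n hn
        rw [hN, mul_zero]
        by_contra hlt
        exact hn ⟨(N - n).toNat, by simp only; omega⟩
    funext n
    by_cases hn : n > N
    · exact hN n hn
    · have := h0 (N - n).toNat
      rwa [show N - ((N - n).toNat : ℤ) = n by omega] at this

theorem hasSum_of_eq {ι : Type*} {f g : ι → ℂ} {s t : ℂ} (h : HasSum f s) (hf : ∀ i, g i = f i)
    (hs : t = s) : HasSum g t := by
  obtain rfl : g = f := funext hf
  rwa [hs]

theorem Expands.add {q : ℂ} {b : BoseRep} {f g : ℤ → ℂ} {F G : ℂ → ℂ} (hf : Expands q b f F)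
    (hg : Expands q b g G) : Expands q b (fun n => f n + g n) (fun z => F z + G z) := by
  filter_upwards [hf, hg] with z h1 h2 hz
  simpa only [mul_add] using (h1 hz).add (h2 hz)

theorem Expands.const_mul {q : ℂ} {b : BoseRep} {f : ℤ → ℂ} {F : ℂ → ℂ} (hf : Expands q b f F)
    (t : ℂ) : Expands q b (fun n => t * f n) (fun z => t * F z) := by
  filter_upwards [hf] with z h1 hz
  simpa only [mul_left_comm] using (h1 hz).mul_left t

theorem Expands.sub {q : ℂ} {b : BoseRep} {f g : ℤ → ℂ} {F G : ℂ → ℂ} (hf : Expands q b f F)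
    (hg : Expands q b g G) : Expands q b (fun n => f n - g n) (fun z => F z - G z) := by
  filter_upwards [hf, hg] with z h1 h2 hz
  simpa only [mul_sub] using (h1 hz).sub (h2 hz)

/-- Together with `Expands.shift` this is the dictionary between q-difference equations and
recurrences: z ↦ qʲz multiplies the n-th coefficient by q^(jn), and multiplication by zʲ shifts the
index. -/
theorem Expands.scale {q : ℂ} (hq : q ≠ 0) {b : BoseRep} {f : ℤ → ℂ} {F : ℂ → ℂ}
    (hf : Expands q b f F) (j : ℤ) :
    Expands q b (fun n => q ^ (j * n) * f n) (fun z => F (q ^ j * z)) := by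
  filter_upwards [(tendsto_mul_lim b (zpow_ne_zero j hq)).eventually hf] with z h1 hz
  refine hasSum_of_eq (h1 (hz.mul hq j)) (fun n => ?_) rfl
  rw [mul_zpow, ← zpow_mul]
  ring

theorem Expands.shift {q : ℂ} {b : BoseRep} {f : ℤ → ℂ} {F : ℂ → ℂ}
    (hf : Expands q b f F) (j : ℤ) :
    Expands q b (fun n => f (n - j)) (fun z => z ^ j * F z) := by
  filter_upwards [hf, eventually_lim_ne_zero b] with z h1 hz0 hz
  have := ((Equiv.subRight j).hasSum_iff.2 (h1 hz)).mul_left (z ^ j)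
  refine hasSum_of_eq this (fun n => ?_) (by ring)
  · simp only [Function.comp, Equiv.subRight_apply]
    rw [← mul_assoc, ← zpow_add₀ hz0, add_sub_cancel]

theorem BddSupp.add {b : BoseRep} {f g : ℤ → ℂ} (hf : BddSupp b f) (hg : BddSupp b g) :
    BddSupp b (fun n => f n + g n) := by
  cases b with
  | fock =>
    obtain ⟨N, hN⟩ := hf
    obtain ⟨M, hM⟩ := hg
    exact ⟨min N M, fun n hn => by
      simp only [hN n (by omega), hM n (by omega), add_zero]⟩
  | antiFock =>
    obtain ⟨N, hN⟩ := hf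
    obtain ⟨M, hM⟩ := hg
    exact ⟨max N M, fun n hn => by
      simp only [hN n (by omega), hM n (by omega), add_zero]⟩

theorem BddSupp.mul {b : BoseRep} {f : ℤ → ℂ} (hf : BddSupp b f) (g : ℤ → ℂ) :
    BddSupp b (fun n => g n * f n) := by
  cases b with
  | fock =>
    obtain ⟨N, hN⟩ := hf
    exact ⟨N, fun n hn => by simp only [hN n hn, mul_zero]⟩
  | antiFock =>
    obtain ⟨N, hN⟩ := hf
    exact ⟨N, fun n hn => by simp only [hN n hn, mul_zero]⟩

theorem BddSupp.sub {b : BoseRep} {f g : ℤ → ℂ} (hf : BddSupp b f) (hg : BddSupp b g) :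
    BddSupp b (fun n => f n - g n) := by
  simpa only [neg_one_mul, ← sub_eq_add_neg] using hf.add (hg.mul fun _ => -1)

theorem BddSupp.shift {b : BoseRep} {f : ℤ → ℂ} (hf : BddSupp b f) (j : ℤ) :
    BddSupp b (fun n => f (n - j)) := by
  cases b with
  | fock =>
    obtain ⟨N, hN⟩ := hf
    exact ⟨N + j, fun n hn => hN _ (by omega)⟩
  | antiFock =>
    obtain ⟨N, hN⟩ := hf
    exact ⟨N + j, fun n hn => hN _ (by omega)⟩

theorem bddSupp_of_spectrum {b : BoseRep} {f : ℤ → ℂ}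
    (h : ∀ n, n ∉ (Osc.bose b).spectrum → f n = 0) : BddSupp b f := by
  cases b with
  | fock => exact ⟨0, fun n hn => h n (fun h' => by
      have : 0 ≤ n := h'
      omega)⟩
  | antiFock => exact ⟨0, fun n hn => h n (fun h' => by
      have : n < 0 := h'
      omega)⟩

/-- The device by which every functional identity below becomes an identity of coefficients. It
needs the functional identity only at generic nonzero points, where no infinite product vanishes. -/
theorem Expands.unique {q : ℂ} (hq0 : 0 < ‖q‖) (hq1 : ‖q‖ < 1) {b : BoseRep} {f g : ℤ → ℂ}
    {F G : ℂ → ℂ} (hf : Expands q b f F) (hg : Expands q b g G) (hbf : BddSupp b f)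
    (hbg : BddSupp b g) (h : ∀ z, z ≠ 0 → Gen q z → F z = G z) (n : ℤ) : f n = g n := by
  have h0 := (hf.sub hg).eq_zero hq0 hq1 (hbf.sub hbg)
    ((eventually_lim_ne_zero b).mono fun z hz hg => sub_eq_zero.2 (h z hz hg))
  exact sub_eq_zero.1 (congrFun h0 n)

theorem AnalyticAt.exists_coeff {H : ℂ → ℂ} (h : AnalyticAt ℂ H 0) :
    ∃ a : ℕ → ℂ, ∀ᶠ z in 𝓝 (0 : ℂ), HasSum (fun n => z ^ n * a n) (H z) := by
  obtain ⟨p, hp⟩ := h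
  refine ⟨p.coeff, ?_⟩
  simpa only [zero_add, smul_eq_mul] using hasFPowerSeriesAt_iff.1 hp

theorem analyticAt_finset_prod_linear (s : Finset ℕ) (c d : ℕ → ℂ) (z : ℂ) :
    AnalyticAt ℂ (fun z => ∏ i ∈ s, (c i + d i * z)) z := by
  apply Differentiable.analyticAt
  fun_prop

/-- At 0 the quotient is analytic since the denominator equals 1 there. At ∞ one expands in w = z⁻¹,
where the condition on the degrees says that the function vanishes at w = 0, so that only strictly
negative powers of z occur, as the anti-Fock spectrum requires. -/
theorem exists_expansion (b : BoseRep) (C : ℂ) (p m n : ℕ) (c d : ℕ → ℂ) (hd : ∀ i, d i ≠ 0)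
    (h : b = .antiFock → p + m < n) :
    ∃ f : ℤ → ℂ, (∀ x, x ∉ (Osc.bose b).spectrum → f x = 0) ∧
      ∀ᶠ z in b.lim, HasSum (fun x : ℤ => z ^ x * f x)
        (b.sign * (C * z ^ p * (∏ i ∈ Finset.range m, (1 - c i * z)) /
          ∏ i ∈ Finset.range n, (1 - d i * z))) := by
  cases b with
  | fock =>
    have hA : AnalyticAt ℂ (fun z => C * z ^ p * (∏ i ∈ Finset.range m, (1 + -c i * z)) /
        ∏ i ∈ Finset.range n, (1 + -d i * z)) 0 := by
      refine AnalyticAt.div ?_ (analyticAt_finset_prod_linear _ (fun _ => 1) _ _) (by simp)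
      refine AnalyticAt.mul ?_ (analyticAt_finset_prod_linear _ (fun _ => 1) _ _)
      fun_prop
    obtain ⟨a, ha⟩ := AnalyticAt.exists_coeff hA
    have hinj : Function.Injective fun i : ℕ => (i : ℤ) := Nat.cast_injective
    refine ⟨fun x => if 0 ≤ x then a x.toNat else 0, fun x hx => if_neg hx, ?_⟩
    filter_upwards [ha.filter_mono nhdsWithin_le_nhds] with z hz
    rw [← hinj.hasSum_iff]
    · simpa [Function.comp_def, BoseRep.sign, sub_eq_add_neg] using hz
    · intro x hx
      rw [if_neg, mul_zero]
      intro h0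
      exact hx ⟨x.toNat, by simp only; omega⟩
  | antiFock =>
    have hlt := h rfl
    -- The exponent is one less than the order of vanishing `n - m - p`: the remaining factor z⁻¹ is
    -- the start of the series at z⁻¹.
    have hA : AnalyticAt ℂ (fun w => C * w ^ (n - 1 - m - p) *
        (∏ i ∈ Finset.range m, (-c i + 1 * w)) / ∏ i ∈ Finset.range n, (-d i + 1 * w)) 0 := by
      refine AnalyticAt.div ?_ (analyticAt_finset_prod_linear _ _ (fun _ => 1) _) ?_
      · refine AnalyticAt.mul ?_ (analyticAt_finset_prod_linear _ _ (fun _ => 1) _)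
        fun_prop
      · rw [Finset.prod_ne_zero_iff]
        intro i _
        simpa using hd i
    obtain ⟨a, ha⟩ := AnalyticAt.exists_coeff hA
    have hinj : Function.Injective fun i : ℕ => -1 - (i : ℤ) := fun i j h => by simpa using h
    refine ⟨fun x => if x < 0 then -a (-1 - x).toNat else 0, fun x hx => if_neg hx, ?_⟩
    have ha' := (tendsto_inv₀_cobounded (α := ℂ)).eventually ha
    filter_upwards [ha', eventually_lim_ne_zero .antiFock] with z hz hz0
    rw [← hinj.hasSum_iff]
    · have h1 := hz.mul_left (-z⁻¹)
      refine hasSum_of_eq h1 (fun i => ?_) ?_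
      · simp only [Function.comp]
        rw [if_pos (by omega), show (-1 - (-1 - (i : ℤ))).toNat = i by omega, sub_eq_add_neg,
          zpow_add₀ hz0, zpow_neg_one, zpow_neg, zpow_natCast, inv_pow]
        ring
      · have e1 : ∀ (k : ℕ) (c : ℕ → ℂ), ∏ i ∈ Finset.range k, (-c i + 1 * z⁻¹) =
            (∏ i ∈ Finset.range k, (1 - c i * z)) * (z⁻¹) ^ k := by
          intro k c
          rw [← Finset.card_range k, ← Finset.prod_const, Finset.card_range,
            ← Finset.prod_mul_distrib]
          refine Finset.prod_congr rfl fun i _ => ?_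
          field_simp
          ring
        rw [e1, e1, BoseRep.sign]
        obtain ⟨j, rfl⟩ : ∃ j, n = p + m + 1 + j := ⟨n - (p + m + 1), by omega⟩
        rw [show p + m + 1 + j - 1 - m - p = j by omega]
        have h2 : z⁻¹ * (z⁻¹ ^ j * z⁻¹ ^ m) = z ^ p * z⁻¹ ^ (p + m + 1 + j) := by
          rw [show p + m + 1 + j = p + (m + 1 + j) by ring, pow_add _ p, ← mul_assoc (z ^ p),
            ← mul_pow, mul_inv_cancel₀ hz0, one_pow]
          ring
        have h3 : z⁻¹ ^ (p + m + 1 + j) ≠ 0 := pow_ne_zero _ (inv_ne_zero hz0)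
        generalize z⁻¹ ^ (p + m + 1 + j) = t at h2 h3 ⊢
        have h4 : -z⁻¹ * (C * z⁻¹ ^ j * ((∏ i ∈ Finset.range m, (1 - c i * z)) * z⁻¹ ^ m) /
            ((∏ i ∈ Finset.range (p + m + 1 + j), (1 - d i * z)) * t)) =
            -(C * (z⁻¹ * (z⁻¹ ^ j * z⁻¹ ^ m)) * (∏ i ∈ Finset.range m, (1 - c i * z)) /
            ((∏ i ∈ Finset.range (p + m + 1 + j), (1 - d i * z)) * t)) := by ring
        rw [h4, h2, show C * (z ^ p * t) * (∏ i ∈ Finset.range m, (1 - c i * z)) =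
          (C * z ^ p * (∏ i ∈ Finset.range m, (1 - c i * z))) * t by ring,
          mul_div_mul_right _ _ h3]
        ring
    · intro x hx
      rw [if_neg, mul_zero]
      intro h0
      exact hx ⟨(-1 - x).toNat, by simp only; omega⟩

/-- `nu / de` is a rational function without zeros or poles at `0`, vanishing to order `k + 1` at
`∞`. -/
def IsRational (k : ℕ) (nu de : ℂ → ℂ) : Prop :=
  ∃ (C : ℂ) (m : ℕ) (c d : ℕ → ℂ), (∀ i, d i ≠ 0) ∧ ∀ z, z ≠ 0 → de z ≠ 0 →
    nu z / de z = C * (∏ i ∈ Finset.range m, (1 - c i * z)) /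
      ∏ i ∈ Finset.range (m + k + 1), (1 - d i * z)

/-- The order of vanishing `k + 1` at ∞ gives more than membership in the spectrum: near ∞ only
powers x with `x + k < 0` occur. Near 0 the condition on `x + k` is automatic. This is the support
that the coefficients of the k-th term must have. -/
theorem IsRational.exists_coeff {k : ℕ} {nu de : ℂ → ℂ} (h : IsRational k nu de) (b : BoseRep) :
    ∃ f : ℤ → ℂ, (∀ x, ¬(x ∈ (Osc.bose b).spectrum ∧ x + k ∈ (Osc.bose b).spectrum) → f x = 0) ∧
      ∀ᶠ z in b.lim, de z ≠ 0 → HasSum (fun x : ℤ => z ^ x * f x) (b.sign * (nu z / de z)) := by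
  obtain ⟨C, m, c, d, hd, he⟩ := h
  cases b with
  | fock =>
    obtain ⟨f, hf, hs⟩ := exists_expansion .fock C 0 m (m + k + 1) c d hd (by simp)
    refine ⟨f, fun x hx => hf x fun h0 => hx ⟨h0, ?_⟩, ?_⟩
    · have : 0 ≤ x := h0
      change 0 ≤ x + k
      omega
    · filter_upwards [hs, eventually_lim_ne_zero .fock] with z hz hz0 hde
      rw [he z hz0 hde]
      simpa using hz
  | antiFock =>
    -- After multiplication by zᵏ the function still vanishes at ∞; shifting the index back by `k`
    -- yields the sharper support.
    obtain ⟨f, hf, hs⟩ := exists_expansion .antiFock C k m (m + k + 1) c d hd (by intro; omega)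
    refine ⟨fun x => f (x + k), fun x hx => hf _ fun h0 => hx ⟨?_, h0⟩, ?_⟩
    · have : x + k < 0 := h0
      change x < 0
      omega
    · filter_upwards [hs, eventually_lim_ne_zero .antiFock] with z hz hz0 hde
      rw [he z hz0 hde]
      have h1 := ((Equiv.addRight (k : ℤ)).hasSum_iff.2 hz).mul_left (z ^ (-(k : ℤ)))
      refine hasSum_of_eq h1 (fun x => ?_) ?_
      · simp only [Function.comp, Equiv.coe_addRight]
        rw [← mul_assoc, ← zpow_add₀ hz0]
        congr 2
        ring
      · rw [zpow_neg, zpow_natCast]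
        have := pow_ne_zero k hz0
        generalize ∏ i ∈ Finset.range m, (1 - c i * z) = P
        generalize ∏ i ∈ Finset.range (m + k + 1), (1 - d i * z) = Q
        field_simp

/-! ### The generating functions -/

theorem qPoch_zpow_succ {q : ℂ} (hq : q ≠ 0) (hq1 : ‖q‖ < 1) (e : ℤ) (x : ℂ) :
    qPoch q (q ^ e * x) = (1 - q ^ e * x) * qPoch q (q ^ (e + 2) * x) := by
  rw [qPoch_eq hq1, zpow_add₀ hq]
  congr 2
  rw [mul_right_comm]
  norm_cast

theorem qPoch_zpow_prod {q : ℂ} (hq : q ≠ 0) (hq1 : ‖q‖ < 1) (e : ℤ) (x : ℂ) (n : ℕ) :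
    qPoch q (q ^ e * x) =
      (∏ i ∈ Finset.range n, (1 - q ^ (e + 2 * i) * x)) * qPoch q (q ^ (e + 2 * n) * x) := by
  have h : ∀ i : ℕ, q ^ e * x * q ^ (2 * i) = q ^ (e + 2 * i) * x := fun i => by
    rw [zpow_add₀ hq, mul_right_comm]
    norm_cast
  rw [qPoch_eq_prod hq1 _ n]
  simp only [h]

theorem Gen.neg {q z : ℂ} (h : Gen q z) : Gen q (-z) := fun m => by
  rw [norm_neg]; exact h m

theorem Gen.ne_zpow {q z : ℂ} (h : Gen q z) (m : ℤ) : z ≠ q ^ m := fun hz =>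
  h m (by rw [hz, norm_zpow])

theorem Gen.one_sub_ne_zero {q z : ℂ} (hq : q ≠ 0) (h : Gen q z) (e : ℤ) : 1 - q ^ e * z ≠ 0 := by
  intro h0
  apply h.ne_zpow (-e)
  rw [zpow_neg]
  exact eq_inv_of_mul_eq_one_right (sub_eq_zero.1 h0).symm

theorem Gen.qPoch_ne_zero {q z : ℂ} (hq : q ≠ 0) (hq1 : ‖q‖ < 1) (h : Gen q z) (e : ℤ) :
    qPoch q (q ^ e * z) ≠ 0 := by
  apply Tetra.qPoch_ne_zero hq1
  intro k hk
  apply h.one_sub_ne_zero hq (e + 2 * k)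
  rw [zpow_add₀ hq, sub_eq_zero, ← hk, mul_right_comm]
  norm_cast

theorem zpow_two_mul' (q : ℂ) (e : ℤ) : q ^ (2 * e) = (q ^ e) ^ 2 := by
  rw [mul_comm, zpow_mul, zpow_ofNat]

theorem sq_zpow (q : ℂ) (e : ℤ) : (q ^ 2) ^ e = (q ^ e) ^ 2 := by
  rw [← zpow_ofNat q 2, ← zpow_mul, mul_comm, zpow_mul, zpow_ofNat]

/-- The generating function for the traces over the outer sites. -/
def outerG (q : ℂ) (k : ℕ) (m n : ℤ) (z : ℂ) : ℂ := outerNum q k m n z / outerDen q k m n z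

/-- The generating function for the trace over the middle site. -/
def midG (q : ℂ) (k : ℕ) (m n : ℤ) (z : ℂ) : ℂ := midNum q k m n z / midDen q k m n z

theorem outerDen_ne_zero {q z : ℂ} (hq : q ≠ 0) (hq1 : ‖q‖ < 1) (h : Gen q z) (k : ℕ) (m n : ℤ) :
    outerDen q k m n z ≠ 0 :=
  mul_ne_zero (h.inv.qPoch_ne_zero hq hq1 _) (h.qPoch_ne_zero hq hq1 _)

theorem midDen_ne_zero {q z : ℂ} (hq : q ≠ 0) (hq1 : ‖q‖ < 1) (h : Gen q z) (k : ℕ) (m n : ℤ) :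
    midDen q k m n z ≠ 0 := by
  rw [midDen, neg_mul, neg_mul, ← mul_neg, ← mul_neg]
  exact mul_ne_zero (h.neg.qPoch_ne_zero hq hq1 _) (h.neg.qPoch_ne_zero hq hq1 _)

/-- The exponents are left free up to a proof of equality, so that products coming from different
arguments or indices can be brought to literally the same exponents and cancelled. -/
theorem outerG_scale {q : ℂ} (hq : q ≠ 0) (k : ℕ) (m n j : ℤ) (z : ℂ) (e f g h : ℤ)
    (he : n - m + k + 2 - j = e := by push_cast; ring) (hf : n + m + k + 2 + j = f := by push_cast; ring) (hg : n + m - k + 2 - j = g := by push_cast; ring)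
    (hh : n - m + k + j = h := by push_cast; ring) :
    outerG q k m n (q ^ j * z) = (q ^ j * z) ^ (m - k) *
      qPoch q (q ^ e * z⁻¹) * qPoch q (q ^ f * z) /
      (qPoch q (q ^ g * z⁻¹) * qPoch q (q ^ h * z)) := by
  subst he hf hg hh
  have h1 : ∀ e : ℤ, q ^ e * (q ^ j * z)⁻¹ = q ^ (e - j) * z⁻¹ := fun e => by
    rw [mul_inv, zpow_sub₀ hq, div_eq_mul_inv, mul_assoc]
  have h2 : ∀ e : ℤ, q ^ e * (q ^ j * z) = q ^ (e + j) * z := fun e => by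
    rw [zpow_add₀ hq, mul_assoc]
  rw [outerG, outerNum, outerDen]
  simp only [h1, h2]

theorem outerG_eq (q : ℂ) (k : ℕ) (m n : ℤ) (z : ℂ) (e f g h : ℤ)
    (he : n - m + k + 2 = e := by push_cast; ring) (hf : n + m + k + 2 = f := by push_cast; ring) (hg : n + m - k + 2 = g := by push_cast; ring)
    (hh : n - m + k = h := by push_cast; ring) :
    outerG q k m n z = z ^ (m - k) *
      qPoch q (q ^ e * z⁻¹) * qPoch q (q ^ f * z) /
      (qPoch q (q ^ g * z⁻¹) * qPoch q (q ^ h * z)) := by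
  subst he hf hg hh
  rfl

theorem powers_ne_zero {q z : ℂ} (hq : q ≠ 0) (k : ℕ) (m n : ℤ) (hz : z ≠ 0) :
    q ^ m ≠ 0 ∧ q ^ n ≠ 0 ∧ q ^ k ≠ 0 ∧ z ^ m ≠ 0 ∧ z ^ k ≠ 0 :=
  ⟨zpow_ne_zero m hq, zpow_ne_zero n hq, pow_ne_zero k hq, zpow_ne_zero m hz, pow_ne_zero k hz⟩

/-! ### Functional equations of the outer generating function. -/

section Identities

variable {q : ℂ} (hq : q ≠ 0) (hq1 : ‖q‖ < 1) (k : ℕ) (m n : ℤ) {z : ℂ} (hz : z ≠ 0)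
  (hg : Gen q z := by push_cast; ring)

include hq hq1 hz hg

/-- In each of these identities the arguments of corresponding infinite products differ by at most
one factor q². Splitting off single linear factors leaves common products, and the rest is a
rational identity in z, q and the powers with exponents m, n, k. The digits in the names are the row
and column of the intertwining relation being served; the primed ones serve the matrices for q⁻¹. -/
theorem outerG_rel_02_plus :
    (1 - q ^ (2 * n)) * (z * outerG q (k + 1) m (n - 1) z) - q ^ (1 + n) * outerG q k (m - 1) n (q ^ (1 : ℤ) * z) = outerG q k m n z := by
  rw [outerG_eq q (k + 1) m (n - 1) z (n - m + k + 2) (n + m + k + 2) (n + m - k) (n - m + k),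
    outerG_scale hq k (m - 1) n 1 z (n - m + k + 2) (n + m + k + 2) (n + m - k) (n - m + k + 2),
    outerG_eq q k m n z (n - m + k + 2) (n + m + k + 2) (n + m - k + 2) (n - m + k)]
  rw [qPoch_zpow_succ hq hq1 (n + m - k) z⁻¹,
    qPoch_zpow_succ hq hq1 (n - m + k) z]
  have a1 := hg.inv.qPoch_ne_zero hq hq1 (n + m - k + 2)
  have a2 := hg.qPoch_ne_zero hq hq1 (n - m + k + 2)
  have b0 := hg.inv.one_sub_ne_zero hq (n + m - k)
  have b1 := hg.one_sub_ne_zero hq (n - m + k)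
  generalize qPoch q (q ^ (n - m + k + 2) * z⁻¹) = C, qPoch q (q ^ (n + m + k + 2) * z) = D,
    qPoch q (q ^ (n + m - k + 2) * z⁻¹) = A, qPoch q (q ^ (n - m + k + 2) * z) = B at *
  -- The linear factors are kept as opaque nonzero quantities while denominators are cleared, and
  -- are unfolded only for the final polynomial identity.
  obtain ⟨W0, hW0⟩ : ∃ W, W = 1 - q ^ (n + m - k) * z⁻¹ := ⟨_, rfl⟩
  rw [← hW0] at b0
  simp only [← hW0]
  obtain ⟨W1, hW1⟩ : ∃ W, W = 1 - q ^ (n - m + k) * z := ⟨_, rfl⟩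
  rw [← hW1] at b1
  simp only [← hW1]
  simp only [zpow_two_mul' q (_ + _), zpow_two_mul' q (_ - _), zpow_two_mul' q m,
    zpow_two_mul' q n, zpow_two_mul' q k, zpow_add₀ hq, zpow_sub₀ hq, zpow_add₀ hz, zpow_sub₀ hz, mul_zpow,
    zpow_natCast, zpow_one, Nat.cast_add, Nat.cast_one, zpow_ofNat, pow_one, sq_zpow] at *
  obtain ⟨c1, c2, c3, c4, c5⟩ := powers_ne_zero hq k m n hz
  generalize q ^ m = Q, q ^ n = P, q ^ k = S, z ^ m = Z, z ^ k = Y at *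
  field_simp
  simp only [hW0, hW1]
  field_simp
  ring

theorem outerG_rel_02_minus :
    outerG q k m n z - q ^ (2 * (k : ℤ) + 2) * outerG q k m n (q ^ (2 : ℤ) * z) - q ^ (3 + n + 2 * k) * (1 - q ^ (2 * (m - k))) * outerG q (k + 1) m n (q ^ (1 : ℤ) * z) = (1 - q ^ (2 * (m + 1))) * outerG q (k + 1) (m + 1) n z := by
  rw [outerG_eq q k m n z (n - m + k + 2) (n + m + k + 2) (n + m - k + 2) (n - m + k),
    outerG_scale hq k m n 2 z (n - m + k) (n + m + k + 2 + 2) (n + m - k) (n - m + k + 2),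
    outerG_scale hq (k + 1) m n 1 z (n - m + k + 2) (n + m + k + 2 + 2) (n + m - k) (n - m + k + 2),
    outerG_eq q (k + 1) (m + 1) n z (n - m + k + 2) (n + m + k + 2 + 2) (n + m - k + 2) (n - m + k)]
  rw [qPoch_zpow_succ hq hq1 (n - m + k) z⁻¹,
    qPoch_zpow_succ hq hq1 (n + m + k + 2) z,
    qPoch_zpow_succ hq hq1 (n + m - k) z⁻¹,
    qPoch_zpow_succ hq hq1 (n - m + k) z]
  have a1 := hg.inv.qPoch_ne_zero hq hq1 (n + m - k + 2)
  have a2 := hg.qPoch_ne_zero hq hq1 (n - m + k + 2)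
  have b0 := hg.inv.one_sub_ne_zero hq (n + m - k)
  have b1 := hg.one_sub_ne_zero hq (n - m + k)
  generalize qPoch q (q ^ (n - m + k + 2) * z⁻¹) = C, qPoch q (q ^ (n + m + k + 2 + 2) * z) = D,
    qPoch q (q ^ (n + m - k + 2) * z⁻¹) = A, qPoch q (q ^ (n - m + k + 2) * z) = B at *
  obtain ⟨W0, hW0⟩ : ∃ W, W = 1 - q ^ (n + m - k) * z⁻¹ := ⟨_, rfl⟩
  rw [← hW0] at b0
  simp only [← hW0]
  obtain ⟨W1, hW1⟩ : ∃ W, W = 1 - q ^ (n - m + k) * z := ⟨_, rfl⟩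
  rw [← hW1] at b1
  simp only [← hW1]
  simp only [zpow_two_mul' q (_ + _), zpow_two_mul' q (_ - _), zpow_two_mul' q m,
    zpow_two_mul' q n, zpow_two_mul' q k, zpow_add₀ hq, zpow_sub₀ hq, zpow_add₀ hz, zpow_sub₀ hz, mul_zpow,
    zpow_natCast, zpow_one, Nat.cast_add, Nat.cast_one, zpow_ofNat, pow_one, sq_zpow] at *
  obtain ⟨c1, c2, c3, c4, c5⟩ := powers_ne_zero hq k m n hz
  generalize q ^ m = Q, q ^ n = P, q ^ k = S, z ^ m = Z, z ^ k = Y at *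
  field_simp
  simp only [hW0, hW1]
  field_simp
  ring

theorem outerG_rel_01_plus :
    q ^ n * (z * outerG q (k + 1) m n z) + outerG q k (m - 1) (n + 1) (q ^ (1 : ℤ) * z) = q ^ (m - k - 1) * outerG q (k + 1) m n z := by
  rw [outerG_eq q (k + 1) m n z (n - m + k + 3) (n + m + k + 3) (n + m - k + 1) (n - m + k + 1),
    outerG_scale hq k (m - 1) (n + 1) 1 z (n - m + k + 3) (n + m + k + 3) (n + m - k + 1) (n - m + k + 1 + 2)]
  rw [qPoch_zpow_succ hq hq1 (n - m + k + 1) z]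
  have a1 := hg.inv.qPoch_ne_zero hq hq1 (n + m - k + 1)
  have a2 := hg.qPoch_ne_zero hq hq1 (n - m + k + 1 + 2)
  have b0 := hg.one_sub_ne_zero hq (n - m + k + 1)
  generalize qPoch q (q ^ (n - m + k + 3) * z⁻¹) = C, qPoch q (q ^ (n + m + k + 3) * z) = D,
    qPoch q (q ^ (n + m - k + 1) * z⁻¹) = A, qPoch q (q ^ (n - m + k + 1 + 2) * z) = B at *
  obtain ⟨W0, hW0⟩ : ∃ W, W = 1 - q ^ (n - m + k + 1) * z := ⟨_, rfl⟩
  rw [← hW0] at b0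
  simp only [← hW0]
  simp only [zpow_two_mul' q (_ + _), zpow_two_mul' q (_ - _), zpow_two_mul' q m,
    zpow_two_mul' q n, zpow_two_mul' q k, zpow_add₀ hq, zpow_sub₀ hq, zpow_add₀ hz, zpow_sub₀ hz, mul_zpow,
    zpow_natCast, zpow_one, Nat.cast_add, Nat.cast_one, zpow_ofNat, pow_one, sq_zpow] at *
  obtain ⟨c1, c2, c3, c4, c5⟩ := powers_ne_zero hq k m n hz
  generalize q ^ m = Q, q ^ n = P, q ^ k = S, z ^ m = Z, z ^ k = Y at *
  field_simp
  simp only [hW0]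
  field_simp
  ring

theorem outerG_rel_12_minus :
    q ^ (k : ℤ) * outerG q k m n (q ^ (1 : ℤ) * z) + q ^ (n + k + 1) * (1 - q ^ (2 * (m - k))) * outerG q (k + 1) m n z = q ^ m * outerG q k m (n + 1) z := by
  rw [outerG_scale hq k m n 1 z (n - m + k + 1) (n + m + k + 3) (n + m - k + 1) (n - m + k + 1),
    outerG_eq q (k + 1) m n z (n - m + k + 1 + 2) (n + m + k + 3) (n + m - k + 1) (n - m + k + 1),
    outerG_eq q k m (n + 1) z (n - m + k + 1 + 2) (n + m + k + 3) (n + m - k + 1 + 2) (n - m + k + 1)]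
  rw [qPoch_zpow_succ hq hq1 (n - m + k + 1) z⁻¹,
    qPoch_zpow_succ hq hq1 (n + m - k + 1) z⁻¹]
  have a1 := hg.inv.qPoch_ne_zero hq hq1 (n + m - k + 1 + 2)
  have a2 := hg.qPoch_ne_zero hq hq1 (n - m + k + 1)
  have b0 := hg.inv.one_sub_ne_zero hq (n + m - k + 1)
  generalize qPoch q (q ^ (n - m + k + 1 + 2) * z⁻¹) = C, qPoch q (q ^ (n + m + k + 3) * z) = D,
    qPoch q (q ^ (n + m - k + 1 + 2) * z⁻¹) = A, qPoch q (q ^ (n - m + k + 1) * z) = B at *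
  obtain ⟨W0, hW0⟩ : ∃ W, W = 1 - q ^ (n + m - k + 1) * z⁻¹ := ⟨_, rfl⟩
  rw [← hW0] at b0
  simp only [← hW0]
  simp only [zpow_two_mul' q (_ + _), zpow_two_mul' q (_ - _), zpow_two_mul' q m,
    zpow_two_mul' q n, zpow_two_mul' q k, zpow_add₀ hq, zpow_sub₀ hq, zpow_add₀ hz, zpow_sub₀ hz, mul_zpow,
    zpow_natCast, zpow_one, Nat.cast_add, Nat.cast_one, zpow_ofNat, pow_one, sq_zpow] at *
  obtain ⟨c1, c2, c3, c4, c5⟩ := powers_ne_zero hq k m n hz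
  generalize q ^ m = Q, q ^ n = P, q ^ k = S, z ^ m = Z, z ^ k = Y at *
  field_simp
  simp only [hW0]
  field_simp
  ring

theorem outerG_rel_02_plus' :
    outerG q k m (n + 1) z - outerG q k m (n + 1) (q ^ (2 : ℤ) * z) - q ^ (1 + n) * (1 - q ^ (2 * (m + 1))) * (z * outerG q (k + 1) (m + 1) n (q ^ (1 : ℤ) * z)) = (1 - q ^ (2 * (m - k))) * (z * outerG q (k + 1) m n z) := by
  rw [outerG_eq q k m (n + 1) z (n - m + k + 1 + 2) (n + m + k + 3) (n + m - k + 1 + 2) (n - m + k + 1),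
    outerG_scale hq k m (n + 1) 2 z (n - m + k + 1) (n + m + k + 3 + 2) (n + m - k + 1) (n - m + k + 1 + 2),
    outerG_scale hq (k + 1) (m + 1) n 1 z (n - m + k + 1) (n + m + k + 3 + 2) (n + m - k + 1) (n - m + k + 1),
    outerG_eq q (k + 1) m n z (n - m + k + 1 + 2) (n + m + k + 3) (n + m - k + 1) (n - m + k + 1)]
  rw [qPoch_zpow_succ hq hq1 (n - m + k + 1) z⁻¹,
    qPoch_zpow_succ hq hq1 (n + m + k + 3) z,
    qPoch_zpow_succ hq hq1 (n + m - k + 1) z⁻¹,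
    qPoch_zpow_succ hq hq1 (n - m + k + 1) z]
  have a1 := hg.inv.qPoch_ne_zero hq hq1 (n + m - k + 1 + 2)
  have a2 := hg.qPoch_ne_zero hq hq1 (n - m + k + 1 + 2)
  have b0 := hg.inv.one_sub_ne_zero hq (n + m - k + 1)
  have b1 := hg.one_sub_ne_zero hq (n - m + k + 1)
  generalize qPoch q (q ^ (n - m + k + 1 + 2) * z⁻¹) = C, qPoch q (q ^ (n + m + k + 3 + 2) * z) = D,
    qPoch q (q ^ (n + m - k + 1 + 2) * z⁻¹) = A, qPoch q (q ^ (n - m + k + 1 + 2) * z) = B at *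
  obtain ⟨W0, hW0⟩ : ∃ W, W = 1 - q ^ (n + m - k + 1) * z⁻¹ := ⟨_, rfl⟩
  rw [← hW0] at b0
  simp only [← hW0]
  obtain ⟨W1, hW1⟩ : ∃ W, W = 1 - q ^ (n - m + k + 1) * z := ⟨_, rfl⟩
  rw [← hW1] at b1
  simp only [← hW1]
  simp only [zpow_two_mul' q (_ + _), zpow_two_mul' q (_ - _), zpow_two_mul' q m,
    zpow_two_mul' q n, zpow_two_mul' q k, zpow_add₀ hq, zpow_sub₀ hq, zpow_add₀ hz, zpow_sub₀ hz, mul_zpow,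
    zpow_natCast, zpow_one, Nat.cast_add, Nat.cast_one, zpow_ofNat, pow_one, sq_zpow] at *
  obtain ⟨c1, c2, c3, c4, c5⟩ := powers_ne_zero hq k m n hz
  generalize q ^ m = Q, q ^ n = P, q ^ k = S, z ^ m = Z, z ^ k = Y at *
  field_simp
  simp only [hW0, hW1]
  field_simp
  ring

theorem outerG_rel_02_minus' :
    (1 - q ^ (2 * (n + k + 1))) * outerG q (k + 1) m n z - q ^ (1 + n + 2 * k) * outerG q k m n (q ^ (1 : ℤ) * z) = outerG q k (m - 1) n z := by
  rw [outerG_eq q (k + 1) m n z (n - m + k + 1 + 2) (n + m + k + 1 + 2) (n + m - k + 1) (n - m + k + 1),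
    outerG_scale hq k m n 1 z (n - m + k + 1) (n + m + k + 1 + 2) (n + m - k + 1) (n - m + k + 1),
    outerG_eq q k (m - 1) n z (n - m + k + 1 + 2) (n + m + k + 1) (n + m - k + 1) (n - m + k + 1)]
  rw [qPoch_zpow_succ hq hq1 (n - m + k + 1) z⁻¹,
    qPoch_zpow_succ hq hq1 (n + m + k + 1) z]
  have a1 := hg.inv.qPoch_ne_zero hq hq1 (n + m - k + 1)
  have a2 := hg.qPoch_ne_zero hq hq1 (n - m + k + 1)
  generalize qPoch q (q ^ (n - m + k + 1 + 2) * z⁻¹) = C, qPoch q (q ^ (n + m + k + 1 + 2) * z) = D,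
    qPoch q (q ^ (n + m - k + 1) * z⁻¹) = A, qPoch q (q ^ (n - m + k + 1) * z) = B at *
  simp only [zpow_two_mul' q (_ + _), zpow_two_mul' q (_ - _), zpow_two_mul' q m,
    zpow_two_mul' q n, zpow_two_mul' q k, zpow_add₀ hq, zpow_sub₀ hq, zpow_add₀ hz, zpow_sub₀ hz, mul_zpow,
    zpow_natCast, zpow_one, Nat.cast_add, Nat.cast_one, zpow_ofNat, pow_one, sq_zpow] at *
  obtain ⟨c1, c2, c3, c4, c5⟩ := powers_ne_zero hq k m n hz
  generalize q ^ m = Q, q ^ n = P, q ^ k = S, z ^ m = Z, z ^ k = Y at *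
  field_simp
  ring

theorem outerG_rel_01_minus' :
    q ^ (n + k + 1) * outerG q (k + 1) m n z + q ^ (k : ℤ) * outerG q k m n (q ^ (1 : ℤ) * z) = q ^ m * (z * outerG q (k + 1) m n z) := by
  rw [outerG_eq q (k + 1) m n z (n - m + k + 1 + 2) (n + m + k + 3) (n + m - k + 1) (n - m + k + 1),
    outerG_scale hq k m n 1 z (n - m + k + 1) (n + m + k + 3) (n + m - k + 1) (n - m + k + 1)]
  rw [qPoch_zpow_succ hq hq1 (n - m + k + 1) z⁻¹]
  have a1 := hg.inv.qPoch_ne_zero hq hq1 (n + m - k + 1)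
  have a2 := hg.qPoch_ne_zero hq hq1 (n - m + k + 1)
  generalize qPoch q (q ^ (n - m + k + 1 + 2) * z⁻¹) = C, qPoch q (q ^ (n + m + k + 3) * z) = D,
    qPoch q (q ^ (n + m - k + 1) * z⁻¹) = A, qPoch q (q ^ (n - m + k + 1) * z) = B at *
  simp only [zpow_two_mul' q (_ + _), zpow_two_mul' q (_ - _), zpow_two_mul' q m,
    zpow_two_mul' q n, zpow_two_mul' q k, zpow_add₀ hq, zpow_sub₀ hq, zpow_add₀ hz, zpow_sub₀ hz, mul_zpow,
    zpow_natCast, zpow_one, Nat.cast_add, Nat.cast_one, zpow_ofNat, pow_one, sq_zpow] at *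
  obtain ⟨c1, c2, c3, c4, c5⟩ := powers_ne_zero hq k m n hz
  generalize q ^ m = Q, q ^ n = P, q ^ k = S, z ^ m = Z, z ^ k = Y at *
  field_simp
  ring

theorem outerG_rel_12_plus' :
    outerG q k m (n + 1) (q ^ (1 : ℤ) * z) + q ^ n * (1 - q ^ (2 * (m + 1))) * (z * outerG q (k + 1) (m + 1) n z) = q ^ (m - k) * outerG q k m n z := by
  rw [outerG_scale hq k m (n + 1) 1 z (n - m + k + 2) (n + m + k + 2 + 2) (n + m - k + 2) (n - m + k + 2),
    outerG_eq q (k + 1) (m + 1) n z (n - m + k + 2) (n + m + k + 2 + 2) (n + m - k + 2) (n - m + k),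
    outerG_eq q k m n z (n - m + k + 2) (n + m + k + 2) (n + m - k + 2) (n - m + k)]
  rw [qPoch_zpow_succ hq hq1 (n + m + k + 2) z,
    qPoch_zpow_succ hq hq1 (n - m + k) z]
  have a1 := hg.inv.qPoch_ne_zero hq hq1 (n + m - k + 2)
  have a2 := hg.qPoch_ne_zero hq hq1 (n - m + k + 2)
  have b0 := hg.one_sub_ne_zero hq (n - m + k)
  generalize qPoch q (q ^ (n - m + k + 2) * z⁻¹) = C, qPoch q (q ^ (n + m + k + 2 + 2) * z) = D,
    qPoch q (q ^ (n + m - k + 2) * z⁻¹) = A, qPoch q (q ^ (n - m + k + 2) * z) = B at *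
  obtain ⟨W0, hW0⟩ : ∃ W, W = 1 - q ^ (n - m + k) * z := ⟨_, rfl⟩
  rw [← hW0] at b0
  simp only [← hW0]
  simp only [zpow_two_mul' q (_ + _), zpow_two_mul' q (_ - _), zpow_two_mul' q m,
    zpow_two_mul' q n, zpow_two_mul' q k, zpow_add₀ hq, zpow_sub₀ hq, zpow_add₀ hz, zpow_sub₀ hz, mul_zpow,
    zpow_natCast, zpow_one, Nat.cast_add, Nat.cast_one, zpow_ofNat, pow_one, sq_zpow] at *
  obtain ⟨c1, c2, c3, c4, c5⟩ := powers_ne_zero hq k m n hz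
  generalize q ^ m = Q, q ^ n = P, q ^ k = S, z ^ m = Z, z ^ k = Y at *
  field_simp
  simp only [hW0]
  field_simp
  ring

end Identities

/-- The prefactor q^(ab) is bilinear in the exponents, so its value is passed separately as `p` and
only its ratios under shifts of a and b enter later computations. -/
theorem midG_scale {q : ℂ} (hq : q ≠ 0) (k : ℕ) (a b j : ℤ) (z p : ℂ) (e f g h : ℤ)
    (hp : q ^ (a * b) = p) (he : 1 - a - b + j = e) (hf : 3 + a + b + 2 * k + j = f)
    (hg : 1 - a + b + j = g) (hh : 1 + a - b + j = h) :
    midG q k a b (q ^ j * z) = p * qPoch q (q ^ e * -z) * qPoch q (q ^ f * -z) /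
      (qPoch q (q ^ g * -z) * qPoch q (q ^ h * -z)) := by
  subst he hf hg hh hp
  have h2 : ∀ e : ℤ, -q ^ e * (q ^ j * z) = q ^ (e + j) * -z := fun e => by
    rw [zpow_add₀ hq]; ring
  rw [midG, midNum, midDen]
  simp only [h2]

theorem midG_eq {q : ℂ} (hq : q ≠ 0) (k : ℕ) (a b : ℤ) (z p : ℂ) (e f g h : ℤ)
    (hp : q ^ (a * b) = p) (he : 1 - a - b = e) (hf : 3 + a + b + 2 * k = f)
    (hg : 1 - a + b = g) (hh : 1 + a - b = h) :
    midG q k a b z = p * qPoch q (q ^ e * -z) * qPoch q (q ^ f * -z) /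
      (qPoch q (q ^ g * -z) * qPoch q (q ^ h * -z)) := by
  have := midG_scale hq k a b 0 z p e f g h hp (by rw [he, add_zero]) (by rw [hf, add_zero])
    (by rw [hg, add_zero]) (by rw [hh, add_zero])
  rwa [zpow_zero, one_mul] at this

section MidIdentities

variable {q : ℂ} (hq : q ≠ 0) (hq1 : ‖q‖ < 1) (k : ℕ) (a b : ℤ) {z : ℂ} (hg : Gen q z)

include hq hq1 hg

/-- The differences with the argument q²z produce, on coefficients, the factors 1 − q^(2x) by which
products `boseE` of different length differ. This lets the middle trace yield the same recurrence as
the outer one. -/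
theorem midG_rel_02_plus :
    (1 - q ^ (2 * a)) * (1 - q ^ (2 * b)) * (z * midG q (k + 1) (a - 1) (b - 1) z) - q ^ (1 + a + b) * (z * (midG q k a b z - q ^ (2 * (k : ℤ) + 2) * midG q k a b (q ^ (2 : ℤ) * z))) = midG q k a b z - midG q k a b (q ^ (2 : ℤ) * z) := by
  have e1 : q ^ ((a - 1) * (b - 1)) = q ^ (a * b) * (q ^ a)⁻¹ * (q ^ b)⁻¹ * q := by
    rw [sub_mul, mul_sub, mul_one, one_mul, zpow_sub₀ hq, zpow_sub₀ hq, zpow_sub₀ hq, zpow_one]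
    field_simp
  rw [midG_eq hq (k + 1) (a - 1) (b - 1) z (q ^ (a * b) * (q ^ a)⁻¹ * (q ^ b)⁻¹ * q) (1 - a - b + 2) (1 + a + b + 2 * k + 2) (1 - a + b) (1 + a - b)
      e1 (by push_cast; ring) (by push_cast; ring) (by push_cast; ring) (by push_cast; ring),
    midG_eq hq k a b z (q ^ (a * b)) (1 - a - b) (1 + a + b + 2 * k + 2) (1 - a + b) (1 + a - b)
      rfl (by push_cast; ring) (by push_cast; ring) (by push_cast; ring) (by push_cast; ring),
    midG_scale hq k a b 2 z (q ^ (a * b)) (1 - a - b + 2) (1 + a + b + 2 * k + 2 + 2) (1 - a + b + 2) (1 + a - b + 2)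
      rfl (by push_cast; ring) (by push_cast; ring) (by push_cast; ring) (by push_cast; ring)]
  rw [qPoch_zpow_succ hq hq1 (1 - a - b) (-z),
    qPoch_zpow_succ hq hq1 (1 + a + b + 2 * k + 2) (-z),
    qPoch_zpow_succ hq hq1 (1 - a + b) (-z),
    qPoch_zpow_succ hq hq1 (1 + a - b) (-z)]
  have a1 := hg.neg.qPoch_ne_zero hq hq1 (1 - a + b + 2)
  have a2 := hg.neg.qPoch_ne_zero hq hq1 (1 + a - b + 2)
  have b0 := hg.neg.one_sub_ne_zero hq (1 - a + b)
  have b1 := hg.neg.one_sub_ne_zero hq (1 + a - b)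
  generalize qPoch q (q ^ (1 - a - b + 2) * -z) = C at *
  generalize qPoch q (q ^ (1 + a + b + 2 * k + 2 + 2) * -z) = D at *
  generalize qPoch q (q ^ (1 - a + b + 2) * -z) = A at *
  generalize qPoch q (q ^ (1 + a - b + 2) * -z) = B at *
  obtain ⟨W0, hW0⟩ : ∃ W, W = 1 - q ^ (1 - a + b) * -z := ⟨_, rfl⟩
  rw [← hW0] at b0
  simp only [← hW0]
  obtain ⟨W1, hW1⟩ : ∃ W, W = 1 - q ^ (1 + a - b) * -z := ⟨_, rfl⟩
  rw [← hW1] at b1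
  simp only [← hW1]
  generalize q ^ (a * b) = T at *
  simp only [zpow_two_mul' q a, zpow_two_mul' q b, zpow_two_mul' q k, zpow_add₀ hq, zpow_sub₀ hq,
    zpow_natCast, zpow_one, Nat.cast_add, Nat.cast_one, zpow_ofNat, pow_one, sq_zpow] at *
  have c1 := zpow_ne_zero a hq
  have c2 := zpow_ne_zero b hq
  have c3 := pow_ne_zero k hq
  generalize q ^ a = Q at *
  generalize q ^ b = P at *
  generalize q ^ k = S at *
  field_simp
  simp only [hW0, hW1]
  field_simp
  ring

/-- Raising k by one removes a single linear factor from one product in the numerator and changes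
nothing else. -/
theorem midG_rel_02_minus :
    midG q k a b z - q ^ (3 + a + b + 2 * k) * (z * midG q (k + 1) a b z) = midG q (k + 1) a b z := by
  rw [midG_eq hq k a b z (q ^ (a * b)) (1 - a - b) (1 + a + b + 2 * k + 2) (1 - a + b) (1 + a - b)
      rfl (by push_cast; ring) (by push_cast; ring) (by push_cast; ring) (by push_cast; ring),
    midG_eq hq (k + 1) a b z (q ^ (a * b)) (1 - a - b) (1 + a + b + 2 * k + 2 + 2) (1 - a + b) (1 + a - b)
      rfl (by push_cast; ring) (by push_cast; ring) (by push_cast; ring) (by push_cast; ring)]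
  rw [qPoch_zpow_succ hq hq1 (1 + a + b + 2 * k + 2) (-z)]
  have a1 := hg.neg.qPoch_ne_zero hq hq1 (1 - a + b)
  have a2 := hg.neg.qPoch_ne_zero hq hq1 (1 + a - b)
  generalize qPoch q (q ^ (1 - a - b) * -z) = C at *
  generalize qPoch q (q ^ (1 + a + b + 2 * k + 2 + 2) * -z) = D at *
  generalize qPoch q (q ^ (1 - a + b) * -z) = A at *
  generalize qPoch q (q ^ (1 + a - b) * -z) = B at *
  generalize q ^ (a * b) = T at *
  simp only [zpow_two_mul' q a, zpow_two_mul' q b, zpow_two_mul' q k, zpow_add₀ hq, zpow_sub₀ hq,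
    zpow_natCast, zpow_one, Nat.cast_add, Nat.cast_one, zpow_ofNat, pow_one, sq_zpow] at *
  have c1 := zpow_ne_zero a hq
  have c2 := zpow_ne_zero b hq
  have c3 := pow_ne_zero k hq
  generalize q ^ a = Q at *
  generalize q ^ b = P at *
  generalize q ^ k = S at *
  field_simp
  ring

/-- Used only through its coefficient at z⁰, which relates the vacuum values of R₀ at neighbouring
occupation numbers of the first site. -/
theorem midG_rel_norm :
    midG q 0 (a + 1) b (q ^ (1 : ℤ) * z) + q ^ (3 + a + b) * (z * midG q 0 (a + 1) b (q ^ (1 : ℤ) * z)) = q ^ b * (midG q 0 a b z + q ^ (1 + a - b) * (z * midG q 0 a b z)) := by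
  have e1 : q ^ ((a + 1) * b) = q ^ (a * b) * q ^ b := by
    rw [add_mul, one_mul, zpow_add₀ hq]
  rw [midG_scale hq 0 (a + 1) b 1 z (q ^ (a * b) * q ^ b) (1 - a - b) (1 + a + b + 2 + 2) (1 - a + b) (1 + a - b + 2)
      e1 (by push_cast; ring) (by push_cast; ring) (by push_cast; ring) (by push_cast; ring),
    midG_eq hq 0 a b z (q ^ (a * b)) (1 - a - b) (1 + a + b + 2) (1 - a + b) (1 + a - b)
      rfl (by push_cast; ring) (by push_cast; ring) (by push_cast; ring) (by push_cast; ring)]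
  rw [qPoch_zpow_succ hq hq1 (1 + a + b + 2) (-z),
    qPoch_zpow_succ hq hq1 (1 + a - b) (-z)]
  have a1 := hg.neg.qPoch_ne_zero hq hq1 (1 - a + b)
  have a2 := hg.neg.qPoch_ne_zero hq hq1 (1 + a - b + 2)
  have b0 := hg.neg.one_sub_ne_zero hq (1 + a - b)
  generalize qPoch q (q ^ (1 - a - b) * -z) = C at *
  generalize qPoch q (q ^ (1 + a + b + 2 + 2) * -z) = D at *
  generalize qPoch q (q ^ (1 - a + b) * -z) = A at *
  generalize qPoch q (q ^ (1 + a - b + 2) * -z) = B at *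
  obtain ⟨W0, hW0⟩ : ∃ W, W = 1 - q ^ (1 + a - b) * -z := ⟨_, rfl⟩
  rw [← hW0] at b0
  simp only [← hW0]
  generalize q ^ (a * b) = T at *
  simp only [zpow_two_mul' q a, zpow_two_mul' q b, zpow_add₀ hq, zpow_sub₀ hq,
    zpow_natCast, zpow_one, Nat.cast_add, Nat.cast_one, zpow_ofNat, pow_one, sq_zpow] at *
  have c1 := zpow_ne_zero a hq
  have c2 := zpow_ne_zero b hq
  generalize q ^ a = Q at *
  generalize q ^ b = P at *
  field_simp
  simp only [hW0]
  field_simp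
  ring

end MidIdentities

/-! ### The generating functions are rational -/

theorem pow_mul_prod_one_sub_mul_inv {z : ℂ} (hz : z ≠ 0) (n : ℕ) (c : ℕ → ℂ)
    (hc : ∀ i, c i ≠ 0) :
    z ^ n * ∏ i ∈ Finset.range n, (1 - c i * z⁻¹) =
      (∏ i ∈ Finset.range n, -c i) * ∏ i ∈ Finset.range n, (1 - (c i)⁻¹ * z) := by
  rw [← Finset.prod_mul_distrib]
  nth_rw 1 [← Finset.card_range n]
  rw [← Finset.prod_const, ← Finset.prod_mul_distrib]
  refine Finset.prod_congr rfl fun i _ => ?_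
  have := hc i
  field_simp
  ring

/-- The two products in z⁻¹ differ by |m − k| linear factors and the two in z by |m + 1|. For m ≥ k
the former remain in the numerator and the latter in the denominator; for m < 0 the roles are
exchanged. The power of z turns factors in z⁻¹ into factors in z, and the degrees differ by k + 1 in
both cases. -/
theorem isRational_outer {q : ℂ} (hq : q ≠ 0) (hq1 : ‖q‖ < 1) (k : ℕ) (m n : ℤ)
    (h : k ≤ m ∨ m < 0) : IsRational k (outerNum q k m n) (outerDen q k m n) := by
  rcases h with h | h
  · obtain ⟨M, rfl⟩ : ∃ M : ℕ, m = M + k := ⟨(m - k).toNat, by omega⟩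
    refine ⟨∏ i ∈ Finset.range M, -q ^ (n - (M + k) + k + 2 + 2 * i), M,
      fun i => (q ^ (n - (M + k) + k + 2 + 2 * i))⁻¹, fun i => q ^ (n - (M + k) + k + 2 * i),
      fun i => zpow_ne_zero _ hq, fun z hz hde => ?_⟩
    rw [outerDen, qPoch_zpow_prod hq hq1 (n - (M + k) + k) z (M + k + 1)] at hde
    rw [outerNum, outerDen, qPoch_zpow_prod hq hq1 (n - (M + k) + k + 2) z⁻¹ M,
      qPoch_zpow_prod hq hq1 (n - (M + k) + k) z (M + k + 1),
      show n - (M + k) + k + 2 + 2 * (M : ℤ) = n + (M + k) - k + 2 by ring,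
      show n - (M + k) + k + 2 * ((M + k + 1 : ℕ) : ℤ) = n + (M + k) + k + 2 by push_cast; ring,
      show (M + k - k : ℤ) = M by ring, zpow_natCast]
    rw [show n - (M + k) + k + 2 * ((M + k + 1 : ℕ) : ℤ) = n + (M + k) + k + 2 by
      push_cast; ring] at hde
    have h1 := pow_mul_prod_one_sub_mul_inv hz M (fun i => q ^ (n - (M + k) + k + 2 + 2 * i))
      (fun i => zpow_ne_zero _ hq)
    rw [← h1]
    generalize qPoch q (q ^ (n + (M + k) - k + 2) * z⁻¹) = A at *
    generalize qPoch q (q ^ (n + (M + k) + k + 2) * z) = B at *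
    have hA := left_ne_zero_of_mul hde
    have hB := right_ne_zero_of_mul (right_ne_zero_of_mul hde)
    have hC := left_ne_zero_of_mul (right_ne_zero_of_mul hde)
    field_simp
  · obtain ⟨M, rfl⟩ : ∃ M : ℕ, m = -M - 1 := ⟨(-m - 1).toNat, by omega⟩
    refine ⟨(∏ i ∈ Finset.range (M + k + 1), -q ^ (n + (-M - 1) - k + 2 + 2 * i))⁻¹, M,
      fun i => q ^ (n + (-M - 1) + k + 2 + 2 * i), fun i => (q ^ (n + (-M - 1) - k + 2 + 2 * i))⁻¹,
      fun i => inv_ne_zero (zpow_ne_zero _ hq), fun z hz hde => ?_⟩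
    have e1 : n + (-M - 1) - k + 2 + 2 * ((M + k + 1 : ℕ) : ℤ) = n - (-M - 1) + k + 2 := by
      push_cast; ring
    have e2 : n + (-M - 1) + k + 2 + 2 * (M : ℤ) = n - (-M - 1) + k := by ring
    rw [outerDen, qPoch_zpow_prod hq hq1 (n + (-M - 1) - k + 2) z⁻¹ (M + k + 1), e1] at hde
    rw [outerNum, outerDen, qPoch_zpow_prod hq hq1 (n + (-M - 1) - k + 2) z⁻¹ (M + k + 1),
      qPoch_zpow_prod hq hq1 (n + (-M - 1) + k + 2) z M, e1, e2,
      show (-M - 1 - k : ℤ) = -((M + k + 1 : ℕ) : ℤ) by push_cast; ring, zpow_neg, zpow_natCast]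
    have h1 := pow_mul_prod_one_sub_mul_inv hz (M + k + 1)
      (fun i => q ^ (n + (-M - 1) - k + 2 + 2 * i)) (fun i => zpow_ne_zero _ hq)
    rw [show ∀ a b c : ℂ, a⁻¹ * b / c = b / (a * c) from fun a b c => by
      rw [inv_mul_eq_div, div_div], ← h1]
    generalize qPoch q (q ^ (n - (-M - 1) + k + 2) * z⁻¹) = A at *
    generalize qPoch q (q ^ (n - (-M - 1) + k) * z) = B at *
    have hA := right_ne_zero_of_mul (left_ne_zero_of_mul hde)
    have hB := right_ne_zero_of_mul hde
    have hC := left_ne_zero_of_mul (left_ne_zero_of_mul hde)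
    have hD := pow_ne_zero (M + k + 1) hz
    beta_reduce at hC ⊢
    generalize ∏ i ∈ Finset.range (M + k + 1), (_ : ℂ) = D at *
    generalize ∏ i ∈ Finset.range M, (_ : ℂ) = E at *
    field_simp

/-- The four products pair up with quotients that are finite products, one of length b and one of
length b + k + 1 for b ≥ 0. For b + k < 0 both lengths are negative, so numerator and denominator
change places. The degrees again differ by k + 1. -/
theorem isRational_mid {q : ℂ} (hq : q ≠ 0) (hq1 : ‖q‖ < 1) (k : ℕ) (a b : ℤ)
    (h : 0 ≤ b ∨ b + k < 0) : IsRational k (midNum q k a b) (midDen q k a b) := by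
  have hs : ∀ (e : ℤ) (z : ℂ), -q ^ e * z = q ^ e * -z := fun e z => by ring
  have hd : ∀ (s : Finset ℕ) (f : ℕ → ℤ) (z : ℂ),
      ∏ i ∈ s, (1 - q ^ f i * -z) = ∏ i ∈ s, (1 - (fun i => -q ^ f i) i * z) := fun s f z =>
    Finset.prod_congr rfl fun i _ => by ring
  rcases h with h | h
  · obtain ⟨M, rfl⟩ : ∃ M : ℕ, b = M := ⟨b.toNat, by omega⟩
    refine ⟨q ^ (a * M), M, fun i => -q ^ (1 - a - M + 2 * i), fun i => -q ^ (1 + a - M + 2 * i),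
      fun i => neg_ne_zero.2 (zpow_ne_zero _ hq), fun z hz hde => ?_⟩
    have e1 : 1 - a - M + 2 * (M : ℤ) = 1 - a + M := by ring
    have e2 : 1 + a - M + 2 * ((M + k + 1 : ℕ) : ℤ) = 3 + a + M + 2 * k := by push_cast; ring
    rw [midDen, hs, hs, qPoch_zpow_prod hq hq1 (1 + a - M) (-z) (M + k + 1), e2, hd] at hde
    rw [midNum, midDen, hs, hs, hs, hs, qPoch_zpow_prod hq hq1 (1 + a - M) (-z) (M + k + 1), e2,
      qPoch_zpow_prod hq hq1 (1 - a - M) (-z) M, e1, hd, hd]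
    generalize qPoch q (q ^ (1 - a + M) * -z) = A at *
    generalize qPoch q (q ^ (3 + a + M + 2 * k) * -z) = B at *
    have hA := left_ne_zero_of_mul hde
    have hB := right_ne_zero_of_mul (right_ne_zero_of_mul hde)
    have hC := left_ne_zero_of_mul (right_ne_zero_of_mul hde)
    beta_reduce at hC ⊢
    generalize ∏ i ∈ Finset.range (M + k + 1), (_ : ℂ) = D at *
    generalize ∏ i ∈ Finset.range M, (_ : ℂ) = E at *
    field_simp
  · obtain ⟨M, rfl⟩ : ∃ M : ℕ, b = -M - 1 - k := ⟨(-b - 1 - k).toNat, by omega⟩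
    refine ⟨q ^ (a * (-M - 1 - k)), M, fun i => -q ^ (3 + a + (-M - 1 - k) + 2 * k + 2 * i),
      fun i => -q ^ (1 - a + (-M - 1 - k) + 2 * i),
      fun i => neg_ne_zero.2 (zpow_ne_zero _ hq), fun z hz hde => ?_⟩
    have e1 : 1 - a + (-M - 1 - k) + 2 * ((M + k + 1 : ℕ) : ℤ) = 1 - a - (-M - 1 - k) := by
      push_cast; ring
    have e2 : 3 + a + (-M - 1 - k) + 2 * k + 2 * (M : ℤ) = 1 + a - (-M - 1 - k) := by ring
    rw [midDen, hs, hs, qPoch_zpow_prod hq hq1 (1 - a + (-M - 1 - k)) (-z) (M + k + 1), e1,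
      hd] at hde
    rw [midNum, midDen, hs, hs, hs, hs,
      qPoch_zpow_prod hq hq1 (1 - a + (-M - 1 - k)) (-z) (M + k + 1), e1,
      qPoch_zpow_prod hq hq1 (3 + a + (-M - 1 - k) + 2 * k) (-z) M, e2, hd, hd]
    generalize qPoch q (q ^ (1 - a - (-M - 1 - k)) * -z) = A at *
    generalize qPoch q (q ^ (1 + a - (-M - 1 - k)) * -z) = B at *
    have hA := right_ne_zero_of_mul (left_ne_zero_of_mul hde)
    have hB := right_ne_zero_of_mul hde
    have hC := left_ne_zero_of_mul (left_ne_zero_of_mul hde)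
    beta_reduce at hC ⊢
    generalize ∏ i ∈ Finset.range (M + k + 1), (_ : ℂ) = D at *
    generalize ∏ i ∈ Finset.range M, (_ : ℂ) = E at *
    field_simp

/-! ### Matrix elements of the traced operators -/

open Classical in
/-- The indicator of a proposition. -/
def ind (p : Prop) : ℂ := if p then 1 else 0

theorem ind_pos {p : Prop} (h : p) : ind p = 1 := if_pos h

theorem ind_neg {p : Prop} (h : ¬p) : ind p = 0 := if_neg h

/-- The general product, where one site may be moved back and forth; the indicator records that the
intermediate state must exist. -/
theorem mono_mul_mono_ind (d e g d' e' g' : ℤ) (f f' : ℤ → ℤ → ℤ → ℂ) :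
    (mono d e g f * mono d' e' g' f' : Op c) =
      mono (d' + d) (e' + e) (g' + g)
        (fun a b k => ind (Adm c (a + d') (b + e') (k + g')) *
          (f (a + d') (b + e') (k + g') * f' a b k)) := by
  apply Op.ext_ket
  intro a b k h
  rw [Module.End.mul_apply, mono_ket _ _ _ _ h, mono_ket _ _ _ _ h, map_smul]
  by_cases h' : Adm c (a + d') (b + e') (k + g')
  · rw [ind_pos h', mono_ket _ _ _ _ h', smul_smul, one_mul, mul_comm, add_assoc, add_assoc,
      add_assoc]
  · rw [ind_neg h', ket_of_not_adm h', map_zero, smul_zero, zero_mul, zero_smul]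

theorem mono_congr_adm {d e g : ℤ} {f f' : ℤ → ℤ → ℤ → ℂ}
    (h : ∀ a b k, Adm c a b k → Adm c (a + d) (b + e) (k + g) → f a b k = f' a b k) :
    (mono d e g f : Op c) = mono d e g f' := by
  apply Op.ext_ket
  intro a b k h1
  rw [mono_ket _ _ _ _ h1, mono_ket _ _ _ _ h1]
  by_cases h2 : Adm c (a + d) (b + e) (k + g)
  · rw [h a b k h1 h2]
  · rw [ket_of_not_adm h2, smul_zero, smul_zero]

/-- A Bose spectrum is a half-line, hence convex. This supplies the intermediate occupation numbers
in all arguments below. -/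
theorem mem_bose_of_between {r : BoseRep} {x y z : ℤ} (hx : x ∈ (Osc.bose r).spectrum)
    (hz : z ∈ (Osc.bose r).spectrum) (h : x ≤ y ∧ y ≤ z ∨ z ≤ y ∧ y ≤ x) :
    y ∈ (Osc.bose r).spectrum := by
  cases r <;> simp only [Osc.spectrum, Set.mem_ofPred_eq] at * <;> omega

theorem mem_bose_mul {r : BoseRep} {x d : ℤ} {k : ℕ} (hx : x ∈ (Osc.bose r).spectrum)
    (hz : x + (k + 1 : ℕ) * d ∈ (Osc.bose r).spectrum) : x + k * d ∈ (Osc.bose r).spectrum := by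
  refine mem_bose_of_between hx hz ?_
  push_cast
  rcases le_total 0 d with h | h
  · left; constructor <;> nlinarith
  · right; constructor <;> nlinarith

/-- All intermediate states lie between the initial and the final one at every site, so convexity of
the spectra removes the indicators. -/
theorem mono_pow {r : Fin 3 → BoseRep} (d e g : ℤ) (f : ℤ → ℤ → ℤ → ℂ) (k : ℕ) :
    (mono d e g f : Op (cAAA r)) ^ k = mono (k * d) (k * e) (k * g)
      (fun a b l => ∏ i ∈ Finset.range k, f (a + i * d) (b + i * e) (l + i * g)) := by
  induction k with
  | zero => simp [one_eq_mono]
  | succ k ih =>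
    rw [pow_succ', ih, mono_mul_mono_ind]
    have hk : ∀ d : ℤ, ((k + 1 : ℕ) : ℤ) * d = k * d + d := fun d => by push_cast; ring
    rw [hk, hk, hk]
    apply mono_congr_adm
    intro a b l h1 h2
    rw [ind_pos, one_mul, Finset.prod_range_succ, mul_comm]
    rw [← hk, ← hk, ← hk] at h2
    exact ⟨mem_bose_mul h1.1 h2.1, mem_bose_mul h1.2.1 h2.2.1, mem_bose_mul h1.2.2 h2.2.2⟩

/-- The eigenvalue of `(a⁻)^k (a⁺)^k` on `|n⟩`. -/
def boseE (q : ℂ) (k : ℕ) (n : ℤ) : ℂ := ∏ i ∈ Finset.range k, (1 - q ^ (2 * (n + i) + 2))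

@[simp] theorem boseE_zero (q : ℂ) (n : ℤ) : boseE q 0 n = 1 := rfl

theorem boseE_succ (q : ℂ) (k : ℕ) (n : ℤ) :
    boseE q (k + 1) n = boseE q k n * (1 - q ^ (2 * (n + k + 1))) := by
  rw [boseE, Finset.prod_range_succ, ← boseE]
  ring_nf

theorem boseE_succ' (q : ℂ) (k : ℕ) (n : ℤ) :
    boseE q (k + 1) n = (1 - q ^ (2 * (n + 1))) * boseE q k (n + 1) := by
  rw [boseE, Finset.prod_range_succ', mul_comm, boseE]
  congr 1
  · push_cast; ring_nf
  · refine Finset.prod_congr rfl fun i _ => ?_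
    push_cast; ring_nf

open Classical in
/-- The zero extension of a function of the state to all triples of integers. -/
def stExt (f : State c → ℂ) (a b d : ℤ) : ℂ := if h : Adm c a b d then f (mkState a b d h) else 0

theorem diagOp_eq_mono_stExt (f : State c → ℂ) : (diagOp f : Op c) = mono 0 0 0 (stExt f) := by
  rw [← diagOp_eq_mono]
  congr 1
  funext n
  rw [stExt, dif_pos (adm_state n), mkState_eta]

/-- The coefficients `R_k`, extended by zero to all triples of integers at which they do not enter
the operator series. -/
def coefExt {r : Fin 3 → BoseRep} (Rk : ℕ → State (cAAA r) → ℂ) (k : ℕ) (a b d : ℤ) : ℂ :=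
  ind (Adm (cAAA r) (a + k) (b - k) (d + k)) * stExt (Rk k) a b d

theorem coefExt_eq_zero {r : Fin 3 → BoseRep} (Rk : ℕ → State (cAAA r) → ℂ) (k : ℕ) {a b d : ℤ}
    (h : ¬(Adm (cAAA r) a b d ∧ Adm (cAAA r) (a + k) (b - k) (d + k))) :
    coefExt Rk k a b d = 0 := by
  rw [coefExt]
  by_cases h1 : Adm (cAAA r) (a + k) (b - k) (d + k)
  · rw [stExt, dif_neg fun h2 => h ⟨h2, h1⟩, mul_zero]
  · rw [ind_neg h1, zero_mul]

theorem matEl_diag_mono (f : ℤ → ℤ → ℤ → ℂ) (d e g : ℤ) (hd : d = 0) (he : e = 0) (hg : g = 0)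
    (n : State c) : matEl (mono d e g f) n n = f (n.1 0) (n.1 1) (n.1 2) := by
  subst hd he hg
  rw [matEl_mono, if_pos]
  simp

theorem up_pow (q : ℂ) {r : Fin 3 → BoseRep} (j : Fin 3) (k : ℕ) :
    (up q j : Op (cAAA r)) ^ k = mono (sel j k 0 0) (sel j 0 k 0) (sel j 0 0 k)
      (fun a b d => boseE q k (sel j a b d)) := by
  rw [up_bose_eq_mono q rfl, mono_pow]
  fin_cases j <;> simp [boseE, sel]

theorem dn_pow (q : ℂ) {r : Fin 3 → BoseRep} (j : Fin 3) (k : ℕ) :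
    (dn q j : Op (cAAA r)) ^ k = mono (sel j (-k) 0 0) (sel j 0 (-k) 0) (sel j 0 0 (-k))
      (fun _ _ _ => 1) := by
  rw [dn_bose_eq_mono q rfl, mono_pow]
  fin_cases j <;> simp [sel]

/-- Raising and lowering the traced site produces the condition that `n₁ + k` is in the spectrum.
The hypotheses cover the two other sites, so this is precisely the support condition built into
`coefExt`. -/
theorem matEl_trace_zero (q z : ℂ) {r : Fin 3 → BoseRep} (Rk : ℕ → State (cAAA r) → ℂ) (k : ℕ)
    (n : State (cAAA r)) (h1 : n.1 1 - k ∈ (cAAA r 1).spectrum)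
    (h2 : n.1 2 + k ∈ (cAAA r 2).spectrum) :
    matEl (pw z 0 * (dn q 0 ^ k * up q 0 ^ k * diagOp (Rk k))) n n =
      z ^ n.1 0 * (boseE q k (n.1 0) * coefExt Rk k (n.1 0) (n.1 1) (n.1 2)) := by
  rw [pw_eq_mono, dn_pow, up_pow, diagOp_eq_mono_stExt, mono_mul_mono_ind, mono_mul_mono_ind,
    mono_mul_mono_ind, matEl_diag_mono _ _ _ _ (by simp) (by simp) (by simp)]
  have ha := adm_state n
  simp only [sel_zero, sel_zero, sel_one, sel_two, coefExt, add_zero, zero_add, ind_pos ha, add_neg_cancel_right,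
    add_neg_cancel, one_mul, add_sub_cancel_right]
  have h3 : Adm (cAAA r) (n.1 0 + k) (n.1 1) (n.1 2) ↔
      Adm (cAAA r) (n.1 0 + k) (n.1 1 - k) (n.1 2 + k) :=
    ⟨fun h => ⟨h.1, h1, h2⟩, fun h => ⟨h.1, ha.2.1, ha.2.2⟩⟩
  rw [h3]
  ring

theorem matEl_trace_two (q z : ℂ) {r : Fin 3 → BoseRep} (Rk : ℕ → State (cAAA r) → ℂ) (k : ℕ)
    (n : State (cAAA r)) (h1 : n.1 0 + k ∈ (cAAA r 0).spectrum)
    (h2 : n.1 1 - k ∈ (cAAA r 1).spectrum) :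
    matEl (pw z 2 * (dn q 2 ^ k * up q 2 ^ k * diagOp (Rk k))) n n =
      z ^ n.1 2 * (boseE q k (n.1 2) * coefExt Rk k (n.1 0) (n.1 1) (n.1 2)) := by
  rw [pw_eq_mono, dn_pow, up_pow, diagOp_eq_mono_stExt, mono_mul_mono_ind, mono_mul_mono_ind,
    mono_mul_mono_ind, matEl_diag_mono _ _ _ _ (by simp) (by simp) (by simp)]
  have ha := adm_state n
  simp only [sel_two, sel_zero, sel_one, sel_two, coefExt, add_zero, zero_add, ind_pos ha, add_neg_cancel_right,
    add_neg_cancel, one_mul, add_sub_cancel_right]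
  have h3 : Adm (cAAA r) (n.1 0) (n.1 1) (n.1 2 + k) ↔
      Adm (cAAA r) (n.1 0 + k) (n.1 1 - k) (n.1 2 + k) :=
    ⟨fun h => ⟨h1, h2, h.2.2⟩, fun h => ⟨ha.1, ha.2.1, h.2.2⟩⟩
  rw [h3]
  ring

/-- Here the creation operators act before R_k, which is therefore evaluated at `n₂ + k`; its second
argument after the shift by −k is again `n₂`. -/
theorem matEl_trace_one (q z : ℂ) {r : Fin 3 → BoseRep} (Rk : ℕ → State (cAAA r) → ℂ) (k : ℕ)
    (n : State (cAAA r)) (h1 : n.1 0 + k ∈ (cAAA r 0).spectrum)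
    (h2 : n.1 2 + k ∈ (cAAA r 2).spectrum) :
    matEl (pw z 1 * (dn q 1 ^ k * diagOp (Rk k) * up q 1 ^ k)) n n =
      z ^ n.1 1 * (boseE q k (n.1 1) * coefExt Rk k (n.1 0) (n.1 1 + k) (n.1 2)) := by
  rw [pw_eq_mono, dn_pow, up_pow, diagOp_eq_mono_stExt, mono_mul_mono_ind, mono_mul_mono_ind,
    mono_mul_mono_ind, matEl_diag_mono _ _ _ _ (by simp) (by simp) (by simp)]
  have ha := adm_state n
  simp only [sel_one, sel_zero, sel_one, sel_two, coefExt, add_zero, zero_add, ind_pos ha, add_neg_cancel_right,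
    add_neg_cancel, one_mul, add_sub_cancel_right]
  rw [ind_pos (show Adm (cAAA r) (n.1 0 + k) (n.1 1) (n.1 2 + k) from ⟨h1, ha.2.1, h2⟩)]
  by_cases h4 : Adm (cAAA r) (n.1 0) (n.1 1 + k) (n.1 2)
  · rw [ind_pos h4]; ring
  · rw [ind_neg h4, stExt, dif_neg h4]; ring

/-- The trace condition asks for convergence wherever the denominator does not vanish, while
`Expands` asks for it only at generic points. A rational function has an expansion converging in the
larger region, and uniqueness identifies its coefficients with the given ones. -/
theorem eventually_hasSum_iff_expands {q : ℂ} (hq0 : 0 < ‖q‖) (hq1 : ‖q‖ < 1) {b : BoseRep}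
    {k : ℕ} {nu de : ℂ → ℂ} (hr : IsRational k nu de) (hde : ∀ z, Gen q z → de z ≠ 0) {f : ℤ → ℂ}
    (hf : ∀ x, x ∉ (Osc.bose b).spectrum → f x = 0) :
    (∀ᶠ z in b.lim, de z ≠ 0 → HasSum (fun x : ℤ => z ^ x * f x) (b.sign * (nu z / de z))) ↔
      Expands q b f (fun z => nu z / de z) := by
  constructor
  · intro h
    exact h.mono fun z hz hg => hz (hde z hg)
  · intro h
    obtain ⟨g, hg, hs⟩ := hr.exists_coeff b
    have h2 : Expands q b g (fun z => nu z / de z) := hs.mono fun z hz hg => hz (hde z hg)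
    have h3 : f = g := funext fun n => h.unique hq0 hq1 h2 (bddSupp_of_spectrum hf)
      (bddSupp_of_spectrum fun x hx => hg x fun h => hx h.1) (fun _ _ _ => rfl) n
    rw [h3]
    exact hs

theorem setAt_same {c : Fin 3 → Osc} (n : State c) (j : Fin 3) (x : (c j).spectrum) :
    (setAt n j x).1 j = x := by
  simp [setAt]

theorem setAt_of_ne {c : Fin 3 → Osc} (n : State c) {i j : Fin 3} (h : i ≠ j)
    (x : (c j).spectrum) : (setAt n j x).1 i = n.1 i := by
  simp [setAt, h]

theorem hasGenFun_iff_expands {q : ℂ} (hq0 : 0 < ‖q‖) (hq1 : ‖q‖ < 1) {r : Fin 3 → BoseRep}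
    {j : Fin 3} {k : ℕ} {nu de : ℂ → ℂ} (hr : IsRational k nu de)
    (hde : ∀ z, Gen q z → de z ≠ 0) {f : ℤ → ℂ}
    (hf : ∀ x, x ∉ (Osc.bose (r j)).spectrum → f x = 0) {D : Op (cAAA r)} {n : State (cAAA r)}
    (h : ∀ z (x : (cAAA r j).spectrum),
      matEl (pw z j * D) (setAt n j x) (setAt n j x) = z ^ (x : ℤ) * f x) :
    HasGenFun j D n nu de ↔ Expands q (r j) f (fun z => nu z / de z) := by
  rw [← eventually_hasSum_iff_expands hq0 hq1 hr hde hf, ← exists_near_iff, HasGenFun]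
  refine exists_congr fun ρ => and_congr_right fun _ => forall_congr' fun z =>
    forall_congr' fun _ => forall_congr' fun _ => ?_
  simp only [h]
  refine hasSum_subtype_iff_of_support_subset (f := fun x : ℤ => z ^ x * f x)
    (s := (cAAA r j).spectrum) fun x hx => ?_
  by_contra h0
  exact hx (by simp only [hf x h0, mul_zero])

/-- The generating functions of the coefficients `ρ` for the trace over the first site. -/
def OuterGen (q : ℂ) (s₁ s₂ s₃ : BoseRep) (ρ : ℕ → ℤ → ℤ → ℤ → ℂ) : Prop :=
  ∀ (k : ℕ) (b d : ℤ), b ∈ (Osc.bose s₂).spectrum → b - k ∈ (Osc.bose s₂).spectrum →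
    d ∈ (Osc.bose s₃).spectrum → d + k ∈ (Osc.bose s₃).spectrum →
    Expands q s₁ (fun x => boseE q k x * ρ k x b d) (outerG q k b d)

/-- The generating functions of the coefficients `ρ` for the trace over the second site. -/
def MidGen (q : ℂ) (s₁ s₂ s₃ : BoseRep) (ρ : ℕ → ℤ → ℤ → ℤ → ℂ) : Prop :=
  ∀ (k : ℕ) (a d : ℤ), a ∈ (Osc.bose s₁).spectrum → a + k ∈ (Osc.bose s₁).spectrum →
    d ∈ (Osc.bose s₃).spectrum → d + k ∈ (Osc.bose s₃).spectrum →
    Expands q s₂ (fun x => boseE q k x * ρ k a (x + k) d) (midG q k a d)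

/-- The coefficients `ρ` vanish unless they enter the operator series. -/
def CoefSupp (s₁ s₂ s₃ : BoseRep) (ρ : ℕ → ℤ → ℤ → ℤ → ℂ) : Prop :=
  ∀ (k : ℕ) (a b d : ℤ), ¬((a ∈ (Osc.bose s₁).spectrum ∧ a + k ∈ (Osc.bose s₁).spectrum) ∧
    (b ∈ (Osc.bose s₂).spectrum ∧ b - k ∈ (Osc.bose s₂).spectrum) ∧
    (d ∈ (Osc.bose s₃).spectrum ∧ d + k ∈ (Osc.bose s₃).spectrum)) → ρ k a b d = 0

theorem coefSupp_coefExt {r : Fin 3 → BoseRep} (Rk : ℕ → State (cAAA r) → ℂ) :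
    CoefSupp (r 0) (r 1) (r 2) (coefExt Rk) := fun k a b d h =>
  coefExt_eq_zero Rk k fun ⟨⟨h1, h2, h3⟩, h4, h5, h6⟩ => h ⟨⟨h1, h4⟩, ⟨h2, h5⟩, h3, h6⟩

theorem CoefSupp.swap {s₁ s₂ s₃ : BoseRep} {ρ : ℕ → ℤ → ℤ → ℤ → ℂ} (h : CoefSupp s₁ s₂ s₃ ρ) :
    CoefSupp s₃ s₂ s₁ (fun k a b d => ρ k d b a) := fun k a b d h' =>
  h k d b a fun ⟨h1, h2, h3⟩ => h' ⟨h3, h2, h1⟩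

theorem bose_outer_cond {s : BoseRep} {b : ℤ} {k : ℕ} (h : b ∈ (Osc.bose s).spectrum)
    (h' : b - k ∈ (Osc.bose s).spectrum) : k ≤ b ∨ b < 0 := by
  cases s <;> simp only [Osc.spectrum, Set.mem_ofPred_eq] at * <;> omega

theorem bose_mid_cond {s : BoseRep} {d : ℤ} {k : ℕ} (h : d ∈ (Osc.bose s).spectrum)
    (h' : d + k ∈ (Osc.bose s).spectrum) : 0 ≤ d ∨ d + k < 0 := by
  cases s <;> simp only [Osc.spectrum, Set.mem_ofPred_eq] at * <;> omega

/-- The trace conditions quantify over full states, although the occupation number at the traced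
site is irrelevant; a dummy value there passes between the two formulations. -/
theorem forall_bose_iff {r : Fin 3 → BoseRep} {i j l : Fin 3} (hij : i ≠ j) (hl : l ≠ i ∧ l ≠ j)
    (h : ∀ t, t = i ∨ t = j ∨ t = l) (P : ℤ → ℤ → Prop) :
    (∀ n : State (cAAA r), P (n.1 i) (n.1 j)) ↔
      ∀ a b, a ∈ (Osc.bose (r i)).spectrum → b ∈ (Osc.bose (r j)).spectrum → P a b := by
  constructor
  · intro h1 a b ha hb
    obtain ⟨e, he⟩ : ∃ e, e ∈ (cAAA r l).spectrum := by
      change ∃ e, e ∈ (Osc.bose (r l)).spectrum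
      cases r l
      · exact ⟨0, le_refl (0 : ℤ)⟩
      · exact ⟨-1, (by decide : (-1 : ℤ) < 0)⟩
    have h2 := h1 ⟨fun t => if t = i then a else if t = j then b else e, fun t => by
      rcases h t with rfl | rfl | rfl
      · simpa using ha
      · simpa [hij.symm] using hb
      · simpa [hl.1, hl.2] using he⟩
    simpa [hij.symm] using h2
  · intro h1 n
    exact h1 _ _ (n.2 i) (n.2 j)

section

variable {q : ℂ} (hq0 : 0 < ‖q‖) (hq1 : ‖q‖ < 1) {r : Fin 3 → BoseRep}
  (Rk : ℕ → State (cAAA r) → ℂ)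

include hq0 hq1

theorem genFun₁_iff : GenFun₁ q Rk ↔ OuterGen q (r 0) (r 1) (r 2) (coefExt Rk) := by
  have hq := norm_pos_iff.1 hq0
  refine forall_congr' fun k => ?_
  rw [← forall_bose_iff (r := r) (i := 1) (j := 2) (l := 0) (by decide) (by decide) (by decide)
    (fun b d => b - k ∈ (Osc.bose (r 1)).spectrum → d ∈ (Osc.bose (r 2)).spectrum →
      d + k ∈ (Osc.bose (r 2)).spectrum →
      Expands q (r 0) (fun x => boseE q k x * coefExt Rk k x b d) (outerG q k b d)) |>.trans
    (forall_congr' fun b => forall_congr' fun d => by tauto)]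
  refine forall_congr' fun n => forall_congr' fun h1 => ?_
  rw [forall_prop_of_true (n.2 2)]
  refine forall_congr' fun h2 => ?_
  refine hasGenFun_iff_expands hq0 hq1 (isRational_outer hq hq1 _ _ _
    (bose_outer_cond (n.2 1) h1)) (fun z hz => outerDen_ne_zero hq hq1 hz _ _ _) (fun x hx => ?_)
    (fun z x => ?_)
  · rw [coefSupp_coefExt Rk _ _ _ _ fun h => hx h.1.1, mul_zero]
  · rw [matEl_trace_zero] <;>
      simp only [setAt_same, setAt_of_ne n (show (1 : Fin 3) ≠ 0 by decide),
        setAt_of_ne n (show (2 : Fin 3) ≠ 0 by decide)]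
    · exact h1
    · exact h2

theorem genFun₃_iff : GenFun₃ q Rk ↔
    OuterGen q (r 2) (r 1) (r 0) (fun k a b d => coefExt Rk k d b a) := by
  have hq := norm_pos_iff.1 hq0
  refine forall_congr' fun k => ?_
  rw [← forall_bose_iff (r := r) (i := 1) (j := 0) (l := 2) (by decide) (by decide) (by decide)
    (fun b d => b - k ∈ (Osc.bose (r 1)).spectrum → d ∈ (Osc.bose (r 0)).spectrum →
      d + k ∈ (Osc.bose (r 0)).spectrum →
      Expands q (r 2) (fun x => boseE q k x * coefExt Rk k d b x) (outerG q k b d)) |>.trans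
    (forall_congr' fun b => forall_congr' fun d => by tauto)]
  refine forall_congr' fun n => ?_
  rw [forall_prop_of_true (n.2 0), forall_comm]
  refine forall_congr' fun h1 => forall_congr' fun h2 => ?_
  refine hasGenFun_iff_expands hq0 hq1 (isRational_outer hq hq1 _ _ _
    (bose_outer_cond (n.2 1) h1)) (fun z hz => outerDen_ne_zero hq hq1 hz _ _ _) (fun x hx => ?_)
    (fun z x => ?_)
  · rw [coefSupp_coefExt Rk _ _ _ _ fun h => hx h.2.2.1, mul_zero]
  · rw [matEl_trace_two] <;>
      simp only [setAt_same, setAt_of_ne n (show (1 : Fin 3) ≠ 2 by decide),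
        setAt_of_ne n (show (0 : Fin 3) ≠ 2 by decide)]
    · exact h2
    · exact h1

theorem genFun₂_iff : GenFun₂ q Rk ↔ MidGen q (r 0) (r 1) (r 2) (coefExt Rk) := by
  have hq := norm_pos_iff.1 hq0
  refine forall_congr' fun k => ?_
  rw [← forall_bose_iff (r := r) (i := 0) (j := 2) (l := 1) (by decide) (by decide) (by decide)
    (fun a d => a + k ∈ (Osc.bose (r 0)).spectrum → d ∈ (Osc.bose (r 2)).spectrum →
      d + k ∈ (Osc.bose (r 2)).spectrum →
      Expands q (r 1) (fun x => boseE q k x * coefExt Rk k a (x + k) d) (midG q k a d)) |>.trans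
    (forall_congr' fun b => forall_congr' fun d => by tauto)]
  refine forall_congr' fun n => forall_congr' fun h1 => ?_
  rw [forall_prop_of_true (n.2 2)]
  refine forall_congr' fun h2 => ?_
  refine hasGenFun_iff_expands hq0 hq1 (isRational_mid hq hq1 _ _ _
    (bose_mid_cond (n.2 2) h2)) (fun z hz => midDen_ne_zero hq hq1 hz _ _ _) (fun x hx => ?_)
    (fun z x => ?_)
  · rw [coefSupp_coefExt Rk _ _ _ _ fun h => hx (by simpa using h.2.1.2), mul_zero]
  · rw [matEl_trace_one] <;>
      simp only [setAt_same, setAt_of_ne n (show (0 : Fin 3) ≠ 1 by decide),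
        setAt_of_ne n (show (2 : Fin 3) ≠ 1 by decide)]
    · exact h1
    · exact h2

end

/-! ### Relations between the coefficients -/

theorem one_sub_zpow_ne_zero {q : ℂ} (hq0 : 0 < ‖q‖) (hq1 : ‖q‖ < 1) {e : ℤ} (he : e ≠ 0) :
    1 - q ^ e ≠ 0 := by
  intro h
  have h1 : ‖q‖ ^ e = 1 := by rw [← norm_zpow, ← sub_eq_zero.1 h, norm_one]
  rcases lt_or_gt_of_ne he with h2 | h2
  · have := one_lt_zpow_of_neg₀ hq0 hq1 h2
    exact this.ne' h1
  · have := zpow_lt_one₀ hq0 hq1 h2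
    exact this.ne h1

/-- A factor vanishes only at the step from −1 to 0, which a path inside one spectrum never takes.
-/
theorem boseE_ne_zero {q : ℂ} (hq0 : 0 < ‖q‖) (hq1 : ‖q‖ < 1) {s : BoseRep} {k : ℕ} {a : ℤ}
    (ha : a ∈ (Osc.bose s).spectrum) (ha' : a + k ∈ (Osc.bose s).spectrum) :
    boseE q k a ≠ 0 := by
  rw [boseE, Finset.prod_ne_zero_iff]
  intro i hi
  have := Finset.mem_range.1 hi
  apply one_sub_zpow_ne_zero hq0 hq1
  cases s <;> simp only [Osc.spectrum, Set.mem_ofPred_eq] at ha ha' <;> omega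

theorem boseE_succ_sub (q : ℂ) (k : ℕ) (n : ℤ) :
    boseE q (k + 1) (n - 1) = (1 - q ^ (2 * n)) * boseE q k n := by
  rw [boseE_succ', sub_add_cancel]

/-- The relations between the coefficients `ρ` that follow from the generating functions for the
trace over the first site. -/
structure CoefRels (q : ℂ) (s₁ s₂ s₃ : BoseRep) (ρ : ℕ → ℤ → ℤ → ℤ → ℂ) : Prop where
  r02p : ∀ (k : ℕ) (a b d : ℤ), a ∈ (Osc.bose s₁).spectrum → a + k ∈ (Osc.bose s₁).spectrum →
    b ∈ (Osc.bose s₂).spectrum → b - 1 - k ∈ (Osc.bose s₂).spectrum →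
    d ∈ (Osc.bose s₃).spectrum → d + k ∈ (Osc.bose s₃).spectrum →
    (1 - q ^ (2 * a)) * (1 - q ^ (2 * d)) * ρ (k + 1) (a - 1) b (d - 1) -
      q ^ (1 + a + d) * ρ k a (b - 1) d = ρ k a b d
  r02m : ∀ (k : ℕ) (a b d : ℤ), a ∈ (Osc.bose s₁).spectrum → a + k + 1 ∈ (Osc.bose s₁).spectrum →
    b ∈ (Osc.bose s₂).spectrum → b - k ∈ (Osc.bose s₂).spectrum →
    d ∈ (Osc.bose s₃).spectrum → d + k + 1 ∈ (Osc.bose s₃).spectrum →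
    ρ k a b d - q ^ (3 + a + d + 2 * k) * (1 - q ^ (2 * (b - k))) * ρ (k + 1) a b d =
      (1 - q ^ (2 * (b + 1))) * ρ (k + 1) a (b + 1) d
  r01p : ∀ (k : ℕ) (a b d : ℤ), a ∈ (Osc.bose s₁).spectrum → a + k ∈ (Osc.bose s₁).spectrum →
    b ∈ (Osc.bose s₂).spectrum → b - 1 - k ∈ (Osc.bose s₂).spectrum →
    d ∈ (Osc.bose s₃).spectrum → d + k + 1 ∈ (Osc.bose s₃).spectrum →
    (1 - q ^ (2 * a)) * q ^ d * ρ (k + 1) (a - 1) b d + q ^ a * ρ k a (b - 1) (d + 1) =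
      q ^ (b - k - 1) * (1 - q ^ (2 * (a + k + 1))) * ρ (k + 1) a b d
  r12m : ∀ (k : ℕ) (a b d : ℤ), a ∈ (Osc.bose s₁).spectrum → a + k ∈ (Osc.bose s₁).spectrum →
    b ∈ (Osc.bose s₂).spectrum → b - k ∈ (Osc.bose s₂).spectrum →
    d ∈ (Osc.bose s₃).spectrum → d + k + 1 ∈ (Osc.bose s₃).spectrum →
    q ^ (k + a) * ρ k a b d +
      q ^ (d + k + 1) * (1 - q ^ (2 * (b - k))) * (1 - q ^ (2 * (a + k + 1))) *
        ρ (k + 1) a b d = q ^ b * ρ k a b (d + 1)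
  r02p' : ∀ (k : ℕ) (a b d : ℤ), a ∈ (Osc.bose s₁).spectrum → a + k + 1 ∈ (Osc.bose s₁).spectrum →
    b ∈ (Osc.bose s₂).spectrum → b - k ∈ (Osc.bose s₂).spectrum →
    d ∈ (Osc.bose s₃).spectrum → d + k + 1 ∈ (Osc.bose s₃).spectrum →
    ρ k (a + 1) b (d + 1) - q ^ (1 + a + d) * (1 - q ^ (2 * (b + 1))) * ρ (k + 1) a (b + 1) d =
      (1 - q ^ (2 * (b - k))) * ρ (k + 1) a b d
  r02m' : ∀ (k : ℕ) (a b d : ℤ), a ∈ (Osc.bose s₁).spectrum → a + k ∈ (Osc.bose s₁).spectrum →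
    b ∈ (Osc.bose s₂).spectrum → b - 1 - k ∈ (Osc.bose s₂).spectrum →
    d ∈ (Osc.bose s₃).spectrum → d + k ∈ (Osc.bose s₃).spectrum →
    (1 - q ^ (2 * (a + k + 1))) * (1 - q ^ (2 * (d + k + 1))) * ρ (k + 1) a b d -
      q ^ (1 + a + d + 2 * k) * ρ k a b d = ρ k a (b - 1) d
  r01m' : ∀ (k : ℕ) (a b d : ℤ), a ∈ (Osc.bose s₁).spectrum → a + k ∈ (Osc.bose s₁).spectrum →
    b ∈ (Osc.bose s₂).spectrum → b - 1 - k ∈ (Osc.bose s₂).spectrum →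
    d ∈ (Osc.bose s₃).spectrum → d + k + 1 ∈ (Osc.bose s₃).spectrum →
    q ^ (d + k + 1) * (1 - q ^ (2 * (a + k + 1))) * ρ (k + 1) a b d + q ^ (k + a) * ρ k a b d =
      q ^ b * (1 - q ^ (2 * a)) * ρ (k + 1) (a - 1) b d
  r12p' : ∀ (k : ℕ) (a b d : ℤ), a ∈ (Osc.bose s₁).spectrum → a + k ∈ (Osc.bose s₁).spectrum →
    b ∈ (Osc.bose s₂).spectrum → b - k ∈ (Osc.bose s₂).spectrum →
    d ∈ (Osc.bose s₃).spectrum → d + k + 1 ∈ (Osc.bose s₃).spectrum →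
    q ^ a * ρ k a b (d + 1) +
      q ^ d * (1 - q ^ (2 * (b + 1))) * (1 - q ^ (2 * a)) * ρ (k + 1) (a - 1) (b + 1) d =
      q ^ (b - k) * ρ k a b d

theorem bose_pred {s : BoseRep} {b : ℤ} (h : b ∈ (Osc.bose s).spectrum) :
    b - 1 ∈ (Osc.bose s).spectrum ∨ b = 0 := by
  cases s <;> simp only [Osc.spectrum, Set.mem_ofPred_eq] at * <;> omega

theorem bose_succ {s : BoseRep} {b : ℤ} (h : b ∈ (Osc.bose s).spectrum) :
    b + 1 ∈ (Osc.bose s).spectrum ∨ b + 1 = 0 := by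
  cases s <;> simp only [Osc.spectrum, Set.mem_ofPred_eq] at * <;> omega

/-- The alternative `t = 0` absorbs the boundary: whenever a term of a functional equation refers to
occupation numbers just outside the spectrum, its coefficient has a factor 1 − q⁰, and nothing has
to be known about its generating function. -/
theorem OuterGen.term {q : ℂ} {s₁ s₂ s₃ : BoseRep} {ρ : ℕ → ℤ → ℤ → ℤ → ℂ}
    (h : OuterGen q s₁ s₂ s₃ ρ) (k : ℕ) (b d : ℤ) (t : ℂ)
    (ht : t = 0 ∨ (b ∈ (Osc.bose s₂).spectrum ∧ b - k ∈ (Osc.bose s₂).spectrum) ∧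
      d ∈ (Osc.bose s₃).spectrum ∧ d + k ∈ (Osc.bose s₃).spectrum) :
    Expands q s₁ (fun x => t * (boseE q k x * ρ k x b d)) (fun z => t * outerG q k b d z) := by
  rcases ht with rfl | ⟨⟨h1, h2⟩, h3, h4⟩
  · exact Eventually.of_forall fun z _ =>
      hasSum_of_eq hasSum_zero (fun x => by simp) (by simp)
  · exact (h k b d h1 h2 h3 h4).const_mul t

theorem CoefSupp.bdd {q : ℂ} {s₁ s₂ s₃ : BoseRep} {ρ : ℕ → ℤ → ℤ → ℤ → ℂ}
    (h : CoefSupp s₁ s₂ s₃ ρ) (k : ℕ) (b d : ℤ) (t : ℂ) :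
    BddSupp s₁ (fun x => t * (boseE q k x * ρ k x b d)) :=
  bddSupp_of_spectrum fun x hx => by rw [h k x b d fun h' => hx h'.1.1, mul_zero, mul_zero]

/-- Each relation compares coefficients in one functional equation of the outer generating function
and divides by the nonzero product `boseE`. Different lengths of `boseE` in the terms account for
the factors depending on the first occupation number. -/
theorem coefRels_of_outerGen {q : ℂ} (hq0 : 0 < ‖q‖) (hq1 : ‖q‖ < 1) {s₁ s₂ s₃ : BoseRep}
    {ρ : ℕ → ℤ → ℤ → ℤ → ℂ} (hs : CoefSupp s₁ s₂ s₃ ρ) (ho : OuterGen q s₁ s₂ s₃ ρ) :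
    CoefRels q s₁ s₂ s₃ ρ := by
  have hq := norm_pos_iff.1 hq0
  constructor
  · intro k a b d ha ha' hb hb' hd hd'
    have hb1 : b - 1 ∈ (Osc.bose s₂).spectrum := mem_bose_of_between hb hb' (by omega)
    have hb2 : b - k ∈ (Osc.bose s₂).spectrum := mem_bose_of_between hb hb' (by omega)
    have H := ((((ho.term (k + 1) b (d - 1) (1 - q ^ (2 * d)) (by
        rcases bose_pred hd with h | rfl
        · right; push_cast
          exact ⟨⟨hb, by convert hb' using 1; ring⟩, h, by convert hd' using 1; ring⟩
        · left; simp)).shift 1).sub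
      ((ho.term k (b - 1) d (q ^ (1 + d)) (.inr ⟨⟨hb1, hb'⟩, hd, hd'⟩)).scale hq 1)).unique hq0 hq1
      (ho.term k b d 1 (.inr ⟨⟨hb, hb2⟩, hd, hd'⟩))
      (((hs.bdd _ _ _ _).shift 1).sub ((hs.bdd _ _ _ _).mul _)) (hs.bdd _ _ _ _)
      (fun z hz hg => by
        rw [zpow_one z]
        linear_combination outerG_rel_02_plus hq hq1 k b d hz hg) a)
    rw [boseE_succ_sub] at H
    refine mul_left_cancel₀ (boseE_ne_zero hq0 hq1 ha ha') ?_
    rw [show 1 + a + d = 1 + d + 1 * a by ring, zpow_add₀ hq _ (1 * a)]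
    linear_combination H
  · intro k a b d ha ha' hb hb' hd hd'
    have hd1 : d + k ∈ (Osc.bose s₃).spectrum := mem_bose_of_between hd hd' (by omega)
    have hd2 : d + (k + 1 : ℕ) ∈ (Osc.bose s₃).spectrum := by convert hd' using 1; push_cast; ring
    -- The combination F(z) − q^(2k+2) F(q²z) multiplies the coefficient at `a` by 1 − q^(2(a+k+1)),
    -- which extends `boseE q k a` to `boseE q (k + 1) a`.
    have H := ((((ho.term k b d 1 (.inr ⟨⟨hb, hb'⟩, hd, hd1⟩)).sub
        ((ho.term k b d (q ^ (2 * (k : ℤ) + 2)) (.inr ⟨⟨hb, hb'⟩, hd, hd1⟩)).scale hq 2)).sub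
        ((ho.term (k + 1) b d (q ^ (3 + d + 2 * k) * (1 - q ^ (2 * (b - k)))) (by
          rcases bose_pred hb' with h | h
          · right; push_cast
            exact ⟨⟨hb, by convert h using 1; ring⟩, hd, by convert hd' using 1; ring⟩
          · left; simp [h])).scale hq 1)).unique hq0 hq1
      (ho.term (k + 1) (b + 1) d (1 - q ^ (2 * (b + 1))) (by
        rcases bose_succ hb with h | h
        · right; push_cast
          exact ⟨⟨h, by convert hb' using 1; ring⟩, hd, by convert hd' using 1; ring⟩
        · left; simp [h]))
      (((hs.bdd _ _ _ _).sub ((hs.bdd _ _ _ _).mul _)).sub ((hs.bdd _ _ _ _).mul _))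
      (hs.bdd _ _ _ _)
      (fun z hz hg => by
        linear_combination outerG_rel_02_minus hq hq1 k b d hz hg) a)
    have hE := boseE_ne_zero hq0 hq1 (k := k + 1) ha (by convert ha' using 1; push_cast; ring)
    refine mul_left_cancel₀ hE ?_
    rw [boseE_succ] at H ⊢
    rw [show 3 + a + d + 2 * (k : ℤ) = (3 + d + 2 * k) + 1 * a by ring, zpow_add₀ hq _ (1 * a),
      show 2 * (a + k + 1) = 2 * a + (2 * (k : ℤ) + 2) by ring, zpow_add₀ hq (2 * a)]
    rw [show 2 * (a + k + 1) = 2 * a + (2 * (k : ℤ) + 2) by ring, zpow_add₀ hq (2 * a)] at H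
    linear_combination H
  · intro k a b d ha ha' hb hb' hd hd'
    have hb1 : b - 1 ∈ (Osc.bose s₂).spectrum := mem_bose_of_between hb hb' (by omega)
    have hd1 : d + 1 ∈ (Osc.bose s₃).spectrum := mem_bose_of_between hd hd' (by omega)
    have hd2 : d + (k + 1 : ℕ) ∈ (Osc.bose s₃).spectrum := by convert hd' using 1; push_cast; ring
    have hb2 : b - (k + 1 : ℕ) ∈ (Osc.bose s₂).spectrum := by convert hb' using 1; push_cast; ring
    have H := ((((ho.term (k + 1) b d (q ^ d) (.inr ⟨⟨hb, hb2⟩, hd, hd2⟩)).shift 1).add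
      ((ho.term k (b - 1) (d + 1) 1 (.inr ⟨⟨hb1, hb'⟩, hd1, by convert hd' using 1; ring⟩)).scale
        hq 1)).unique hq0 hq1
      (ho.term (k + 1) b d (q ^ (b - k - 1)) (.inr ⟨⟨hb, hb2⟩, hd, hd2⟩))
      (((hs.bdd _ _ _ _).shift 1).add ((hs.bdd _ _ _ _).mul _)) (hs.bdd _ _ _ _)
      (fun z hz hg => by
        rw [zpow_one z]
        linear_combination outerG_rel_01_plus hq hq1 k b d hz hg) a)
    rw [boseE_succ_sub, boseE_succ, one_mul a] at H
    refine mul_left_cancel₀ (boseE_ne_zero hq0 hq1 ha ha') ?_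
    linear_combination H
  · intro k a b d ha ha' hb hb' hd hd'
    have hd1 : d + k ∈ (Osc.bose s₃).spectrum := mem_bose_of_between hd hd' (by omega)
    have hd2 : d + (k + 1 : ℕ) ∈ (Osc.bose s₃).spectrum := by convert hd' using 1; push_cast; ring
    have hd3 : d + 1 ∈ (Osc.bose s₃).spectrum := mem_bose_of_between hd hd' (by omega)
    have H := ((((ho.term k b d (q ^ (k : ℤ)) (.inr ⟨⟨hb, hb'⟩, hd, hd1⟩)).scale hq 1).add
      (ho.term (k + 1) b d (q ^ (d + k + 1) * (1 - q ^ (2 * (b - k)))) (by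
          rcases bose_pred hb' with h | h
          · right; push_cast
            exact ⟨⟨hb, by convert h using 1; ring⟩, hd, by convert hd' using 1; ring⟩
          · left; simp [h]))).unique hq0 hq1
      (ho.term k b (d + 1) (q ^ b) (.inr ⟨⟨hb, hb'⟩, hd3, by convert hd' using 1; ring⟩))
      (((hs.bdd _ _ _ _).mul _).add (hs.bdd _ _ _ _)) (hs.bdd _ _ _ _)
      (fun z hz hg => by
        linear_combination outerG_rel_12_minus hq hq1 k b d hz hg) a)
    rw [boseE_succ, one_mul a] at H
    refine mul_left_cancel₀ (boseE_ne_zero hq0 hq1 ha ha') ?_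
    rw [zpow_add₀ hq k a]
    linear_combination H
  · intro k a b d ha ha' hb hb' hd hd'
    have hd3 : d + 1 ∈ (Osc.bose s₃).spectrum := mem_bose_of_between hd hd' (by omega)
    have hd4 : d + 1 + k ∈ (Osc.bose s₃).spectrum := by convert hd' using 1; ring
    -- Coefficients are compared at `a + 1`. The difference F(z) − F(q²z) gives 1 − q^(2(a+1)), the
    -- factor by which `boseE q (k + 1) a` exceeds `boseE q k (a + 1)`, and the terms multiplied by
    -- z contribute their coefficients at `a`.
    have H := ((((ho.term k b (d + 1) 1 (.inr ⟨⟨hb, hb'⟩, hd3, hd4⟩)).sub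
        ((ho.term k b (d + 1) 1 (.inr ⟨⟨hb, hb'⟩, hd3, hd4⟩)).scale hq 2)).sub
        (((ho.term (k + 1) (b + 1) d (q ^ (1 + d) * (1 - q ^ (2 * (b + 1)))) (by
          rcases bose_succ hb with h | h
          · right; push_cast
            exact ⟨⟨h, by convert hb' using 1; ring⟩, hd, by convert hd' using 1; ring⟩
          · left; simp [h])).scale hq 1).shift 1)).unique hq0 hq1
      ((ho.term (k + 1) b d (1 - q ^ (2 * (b - k))) (by
          rcases bose_pred hb' with h | h
          · right; push_cast
            exact ⟨⟨hb, by convert h using 1; ring⟩, hd, by convert hd' using 1; ring⟩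
          · left; simp [h])).shift 1)
      (((hs.bdd _ _ _ _).sub ((hs.bdd _ _ _ _).mul _)).sub
        (((hs.bdd (k + 1) (b + 1) d _).mul fun n => q ^ (1 * n)).shift 1)) ((hs.bdd _ _ _ _).shift 1)
      (fun z hz hg => by
        rw [zpow_one z]
        linear_combination outerG_rel_02_plus' hq hq1 k b d hz hg) (a + 1))
    have hE := boseE_ne_zero hq0 hq1 (k := k + 1) ha (by convert ha' using 1; push_cast; ring)
    refine mul_left_cancel₀ hE ?_
    rw [add_sub_cancel_right, boseE_succ'] at H
    rw [boseE_succ', show 1 + a + d = 1 + d + 1 * a by ring, zpow_add₀ hq _ (1 * a)]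
    linear_combination H
  · intro k a b d ha ha' hb hb' hd hd'
    have hb1 : b - 1 ∈ (Osc.bose s₂).spectrum := mem_bose_of_between hb hb' (by omega)
    have hb2 : b - k ∈ (Osc.bose s₂).spectrum := mem_bose_of_between hb hb' (by omega)
    have H := (((ho.term (k + 1) b d (1 - q ^ (2 * (d + k + 1))) (by
        rcases bose_succ hd' with h | h
        · right; push_cast
          exact ⟨⟨hb, by convert hb' using 1; ring⟩, hd, by convert h using 1; ring⟩
        · left; simp [h])).sub
      ((ho.term k b d (q ^ (1 + d + 2 * k)) (.inr ⟨⟨hb, hb2⟩, hd, hd'⟩)).scale hq 1)).unique hq0 hq1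
      (ho.term k (b - 1) d 1 (.inr ⟨⟨hb1, hb'⟩, hd, hd'⟩))
      ((hs.bdd _ _ _ _).sub ((hs.bdd _ _ _ _).mul _)) (hs.bdd _ _ _ _)
      (fun z hz hg => by
        linear_combination outerG_rel_02_minus' hq hq1 k b d hz hg) a)
    rw [boseE_succ] at H
    refine mul_left_cancel₀ (boseE_ne_zero hq0 hq1 ha ha') ?_
    rw [show 1 + a + d + 2 * (k : ℤ) = 1 + d + 2 * k + 1 * a by ring, zpow_add₀ hq _ (1 * a)]
    linear_combination H
  · intro k a b d ha ha' hb hb' hd hd'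
    have hb2 : b - k ∈ (Osc.bose s₂).spectrum := mem_bose_of_between hb hb' (by omega)
    have hb3 : b - (k + 1 : ℕ) ∈ (Osc.bose s₂).spectrum := by convert hb' using 1; push_cast; ring
    have hd1 : d + k ∈ (Osc.bose s₃).spectrum := mem_bose_of_between hd hd' (by omega)
    have hd2 : d + (k + 1 : ℕ) ∈ (Osc.bose s₃).spectrum := by convert hd' using 1; push_cast; ring
    have H := (((ho.term (k + 1) b d (q ^ (d + k + 1)) (.inr ⟨⟨hb, hb3⟩, hd, hd2⟩)).add
      ((ho.term k b d (q ^ (k : ℤ)) (.inr ⟨⟨hb, hb2⟩, hd, hd1⟩)).scale hq 1)).unique hq0 hq1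
      ((ho.term (k + 1) b d (q ^ b) (.inr ⟨⟨hb, hb3⟩, hd, hd2⟩)).shift 1)
      ((hs.bdd _ _ _ _).add ((hs.bdd _ _ _ _).mul _)) ((hs.bdd _ _ _ _).shift 1)
      (fun z hz hg => by
        rw [zpow_one z]
        linear_combination outerG_rel_01_minus' hq hq1 k b d hz hg) a)
    rw [boseE_succ_sub, boseE_succ, one_mul a] at H
    refine mul_left_cancel₀ (boseE_ne_zero hq0 hq1 ha ha') ?_
    rw [zpow_add₀ hq k a]
    linear_combination H
  · intro k a b d ha ha' hb hb' hd hd'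
    have hd1 : d + k ∈ (Osc.bose s₃).spectrum := mem_bose_of_between hd hd' (by omega)
    have hd3 : d + 1 ∈ (Osc.bose s₃).spectrum := mem_bose_of_between hd hd' (by omega)
    have hd4 : d + 1 + k ∈ (Osc.bose s₃).spectrum := by convert hd' using 1; ring
    have H := ((((ho.term k b (d + 1) 1 (.inr ⟨⟨hb, hb'⟩, hd3, hd4⟩)).scale hq 1).add
      ((ho.term (k + 1) (b + 1) d (q ^ d * (1 - q ^ (2 * (b + 1)))) (by
          rcases bose_succ hb with h | h
          · right; push_cast
            exact ⟨⟨h, by convert hb' using 1; ring⟩, hd, by convert hd' using 1; ring⟩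
          · left; simp [h])).shift 1)).unique hq0 hq1
      (ho.term k b d (q ^ (b - k)) (.inr ⟨⟨hb, hb'⟩, hd, hd1⟩))
      (((hs.bdd _ _ _ _).mul _).add ((hs.bdd _ _ _ _).shift 1)) (hs.bdd _ _ _ _)
      (fun z hz hg => by
        rw [zpow_one z]
        linear_combination outerG_rel_12_plus' hq hq1 k b d hz hg) a)
    rw [boseE_succ_sub, one_mul a] at H
    refine mul_left_cancel₀ (boseE_ne_zero hq0 hq1 ha ha') ?_
    linear_combination H

/-! ### The matrix elements of the operator series -/

/-- The matrix elements of the operator series with coefficients `ρ`. -/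
def serKer (q : ℂ) (ρ : ℕ → ℤ → ℤ → ℤ → ℂ) (a b d x y z : ℤ) : ℂ :=
  if x - a = b - y ∧ x - a = z - d then
    if a ≤ x then boseE q (x - a).toNat y * ρ (x - a).toNat a b d
    else boseE q (a - x).toNat x * boseE q (a - x).toNat z * ρ (a - x).toNat x y z
  else 0

theorem serKer_lower (q : ℂ) (ρ : ℕ → ℤ → ℤ → ℤ → ℂ) (k : ℕ) {a b d x y z : ℤ}
    (h0 : x = a + k := by push_cast; omega)
    (h1 : b = y + k := by push_cast; omega) (h2 : z = d + k := by push_cast; omega) :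
    serKer q ρ a b d x y z = boseE q k y * ρ k a b d := by
  rw [serKer, if_pos ⟨by omega, by omega⟩, if_pos (by omega), show (x - a).toNat = k by omega]

theorem serKer_upper (q : ℂ) (ρ : ℕ → ℤ → ℤ → ℤ → ℂ) (k : ℕ) {a b d x y z : ℤ}
    (h0 : a = x + k := by push_cast; omega)
    (h1 : y = b + k := by push_cast; omega) (h2 : d = z + k := by push_cast; omega) :
    serKer q ρ a b d x y z = boseE q k x * boseE q k z * ρ k x y z := by
  -- For `k = 0` the definition takes the lowering branch; on the diagonal both branches give ρ₀.
  rcases Nat.eq_zero_or_pos k with rfl | hk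
  · rw [serKer_lower q ρ 0 (by omega) (by omega) (by omega), show a = x by simpa using h0,
      show b = y by simpa using h1.symm, show d = z by simpa using h2]
    simp
  · rw [serKer, if_pos ⟨by omega, by omega⟩, if_neg (by omega), show (a - x).toNat = k by omega]

theorem serKer_eq_zero (q : ℂ) (ρ : ℕ → ℤ → ℤ → ℤ → ℂ) {a b d x y z : ℤ}
    (h : ¬(x - a = b - y ∧ x - a = z - d)) : serKer q ρ a b d x y z = 0 := if_neg h

/-- The series is symmetric under exchange of the outer sites together with the arguments of its
coefficients, so relations for entries 12 and 21 are mirror images of those for 01 and 10. -/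
theorem serKer_swap (q : ℂ) (ρ : ℕ → ℤ → ℤ → ℤ → ℂ) (a b d x y z : ℤ) :
    serKer q (fun k a b d => ρ k d b a) a b d x y z = serKer q ρ d b a z y x := by
  by_cases h : x - a = b - y ∧ x - a = z - d
  · rcases le_total a x with h1 | h1
    · obtain ⟨k, hk⟩ := Int.le.dest h1
      rw [serKer_lower _ _ k (by omega) (by omega) (by omega),
        serKer_lower _ _ k (by omega) (by omega) (by omega)]
    · obtain ⟨k, hk⟩ := Int.le.dest h1
      rw [serKer_upper _ _ k (by omega) (by omega) (by omega),
        serKer_upper _ _ k (by omega) (by omega) (by omega)]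
      ring
  · rw [serKer_eq_zero _ _ h, serKer_eq_zero]
    omega

theorem coefExt_of_adm {r : Fin 3 → BoseRep} (Rk : ℕ → State (cAAA r) → ℂ) (k : ℕ) {a b d : ℤ}
    (h : Adm (cAAA r) (a + k) (b - k) (d + k)) : coefExt Rk k a b d = stExt (Rk k) a b d := by
  rw [coefExt, ind_pos h, one_mul]

/-- The closed formula already vanishes off the spectra, so it agrees with the zero extension of the
kernel without any indicator. -/
theorem CoefSupp.serKer_eq_zero_left {q : ℂ} {s₁ s₂ s₃ : BoseRep} {ρ : ℕ → ℤ → ℤ → ℤ → ℂ}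
    (hs : CoefSupp s₁ s₂ s₃ ρ) {a b d : ℤ} (h : ¬(a ∈ (Osc.bose s₁).spectrum ∧
      b ∈ (Osc.bose s₂).spectrum ∧ d ∈ (Osc.bose s₃).spectrum)) (x y z : ℤ) :
    serKer q ρ a b d x y z = 0 := by
  by_cases hc : x - a = b - y ∧ x - a = z - d
  · rcases le_total a x with h1 | h1
    · obtain ⟨k, hk⟩ := Int.le.dest h1
      rw [serKer_lower _ _ k (by omega) (by omega) (by omega), hs _ _ _ _ fun h' =>
        h ⟨h'.1.1, h'.2.1.1, h'.2.2.1⟩, mul_zero]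
    · obtain ⟨k, hk⟩ := Int.le.dest h1
      rw [serKer_upper _ _ k (by omega) (by omega) (by omega), hs _ _ _ _ fun h' =>
        h ⟨?_, ?_, ?_⟩, mul_zero]
      · convert h'.1.2 using 1; omega
      · convert h'.2.1.2 using 1; omega
      · convert h'.2.2.2 using 1; omega
  · exact serKer_eq_zero _ _ hc

theorem CoefSupp.serKer_eq_zero_right {q : ℂ} {s₁ s₂ s₃ : BoseRep} {ρ : ℕ → ℤ → ℤ → ℤ → ℂ}
    (hs : CoefSupp s₁ s₂ s₃ ρ) {x y z : ℤ} (h : ¬(x ∈ (Osc.bose s₁).spectrum ∧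
      y ∈ (Osc.bose s₂).spectrum ∧ z ∈ (Osc.bose s₃).spectrum)) (a b d : ℤ) :
    serKer q ρ a b d x y z = 0 := by
  by_cases hc : x - a = b - y ∧ x - a = z - d
  · rcases le_total a x with h1 | h1
    · obtain ⟨k, hk⟩ := Int.le.dest h1
      rw [serKer_lower _ _ k (by omega) (by omega) (by omega), hs _ _ _ _ fun h' =>
        h ⟨?_, ?_, ?_⟩, mul_zero]
      · convert h'.1.2 using 1; omega
      · convert h'.2.1.2 using 1; omega
      · convert h'.2.2.2 using 1; omega
    · obtain ⟨k, hk⟩ := Int.le.dest h1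
      rw [serKer_upper _ _ k (by omega) (by omega) (by omega), hs _ _ _ _ fun h' =>
        h ⟨h'.1.1, h'.2.1.1, h'.2.2.1⟩, mul_zero]
  · exact serKer_eq_zero _ _ hc

theorem dn_up_dn_pow (q : ℂ) {r : Fin 3 → BoseRep} (k : ℕ) :
    (dn q 0 * up q 1 * dn q 2 : Op (cAAA r)) ^ k =
      mono (-k) k (-k) (fun _ b _ => boseE q k b) := by
  rw [dn_bose_eq_mono q rfl, dn_bose_eq_mono q rfl, up_bose_eq_mono q rfl,
    mono_mul_mono _ _ (by simp) (by simp) (by simp), mono_mul_mono _ _ (by simp) (by simp) (by simp),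
    mono_pow]
  simp [boseE]

theorem up_dn_up_pow (q : ℂ) {r : Fin 3 → BoseRep} (k : ℕ) :
    (up q 0 * dn q 1 * up q 2 : Op (cAAA r)) ^ k =
      mono k (-k) k (fun a _ d => boseE q k a * boseE q k d) := by
  rw [up_bose_eq_mono q rfl, up_bose_eq_mono q rfl, dn_bose_eq_mono q rfl,
    mono_mul_mono _ _ (by simp) (by simp) (by simp), mono_mul_mono _ _ (by simp) (by simp) (by simp),
    mono_pow]
  simp [boseE, Finset.prod_mul_distrib]

theorem matEl_lower_term (q : ℂ) {r : Fin 3 → BoseRep} (Rk : ℕ → State (cAAA r) → ℂ) (k : ℕ)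
    (n m : State (cAAA r)) [Decidable (m.1 0 = n.1 0 + k ∧ n.1 1 = m.1 1 + k ∧ m.1 2 = n.1 2 + k)] :
    matEl (diagOp (Rk k) * (dn q 0 * up q 1 * dn q 2) ^ k) n m =
      if m.1 0 = n.1 0 + k ∧ n.1 1 = m.1 1 + k ∧ m.1 2 = n.1 2 + k then
        boseE q k (m.1 1) * coefExt Rk k (n.1 0) (n.1 1) (n.1 2) else 0 := by
  rw [dn_up_dn_pow, diagOp_eq_mono_stExt, mono_mul_mono _ _ (by simp) (by simp) (by simp),
    matEl_mono]
  split_ifs with h h' h'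
  · rw [coefExt_of_adm, mul_comm]
    · congr 2 <;> omega
    · have := adm_state m
      convert this using 1 <;> omega
  · omega
  · omega
  · rfl

theorem matEl_upper_term (q : ℂ) {r : Fin 3 → BoseRep} (Rk : ℕ → State (cAAA r) → ℂ) (k : ℕ)
    (n m : State (cAAA r)) [Decidable (n.1 0 = m.1 0 + k ∧ m.1 1 = n.1 1 + k ∧ n.1 2 = m.1 2 + k)] :
    matEl ((up q 0 * dn q 1 * up q 2) ^ k * diagOp (Rk k)) n m =
      if n.1 0 = m.1 0 + k ∧ m.1 1 = n.1 1 + k ∧ n.1 2 = m.1 2 + k then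
        boseE q k (m.1 0) * boseE q k (m.1 2) * coefExt Rk k (m.1 0) (m.1 1) (m.1 2) else 0 := by
  rw [up_dn_up_pow, diagOp_eq_mono_stExt, mono_mul_mono _ _ (by simp) (by simp) (by simp),
    matEl_mono]
  split_ifs with h h' h'
  · rw [coefExt_of_adm]
    · simp
    · have := adm_state n
      convert this using 1 <;> omega
  · omega
  · omega
  · rfl

/-- Between two given states only the term with k equal to the absolute change of the first
occupation number can contribute, so the infinite series is one term. -/
theorem kernelAAA_eq_serKer (q : ℂ) {r : Fin 3 → BoseRep} (Rk : ℕ → State (cAAA r) → ℂ)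
    (n m : State (cAAA r)) : kernelAAA q r Rk n m =
      serKer q (coefExt Rk) (n.1 0) (n.1 1) (n.1 2) (m.1 0) (m.1 1) (m.1 2) := by
  classical
  have h0 := matEl_lower_term q Rk 0 n m
  rw [pow_zero, mul_one] at h0
  rw [kernelAAA, h0]
  simp only [matEl_lower_term, matEl_upper_term]
  by_cases hc : m.1 0 - n.1 0 = n.1 1 - m.1 1 ∧ m.1 0 - n.1 0 = m.1 2 - n.1 2
  · rcases lt_trichotomy (n.1 0) (m.1 0) with h | h | h
    · obtain ⟨k, hk⟩ := Int.lt.dest h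
      rw [serKer_lower q _ (k + 1) (by omega) (by omega) (by omega), if_neg (by omega), zero_add,
        tsum_eq_single k, if_pos (by omega), if_neg (by omega), add_zero]
      intro l hl
      rw [if_neg (by omega), if_neg (by omega), add_zero]
    · rw [serKer_lower q _ 0 (by omega) (by omega) (by omega), if_pos (by omega)]
      convert add_zero _
      convert tsum_zero with l
      rw [if_neg (by omega), if_neg (by omega), add_zero]
    · obtain ⟨k, hk⟩ := Int.lt.dest h
      rw [serKer_upper q _ (k + 1) (by omega) (by omega) (by omega), if_neg (by omega), zero_add,
        tsum_eq_single k, if_neg (by omega), if_pos (by omega), zero_add]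
      intro l hl
      rw [if_neg (by omega), if_neg (by omega), add_zero]
  · rw [serKer_eq_zero q _ hc, if_neg (by omega), zero_add]
    convert tsum_zero with l
    rw [if_neg (by omega), if_neg (by omega), add_zero]

theorem kerExt_kernelAAA (q : ℂ) {r : Fin 3 → BoseRep} (Rk : ℕ → State (cAAA r) → ℂ) :
    kerExt (kernelAAA q r Rk) = serKer q (coefExt Rk) := by
  funext a b d x y z
  by_cases h : Adm (cAAA r) a b d
  · by_cases h' : Adm (cAAA r) x y z
    · rw [kerExt_mkState _ h h', kernelAAA_eq_serKer]
      rfl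
    · rw [kerExt_of_not_right _ h', (coefSupp_coefExt Rk).serKer_eq_zero_right h']
  · rw [kerExt_of_not_left _ h, (coefSupp_coefExt Rk).serKer_eq_zero_left h]

/-! ### The operator series intertwines -/

theorem mem_of_mem_of_eq {S : Set ℤ} {x y : ℤ} (h : x ∈ S)
    (e : x = y := by push_cast; omega) : y ∈ S := e ▸ h

theorem boseE_succ_of_eq (q : ℂ) (k : ℕ) {x a : ℤ} (h : a = x + k + 1) :
    boseE q (k + 1) x = boseE q k x * (1 - q ^ (2 * a)) := by
  rw [boseE_succ, h]

section

variable {q : ℂ} {s₁ s₂ s₃ : BoseRep} {ρ : ℕ → ℤ → ℤ → ℤ → ℂ}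

/-- The relation for the middle entry is not read off from a generating function: it is obtained by
eliminating the coefficient at `(a + 1, b, d)` between the 01 relation and the mirror image of the
12 relation. -/
theorem CoefRels.r11 (hq : q ≠ 0) (h : CoefRels q s₁ s₂ s₃ ρ)
    (h' : CoefRels q s₃ s₂ s₁ (fun k a b d => ρ k d b a)) (k : ℕ) (a b d : ℤ)
    (ha : a ∈ (Osc.bose s₁).spectrum) (ha' : a + k + 1 ∈ (Osc.bose s₁).spectrum)
    (hb : b ∈ (Osc.bose s₂).spectrum) (hb' : b - 1 - k ∈ (Osc.bose s₂).spectrum)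
    (hd : d ∈ (Osc.bose s₃).spectrum) (hd' : d + k + 1 ∈ (Osc.bose s₃).spectrum) :
    ρ k (a + 1) (b - 1) (d + 1) - q ^ (1 + a + d) * (1 - q ^ (2 * ((k : ℤ) + 1))) * ρ (k + 1) a b d =
      (1 - q ^ (2 * (a + k + 2))) * (1 - q ^ (2 * (d + k + 2))) * (1 - q ^ (2 * (b - 1 - k))) *
        ρ (k + 2) a b d := by
  have h1 := h.r01p k (a + 1) b d (mem_bose_of_between ha ha' (by omega))
    (mem_of_mem_of_eq ha' (by ring)) hb hb' hd hd'
  have h2 : (1 - q ^ (2 * (a + k + 2))) * (q ^ (k + 1 + d) * ρ (k + 1) a b d +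
      q ^ (a + k + 2) * (1 - q ^ (2 * (b - 1 - k))) * (1 - q ^ (2 * (d + k + 2))) *
        ρ (k + 2) a b d) = (1 - q ^ (2 * (a + k + 2))) * (q ^ b * ρ (k + 1) (a + 1) b d) := by
    -- If `a + k + 2` is outside the spectrum, it equals 1 + 0 − 1 = 0 and the prefactor vanishes,
    -- so the mirrored relation is not needed.
    rcases bose_succ ha' with h3 | h3
    · congr 1
      have := h'.r12m (k + 1) d b a hd (mem_of_mem_of_eq hd' (by push_cast; ring)) hb
        (mem_of_mem_of_eq hb' (by push_cast; ring)) ha (mem_of_mem_of_eq h3)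
      push_cast at this
      rw [show a + (k + 1) + 1 = a + k + 2 by ring, show d + (k + 1) + 1 = d + k + 2 by ring,
        show b - (k + 1) = b - 1 - k by ring] at this
      exact this
    · rw [show a + k + 2 = a + k + 1 + 1 by ring, h3]; simp
  refine mul_left_cancel₀ (zpow_ne_zero (a + k + 2) hq) ?_
  rw [add_sub_cancel_right, show a + 1 + k + 1 = a + k + 2 by ring] at h1
  have e1 : q ^ (b - k - 1) * q ^ ((k : ℤ) + 1) = q ^ b := by rw [← zpow_add₀ hq]; ring_nf
  have e2 : q ^ d * q ^ ((k : ℤ) + 1) = q ^ (k + 1 + d) := by rw [← zpow_add₀ hq]; ring_nf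
  have e3 : q ^ (a + 1) * q ^ ((k : ℤ) + 1) = q ^ (a + k + 2) := by rw [← zpow_add₀ hq]; ring_nf
  have e4 : q ^ (a + k + 2) * q ^ (1 + a + d) = q ^ (k + 1 + d) * q ^ (2 * (a + 1)) := by
    rw [← zpow_add₀ hq, ← zpow_add₀ hq]; ring_nf
  have e5 : q ^ (2 * (a + k + 2)) = q ^ (2 * (a + 1)) * q ^ (2 * ((k : ℤ) + 1)) := by
    rw [← zpow_add₀ hq]; ring_nf
  have h3 : (1 - q ^ (2 * (a + 1))) * q ^ (k + 1 + d) * ρ (k + 1) a b d +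
      q ^ (a + k + 2) * ρ k (a + 1) (b - 1) (d + 1) =
      q ^ b * (1 - q ^ (2 * (a + k + 2))) * ρ (k + 1) (a + 1) b d := by
    rw [← e1, ← e2, ← e3]
    linear_combination q ^ ((k : ℤ) + 1) * h1
  linear_combination h3 - h2 - (1 - q ^ (2 * ((k : ℤ) + 1))) * ρ (k + 1) a b d * e4 -
    q ^ (k + 1 + d) * ρ (k + 1) a b d * e5

theorem CoefRels.r11' (hq : q ≠ 0) (h : CoefRels q s₁ s₂ s₃ ρ)
    (h' : CoefRels q s₃ s₂ s₁ (fun k a b d => ρ k d b a)) (k : ℕ) (a b d : ℤ)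
    (ha : a ∈ (Osc.bose s₁).spectrum) (ha' : a + k + 1 ∈ (Osc.bose s₁).spectrum)
    (hb : b ∈ (Osc.bose s₂).spectrum) (hb' : b - 1 - k ∈ (Osc.bose s₂).spectrum)
    (hd : d ∈ (Osc.bose s₃).spectrum) (hd' : d + k + 1 ∈ (Osc.bose s₃).spectrum) :
    ρ k a b d + q ^ (1 + a + d) * (1 - q ^ (2 * ((k : ℤ) + 1))) * ρ (k + 1) a b d =
      (1 - q ^ (2 * a)) * (1 - q ^ (2 * d)) * (1 - q ^ (2 * (b + 1))) *
        ρ (k + 2) (a - 1) (b + 1) (d - 1) := by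
  have h1 := h.r01m' k a b d ha (mem_bose_of_between ha ha' (by omega)) hb hb' hd hd'
  have h2 : (1 - q ^ (2 * a)) * (q ^ d * ρ (k + 1) a b d + q ^ (a - 1) * (1 - q ^ (2 * (b + 1))) *
      (1 - q ^ (2 * d)) * ρ (k + 2) (a - 1) (b + 1) (d - 1)) =
      (1 - q ^ (2 * a)) * (q ^ (b - 1 - k) * ρ (k + 1) (a - 1) b d) := by
    rcases bose_pred ha with h3 | h3
    · congr 1
      have := h'.r12p' (k + 1) d b (a - 1) hd (mem_of_mem_of_eq hd' (by push_cast; ring)) hb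
        (mem_of_mem_of_eq hb' (by push_cast; ring)) h3 (mem_of_mem_of_eq ha' (by push_cast; ring))
      rw [sub_add_cancel] at this
      rw [show b - 1 - (k : ℤ) = b - (k + 1 : ℕ) by push_cast; ring]
      exact this
    · rw [h3]; simp
  refine mul_left_cancel₀ (zpow_ne_zero (k + a) hq) ?_
  have e1 : q ^ (b - 1 - k) * q ^ ((k : ℤ) + 1) = q ^ b := by rw [← zpow_add₀ hq]; ring_nf
  have e2 : q ^ d * q ^ ((k : ℤ) + 1) = q ^ (d + k + 1) := by rw [← zpow_add₀ hq]; ring_nf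
  have e3 : q ^ (a - 1) * q ^ ((k : ℤ) + 1) = q ^ (k + a) := by rw [← zpow_add₀ hq]; ring_nf
  have e4 : q ^ (k + a) * q ^ (1 + a + d) = q ^ (d + k + 1) * q ^ (2 * a) := by
    rw [← zpow_add₀ hq, ← zpow_add₀ hq]; ring_nf
  have e5 : q ^ (2 * (a + k + 1)) = q ^ (2 * a) * q ^ (2 * ((k : ℤ) + 1)) := by
    rw [← zpow_add₀ hq]; ring_nf
  have h3 : (1 - q ^ (2 * a)) * (q ^ (d + k + 1) * ρ (k + 1) a b d + q ^ (k + a) *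
      (1 - q ^ (2 * (b + 1))) * (1 - q ^ (2 * d)) * ρ (k + 2) (a - 1) (b + 1) (d - 1)) =
      (1 - q ^ (2 * a)) * (q ^ b * ρ (k + 1) (a - 1) b d) := by
    rw [← e1, ← e2, ← e3]
    linear_combination q ^ ((k : ℤ) + 1) * h2
  linear_combination h1 - h3 + (1 - q ^ (2 * ((k : ℤ) + 1))) * ρ (k + 1) a b d * e4 +
    q ^ (d + k + 1) * ρ (k + 1) a b d * e5

variable (h : CoefRels q s₁ s₂ s₃ ρ) (h' : CoefRels q s₃ s₂ s₁ (fun k a b d => ρ k d b a))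
  {a b d x y z : ℤ} (ha : a ∈ (Osc.bose s₁).spectrum) (hb : b ∈ (Osc.bose s₂).spectrum)
  (hd : d ∈ (Osc.bose s₃).spectrum) (hx : x ∈ (Osc.bose s₁).spectrum)
  (hy : y ∈ (Osc.bose s₂).spectrum) (hz : z ∈ (Osc.bose s₃).spectrum)

include h ha hb hd hx hy hz

/-- Particle conservation leaves two cases according to the direction in which the first occupation
number moves. The lowering half is the relation `r02p` and the raising half is `r02m`; for the
transposed entry in `CoefRels.ser20` the two relations exchange their roles. -/
theorem CoefRels.ser02 :
    (1 - q ^ (2 * a)) * (1 - q ^ (2 * d)) * serKer q ρ (a - 1) b (d - 1) x y z -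
      q ^ (1 + a + d) * (1 - q ^ (2 * b)) * serKer q ρ a (b - 1) d x y z =
      (1 - q ^ (2 * (y + 1))) * serKer q ρ a b d x (y + 1) z := by
  by_cases hc : x - a = b - 1 - y ∧ x - a = z - d
  swap
  · rw [serKer_eq_zero q ρ (by omega), serKer_eq_zero q ρ (by omega), serKer_eq_zero q ρ (by omega)]
    ring
  rcases show a ≤ x ∨ x + 1 ≤ a by omega with h1 | h1
  · obtain ⟨k, hk⟩ := Int.le.dest h1
    rw [serKer_lower q ρ (k + 1),
      serKer_lower q ρ k,
      serKer_lower q ρ k]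
    have e1 := boseE_succ' q k y
    have e2 := boseE_succ_of_eq q k (x := y) (a := b) (by omega)
    have h2 := h.r02p k a b d ha (mem_of_mem_of_eq hx) hb (mem_of_mem_of_eq hy) hd (mem_of_mem_of_eq hz)
    linear_combination boseE q (k + 1) y * h2 + q ^ (1 + a + d) * ρ k a (b - 1) d * e2 +
      ρ k a b d * e1
  · obtain ⟨k, hk⟩ := Int.le.dest h1
    rw [serKer_upper q ρ k,
      serKer_upper q ρ (k + 1),
      serKer_upper q ρ (k + 1),
      boseE_succ_of_eq q k (x := x) (a := a) (by omega),
      boseE_succ_of_eq q k (x := z) (a := d) (by omega)]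
    have h2 := h.r02m k x y z hx (mem_of_mem_of_eq ha) hy (mem_of_mem_of_eq hb) hz (mem_of_mem_of_eq hd)
    rw [show 3 + x + z + 2 * (k : ℤ) = 1 + a + d by omega, show y - k = b by omega] at h2
    linear_combination boseE q k x * (1 - q ^ (2 * a)) * boseE q k z * (1 - q ^ (2 * d)) * h2

theorem CoefRels.ser20 :
    serKer q ρ a (b + 1) d x y z = -q ^ (1 + x + z) * serKer q ρ a b d x (y - 1) z +
      serKer q ρ a b d (x - 1) y (z - 1) := by
  by_cases hc : x - a = b + 1 - y ∧ x - a = z - d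
  swap
  · rw [serKer_eq_zero q ρ (by omega), serKer_eq_zero q ρ (by omega), serKer_eq_zero q ρ (by omega)]
    ring
  rcases show a + 1 ≤ x ∨ x ≤ a by omega with h1 | h1
  · obtain ⟨k, hk⟩ := Int.le.dest h1
    rw [serKer_lower q ρ (k + 1),
      serKer_lower q ρ (k + 1),
      serKer_lower q ρ k,
      boseE_succ_of_eq q k (x := y) (a := b + 1) (by omega),
      boseE_succ_sub]
    have h2 := h.r02m k a b d ha (mem_of_mem_of_eq hx) hb (mem_of_mem_of_eq hy) hd (mem_of_mem_of_eq hz)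
    rw [show 3 + a + d + 2 * (k : ℤ) = 1 + x + z by omega, show b - k = y by omega] at h2
    linear_combination -boseE q k y * h2
  · obtain ⟨k, hk⟩ := Int.le.dest h1
    rw [serKer_upper q ρ k,
      serKer_upper q ρ k,
      serKer_upper q ρ (k + 1),
      boseE_succ_sub,
      boseE_succ_sub]
    have h2 := h.r02p k x y z hx (mem_of_mem_of_eq ha) hy (mem_of_mem_of_eq hb) hz (mem_of_mem_of_eq hd)
    linear_combination -boseE q k x * boseE q k z * h2

theorem CoefRels.ser02' :
    serKer q ρ (a + 1) b (d + 1) x y z - q ^ (1 + a + d) * serKer q ρ a (b + 1) d x y z =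
      serKer q ρ a b d x (y - 1) z := by
  by_cases hc : x - a = b + 1 - y ∧ x - a = z - d
  swap
  · rw [serKer_eq_zero q ρ (by omega), serKer_eq_zero q ρ (by omega), serKer_eq_zero q ρ (by omega)]
    ring
  rcases show a + 1 ≤ x ∨ x ≤ a by omega with h1 | h1
  · obtain ⟨k, hk⟩ := Int.le.dest h1
    rw [serKer_lower q ρ k,
      serKer_lower q ρ (k + 1),
      serKer_lower q ρ (k + 1),
      boseE_succ_of_eq q k (x := y) (a := b + 1) (by omega),
      boseE_succ_sub]
    have h2 := h.r02p' k a b d ha (mem_of_mem_of_eq hx) hb (mem_of_mem_of_eq hy) hd (mem_of_mem_of_eq hz)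
    rw [show b - k = y by omega] at h2
    linear_combination boseE q k y * h2
  · obtain ⟨k, hk⟩ := Int.le.dest h1
    rw [serKer_upper q ρ (k + 1),
      serKer_upper q ρ k,
      serKer_upper q ρ k,
      boseE_succ_of_eq q k (x := x) (a := x + k + 1) rfl,
      boseE_succ_of_eq q k (x := z) (a := z + k + 1) rfl]
    have h2 := h.r02m' k x y z hx (mem_of_mem_of_eq ha) hy (mem_of_mem_of_eq hb) hz (mem_of_mem_of_eq hd)
    rw [show 1 + x + z + 2 * (k : ℤ) = 1 + a + d by omega] at h2
    linear_combination boseE q k x * boseE q k z * h2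

theorem CoefRels.ser20' :
    (1 - q ^ (2 * b)) * serKer q ρ a (b - 1) d x y z =
      -q ^ (1 + x + z) * (1 - q ^ (2 * (y + 1))) * serKer q ρ a b d x (y + 1) z +
      (1 - q ^ (2 * (x + 1))) * (1 - q ^ (2 * (z + 1))) * serKer q ρ a b d (x + 1) y (z + 1) := by
  by_cases hc : x - a = b - 1 - y ∧ x - a = z - d
  swap
  · rw [serKer_eq_zero q ρ (by omega), serKer_eq_zero q ρ (by omega), serKer_eq_zero q ρ (by omega)]
    ring
  rcases show a ≤ x ∨ x + 1 ≤ a by omega with h1 | h1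
  · obtain ⟨k, hk⟩ := Int.le.dest h1
    rw [serKer_lower q ρ k,
      serKer_lower q ρ k,
      serKer_lower q ρ (k + 1)]
    have e1 := boseE_succ' q k y
    have e2 := boseE_succ_of_eq q k (x := y) (a := b) (by omega)
    have h2 := h.r02m' k a b d ha (mem_of_mem_of_eq hx) hb (mem_of_mem_of_eq hy) hd (mem_of_mem_of_eq hz)
    rw [show 1 + a + d + 2 * (k : ℤ) = 1 + x + z by omega, show a + k + 1 = x + 1 by omega,
      show d + k + 1 = z + 1 by omega] at h2
    linear_combination -boseE q (k + 1) y * h2 - ρ k a (b - 1) d * e2 - q ^ (1 + x + z) * ρ k a b d * e1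
  · obtain ⟨k, hk⟩ := Int.le.dest h1
    rw [serKer_upper q ρ (k + 1),
      serKer_upper q ρ (k + 1),
      serKer_upper q ρ k,
      boseE_succ' q k x,
      boseE_succ' q k z]
    have h2 := h.r02p' k x y z hx (mem_of_mem_of_eq ha) hy (mem_of_mem_of_eq hb) hz (mem_of_mem_of_eq hd)
    rw [show y - k = b by omega] at h2
    linear_combination -(1 - q ^ (2 * (x + 1))) * boseE q k (x + 1) * ((1 - q ^ (2 * (z + 1))) *
      boseE q k (z + 1)) * h2

include h'

/-- The lowering half uses the 01 relation, the raising half the mirror image of the 12 relation;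
this is why the coefficients are required to satisfy the relations in both orders of the outer
sites. -/
theorem CoefRels.ser01 :
    (1 - q ^ (2 * a)) * q ^ d * serKer q ρ (a - 1) b d x y z +
      q ^ a * (1 - q ^ (2 * b)) * serKer q ρ a (b - 1) (d + 1) x y z =
      q ^ y * (1 - q ^ (2 * (x + 1))) * serKer q ρ a b d (x + 1) y z := by
  by_cases hc : x - (a - 1) = b - y ∧ x - (a - 1) = z - d
  swap
  · rw [serKer_eq_zero q ρ (by omega), serKer_eq_zero q ρ (by omega), serKer_eq_zero q ρ (by omega)]
    ring
  rcases show a ≤ x ∨ x + 1 ≤ a by omega with h1 | h1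
  · obtain ⟨k, hk⟩ := Int.le.dest h1
    rw [serKer_lower q ρ (k + 1),
      serKer_lower q ρ k,
      serKer_lower q ρ (k + 1),
      boseE_succ_of_eq q k (x := y) (a := b) (by omega)]
    have h2 := h.r01p k a b d ha (mem_of_mem_of_eq hx) hb (mem_of_mem_of_eq hy) hd (mem_of_mem_of_eq hz)
    rw [show b - (k : ℤ) - 1 = y by omega, show a + k + 1 = x + 1 by omega] at h2
    linear_combination boseE q k y * (1 - q ^ (2 * b)) * h2
  · obtain ⟨k, hk⟩ := Int.le.dest h1
    rw [serKer_upper q ρ k,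
      serKer_upper q ρ (k + 1),
      serKer_upper q ρ k,
      boseE_succ_of_eq q k (x := z) (a := z + k + 1) rfl]
    have e1 := boseE_succ' q k x
    have e2 := boseE_succ_of_eq q k (x := x) (a := a) (by omega)
    have h2 := h'.r12m k z y x hz (mem_of_mem_of_eq hd) hy (mem_of_mem_of_eq hb) hx (mem_of_mem_of_eq ha)
    rw [show x + k + 1 = a by omega, show (k : ℤ) + z = d by omega, show y - k = b by omega] at h2
    linear_combination boseE q (k + 1) x * boseE q k z * h2 - q ^ d * ρ k x y z * boseE q k z * e2 +
      q ^ y * ρ k (x + 1) y z * boseE q k z * e1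

theorem CoefRels.ser10 :
    q ^ b * serKer q ρ (a + 1) b d x y z =
      q ^ x * (1 - q ^ (2 * (z + 1))) * serKer q ρ a b d x (y - 1) (z + 1) +
      q ^ z * serKer q ρ a b d (x - 1) y z := by
  by_cases hc : x - (a + 1) = b - y ∧ x - (a + 1) = z - d
  swap
  · rw [serKer_eq_zero q ρ (by omega), serKer_eq_zero q ρ (by omega), serKer_eq_zero q ρ (by omega)]
    ring
  rcases show a + 1 ≤ x ∨ x ≤ a by omega with h1 | h1
  · obtain ⟨k, hk⟩ := Int.le.dest h1
    rw [serKer_lower q ρ k,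
      serKer_lower q ρ (k + 1),
      serKer_lower q ρ k,
      boseE_succ_sub]
    have h2 := h'.r12m k d b a hd (mem_of_mem_of_eq hz) hb (mem_of_mem_of_eq hy) ha (mem_of_mem_of_eq hx)
    rw [show a + k + 1 = x by omega, show (k : ℤ) + d = z by omega, show b - k = y by omega,
      show d + k + 1 = z + 1 by omega] at h2
    linear_combination -boseE q k y * h2
  · obtain ⟨k, hk⟩ := Int.le.dest h1
    rw [serKer_upper q ρ (k + 1),
      serKer_upper q ρ k,
      serKer_upper q ρ (k + 1),
      boseE_succ_sub,
      boseE_succ_of_eq q k (x := x) (a := a + 1) (by omega),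
      boseE_succ' q k z]
    have h2 := h.r01p k x y z hx (mem_of_mem_of_eq ha) hy (mem_of_mem_of_eq hb) hz (mem_of_mem_of_eq hd)
    rw [show y - (k : ℤ) - 1 = b by omega, show x + k + 1 = a + 1 by omega] at h2
    linear_combination -boseE q k x * ((1 - q ^ (2 * (z + 1))) * boseE q k (z + 1)) * h2

theorem CoefRels.ser01' :
    q ^ d * serKer q ρ (a + 1) b d x y z + q ^ a * (1 - q ^ (2 * d)) *
      serKer q ρ a (b + 1) (d - 1) x y z = q ^ y * serKer q ρ a b d (x - 1) y z := by
  by_cases hc : x - (a + 1) = b - y ∧ x - (a + 1) = z - d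
  swap
  · rw [serKer_eq_zero q ρ (by omega), serKer_eq_zero q ρ (by omega), serKer_eq_zero q ρ (by omega)]
    ring
  rcases show a + 1 ≤ x ∨ x ≤ a by omega with h1 | h1
  · obtain ⟨k, hk⟩ := Int.le.dest h1
    rw [serKer_lower q ρ k,
      serKer_lower q ρ (k + 1),
      serKer_lower q ρ k,
      boseE_succ_of_eq q k (x := y) (a := b + 1) (by omega)]
    have h2 := h'.r12p' k d b a hd (mem_of_mem_of_eq hz) hb (mem_of_mem_of_eq hy) ha (mem_of_mem_of_eq hx)
    rw [show b - k = y by omega] at h2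
    linear_combination boseE q k y * h2
  · obtain ⟨k, hk⟩ := Int.le.dest h1
    rw [serKer_upper q ρ (k + 1),
      serKer_upper q ρ k,
      serKer_upper q ρ (k + 1),
      boseE_succ_sub,
      boseE_succ_of_eq q k (x := x) (a := x + k + 1) rfl,
      boseE_succ_of_eq q k (x := z) (a := d) (by omega)]
    have h2 := h.r01m' k x y z hx (mem_of_mem_of_eq ha) hy (mem_of_mem_of_eq hb) hz (mem_of_mem_of_eq hd)
    rw [show z + (k : ℤ) + 1 = d by omega, show (k : ℤ) + x = a by omega] at h2
    linear_combination boseE q k x * (boseE q k z * (1 - q ^ (2 * d))) * h2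

theorem CoefRels.ser10' :
    (1 - q ^ (2 * a)) * q ^ b * serKer q ρ (a - 1) b d x y z =
      q ^ x * (1 - q ^ (2 * (y + 1))) * serKer q ρ a b d x (y + 1) (z - 1) +
      q ^ z * (1 - q ^ (2 * (x + 1))) * serKer q ρ a b d (x + 1) y z := by
  by_cases hc : x - (a - 1) = b - y ∧ x - (a - 1) = z - d
  swap
  · rw [serKer_eq_zero q ρ (by omega), serKer_eq_zero q ρ (by omega), serKer_eq_zero q ρ (by omega)]
    ring
  rcases show a ≤ x ∨ x + 1 ≤ a by omega with h1 | h1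
  · obtain ⟨k, hk⟩ := Int.le.dest h1
    rw [serKer_lower q ρ (k + 1),
      serKer_lower q ρ k,
      serKer_lower q ρ (k + 1),
      boseE_succ' q k y]
    have h2 := h.r01m' k a b d ha (mem_of_mem_of_eq hx) hb (mem_of_mem_of_eq hy) hd (mem_of_mem_of_eq hz)
    rw [show d + (k : ℤ) + 1 = z by omega, show a + k + 1 = x + 1 by omega,
      show (k : ℤ) + a = x by omega] at h2
    linear_combination -(1 - q ^ (2 * (y + 1))) * boseE q k (y + 1) * h2
  · obtain ⟨k, hk⟩ := Int.le.dest h1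
    rw [serKer_upper q ρ k,
      serKer_upper q ρ (k + 1),
      serKer_upper q ρ k,
      boseE_succ_sub]
    have e1 := boseE_succ' q k x
    have e2 := boseE_succ_of_eq q k (x := x) (a := a) (by omega)
    have h2 := h'.r12p' k z y x hz (mem_of_mem_of_eq hd) hy (mem_of_mem_of_eq hb) hx (mem_of_mem_of_eq ha)
    rw [show y - k = b by omega] at h2
    linear_combination -boseE q (k + 1) x * boseE q k z * h2 - q ^ b * ρ k x y z * boseE q k z * e2 +
      q ^ z * ρ k (x + 1) y z * boseE q k z * e1

theorem CoefRels.ser11 (hq : q ≠ 0) :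
    -q ^ (1 + a + d) * serKer q ρ a b d x y z +
      (1 - q ^ (2 * b)) * serKer q ρ (a + 1) (b - 1) (d + 1) x y z =
      (1 - q ^ (2 * (z + 1))) * (1 - q ^ (2 * (x + 1))) *
        serKer q ρ a b d (x + 1) (y - 1) (z + 1) - q ^ (1 + x + z) * serKer q ρ a b d x y z := by
  by_cases hc : x - a = b - y ∧ x - a = z - d
  swap
  · rw [serKer_eq_zero q ρ (by omega), serKer_eq_zero q ρ (by omega), serKer_eq_zero q ρ (by omega)]
    ring
  rcases lt_trichotomy a x with h1 | h1 | h1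
  · obtain ⟨k, hk⟩ := Int.lt.dest h1
    push_cast at hk
    rw [serKer_lower q ρ (k + 1),
      serKer_lower q ρ k,
      serKer_lower q ρ (k + 1 + 1),
      boseE_succ_sub,
      boseE_succ_of_eq q k (x := y) (a := b) (by omega)]
    have h2 := h.r11 hq h' k a b d ha (mem_of_mem_of_eq hx) hb (mem_of_mem_of_eq hy) hd (mem_of_mem_of_eq hz)
    rw [show a + k + 2 = x + 1 by omega, show d + k + 2 = z + 1 by omega, show b - 1 - k = y by omega] at h2
    have e : q ^ (1 + x + z) = q ^ (1 + a + d) * q ^ (2 * ((k : ℤ) + 1)) := by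
      rw [← zpow_add₀ hq]; congr 1; omega
    rw [e]
    linear_combination boseE q k y * (1 - q ^ (2 * b)) * h2
  -- On the diagonal the shifted elements involve k = 1 in opposite directions. Both reduce to the
  -- same multiple of the same coefficient, so no relation between coefficients is used.
  · obtain rfl : x = a := by omega
    obtain rfl : y = b := by omega
    obtain rfl : z = d := by omega
    rw [serKer_upper q ρ 1 (a := x + 1) (by simp) (by simp) (by simp),
      serKer_lower q ρ 1 (x := x + 1) (by simp) (by simp) (by simp)]
    simp only [boseE, Finset.prod_range_one, Nat.cast_zero, add_zero]
    rw [show 2 * (y - 1) + 2 = 2 * y by ring, show 2 * x + 2 = 2 * (x + 1) by ring,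
      show 2 * z + 2 = 2 * (z + 1) by ring]
    ring
  · obtain ⟨k, hk⟩ := Int.lt.dest h1
    push_cast at hk
    rw [serKer_upper q ρ (k + 1),
      serKer_upper q ρ (k + 1 + 1),
      serKer_upper q ρ k,
      boseE_succ_of_eq q (k + 1) (x := x) (a := a + 1) (by push_cast; omega),
      boseE_succ_of_eq q (k + 1) (x := z) (a := d + 1) (by push_cast; omega),
      boseE_succ' q k x,
      boseE_succ' q k z]
    have h2 := h.r11 hq h' k x y z hx (mem_of_mem_of_eq ha) hy (mem_of_mem_of_eq hb) hz (mem_of_mem_of_eq hd)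
    rw [show x + k + 2 = a + 1 by omega, show z + k + 2 = d + 1 by omega, show y - 1 - k = b by omega] at h2
    have e : q ^ (1 + a + d) = q ^ (1 + x + z) * q ^ (2 * ((k : ℤ) + 1)) := by
      rw [← zpow_add₀ hq]; congr 1; omega
    rw [e]
    linear_combination -((1 - q ^ (2 * (x + 1))) * boseE q k (x + 1)) *
      ((1 - q ^ (2 * (z + 1))) * boseE q k (z + 1)) * h2

theorem CoefRels.ser11' (hq : q ≠ 0) :
    -q ^ (1 + a + d) * serKer q ρ a b d x y z +
      (1 - q ^ (2 * a)) * (1 - q ^ (2 * d)) * serKer q ρ (a - 1) (b + 1) (d - 1) x y z =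
      (1 - q ^ (2 * (y + 1))) * serKer q ρ a b d (x - 1) (y + 1) (z - 1) -
        q ^ (1 + x + z) * serKer q ρ a b d x y z := by
  by_cases hc : x - a = b - y ∧ x - a = z - d
  swap
  · rw [serKer_eq_zero q ρ (by omega), serKer_eq_zero q ρ (by omega), serKer_eq_zero q ρ (by omega)]
    ring
  rcases lt_trichotomy a x with h1 | h1 | h1
  · obtain ⟨k, hk⟩ := Int.lt.dest h1
    push_cast at hk
    rw [serKer_lower q ρ (k + 1),
      serKer_lower q ρ (k + 1 + 1),
      serKer_lower q ρ k,
      boseE_succ_of_eq q (k + 1) (x := y) (a := b + 1) (by push_cast; omega),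
      boseE_succ' q k y]
    have h2 := h.r11' hq h' k a b d ha (mem_of_mem_of_eq hx) hb (mem_of_mem_of_eq hy) hd (mem_of_mem_of_eq hz)
    have e : q ^ (1 + x + z) = q ^ (1 + a + d) * q ^ (2 * ((k : ℤ) + 1)) := by
      rw [← zpow_add₀ hq]; congr 1; omega
    rw [e]
    linear_combination -((1 - q ^ (2 * (y + 1))) * boseE q k (y + 1)) * h2
  · obtain rfl : x = a := by omega
    obtain rfl : y = b := by omega
    obtain rfl : z = d := by omega
    rw [serKer_lower q ρ 1 (a := x - 1) (by simp) (by simp) (by simp),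
      serKer_upper q ρ 1 (x := x - 1) (by simp) (by simp) (by simp)]
    simp only [boseE, Finset.prod_range_one, Nat.cast_zero, add_zero]
    rw [show 2 * (x - 1) + 2 = 2 * x by ring, show 2 * (z - 1) + 2 = 2 * z by ring,
      show 2 * y + 2 = 2 * (y + 1) by ring]
    ring
  · obtain ⟨k, hk⟩ := Int.lt.dest h1
    push_cast at hk
    rw [serKer_upper q ρ (k + 1),
      serKer_upper q ρ k,
      serKer_upper q ρ (k + 1 + 1),
      boseE_succ_sub,
      boseE_succ_sub,
      boseE_succ_of_eq q k (x := x) (a := a) (by omega),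
      boseE_succ_of_eq q k (x := z) (a := d) (by omega)]
    have h2 := h.r11' hq h' k x y z hx (mem_of_mem_of_eq ha) hy (mem_of_mem_of_eq hb) hz (mem_of_mem_of_eq hd)
    have e : q ^ (1 + a + d) = q ^ (1 + x + z) * q ^ (2 * ((k : ℤ) + 1)) := by
      rw [← zpow_add₀ hq]; congr 1; omega
    rw [e]
    linear_combination boseE q k x * (1 - q ^ (2 * a)) * (boseE q k z * (1 - q ^ (2 * d))) * h2

end

theorem serKer_conserves {q : ℂ} {ρ : ℕ → ℤ → ℤ → ℤ → ℂ} {a b d x y z : ℤ}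
    (h : serKer q ρ a b d x y z ≠ 0) : x - a = b - y ∧ x - a = z - d := by
  by_contra h'
  exact h (serKer_eq_zero q ρ h')

section

variable {q : ℂ} {r : Fin 3 → BoseRep} {ρ : ℕ → ℤ → ℤ → ℤ → ℂ}

/-- The corner entries 00 and 22 express conservation of N₁+N₂ and N₂+N₃. The entries 12 and 21 are
the entries 01 and 10 of the mirror image. -/
theorem rels_bose_of_coefRels (hq : q ≠ 0) (h : CoefRels q (r 0) (r 1) (r 2) ρ)
    (h' : CoefRels q (r 2) (r 1) (r 0) (fun k a b d => ρ k d b a)) :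
    Rels (.bose q 0) (.bose q 1) (.bose q 2) (Adm (cAAA r)) (serKer q ρ) := by
  have t3 : ∀ n : ℤ, 2 * n + 2 = 2 * (n + 1) := fun n => by ring
  have t4 : ∀ a d : ℤ, q ^ (1 + a + d) = q * q ^ a * q ^ d := fun a d => by
    rw [zpow_add₀ hq, zpow_add₀ hq, zpow_one]
  constructor <;> intro a b d x y z hn hm <;>
    simp only [LData.bose, sel_zero, sel_one, sel_two, t3, sub_add_cancel]
  · rcases eq_or_ne (serKer q ρ a b d x y z) 0 with h0 | h0
    · rw [h0]; ring
    · have := serKer_conserves h0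
      rw [← zpow_add₀ hq, ← zpow_add₀ hq, show a + b = y + x by omega]
  · have := h.ser01 h' hn.1 hn.2.1 hn.2.2 hm.1 hm.2.1 hm.2.2
    linear_combination this
  · have := h.ser02 hn.1 hn.2.1 hn.2.2 hm.1 hm.2.1 hm.2.2
    rw [t4] at this
    linear_combination this
  · have := h.ser10 h' hn.1 hn.2.1 hn.2.2 hm.1 hm.2.1 hm.2.2
    linear_combination this
  · have := h.ser11 h' hn.1 hn.2.1 hn.2.2 hm.1 hm.2.1 hm.2.2 hq
    rw [t4, t4] at this
    linear_combination this
  · have := h'.ser01 h hn.2.2 hn.2.1 hn.1 hm.2.2 hm.2.1 hm.1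
    simp only [serKer_swap] at this
    linear_combination -q * this
  · have := h.ser20 hn.1 hn.2.1 hn.2.2 hm.1 hm.2.1 hm.2.2
    rw [t4] at this
    linear_combination this
  · have := h'.ser10 h hn.2.2 hn.2.1 hn.1 hm.2.2 hm.2.1 hm.1
    simp only [serKer_swap] at this
    linear_combination -q * this
  · rcases eq_or_ne (serKer q ρ a b d x y z) 0 with h0 | h0
    · rw [h0]; ring
    · have := serKer_conserves h0
      have e : q ^ b * q ^ d = q ^ z * q ^ y := by
        rw [← zpow_add₀ hq, ← zpow_add₀ hq, show b + d = z + y by omega]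
      linear_combination q * q * serKer q ρ a b d x y z * e

theorem rels_boseInv_of_coefRels (hq : q ≠ 0) (h : CoefRels q (r 0) (r 1) (r 2) ρ)
    (h' : CoefRels q (r 2) (r 1) (r 0) (fun k a b d => ρ k d b a)) :
    Rels (.boseInv q 0) (.boseInv q 1) (.boseInv q 2) (Adm (cAAA r)) (serKer q ρ) := by
  have t2 : ∀ n : ℤ, 2 * (n - 1) + 2 = 2 * n := fun n => by ring
  have t3 : ∀ n : ℤ, 2 * n + 2 = 2 * (n + 1) := fun n => by ring
  have t4 : ∀ a d : ℤ, q ^ (1 + a + d) = q * q ^ a * q ^ d := fun a d => by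
    rw [zpow_add₀ hq, zpow_add₀ hq, zpow_one]
  constructor <;> intro a b d x y z hn hm <;>
    simp only [LData.boseInv, sel_zero, sel_one, sel_two, sub_neg_eq_add, ← sub_eq_add_neg, t2, t3,
      add_sub_cancel_right, sub_add_cancel]
  · rcases eq_or_ne (serKer q ρ a b d x y z) 0 with h0 | h0
    · rw [h0]; ring
    · have := serKer_conserves h0
      have e : q ^ a * q ^ b = q ^ y * q ^ x := by
        rw [← zpow_add₀ hq, ← zpow_add₀ hq, show a + b = y + x by omega]
      linear_combination q * q * serKer q ρ a b d x y z * e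
  · have := h.ser01' h' hn.1 hn.2.1 hn.2.2 hm.1 hm.2.1 hm.2.2
    linear_combination q * this
  · have := h.ser02' hn.1 hn.2.1 hn.2.2 hm.1 hm.2.1 hm.2.2
    rw [t4] at this
    linear_combination this
  · have := h.ser10' h' hn.1 hn.2.1 hn.2.2 hm.1 hm.2.1 hm.2.2
    linear_combination q * this
  · have := h.ser11' h' hn.1 hn.2.1 hn.2.2 hm.1 hm.2.1 hm.2.2 hq
    rw [t4, t4] at this
    linear_combination this
  · have := h'.ser01' h hn.2.2 hn.2.1 hn.1 hm.2.2 hm.2.1 hm.1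
    simp only [serKer_swap] at this
    linear_combination -this
  · have := h.ser20' hn.1 hn.2.1 hn.2.2 hm.1 hm.2.1 hm.2.2
    rw [t4] at this
    linear_combination this
  · have := h'.ser10' h hn.2.2 hn.2.1 hn.1 hm.2.2 hm.2.1 hm.1
    simp only [serKer_swap] at this
    linear_combination -this
  · rcases eq_or_ne (serKer q ρ a b d x y z) 0 with h0 | h0
    · rw [h0]; ring
    · have := serKer_conserves h0
      have e : q ^ b * q ^ d = q ^ z * q ^ y := by
        rw [← zpow_add₀ hq, ← zpow_add₀ hq, show b + d = z + y by omega]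
      linear_combination serKer q ρ a b d x y z * e

end

/-! ### Equivalence of the generating functions -/

/-- The occupation number of the vacuum. -/
def _root_.BoseRep.vac : BoseRep → ℤ
  | .fock => 0
  | .antiFock => -1

/-- The occupation numbers in the order of their distance from the vacuum. -/
def _root_.BoseRep.level : BoseRep → ℕ → ℤ
  | .fock, m => m
  | .antiFock, m => -1 - m

theorem vac_mem (s : BoseRep) : s.vac ∈ (Osc.bose s).spectrum := by
  cases s
  · exact le_refl (0 : ℤ)
  · exact (by decide : (-1 : ℤ) < 0)

/-- The relations common to the generating functions for all three traces. -/
structure MidRels (q : ℂ) (s₁ s₂ s₃ : BoseRep) (ρ : ℕ → ℤ → ℤ → ℤ → ℂ) : Prop where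
  r02p : ∀ (k : ℕ) (a b d : ℤ), a ∈ (Osc.bose s₁).spectrum → a + k ∈ (Osc.bose s₁).spectrum →
    b ∈ (Osc.bose s₂).spectrum → b - 1 - k ∈ (Osc.bose s₂).spectrum →
    d ∈ (Osc.bose s₃).spectrum → d + k ∈ (Osc.bose s₃).spectrum →
    (1 - q ^ (2 * a)) * (1 - q ^ (2 * d)) * ρ (k + 1) (a - 1) b (d - 1) -
      q ^ (1 + a + d) * ρ k a (b - 1) d = ρ k a b d
  r02m : ∀ (k : ℕ) (a b d : ℤ), a ∈ (Osc.bose s₁).spectrum → a + k + 1 ∈ (Osc.bose s₁).spectrum →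
    b ∈ (Osc.bose s₂).spectrum → b - k ∈ (Osc.bose s₂).spectrum →
    d ∈ (Osc.bose s₃).spectrum → d + k + 1 ∈ (Osc.bose s₃).spectrum →
    ρ k a b d - q ^ (3 + a + d + 2 * k) * (1 - q ^ (2 * (b - k))) * ρ (k + 1) a b d =
      (1 - q ^ (2 * (b + 1))) * ρ (k + 1) a (b + 1) d

theorem CoefRels.midRels {q : ℂ} {s₁ s₂ s₃ : BoseRep} {ρ : ℕ → ℤ → ℤ → ℤ → ℂ}
    (h : CoefRels q s₁ s₂ s₃ ρ) : MidRels q s₁ s₂ s₃ ρ := ⟨h.r02p, h.r02m⟩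

theorem MidRels.smul {q : ℂ} {s₁ s₂ s₃ : BoseRep} {ρ : ℕ → ℤ → ℤ → ℤ → ℂ}
    (h : MidRels q s₁ s₂ s₃ ρ) (t : ℂ) : MidRels q s₁ s₂ s₃ (fun k a b d => t * ρ k a b d) :=
  ⟨fun k a b d h1 h2 h3 h4 h5 h6 => by linear_combination t * h.r02p k a b d h1 h2 h3 h4 h5 h6,
    fun k a b d h1 h2 h3 h4 h5 h6 => by linear_combination t * h.r02m k a b d h1 h2 h3 h4 h5 h6⟩

theorem MidRels.swap {q : ℂ} {s₁ s₂ s₃ : BoseRep} {ρ : ℕ → ℤ → ℤ → ℤ → ℂ}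
    (h : MidRels q s₁ s₂ s₃ ρ) : MidRels q s₃ s₂ s₁ (fun k a b d => ρ k d b a) :=
  ⟨fun k a b d h1 h2 h3 h4 h5 h6 => by
    rw [show 1 + a + d = 1 + d + a by ring]
    linear_combination h.r02p k d b a h5 h6 h3 h4 h1 h2,
    fun k a b d h1 h2 h3 h4 h5 h6 => by
    rw [show 3 + a + d + 2 * (k : ℤ) = 3 + d + a + 2 * k by ring]
    linear_combination h.r02m k d b a h5 h6 h3 h4 h1 h2⟩

/-- The two relations determine all coefficients by induction on the distance of the second
occupation number from its vacuum. Passing to a larger distance uses `r02m` and `r02p` in Fock space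
and only `r02p` in the anti-Fock space; at the vacuum itself the anti-Fock case needs `r02m` to
reach positive k. -/
theorem MidRels.ext {q : ℂ} (hq0 : 0 < ‖q‖) (hq1 : ‖q‖ < 1) {s₁ s₂ s₃ : BoseRep}
    {ρ ρ' : ℕ → ℤ → ℤ → ℤ → ℂ} (hs : CoefSupp s₁ s₂ s₃ ρ) (hs' : CoefSupp s₁ s₂ s₃ ρ')
    (h : MidRels q s₁ s₂ s₃ ρ) (h' : MidRels q s₁ s₂ s₃ ρ')
    (hn : ∀ a d, a ∈ (Osc.bose s₁).spectrum → d ∈ (Osc.bose s₃).spectrum →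
      ρ 0 a s₂.vac d = ρ' 0 a s₂.vac d) : ρ = ρ' := by
  have hq := norm_pos_iff.1 hq0
  suffices H : ∀ (m : ℕ) (k : ℕ) (a d : ℤ), ∀ b, b = s₂.level m → ρ k a b d = ρ' k a b d by
    funext k a b d
    by_cases hb : b ∈ (Osc.bose s₂).spectrum
    · cases s₂ with
      | fock =>
        have : 0 ≤ b := hb
        exact H b.toNat k a d b (by simp only [BoseRep.level]; omega)
      | antiFock =>
        have : b < 0 := hb
        exact H (-1 - b).toNat k a d b (by simp only [BoseRep.level]; omega)
    · rw [hs k a b d fun h => hb h.2.1.1, hs' k a b d fun h => hb h.2.1.1]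
  intro m
  induction m with
  | zero =>
    intro k
    induction k with
    | zero =>
      intro a d b hb
      by_cases hr : a ∈ (Osc.bose s₁).spectrum ∧ d ∈ (Osc.bose s₃).spectrum
      · have := hn a d hr.1 hr.2
        cases s₂ <;> simpa [BoseRep.vac, BoseRep.level, hb] using this
      · rw [hs 0 a b d fun h => hr ⟨h.1.1, h.2.2.1⟩, hs' 0 a b d fun h => hr ⟨h.1.1, h.2.2.1⟩]
    | succ k ih =>
      intro a d b hb
      by_cases hr : (a ∈ (Osc.bose s₁).spectrum ∧ a + (k + 1 : ℕ) ∈ (Osc.bose s₁).spectrum) ∧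
        (b ∈ (Osc.bose s₂).spectrum ∧ b - (k + 1 : ℕ) ∈ (Osc.bose s₂).spectrum) ∧
        (d ∈ (Osc.bose s₃).spectrum ∧ d + (k + 1 : ℕ) ∈ (Osc.bose s₃).spectrum)
      · obtain ⟨⟨h1, h2⟩, ⟨h3, h4⟩, h5, h6⟩ := hr
        cases s₂ with
        | fock =>
          -- At the Fock vacuum the second site cannot be lowered, so only `k = 0` occurs.
          have : (0 : ℤ) ≤ b - (k + 1 : ℕ) := h4
          simp only [BoseRep.level, Nat.cast_zero] at hb
          push_cast at this
          omega
        | antiFock =>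
          simp only [BoseRep.level, Nat.cast_zero, sub_zero] at hb
          subst hb
          have h7 : (-1 - k : ℤ) ∈ (Osc.bose .antiFock).spectrum :=
            mem_bose_of_between h3 h4 (by push_cast; omega)
          -- At `b = -1` the factor 1 − q^(2(b+1)) on the right vanishes, and the relation expresses
          -- the coefficient for `k + 1` through that for `k`.
          have e1 := h.r02m k a (-1) d h1 (mem_of_mem_of_eq h2 (by push_cast; ring)) h3 h7 h5
            (mem_of_mem_of_eq h6 (by push_cast; ring))
          have e2 := h'.r02m k a (-1) d h1 (mem_of_mem_of_eq h2 (by push_cast; ring)) h3 h7 h5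
            (mem_of_mem_of_eq h6 (by push_cast; ring))
          rw [neg_add_cancel, mul_zero, zpow_zero, sub_self, zero_mul] at e1 e2
          have e3 := ih a d (-1) (by simp [BoseRep.level])
          have n1 : q ^ (3 + a + d + 2 * k) * (1 - q ^ (2 * (-1 - k : ℤ))) ≠ 0 :=
            mul_ne_zero (zpow_ne_zero _ hq) (one_sub_zpow_ne_zero hq0 hq1 (by omega))
          refine mul_left_cancel₀ n1 ?_
          linear_combination e3 - e1 + e2
      · rw [hs _ _ _ _ hr, hs' _ _ _ _ hr]
  | succ m ih =>
    cases s₂ with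
    | fock =>
      -- `r02m` expresses the coefficients with positive index at level `m + 1` through level `m`.
      -- The one with index 0 is out of its reach and is obtained afterwards from `r02p`, in terms
      -- of index 1 at the same level.
      have hsucc : ∀ (k : ℕ) (a d : ℤ), ρ (k + 1) a (m + 1) d = ρ' (k + 1) a (m + 1) d := by
        intro k a d
        by_cases hr : (a ∈ (Osc.bose s₁).spectrum ∧ a + (k + 1 : ℕ) ∈ (Osc.bose s₁).spectrum) ∧
          ((m : ℤ) + 1 ∈ (Osc.bose .fock).spectrum ∧ (m : ℤ) + 1 - (k + 1 : ℕ) ∈ (Osc.bose .fock).spectrum) ∧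
          (d ∈ (Osc.bose s₃).spectrum ∧ d + (k + 1 : ℕ) ∈ (Osc.bose s₃).spectrum)
        · obtain ⟨⟨h1, h2⟩, ⟨h3, h4⟩, h5, h6⟩ := hr
          have h7 : (m : ℤ) ∈ (Osc.bose .fock).spectrum := Int.natCast_nonneg m
          have h8 : (m : ℤ) - k ∈ (Osc.bose .fock).spectrum :=
            mem_of_mem_of_eq h4 (by push_cast; ring)
          have e1 := h.r02m k a m d h1 (mem_of_mem_of_eq h2 (by push_cast; ring)) h7 h8 h5
            (mem_of_mem_of_eq h6 (by push_cast; ring))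
          have e2 := h'.r02m k a m d h1 (mem_of_mem_of_eq h2 (by push_cast; ring)) h7 h8 h5
            (mem_of_mem_of_eq h6 (by push_cast; ring))
          have e3 := ih k a d m rfl
          have e4 := ih (k + 1) a d m rfl
          rw [e3, e4] at e1
          refine mul_left_cancel₀ (one_sub_zpow_ne_zero hq0 hq1
            (show 2 * ((m : ℤ) + 1) ≠ 0 by omega)) ?_
          linear_combination e2 - e1
        · rw [hs _ _ _ _ hr, hs' _ _ _ _ hr]
      intro k a d b hb
      obtain rfl : b = m + 1 := by simpa [BoseRep.level] using hb
      cases k with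
      | succ k => exact hsucc k a d
      | zero =>
        by_cases hr : a ∈ (Osc.bose s₁).spectrum ∧ d ∈ (Osc.bose s₃).spectrum
        · have h3 : (m + 1 : ℤ) ∈ (Osc.bose .fock).spectrum := by
            change (0 : ℤ) ≤ m + 1
            omega
          have h4 : (m + 1 - 1 - (0 : ℕ) : ℤ) ∈ (Osc.bose .fock).spectrum := by
            change (0 : ℤ) ≤ m + 1 - 1 - (0 : ℕ)
            simp
          have e1 := h.r02p 0 a (m + 1) d hr.1 (by simpa using hr.1) h3 h4 hr.2
            (by simpa using hr.2)
          have e2 := h'.r02p 0 a (m + 1) d hr.1 (by simpa using hr.1) h3 h4 hr.2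
            (by simpa using hr.2)
          rw [zero_add, add_sub_cancel_right] at e1 e2
          have e3 := hsucc 0 (a - 1) (d - 1)
          rw [zero_add] at e3
          have e4 := ih 0 a d m rfl
          rw [e3, e4] at e1
          rw [← e1, ← e2]
        · rw [hs 0 a _ d fun h => hr ⟨h.1.1, h.2.2.1⟩, hs' 0 a _ d fun h => hr ⟨h.1.1, h.2.2.1⟩]
    | antiFock =>
      intro k a d b hb
      obtain rfl : b = -1 - m - 1 := by
        simp only [BoseRep.level] at hb
        push_cast at hb
        omega
      by_cases hr : (a ∈ (Osc.bose s₁).spectrum ∧ a + k ∈ (Osc.bose s₁).spectrum) ∧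
          (d ∈ (Osc.bose s₃).spectrum ∧ d + k ∈ (Osc.bose s₃).spectrum)
      · obtain ⟨⟨h1, h2⟩, h5, h6⟩ := hr
        have h3 : (-1 - m : ℤ) ∈ (Osc.bose .antiFock).spectrum := by
          change (-1 - m : ℤ) < 0
          omega
        have h4 : (-1 - m - 1 - k : ℤ) ∈ (Osc.bose .antiFock).spectrum := by
          change (-1 - m - 1 - k : ℤ) < 0
          omega
        -- Here the value at `b - 1` is the unknown; its coefficient q^(1+a+d) never vanishes.
        have e1 := h.r02p k a (-1 - m) d h1 h2 h3 h4 h5 h6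
        have e2 := h'.r02p k a (-1 - m) d h1 h2 h3 h4 h5 h6
        have e3 := ih (k + 1) (a - 1) (d - 1) (-1 - m) rfl
        have e4 := ih k a d (-1 - m) rfl
        rw [e3, e4] at e1
        refine mul_left_cancel₀ (zpow_ne_zero (1 + a + d) hq) ?_
        linear_combination e2 - e1
      · rw [hs _ _ _ _ fun h => hr ⟨h.1, h.2.2⟩, hs' _ _ _ _ fun h => hr ⟨h.1, h.2.2⟩]

/-- The values of `R₀` at the vacuum of the second site. -/
def normVal (q : ℂ) (s : BoseRep) (a d : ℤ) : ℂ :=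
  match s with
  | .fock => q ^ (a * d)
  | .antiFock => -q ^ (-((a + 1) * (d + 1)))

theorem normVal_comm (q : ℂ) (s : BoseRep) (a d : ℤ) : normVal q s a d = normVal q s d a := by
  cases s <;> simp only [normVal, mul_comm]

open Classical in
-- With the sign convention for expansions near ∞, both expansions of 1/(1 − tz) have the
-- coefficients tˣ, merely restricted to different spectra. Hence Fock and anti-Fock traces are
-- handled by the same computation.
theorem expands_geometric (q : ℂ) (b : BoseRep) {t : ℂ} (ht : t ≠ 0) :
    Expands q b (fun x => if x ∈ (Osc.bose b).spectrum then t ^ x else 0)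
      (fun z => (1 - t * z)⁻¹) := by
  cases b with
  | fock =>
    have h0 : Tendsto (fun z : ℂ => t * z) (𝓝[≠] 0) (𝓝 0) := by
      have h2 : Tendsto (fun z : ℂ => z) (𝓝[≠] 0) (𝓝 0) := nhdsWithin_le_nhds
      simpa using h2.const_mul t
    have h1 : ∀ᶠ z in BoseRep.fock.lim, ‖t * z‖ < 1 :=
      h0.norm.eventually (gt_mem_nhds (by simp))
    filter_upwards [h1] with z hz _
    rw [BoseRep.sign, one_mul, ← (Nat.cast_injective (R := ℤ)).hasSum_iff]
    · refine hasSum_of_eq (hasSum_geometric_of_norm_lt_one hz) (fun n => ?_) rfl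
      have h2 : ((n : ℕ) : ℤ) ∈ (Osc.bose .fock).spectrum := Int.natCast_nonneg n
      simp only [Function.comp, h2, if_true, zpow_natCast]
      rw [mul_pow, mul_comm]
    · intro x hx
      rw [if_neg, mul_zero]
      intro h2
      have h3 : 0 ≤ x := h2
      exact hx ⟨x.toNat, by simp [h3]⟩
  | antiFock =>
    have h0 : Tendsto (fun z : ℂ => (t * z)⁻¹) (cobounded ℂ) (𝓝 0) := by
      have := (tendsto_inv₀_cobounded (α := ℂ)).const_mul t⁻¹
      simpa only [mul_inv, mul_zero] using this
    have h1 : ∀ᶠ z in BoseRep.antiFock.lim, ‖(t * z)⁻¹‖ < 1 :=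
      h0.norm.eventually (gt_mem_nhds (by simp))
    filter_upwards [h1, eventually_lim_ne_zero .antiFock] with z hz hz0 _
    have hinj : Function.Injective fun i : ℕ => -1 - (i : ℤ) := fun i j h => by simpa using h
    rw [← hinj.hasSum_iff]
    · refine hasSum_of_eq ((hasSum_geometric_of_norm_lt_one hz).mul_left (t * z)⁻¹)
        (fun n => ?_) ?_
      · have h2 : (-1 - (n : ℤ)) ∈ (Osc.bose .antiFock).spectrum := by
          change (-1 - (n : ℤ)) < 0
          omega
        simp only [Function.comp, h2, if_true]
        rw [← mul_zpow, mul_comm z t, sub_eq_add_neg, zpow_add₀ (mul_ne_zero ht hz0), zpow_neg_one,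
          zpow_neg, zpow_natCast, inv_pow]
      · rw [BoseRep.sign, ← mul_inv, mul_sub, mul_one, mul_inv_cancel₀ (mul_ne_zero ht hz0),
          neg_one_mul, ← inv_neg, neg_sub]
    · intro x hx
      rw [if_neg, mul_zero]
      intro h2
      have h3 : x < 0 := h2
      exact hx ⟨(-1 - x).toNat, by simp only; omega⟩

/-- The step is an equivalence because the distance from the vacuum grows upwards in the Fock and
downwards in the anti-Fock spectrum. -/
theorem spectrum_induction {s : BoseRep} {P : ℤ → Prop} (h0 : P s.vac)
    (hs : ∀ a, a ∈ (Osc.bose s).spectrum → a + 1 ∈ (Osc.bose s).spectrum → (P a ↔ P (a + 1))) :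
    ∀ a, a ∈ (Osc.bose s).spectrum → P a := by
  suffices H : ∀ m : ℕ, P (s.level m) by
    intro a ha
    cases s with
    | fock =>
      have h1 : 0 ≤ a := ha
      have := H a.toNat
      rwa [BoseRep.level, Int.toNat_of_nonneg h1] at this
    | antiFock =>
      have h1 : a < 0 := ha
      have := H (-1 - a).toNat
      rwa [BoseRep.level, Int.toNat_of_nonneg (by omega), sub_sub_cancel] at this
  intro m
  induction m with
  | zero => cases s <;> simpa [BoseRep.level, BoseRep.vac] using h0
  | succ m ih =>
    cases s with
    | fock =>
      have h1 : (m : ℤ) ∈ (Osc.bose .fock).spectrum := Int.natCast_nonneg m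
      have h2 : (m : ℤ) + 1 ∈ (Osc.bose .fock).spectrum := by
        change (0 : ℤ) ≤ m + 1
        omega
      have := (hs m h1 h2).1 ih
      simpa only [BoseRep.level, Nat.cast_add, Nat.cast_one] using this
    | antiFock =>
      have h1 : -1 - ((m + 1 : ℕ) : ℤ) ∈ (Osc.bose .antiFock).spectrum := by
        change -1 - ((m + 1 : ℕ) : ℤ) < 0
        omega
      have h2 : -1 - ((m + 1 : ℕ) : ℤ) + 1 ∈ (Osc.bose .antiFock).spectrum := by
        change -1 - ((m + 1 : ℕ) : ℤ) + 1 < 0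
        push_cast
        omega
      refine (hs _ h1 h2).2 ?_
      rw [show -1 - ((m + 1 : ℕ) : ℤ) + 1 = -1 - m by push_cast; ring]
      exact ih

section

variable {q : ℂ} (hq0 : 0 < ‖q‖) (hq1 : ‖q‖ < 1) {s₁ s₂ s₃ : BoseRep} {ρ : ℕ → ℤ → ℤ → ℤ → ℂ}

theorem MidGen.term (h : MidGen q s₁ s₂ s₃ ρ) (k : ℕ) (a d : ℤ) (t : ℂ)
    (ht : t = 0 ∨ (a ∈ (Osc.bose s₁).spectrum ∧ a + k ∈ (Osc.bose s₁).spectrum) ∧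
      d ∈ (Osc.bose s₃).spectrum ∧ d + k ∈ (Osc.bose s₃).spectrum) :
    Expands q s₂ (fun x => t * (boseE q k x * ρ k a (x + k) d)) (fun z => t * midG q k a d z) := by
  rcases ht with rfl | ⟨⟨h1, h2⟩, h3, h4⟩
  · exact Eventually.of_forall fun z _ =>
      hasSum_of_eq hasSum_zero (fun x => by simp) (by simp)
  · exact (h k a d h1 h2 h3 h4).const_mul t

theorem CoefSupp.bdd_mid (h : CoefSupp s₁ s₂ s₃ ρ) (k : ℕ) (a d : ℤ) (t : ℂ) :
    BddSupp s₂ (fun x => t * (boseE q k x * ρ k a (x + k) d)) :=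
  bddSupp_of_spectrum fun x hx => by
    rw [h k a (x + k) d fun h' => hx (by simpa using h'.2.1.2), mul_zero, mul_zero]

include hq0 hq1

/-- The coefficient at z^(b−k) of the middle generating function carries ρ_k at the second
occupation number b. Comparing coefficients there yields the same two relations as the outer traces.
-/
theorem midRels_of_midGen (hs : CoefSupp s₁ s₂ s₃ ρ) (h : MidGen q s₁ s₂ s₃ ρ) :
    MidRels q s₁ s₂ s₃ ρ := by
  have hq := norm_pos_iff.1 hq0
  constructor
  · intro k a b d ha ha' hb hb' hd hd'
    have H := ((((h.term (k + 1) (a - 1) (d - 1) ((1 - q ^ (2 * a)) * (1 - q ^ (2 * d))) (by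
        rcases bose_pred ha with h1 | h1
        · rcases bose_pred hd with h2 | h2
          · right; push_cast
            exact ⟨⟨h1, by convert ha' using 1; ring⟩, h2, by convert hd' using 1; ring⟩
          · left; simp [h2]
        · left; simp [h1])).shift 1).sub
      (((h.term k a d (q ^ (1 + a + d)) (.inr ⟨⟨ha, ha'⟩, hd, hd'⟩)).sub
        ((h.term k a d (q ^ (1 + a + d) * q ^ (2 * (k : ℤ) + 2))
          (.inr ⟨⟨ha, ha'⟩, hd, hd'⟩)).scale hq 2)).shift 1)).unique hq0 hq1
      ((h.term k a d 1 (.inr ⟨⟨ha, ha'⟩, hd, hd'⟩)).sub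
        ((h.term k a d 1 (.inr ⟨⟨ha, ha'⟩, hd, hd'⟩)).scale hq 2))
      (((hs.bdd_mid _ _ _ _).shift 1).sub
        (((hs.bdd_mid k a d _).sub ((hs.bdd_mid k a d _).mul fun n => q ^ (2 * n))).shift 1))
      ((hs.bdd_mid _ _ _ _).sub ((hs.bdd_mid _ _ _ _).mul _))
      (fun z hz hg => by
        rw [zpow_one z]
        linear_combination midG_rel_02_plus hq hq1 k a d hg) (b - k))
    rw [show b - k - 1 + (k + 1 : ℕ) = b by push_cast; ring, sub_add_cancel,
      show b - k - 1 + (k : ℤ) = b - 1 by ring, boseE_succ_sub] at H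
    have hb2 : b - 1 - k + (k + 1 : ℕ) ∈ (Osc.bose s₂).spectrum := by
      convert hb using 1; push_cast; ring
    refine mul_left_cancel₀ (boseE_ne_zero hq0 hq1 (k := k + 1) hb' hb2) ?_
    have e1 := boseE_succ_of_eq q k (x := b - k - 1) (a := b) (by ring)
    rw [show b - 1 - (k : ℤ) = b - k - 1 by ring]
    have e2 := boseE_succ_sub q k (b - k)
    have e3 : q ^ (2 * (k : ℤ) + 2) * q ^ (2 * (b - k - 1)) = q ^ (2 * b) := by
      rw [← zpow_add₀ hq]; ring_nf
    linear_combination H + ((1 - q ^ (2 * a)) * (1 - q ^ (2 * d)) * ρ (k + 1) (a - 1) b (d - 1) -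
      ρ k a b d) * e2 - q ^ (1 + a + d) * ρ k a (b - 1) d * e1 -
      q ^ (1 + a + d) * ρ k a (b - 1) d * boseE q k (b - k - 1) * e3
  · intro k a b d ha ha' hb hb' hd hd'
    have ha1 : a + k ∈ (Osc.bose s₁).spectrum := mem_bose_of_between ha ha' (by omega)
    have hd1 : d + k ∈ (Osc.bose s₃).spectrum := mem_bose_of_between hd hd' (by omega)
    have ha2 : a + (k + 1 : ℕ) ∈ (Osc.bose s₁).spectrum := by convert ha' using 1; push_cast; ring
    have hd2 : d + (k + 1 : ℕ) ∈ (Osc.bose s₃).spectrum := by convert hd' using 1; push_cast; ring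
    have H := (((h.term k a d 1 (.inr ⟨⟨ha, ha1⟩, hd, hd1⟩)).sub
      ((h.term (k + 1) a d (q ^ (3 + a + d + 2 * k)) (.inr ⟨⟨ha, ha2⟩, hd, hd2⟩)).shift 1)).unique
        hq0 hq1 (h.term (k + 1) a d 1 (.inr ⟨⟨ha, ha2⟩, hd, hd2⟩))
      ((hs.bdd_mid _ _ _ _).sub ((hs.bdd_mid _ _ _ _).shift 1)) (hs.bdd_mid _ _ _ _)
      (fun z hz hg => by
        rw [zpow_one z]
        linear_combination midG_rel_02_minus hq hq1 k a d hg) (b - k))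
    rw [sub_add_cancel, show b - k - 1 + (k + 1 : ℕ) = b by push_cast; ring,
      show b - k + (k + 1 : ℕ) = b + 1 by push_cast; ring, boseE_succ_sub,
      boseE_succ_of_eq q k (x := b - k) (a := b + 1) (by ring)] at H
    have hb2 : b - k + k ∈ (Osc.bose s₂).spectrum := by convert hb using 1; ring
    refine mul_left_cancel₀ (boseE_ne_zero hq0 hq1 hb' hb2) ?_
    linear_combination H

/-- For k = 0 at the vacuum of the second site all but one linear factor cancel: the generating
function is 1/(1 − q^d z) in the Fock case and −q^(−d−1)/(1 − q^(−d−1) z) in the anti-Fock case. -/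
theorem norm_of_outerGen (hs : CoefSupp s₁ s₂ s₃ ρ) (h : OuterGen q s₁ s₂ s₃ ρ) (a d : ℤ)
    (ha : a ∈ (Osc.bose s₁).spectrum) (hd : d ∈ (Osc.bose s₃).spectrum) :
    ρ 0 a s₂.vac d = normVal q s₂ a d := by
  have hq := norm_pos_iff.1 hq0
  have hb : s₂.vac - (0 : ℕ) ∈ (Osc.bose s₂).spectrum := by simpa using vac_mem s₂
  have hd' : d + (0 : ℕ) ∈ (Osc.bose s₃).spectrum := by simpa using hd
  have h1 := h.term 0 s₂.vac d 1 (.inr ⟨⟨vac_mem s₂, hb⟩, hd, hd'⟩)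
  have hsp : BddSupp s₁ (fun x => boseE q 0 x * ρ 0 x s₂.vac d) := by
    simpa using hs.bdd (q := q) 0 s₂.vac d 1
  cases s₂ with
  | fock =>
    have h2 := h1.unique hq0 hq1 (expands_geometric q s₁ (zpow_ne_zero d hq)) (hs.bdd _ _ _ _)
      (bddSupp_of_spectrum fun n hn => if_neg hn) (fun z hz hg => by
        rw [one_mul, outerG_eq q 0 _ d z (d + 2) (d + 2) (d + 2) d (by simp [BoseRep.vac])
          (by simp [BoseRep.vac]) (by simp [BoseRep.vac]) (by simp [BoseRep.vac]),
          qPoch_zpow_succ hq hq1 d]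
        have n1 := hg.inv.qPoch_ne_zero hq hq1 (d + 2)
        have n2 := hg.qPoch_ne_zero hq hq1 (d + 2)
        have n3 := hg.one_sub_ne_zero hq d
        simp only [BoseRep.vac, Nat.cast_zero, sub_zero, zpow_zero, one_mul]
        rw [← div_div, mul_div_cancel_left₀ _ n1, div_mul_cancel_right₀ n2]) a
    rw [if_pos ha, boseE_zero, one_mul, one_mul] at h2
    rw [h2, normVal, ← zpow_mul, mul_comm]
  | antiFock =>
    have h2 := h1.unique hq0 hq1 ((expands_geometric q s₁ (zpow_ne_zero (-d - 1) hq)).const_mul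
      (-q ^ (-d - 1))) (hs.bdd _ _ _ _)
      ((bddSupp_of_spectrum fun n hn => if_neg hn).mul _) (fun z hz hg => by
        rw [one_mul, outerG_eq q 0 _ d z (d + 1 + 2) (d + 1) (d + 1) (d + 1)
          (by simp [BoseRep.vac]) (by simp [BoseRep.vac]; ring) (by simp [BoseRep.vac]; ring)
          (by simp [BoseRep.vac]), qPoch_zpow_succ hq hq1 (d + 1) z⁻¹]
        have n1 := hg.inv.qPoch_ne_zero hq hq1 (d + 1 + 2)
        have n2 := hg.qPoch_ne_zero hq hq1 (d + 1)
        have n3 := hg.inv.one_sub_ne_zero hq (d + 1)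
        have n4 := hg.one_sub_ne_zero hq (-d - 1)
        simp only [BoseRep.vac, Nat.cast_zero, sub_zero, zpow_neg_one]
        generalize qPoch q (q ^ (d + 1 + 2) * z⁻¹) = A at *
        generalize qPoch q (q ^ (d + 1) * z) = B at *
        rw [mul_div_mul_right _ _ n2, mul_div_mul_right _ _ n1]
        rw [show -d - 1 = -(d + 1) by ring, zpow_neg] at n4 ⊢
        have n5 := zpow_ne_zero (d + 1) hq
        generalize q ^ (d + 1) = Q at *
        rw [div_eq_iff n3, mul_comm, ← mul_assoc, eq_comm, mul_inv_eq_iff_eq_mul₀ n4]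
        field_simp
        ring) a
    rw [if_pos ha, boseE_zero, one_mul, one_mul] at h2
    rw [h2, normVal, ← zpow_mul, neg_mul, ← zpow_add₀ hq]
    ring_nf

/-- The middle generating function is geometric only at the vacuum of the first site. From there the
vacuum values propagate along the first site by the z⁰ coefficient of `midG_rel_norm`. -/
theorem norm_of_midGen (hs : CoefSupp s₁ s₂ s₃ ρ) (h : MidGen q s₁ s₂ s₃ ρ) (a d : ℤ)
    (ha : a ∈ (Osc.bose s₁).spectrum) (hd : d ∈ (Osc.bose s₃).spectrum) :
    ρ 0 a s₂.vac d = normVal q s₂ a d := by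
  have hq := norm_pos_iff.1 hq0
  have hd' : d + (0 : ℕ) ∈ (Osc.bose s₃).spectrum := by simpa using hd
  have ht : ∀ a t, a ∈ (Osc.bose s₁).spectrum →
      Expands q s₂ (fun x => t * ρ 0 a x d) (fun z => t * midG q 0 a d z) := fun a t ha => by
    simpa using h.term 0 a d t (.inr ⟨⟨ha, by simpa using ha⟩, hd, hd'⟩)
  have hb : ∀ a t, BddSupp s₂ (fun x => t * ρ 0 a x d) := fun a t => by
    simpa using hs.bdd_mid (q := q) 0 a d t
  refine spectrum_induction (s := s₁) (P := fun a => ρ 0 a s₂.vac d = normVal q s₂ a d) ?_ ?_ a ha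
  · have h2 : ∀ x ∈ (Osc.bose s₂).spectrum, ρ 0 s₁.vac x d =
        (match s₁ with
          | .fock => (-q ^ (1 + d)) ^ x
          | .antiFock => q ^ (-d) * (-q ^ (-d)) ^ x) := by
      intro x hx
      cases s₁ with
      | fock =>
        have := (ht 0 1 (vac_mem .fock)).unique hq0 hq1
          (expands_geometric q s₂ (neg_ne_zero.2 (zpow_ne_zero (1 + d) hq))) (hb _ _)
          (bddSupp_of_spectrum fun n hn => if_neg hn) (fun z hz hg => by
            rw [one_mul, midG_eq hq 0 0 d z 1 (1 - d) (1 + d + 2) (1 + d) (1 - d) (by simp) (by simp)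
              (by simp; ring) (by simp) (by simp), qPoch_zpow_succ hq hq1 (1 + d)]
            have n1 := hg.neg.qPoch_ne_zero hq hq1 (1 - d)
            have n2 := hg.neg.qPoch_ne_zero hq hq1 (1 + d + 2)
            have n3 := hg.neg.one_sub_ne_zero hq (1 + d)
            rw [one_mul, mul_comm (_ * _) (qPoch q (q ^ (1 - d) * -z)), mul_div_mul_left _ _ n1,
              div_mul_cancel_right₀ n2, mul_neg, neg_mul]) x
        rw [if_pos hx, one_mul] at this
        exact this
      | antiFock =>
        have := (ht (-1) 1 (vac_mem .antiFock)).unique hq0 hq1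
          ((expands_geometric q s₂ (neg_ne_zero.2 (zpow_ne_zero (-d) hq))).const_mul (q ^ (-d)))
          (hb _ _) ((bddSupp_of_spectrum fun n hn => if_neg hn).mul _) (fun z hz hg => by
            rw [one_mul, midG_eq hq 0 (-1) d z (q ^ (-d)) (-d + 2) (2 + d) (2 + d) (-d) (by simp)
              (by ring) (by simp) (by ring) (by ring), qPoch_zpow_succ hq hq1 (-d)]
            have n1 := hg.neg.qPoch_ne_zero hq hq1 (2 + d)
            have n2 := hg.neg.qPoch_ne_zero hq hq1 (-d + 2)
            have n3 := hg.neg.one_sub_ne_zero hq (-d)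
            rw [mul_comm (_ * _) (qPoch q (q ^ (2 + d) * -z)), mul_div_mul_left _ _ n1,
              mul_div_mul_right _ _ n2, mul_neg, neg_mul, div_eq_mul_inv]) x
        rw [if_pos hx, one_mul] at this
        exact this
    rw [h2 _ (vac_mem s₂)]
    cases s₁ <;> cases s₂ <;> simp only [normVal, BoseRep.vac, zpow_zero, zpow_neg_one, mul_one,
      zero_mul, zero_add, one_mul, inv_neg, neg_add_cancel, neg_zero, mul_neg, ← zpow_neg, neg_neg,
      neg_mul]
    · rw [add_comm]
    · rw [← zpow_add₀ hq, neg_add_cancel, zpow_zero]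
  · intro a ha ha'
    have H := ((((ht (a + 1) 1 ha').scale hq 1)).add
      (((ht (a + 1) (q ^ (3 + a + d)) ha').scale hq 1).shift 1)).unique hq0 hq1
      ((ht a (q ^ d) ha).add ((ht a (q ^ d * q ^ (1 + a - d)) ha).shift 1))
      (((hb _ _).mul _).add (((hb (a + 1) (q ^ (3 + a + d))).mul fun n => q ^ (1 * n)).shift 1))
      ((hb _ _).add ((hb a _).shift 1)) (fun z hz hg => by
        rw [zpow_one z]
        linear_combination midG_rel_norm hq hq1 a d hg) 0
    -- The comparison at z⁰ involves second occupation numbers 0 and −1. In each representation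
    -- exactly one of them is in the spectrum, and it is the vacuum.
    simp only [mul_zero, zpow_zero, one_mul, zero_sub] at H
    cases s₂ with
    | fock =>
      have e : ∀ a, ρ 0 a (-1) d = 0 := fun a => hs 0 a (-1) d fun h => by
        have : (0 : ℤ) ≤ -1 := h.2.1.1
        omega
      simp only [e, mul_zero, add_zero] at H
      simp only [BoseRep.vac, normVal, H]
      rw [add_mul, one_mul, zpow_add₀ hq, mul_comm (q ^ (a * d)),
        mul_right_inj' (zpow_ne_zero d hq)]
    | antiFock =>
      have e : ∀ a, ρ 0 a 0 d = 0 := fun a => hs 0 a 0 d fun h => by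
        have : (0 : ℤ) < 0 := h.2.1.1
        omega
      simp only [e, mul_zero, zero_add] at H
      simp only [BoseRep.vac, normVal]
      rw [← mul_assoc, ← zpow_add₀ hq, ← zpow_add₀ hq] at H
      have e1 : ρ 0 (a + 1) (-1) d = q ^ (-(d + 1)) * ρ 0 a (-1) d := by
        refine mul_left_cancel₀ (zpow_ne_zero (-1 + (3 + a + d)) hq) ?_
        rw [H, ← mul_assoc, ← zpow_add₀ hq]
        ring_nf
      rw [e1, show -((a + 1 + 1) * (d + 1)) = -(d + 1) + -((a + 1) * (d + 1)) by ring,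
        zpow_add₀ hq, ← mul_neg (q ^ (-(d + 1))), mul_right_inj' (zpow_ne_zero _ hq)]

end

/-! ### Existence and equivalence of the three generating functions. -/

section

variable {q : ℂ} (hq0 : 0 < ‖q‖) (hq1 : ‖q‖ < 1) {s₁ s₂ s₃ : BoseRep} {ρ ρ' : ℕ → ℤ → ℤ → ℤ → ℂ}

include hq0 hq1

/-- The generating function is rational, hence expandable, and its coefficients vanish wherever
`boseE` might. Dividing by `boseE` gives the required family. -/
theorem exists_outerGen (s₁ s₂ s₃ : BoseRep) :
    ∃ ρ, CoefSupp s₁ s₂ s₃ ρ ∧ OuterGen q s₁ s₂ s₃ ρ := by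
  classical
  have hq := norm_pos_iff.1 hq0
  have H : ∀ (k : ℕ) (b d : ℤ), ∃ f : ℤ → ℂ, b ∈ (Osc.bose s₂).spectrum →
      b - k ∈ (Osc.bose s₂).spectrum →
      (∀ x, ¬(x ∈ (Osc.bose s₁).spectrum ∧ x + k ∈ (Osc.bose s₁).spectrum) → f x = 0) ∧
        Expands q s₁ f (outerG q k b d) := fun k b d => by
    by_cases h : b ∈ (Osc.bose s₂).spectrum ∧ b - k ∈ (Osc.bose s₂).spectrum
    · obtain ⟨f, hf, hs⟩ := (isRational_outer hq hq1 k b d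
        (bose_outer_cond h.1 h.2)).exists_coeff s₁
      exact ⟨f, fun _ _ => ⟨hf, hs.mono fun z hz hg => hz (outerDen_ne_zero hq hq1 hg _ _ _)⟩⟩
    · exact ⟨0, fun h1 h2 => absurd ⟨h1, h2⟩ h⟩
  choose f hf using H
  refine ⟨fun k a b d => if (a ∈ (Osc.bose s₁).spectrum ∧ a + k ∈ (Osc.bose s₁).spectrum) ∧
    (b ∈ (Osc.bose s₂).spectrum ∧ b - k ∈ (Osc.bose s₂).spectrum) ∧
    (d ∈ (Osc.bose s₃).spectrum ∧ d + k ∈ (Osc.bose s₃).spectrum) then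
      f k b d a / boseE q k a else 0, fun k a b d h => if_neg h, fun k b d h1 h2 h3 h4 => ?_⟩
  convert (hf k b d h1 h2).2 using 2 with x
  beta_reduce
  by_cases hx : x ∈ (Osc.bose s₁).spectrum ∧ x + k ∈ (Osc.bose s₁).spectrum
  · simp only [hx, h1, h2, h3, h4, and_self, if_true]
    rw [mul_div_cancel₀ _ (boseE_ne_zero hq0 hq1 hx.1 hx.2)]
  · rw [if_neg fun h : _ ∧ _ => hx h.1, mul_zero, (hf k b d h1 h2).1 x hx]

theorem exists_midGen (s₁ s₂ s₃ : BoseRep) :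
    ∃ ρ, CoefSupp s₁ s₂ s₃ ρ ∧ MidGen q s₁ s₂ s₃ ρ := by
  classical
  have hq := norm_pos_iff.1 hq0
  have H : ∀ (k : ℕ) (a d : ℤ), ∃ f : ℤ → ℂ, d ∈ (Osc.bose s₃).spectrum →
      d + k ∈ (Osc.bose s₃).spectrum →
      (∀ x, ¬(x ∈ (Osc.bose s₂).spectrum ∧ x + k ∈ (Osc.bose s₂).spectrum) → f x = 0) ∧
        Expands q s₂ f (midG q k a d) := fun k a d => by
    by_cases h : d ∈ (Osc.bose s₃).spectrum ∧ d + k ∈ (Osc.bose s₃).spectrum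
    · obtain ⟨f, hf, hs⟩ := (isRational_mid hq hq1 k a d
        (bose_mid_cond h.1 h.2)).exists_coeff s₂
      exact ⟨f, fun _ _ => ⟨hf, hs.mono fun z hz hg => hz (midDen_ne_zero hq hq1 hg _ _ _)⟩⟩
    · exact ⟨0, fun h1 h2 => absurd ⟨h1, h2⟩ h⟩
  choose f hf using H
  refine ⟨fun k a b d => if (a ∈ (Osc.bose s₁).spectrum ∧ a + k ∈ (Osc.bose s₁).spectrum) ∧
    (b ∈ (Osc.bose s₂).spectrum ∧ b - k ∈ (Osc.bose s₂).spectrum) ∧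
    (d ∈ (Osc.bose s₃).spectrum ∧ d + k ∈ (Osc.bose s₃).spectrum) then
      f k a d (b - k) / boseE q k (b - k) else 0, fun k a b d h => if_neg h,
      fun k a d h1 h2 h3 h4 => ?_⟩
  convert (hf k a d h3 h4).2 using 2 with x
  beta_reduce
  rw [add_sub_cancel_right]
  by_cases hx : x ∈ (Osc.bose s₂).spectrum ∧ x + k ∈ (Osc.bose s₂).spectrum
  · simp only [hx, h1, h2, h3, h4, and_self, if_true]
    rw [mul_div_cancel₀ _ (boseE_ne_zero hq0 hq1 hx.1 hx.2)]
  · rw [if_neg fun h : _ ∧ _ => hx h.2.1.symm, mul_zero, (hf k a d h3 h4).1 x hx]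

/-- The converse direction is not a summation of the series: some family with the given generating
functions exists, it has the same relations and vacuum values, and uniqueness identifies it with the
given family. -/
theorem outerGen_iff (hs : CoefSupp s₁ s₂ s₃ ρ) : OuterGen q s₁ s₂ s₃ ρ ↔
    MidRels q s₁ s₂ s₃ ρ ∧ ∀ a d, a ∈ (Osc.bose s₁).spectrum → d ∈ (Osc.bose s₃).spectrum →
      ρ 0 a s₂.vac d = normVal q s₂ a d := by
  refine ⟨fun h => ⟨(coefRels_of_outerGen hq0 hq1 hs h).midRels,
    norm_of_outerGen hq0 hq1 hs h⟩, fun ⟨h1, h2⟩ => ?_⟩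
  obtain ⟨ρ', hs', h'⟩ := exists_outerGen hq0 hq1 s₁ s₂ s₃
  rwa [MidRels.ext hq0 hq1 hs hs' h1 (coefRels_of_outerGen hq0 hq1 hs' h').midRels fun a d ha hd =>
    (h2 a d ha hd).trans (norm_of_outerGen hq0 hq1 hs' h' a d ha hd).symm]

theorem midGen_iff (hs : CoefSupp s₁ s₂ s₃ ρ) : MidGen q s₁ s₂ s₃ ρ ↔
    MidRels q s₁ s₂ s₃ ρ ∧ ∀ a d, a ∈ (Osc.bose s₁).spectrum → d ∈ (Osc.bose s₃).spectrum →
      ρ 0 a s₂.vac d = normVal q s₂ a d := by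
  refine ⟨fun h => ⟨midRels_of_midGen hq0 hq1 hs h, norm_of_midGen hq0 hq1 hs h⟩,
    fun ⟨h1, h2⟩ => ?_⟩
  obtain ⟨ρ', hs', h'⟩ := exists_midGen hq0 hq1 s₁ s₂ s₃
  rwa [MidRels.ext hq0 hq1 hs hs' h1 (midRels_of_midGen hq0 hq1 hs' h') fun a d ha hd =>
    (h2 a d ha hd).trans (norm_of_midGen hq0 hq1 hs' h' a d ha hd).symm]

theorem outerGen_iff_midGen (hs : CoefSupp s₁ s₂ s₃ ρ) :
    OuterGen q s₁ s₂ s₃ ρ ↔ MidGen q s₁ s₂ s₃ ρ :=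
  (outerGen_iff hq0 hq1 hs).trans (midGen_iff hq0 hq1 hs).symm

/-- Although the outer generating function treats the outer sites differently, its characterization
by `MidRels` and `normVal` is symmetric in them. -/
theorem outerGen_swap_iff (hs : CoefSupp s₁ s₂ s₃ ρ) :
    OuterGen q s₃ s₂ s₁ (fun k a b d => ρ k d b a) ↔ OuterGen q s₁ s₂ s₃ ρ := by
  rw [outerGen_iff hq0 hq1 hs, outerGen_iff hq0 hq1 hs.swap]
  refine and_congr ⟨fun h => h.swap, fun h => h.swap⟩
    ⟨fun h a d ha hd => ?_, fun h a d ha hd => ?_⟩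
  · rw [h d a hd ha, normVal_comm]
  · rw [h d a hd ha, normVal_comm]

theorem genFun₁_iff_genFun₂ {r : Fin 3 → BoseRep} (Rk : ℕ → State (cAAA r) → ℂ) :
    GenFun₁ q Rk ↔ GenFun₂ q Rk := by
  rw [genFun₁_iff hq0 hq1, genFun₂_iff hq0 hq1, outerGen_iff_midGen hq0 hq1 (coefSupp_coefExt Rk)]

theorem genFun₂_iff_genFun₃ {r : Fin 3 → BoseRep} (Rk : ℕ → State (cAAA r) → ℂ) :
    GenFun₂ q Rk ↔ GenFun₃ q Rk := by
  rw [← genFun₁_iff_genFun₂ hq0 hq1, genFun₁_iff hq0 hq1, genFun₃_iff hq0 hq1,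
    outerGen_swap_iff hq0 hq1 (coefSupp_coefExt Rk)]

theorem exists_genFun₁ (r : Fin 3 → BoseRep) : ∃ Rk : ℕ → State (cAAA r) → ℂ, GenFun₁ q Rk := by
  obtain ⟨ρ, hs, h⟩ := exists_outerGen hq0 hq1 (r 0) (r 1) (r 2)
  refine ⟨fun k n => ρ k (n.1 0) (n.1 1) (n.1 2), (genFun₁_iff hq0 hq1 _).2 ?_⟩
  convert h using 1
  funext k a b d
  by_cases hA : Adm (cAAA r) a b d ∧ Adm (cAAA r) (a + k) (b - k) (d + k)
  · rw [coefExt, ind_pos hA.2, one_mul, stExt, dif_pos hA.1]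
    rfl
  · rw [coefExt_eq_zero _ _ hA, hs k a b d fun ⟨⟨h1, h4⟩, ⟨h2, h5⟩, h3, h6⟩ =>
      hA ⟨⟨h1, h2, h3⟩, h4, h5, h6⟩]

end

/-! ### The purely bosonic intertwiner -/

theorem rels_of_genFun₁ {q : ℂ} (hq0 : 0 < ‖q‖) (hq1 : ‖q‖ < 1) {r : Fin 3 → BoseRep}
    {Rk : ℕ → State (cAAA r) → ℂ} (h : GenFun₁ q Rk) :
    Rels (.bose q 0) (.bose q 1) (.bose q 2) (Adm (cAAA r)) (kerExt (kernelAAA q r Rk)) ∧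
    Rels (.boseInv q 0) (.boseInv q 1) (.boseInv q 2) (Adm (cAAA r))
      (kerExt (kernelAAA q r Rk)) := by
  have hq := norm_pos_iff.1 hq0
  have hs := coefSupp_coefExt Rk
  have ho := (genFun₁_iff hq0 hq1 Rk).1 h
  have h1 := coefRels_of_outerGen hq0 hq1 hs ho
  have h2 := coefRels_of_outerGen hq0 hq1 hs.swap ((outerGen_swap_iff hq0 hq1 hs).2 ho)
  rw [kerExt_kernelAAA]
  exact ⟨rels_bose_of_coefRels hq h1 h2, rels_boseInv_of_coefRels hq h1 h2⟩

theorem mono_congr {d e g : ℤ} {f f' : ℤ → ℤ → ℤ → ℂ} (h : ∀ a b k, f a b k = f' a b k) :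
    (mono d e g f : Op c) = mono d e g f' := by
  rw [show f = f' from funext fun a => funext fun b => funext fun k => h a b k]

/-- Transposition reverses the order of the two summands in an entry of the product of three
matrices. -/
theorem mono_add_congr' {d e g d' e' g' : ℤ} {f f' h h' : ℤ → ℤ → ℤ → ℂ}
    (h1 : ∀ a b k, f a b k = f' a b k) (h2 : ∀ a b k, h a b k = h' a b k) :
    (mono d e g f + mono d' e' g' h : Op c) = mono d' e' g' h' + mono d e g f' := by
  rw [mono_congr h1, mono_congr h2, add_comm]

/-- Transposing X for q gives X for q⁻¹ up to scalars, and transposing a product of three such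
matrices reverses the order of the factors. The relation for q⁻¹ thus says that the same R
intertwines in the opposite direction. -/
theorem intertwines_transpose_bose {q : ℂ} (hq : q ≠ 0) (i j : Fin 3) :
    ∃ t : ℂ, t ≠ 0 ∧
    lhsX ((LData.boseInv q 0).toMatrix 0) ((LData.boseInv q 1).toMatrix 1)
        ((LData.boseInv q 2).toMatrix 2) j i =
      t • (rhsX ((LData.bose q 0).toMatrix 0) ((LData.bose q 1).toMatrix 1)
        ((LData.bose q 2).toMatrix 2) i j : Op c) ∧
    rhsX ((LData.boseInv q 0).toMatrix 0) ((LData.boseInv q 1).toMatrix 1)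
        ((LData.boseInv q 2).toMatrix 2) j i =
      t • (lhsX ((LData.bose q 0).toMatrix 0) ((LData.bose q 1).toMatrix 1)
        ((LData.bose q 2).toMatrix 2) i j : Op c) := by
  refine ⟨q ^ (2 - (i : ℤ) - j), zpow_ne_zero _ hq, ?_⟩
  rw [lhsX_eq, rhsX_eq, lhsX_eq, rhsX_eq]
  fin_cases i <;> fin_cases j <;>
    simp [LData.toMatrix, LData.bose, LData.boseInv, mono_mul_mono, smul_mono, smul_add]
  all_goals try refine And.intro ?_ ?_
  all_goals first
    | with_reducible refine mono_congr fun a b d => ?_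
    | with_reducible refine mono_add_congr' (fun a b d => ?_) (fun a b d => ?_)
  all_goals field_simp
  all_goals ring

theorem commute_mul_self {A B T : Op c} (h1 : A * T = T * B) (h2 : B * T = T * A) :
    Commute (T * T) A := by
  change T * T * A = A * (T * T)
  rw [← mul_assoc, h1, mul_assoc, mul_assoc, ← h2]

theorem ket_eigen_step {S : Op c} {d e g : ℤ} {f : ℤ → ℤ → ℤ → ℂ} (hc : Commute S (mono d e g f))
    {a b k : ℤ} (h : Adm c a b k) (hf : f a b k ≠ 0) (hS : S (ket a b k) = ket a b k) :
    S (ket (a + d) (b + e) (k + g)) = ket (a + d) (b + e) (k + g) := by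
  have h1 := LinearMap.congr_fun hc.eq (ket a b k)
  rw [Module.End.mul_apply, Module.End.mul_apply, hS, mono_ket _ _ _ _ h, map_smul] at h1
  exact smul_right_injective _ hf h1

theorem exists_op_of_finite_columns (R : State c → State c → ℂ)
    (h : ∀ m, (Function.support fun n => R n m).Finite) : ∃ T : Op c, matEl T = R := by
  refine ⟨Finsupp.linearCombination ℂ fun m => Finsupp.ofSupportFinite (fun n => R n m) (h m), ?_⟩
  funext n m
  simp only [matEl, Finsupp.linearCombination_single, one_smul]
  rfl

theorem intertwines_one_iff (X Y Z : LData) (T : Op c) :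
    Intertwines (X.toMatrix 0) (Y.toMatrix 1) (Z.toMatrix 2) T ↔
      Rels X Y Z (Adm c) (kerExt (matEl T)) := by
  rw [intertwines_iff, kernelIntertwines_iff]

section

variable {q : ℂ} {r : Fin 3 → BoseRep} {ρ : ℕ → ℤ → ℤ → ℤ → ℂ}

/-- Conservation fixes N₁+N₂ and N₂+N₃. If two neighbouring numbers are both nonnegative or both
negative, a fixed sum bounds them, and the second occupation number determines the rest. -/
theorem finite_column_serKer (hr : r 1 = r 0 ∨ r 1 = r 2) (m : State (cAAA r)) :
    (Function.support fun n : State (cAAA r) =>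
      serKer q ρ (n.1 0) (n.1 1) (n.1 2) (m.1 0) (m.1 1) (m.1 2)).Finite := by
  refine Set.Finite.of_finite_image (f := fun n => n.1 1) ?_ fun n hn n' hn' h => ?_
  · refine (Set.finite_Icc (-|m.1 0 + m.1 1| - |m.1 1 + m.1 2|)
      (|m.1 0 + m.1 1| + |m.1 1 + m.1 2|)).subset ?_
    rintro _ ⟨n, hn, rfl⟩
    have h := serKer_conserves hn
    have h0 := abs_nonneg (m.1 0 + m.1 1)
    have h1 := abs_nonneg (m.1 1 + m.1 2)
    have h2 := le_abs_self (m.1 0 + m.1 1)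
    have h3 := neg_abs_le (m.1 0 + m.1 1)
    have h4 := le_abs_self (m.1 1 + m.1 2)
    have h5 := neg_abs_le (m.1 1 + m.1 2)
    have n1 : n.1 1 ∈ (Osc.bose (r 1)).spectrum := n.2 1
    change _ ≤ n.1 1 ∧ n.1 1 ≤ _
    rcases hr with hr | hr
    · have n0 : n.1 0 ∈ (Osc.bose (r 0)).spectrum := n.2 0
      rw [hr] at n1
      cases h6 : r 0 <;> rw [h6] at n0 n1 <;>
        simp only [Osc.spectrum, Set.mem_ofPred_eq] at n0 n1 <;> constructor <;> omega
    · have n0 : n.1 2 ∈ (Osc.bose (r 2)).spectrum := n.2 2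
      rw [hr] at n1
      cases h6 : r 2 <;> rw [h6] at n0 n1 <;>
        simp only [Osc.spectrum, Set.mem_ofPred_eq] at n0 n1 <;> constructor <;> omega
  · have h1 := serKer_conserves hn
    have h2 := serKer_conserves hn'
    simp only at h
    exact (State.ext_iff' n n').2 ⟨by omega, h, by omega⟩

/-- The hypothesis `hu` says that the state is alone in its sector of fixed N₁+N₂ and N₂+N₃, so it
is an eigenvector. -/
theorem serKer_ket {T : Op (cAAA r)} (hT : ∀ n m : State (cAAA r), matEl T n m =
      serKer q ρ (n.1 0) (n.1 1) (n.1 2) (m.1 0) (m.1 1) (m.1 2)) {a b d : ℤ}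
    (h : Adm (cAAA r) a b d) (hu : ∀ j, Adm (cAAA r) (a + j) (b - j) (d + j) → j = 0) :
    T (ket a b d) = ρ 0 a b d • ket a b d := by
  rw [ket_of_adm h]
  ext n
  have h1 := hT n (mkState a b d h)
  rw [matEl] at h1
  rw [h1, Finsupp.smul_apply]
  change serKer q ρ (n.1 0) (n.1 1) (n.1 2) a b d = _
  by_cases h0 : serKer q ρ (n.1 0) (n.1 1) (n.1 2) a b d = 0
  · rw [h0]
    by_cases hn : mkState a b d h = n
    · subst hn
      rw [← h0]
      change serKer q ρ a b d a b d = _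
      rw [serKer_lower q ρ 0 (by simp) (by simp) (by simp)]
      simp
    · rw [Finsupp.single_eq_of_ne (Ne.symm hn)]
      simp
  · have h2 := serKer_conserves h0
    have h3 := hu (n.1 0 - a) (by
      convert adm_state n using 1 <;> omega)
    obtain rfl : n = mkState a b d h := (State.ext_iff' _ _).2
      ⟨by change n.1 0 = a; omega, by change n.1 1 = b; omega, by change n.1 2 = d; omega⟩
    change serKer q ρ a b d a b d = _
    rw [serKer_lower q ρ 0 (by simp) (by simp) (by simp)]
    simp

end

/-- T intertwines in both directions, so T² commutes with all entries. If sites 1 and 2 are of the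
same kind, a state with both of them in the vacuum is alone in its sector and T acts on it by ±1.
Entries that move one site at a time with nonzero coefficients carry the eigenvalue 1 of T² to every
state. The case of sites 2 and 3 is analogous. -/
theorem kernelSqOne_kernelAAA {q : ℂ} (hq0 : 0 < ‖q‖) (hq1 : ‖q‖ < 1) {r : Fin 3 → BoseRep}
    {Rk : ℕ → State (cAAA r) → ℂ} (h : GenFun₁ q Rk) (hr : r 1 = r 0 ∨ r 1 = r 2) :
    KernelSqOne (kernelAAA q r Rk) := by
  have hq := norm_pos_iff.1 hq0
  have hs := coefSupp_coefExt Rk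
  obtain ⟨-, hn⟩ := (outerGen_iff hq0 hq1 hs).1 ((genFun₁_iff hq0 hq1 Rk).1 h)
  obtain ⟨T, hT⟩ := exists_op_of_finite_columns (kernelAAA q r Rk) fun m => by
    simp only [kernelAAA_eq_serKer]
    exact finite_column_serKer hr m
  have hT' : ∀ n m : State (cAAA r), matEl T n m =
      serKer q (coefExt Rk) (n.1 0) (n.1 1) (n.1 2) (m.1 0) (m.1 1) (m.1 2) := fun n m => by
    rw [hT, kernelAAA_eq_serKer]
  obtain ⟨h1, h2⟩ := rels_of_genFun₁ hq0 hq1 h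
  rw [← hT, ← intertwines_one_iff] at h1 h2
  have hc : ∀ i j, Commute (T * T) (lhsX ((LData.bose q 0).toMatrix 0)
      ((LData.bose q 1).toMatrix 1) ((LData.bose q 2).toMatrix 2) i j) ∧
      Commute (T * T) (rhsX ((LData.bose q 0).toMatrix 0)
      ((LData.bose q 1).toMatrix 1) ((LData.bose q 2).toMatrix 2) i j) := fun i j => by
    obtain ⟨t, ht, e1, e2⟩ := intertwines_transpose_bose (c := cAAA r) hq i j
    have e3 := h2 j i
    rw [e1, e2, smul_mul_assoc, mul_smul_comm] at e3
    have e4 := smul_right_injective _ ht e3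
    exact ⟨commute_mul_self (h1 i j) e4, commute_mul_self e4 (h1 i j)⟩
  have c0 : Commute (T * T) (mono 1 0 0 fun a b _ => q ^ b * (1 - q ^ (2 * a + 2))) := by
    simpa [rhsX_eq, LData.toMatrix, LData.bose, mono_mul_mono] using (hc 0 1).2
  have c0' : Commute (T * T) (mono (-1) 0 0 fun _ b _ => q ^ b) := by
    simpa [lhsX_eq, LData.toMatrix, LData.bose, mono_mul_mono] using (hc 1 0).1
  have c1 : Commute (T * T) (mono 0 1 0 fun _ b _ => (1 - q ^ (2 * b + 2))) := by
    simpa [rhsX_eq, LData.toMatrix, LData.bose, mono_mul_mono] using (hc 0 2).2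
  have c1' : Commute (T * T) (mono 0 (-1) 0 fun _ _ _ => 1) := by
    simpa [lhsX_eq, LData.toMatrix, LData.bose, mono_mul_mono] using (hc 2 0).1
  have c2 : Commute (T * T) (mono 0 0 1 fun _ b d => -((1 - q ^ (2 * d + 2)) * (q * q ^ b))) := by
    simpa [rhsX_eq, LData.toMatrix, LData.bose, mono_mul_mono] using (hc 1 2).2
  have c2' : Commute (T * T) (mono 0 0 (-1) fun _ b _ => -(q * q ^ b)) := by
    simpa [lhsX_eq, LData.toMatrix, LData.bose, mono_mul_mono] using (hc 2 1).1
  have nz : ∀ {s : BoseRep} {a : ℤ}, a ∈ (Osc.bose s).spectrum → a + 1 ∈ (Osc.bose s).spectrum →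
      1 - q ^ (2 * a + 2) ≠ 0 := fun {s} {a} h1 h2 => one_sub_zpow_ne_zero hq0 hq1 (by
    cases s <;> simp only [Osc.spectrum, Set.mem_ofPred_eq] at h1 h2 <;> omega)
  -- At the common vacuum `normVal` is 1 in the Fock and −1 in the anti-Fock case, whatever the
  -- third site; only its square matters.
  have hvac : ∀ a b d, Adm (cAAA r) a b d → b = (r 1).vac →
      (∀ j, Adm (cAAA r) (a + j) (b - j) (d + j) → j = 0) → (normVal q (r 1) a d) ^ 2 = 1 →
      (T * T) (ket a b d) = ket a b d := by
    rintro a b d ha rfl hj hv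
    have h3 := serKer_ket hT' ha hj
    rw [hn a d ha.1 ha.2.2] at h3
    rw [Module.End.mul_apply, h3, map_smul, h3, smul_smul, ← sq, hv, one_smul]
  have hfix : ∀ a b d, Adm (cAAA r) a b d → (T * T) (ket a b d) = ket a b d := by
    intro a b d ha
    rcases hr with hr | hr
    · have hv : (r 0).vac ∈ (Osc.bose (r 0)).spectrum := vac_mem _
      have hv1 : (r 1).vac ∈ (Osc.bose (r 1)).spectrum := vac_mem _
      refine spectrum_induction (s := r 0) (P := fun a => (T * T) (ket a b d) = ket a b d) ?_ ?_ a
        ha.1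
      · refine spectrum_induction (s := r 1)
          (P := fun b => (T * T) (ket (r 0).vac b d) = ket (r 0).vac b d) ?_ ?_ b ha.2.1
        · refine hvac _ _ _ ⟨hv, hv1, ha.2.2⟩ rfl (fun j hj => ?_) ?_
          · obtain ⟨j0, j1, -⟩ := hj
            simp only [cAAA, hr] at j0 j1
            cases h6 : r 0 <;> rw [h6] at j0 j1 <;>
              simp only [Osc.spectrum, Set.mem_ofPred_eq, BoseRep.vac] at j0 j1 <;> omega
          · rw [hr]
            cases h6 : r 0 <;> simp [normVal, BoseRep.vac]
        · intro x hx hx'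
          constructor
          · intro hh
            simpa using ket_eigen_step c1 (a := (r 0).vac) ⟨hv, hx, ha.2.2⟩ (nz hx hx') hh
          · intro hh
            simpa using ket_eigen_step c1' (a := (r 0).vac) ⟨hv, hx', ha.2.2⟩ one_ne_zero hh
      · intro x hx hx'
        constructor
        · intro hh
          simpa using ket_eigen_step c0 (a := x) ⟨hx, ha.2⟩
            (mul_ne_zero (zpow_ne_zero _ hq) (nz hx hx')) hh
        · intro hh
          simpa using ket_eigen_step c0' (a := x + 1) ⟨hx', ha.2⟩ (zpow_ne_zero _ hq) hh
    · have hv : (r 2).vac ∈ (Osc.bose (r 2)).spectrum := vac_mem _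
      have hv1 : (r 1).vac ∈ (Osc.bose (r 1)).spectrum := vac_mem _
      refine spectrum_induction (s := r 2) (P := fun d => (T * T) (ket a b d) = ket a b d) ?_ ?_ d
        ha.2.2
      · refine spectrum_induction (s := r 1)
          (P := fun b => (T * T) (ket a b (r 2).vac) = ket a b (r 2).vac) ?_ ?_ b ha.2.1
        · refine hvac _ _ _ ⟨ha.1, hv1, hv⟩ rfl (fun j hj => ?_) ?_
          · obtain ⟨-, j1, j0⟩ := hj
            simp only [cAAA, hr] at j0 j1
            cases h6 : r 2 <;> rw [h6] at j0 j1 <;>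
              simp only [Osc.spectrum, Set.mem_ofPred_eq, BoseRep.vac] at j0 j1 <;> omega
          · rw [hr]
            cases h6 : r 2 <;> simp [normVal, BoseRep.vac]
        · intro x hx hx'
          constructor
          · intro hh
            simpa using ket_eigen_step c1 (a := a) ⟨ha.1, hx, hv⟩ (nz hx hx') hh
          · intro hh
            simpa using ket_eigen_step c1' (a := a) ⟨ha.1, hx', hv⟩ one_ne_zero hh
      · intro x hx hx'
        constructor
        · intro hh
          simpa using ket_eigen_step c2 (a := a) ⟨ha.1, ha.2.1, hx⟩
            (neg_ne_zero.2 (mul_ne_zero (nz hx hx') (mul_ne_zero hq (zpow_ne_zero _ hq)))) hh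
        · intro hh
          simpa using ket_eigen_step c2' (a := a) ⟨ha.1, ha.2.1, hx'⟩
            (neg_ne_zero.2 (mul_ne_zero hq (zpow_ne_zero _ hq))) hh
  have hone : T * T = 1 := Op.ext_ket fun a b d ha => hfix a b d ha
  intro n m
  rw [← hT]
  have h3 := hasSum_matEl_mul T T n m
  rw [hone] at h3
  convert h3 using 1
  rw [matEl, Module.End.one_apply, Finsupp.single_apply]
  simp only [eq_comm]

/-! ### Uniqueness of the purely bosonic intertwiner. -/

theorem zpow_injective_of_norm_lt_one {q : ℂ} (hq0 : 0 < ‖q‖) (hq1 : ‖q‖ < 1) :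
    Function.Injective fun n : ℤ => q ^ n := fun m n h => by
  by_contra hmn
  have h1 := one_sub_zpow_ne_zero hq0 hq1 (sub_ne_zero.2 hmn)
  rw [zpow_sub₀ (norm_pos_iff.1 hq0)] at h1
  have h2 : q ^ m = q ^ n := h
  rw [h2, div_self (zpow_ne_zero n (norm_pos_iff.1 hq0)), sub_self] at h1
  exact h1 rfl

/-- The coefficients of the part of an infinite matrix that lowers the first occupation number. -/
def lowerCoef (q : ℂ) (D : ℤ → ℤ → ℤ → ℤ → ℤ → ℤ → ℂ) (k : ℕ) (a b d : ℤ) : ℂ :=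
  D a b d (a + k) (b - k) (d + k) / boseE q k (b - k)

/-- The coefficients of the part of an infinite matrix that raises the first occupation number. -/
def upperCoef (q : ℂ) (D : ℤ → ℤ → ℤ → ℤ → ℤ → ℤ → ℂ) (k : ℕ) (a b d : ℤ) : ℂ :=
  D (a + k) (b - k) (d + k) a b d / (boseE q k a * boseE q k d)

section

variable {q : ℂ} (hq0 : 0 < ‖q‖) (hq1 : ‖q‖ < 1) {r : Fin 3 → BoseRep}
  {R : State (cAAA r) → State (cAAA r) → ℂ}

theorem coefSupp_lowerCoef (q : ℂ) (R : State (cAAA r) → State (cAAA r) → ℂ) :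
    CoefSupp (r 0) (r 1) (r 2) (lowerCoef q (kerExt R)) := by
  intro k a b d h
  rw [lowerCoef]
  by_cases h1 : Adm (cAAA r) a b d
  · rw [kerExt_of_not_right, zero_div]
    exact fun h2 => h ⟨⟨h1.1, h2.1⟩, ⟨h1.2.1, h2.2.1⟩, h1.2.2, h2.2.2⟩
  · rw [kerExt_of_not_left _ h1, zero_div]

theorem coefSupp_upperCoef (q : ℂ) (R : State (cAAA r) → State (cAAA r) → ℂ) :
    CoefSupp (r 0) (r 1) (r 2) (upperCoef q (kerExt R)) := by
  intro k a b d h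
  rw [upperCoef]
  by_cases h1 : Adm (cAAA r) a b d
  · rw [kerExt_of_not_left, zero_div]
    exact fun h2 => h ⟨⟨h1.1, h2.1⟩, ⟨h1.2.1, h2.2.1⟩, h1.2.2, h2.2.2⟩
  · rw [kerExt_of_not_right _ h1, zero_div]

include hq0 hq1

theorem kerExt_lower (k : ℕ) {a b d x y z : ℤ} (h0 : x = a + k) (h1 : y = b - k) (h2 : z = d + k) :
    kerExt R a b d x y z = boseE q k y * lowerCoef q (kerExt R) k a b d := by
  subst h0 h1 h2
  rw [lowerCoef]
  by_cases h : Adm (cAAA r) a b d ∧ Adm (cAAA r) (a + k) (b - k) (d + k)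
  · rw [mul_div_cancel₀]
    exact boseE_ne_zero hq0 hq1 h.2.2.1 (mem_of_mem_of_eq h.1.2.1 (by ring))
  · have : kerExt R a b d (a + k) (b - k) (d + k) = 0 := by
      by_contra h3
      exact h ⟨by_contra fun h4 => h3 (kerExt_of_not_left _ h4),
        by_contra fun h4 => h3 (kerExt_of_not_right _ h4)⟩
    rw [this, zero_div, mul_zero]

theorem kerExt_upper (k : ℕ) {a b d x y z : ℤ} (h0 : a = x + k) (h1 : b = y - k) (h2 : d = z + k) :
    kerExt R a b d x y z = boseE q k x * boseE q k z * upperCoef q (kerExt R) k x y z := by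
  subst h0 h1 h2
  rw [upperCoef]
  by_cases h : Adm (cAAA r) x y z ∧ Adm (cAAA r) (x + k) (y - k) (z + k)
  · rw [mul_div_cancel₀]
    exact mul_ne_zero (boseE_ne_zero hq0 hq1 h.1.1 h.2.1) (boseE_ne_zero hq0 hq1 h.1.2.2 h.2.2.2)
  · have : kerExt R (x + k) (y - k) (z + k) x y z = 0 := by
      by_contra h3
      exact h ⟨by_contra fun h4 => h3 (kerExt_of_not_right _ h4),
        by_contra fun h4 => h3 (kerExt_of_not_left _ h4)⟩
    rw [this, zero_div, mul_zero]

variable (h : Rels (.bose q 0) (.bose q 1) (.bose q 2) (Adm (cAAA r)) (kerExt R))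

include h

/-- The entries 00 and 22 are diagonal with eigenvalues proportional to q^(N₁+N₂) and q^(N₂+N₃), and
q is not a root of unity. -/
theorem kerExt_conserves {a b d x y z : ℤ} (hD : kerExt R a b d x y z ≠ 0) :
    a + b = x + y ∧ b + d = y + z := by
  have hq := norm_pos_iff.1 hq0
  have h1 : Adm (cAAA r) a b d := by_contra fun h4 => hD (kerExt_of_not_left _ h4)
  have h2 : Adm (cAAA r) x y z := by_contra fun h4 => hD (kerExt_of_not_right _ h4)
  have e0 := mul_right_cancel₀ hD (h.e00 a b d x y z h1 h2)
  have e2 := mul_right_cancel₀ hD (h.e22 a b d x y z h1 h2)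
  simp only [LData.bose, sel_zero, sel_one, sel_two] at e0 e2
  constructor
  · apply zpow_injective_of_norm_lt_one hq0 hq1
    simp only [zpow_add₀ hq]
    linear_combination e0
  · apply zpow_injective_of_norm_lt_one hq0 hq1
    simp only [zpow_add₀ hq]
    refine mul_left_cancel₀ (mul_ne_zero hq hq) ?_
    linear_combination e2

/-- The entries 02 and 20 of the intertwining relation, read on the lowering half, are the two
relations of `MidRels`. On the raising half, treated in `midRels_upperCoef`, the same two entries
exchange their roles. -/
theorem midRels_lowerCoef : MidRels q (r 0) (r 1) (r 2) (lowerCoef q (kerExt R)) := by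
  have hq := norm_pos_iff.1 hq0
  constructor
  · intro k a b d ha ha' hb hb' hd hd'
    have H := h.e02 a b d (a + k) (b - 1 - k) (d + k) ⟨ha, hb, hd⟩ ⟨ha', hb', hd'⟩
    simp only [LData.bose, sel_zero, sel_one, sel_two] at H
    rw [kerExt_lower hq0 hq1 (k + 1) (by push_cast; ring) (by push_cast; ring) (by push_cast; ring),
      kerExt_lower hq0 hq1 k rfl rfl rfl,
      kerExt_lower hq0 hq1 k rfl (by ring) rfl] at H
    have hE : boseE q (k + 1) (b - 1 - k) ≠ 0 := boseE_ne_zero hq0 hq1 hb'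
      (mem_of_mem_of_eq hb (by push_cast; ring))
    refine mul_left_cancel₀ hE ?_
    have e1 := boseE_succ_of_eq q k (x := b - 1 - k) (a := b) (by ring)
    have e2 := boseE_succ' q k (b - 1 - k)
    have e3 : q ^ (1 + a + d) = q * q ^ a * q ^ d := by rw [zpow_add₀ hq, zpow_add₀ hq, zpow_one]
    rw [show 2 * (a - 1) + 2 = 2 * a by ring, show 2 * (d - 1) + 2 = 2 * d by ring,
      show 2 * (b - 1) + 2 = 2 * b by ring, show 2 * (b - 1 - (k : ℤ)) + 2 =
        2 * (b - 1 - (k : ℤ) + 1) by ring] at H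
    rw [e3]
    linear_combination H - q * q ^ a * q ^ d * lowerCoef q (kerExt R) k a (b - 1) d * e1 -
      lowerCoef q (kerExt R) k a b d * e2
  · intro k a b d ha ha' hb hb' hd hd'
    have H := h.e20 a b d (a + k + 1) (b - k) (d + k + 1) ⟨ha, hb, hd⟩ ⟨ha', hb', hd'⟩
    simp only [LData.bose, sel_zero, sel_one, sel_two] at H
    rw [kerExt_lower hq0 hq1 (k + 1) (by push_cast; ring) (by push_cast; ring) (by push_cast; ring),
      kerExt_lower hq0 hq1 (k + 1) (by push_cast; ring) (by push_cast; ring) (by push_cast; ring),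
      kerExt_lower hq0 hq1 k (by ring) rfl (by ring)] at H
    have hE : boseE q k (b - k) ≠ 0 := boseE_ne_zero hq0 hq1 hb'
      (mem_of_mem_of_eq hb (by ring))
    refine mul_left_cancel₀ hE ?_
    have e1 := boseE_succ_of_eq q k (x := b - k) (a := b + 1) (by ring)
    have e2 := boseE_succ_sub q k (b - k)
    have e3 : q ^ (3 + a + d + 2 * k) = q * q ^ (d + k + 1) * q ^ (a + k + 1) := by
      rw [← zpow_one_add₀ hq, ← zpow_add₀ hq]; ring_nf
    rw [e3]
    linear_combination -H + q * q ^ (d + k + 1) * q ^ (a + k + 1) *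
      lowerCoef q (kerExt R) (k + 1) a b d * e2 + lowerCoef q (kerExt R) (k + 1) a (b + 1) d * e1

theorem midRels_upperCoef : MidRels q (r 0) (r 1) (r 2) (upperCoef q (kerExt R)) := by
  have hq := norm_pos_iff.1 hq0
  constructor
  · intro k a b d ha ha' hb hb' hd hd'
    have H := h.e20 (a + k) (b - 1 - k) (d + k) a b d ⟨ha', hb', hd'⟩ ⟨ha, hb, hd⟩
    simp only [LData.bose, sel_zero, sel_one, sel_two] at H
    rw [kerExt_upper hq0 hq1 k rfl (by ring) rfl,
      kerExt_upper hq0 hq1 k rfl rfl rfl,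
      kerExt_upper hq0 hq1 (k + 1) (by push_cast; ring) (by push_cast; ring)
        (by push_cast; ring)] at H
    have hE : boseE q k a * boseE q k d ≠ 0 :=
      mul_ne_zero (boseE_ne_zero hq0 hq1 ha ha') (boseE_ne_zero hq0 hq1 hd hd')
    refine mul_left_cancel₀ hE ?_
    have e3 : q ^ (1 + a + d) = q * q ^ a * q ^ d := by rw [zpow_add₀ hq, zpow_add₀ hq, zpow_one]
    rw [boseE_succ_sub, boseE_succ_sub] at H
    rw [e3]
    linear_combination -H
  · intro k a b d ha ha' hb hb' hd hd'
    have H := h.e02 (a + k + 1) (b - k) (d + k + 1) a b d ⟨ha', hb', hd'⟩ ⟨ha, hb, hd⟩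
    simp only [LData.bose, sel_zero, sel_one, sel_two] at H
    rw [kerExt_upper hq0 hq1 k (by ring) rfl (by ring),
      kerExt_upper hq0 hq1 (k + 1) (by push_cast; ring) (by push_cast; ring) (by push_cast; ring),
      kerExt_upper hq0 hq1 (k + 1) (by push_cast; ring) (by push_cast; ring)
        (by push_cast; ring)] at H
    have hE : boseE q (k + 1) a * boseE q (k + 1) d ≠ 0 :=
      mul_ne_zero (boseE_ne_zero hq0 hq1 ha (mem_of_mem_of_eq ha' (by push_cast; ring)))
        (boseE_ne_zero hq0 hq1 hd (mem_of_mem_of_eq hd' (by push_cast; ring)))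
    refine mul_left_cancel₀ hE ?_
    have e1 := boseE_succ_of_eq q k (x := a) (a := a + k + 1) (by ring)
    have e2 := boseE_succ_of_eq q k (x := d) (a := d + k + 1) (by ring)
    have e3 : q ^ (3 + a + d + 2 * k) = q * q ^ (d + k + 1) * q ^ (a + k + 1) := by
      rw [← zpow_one_add₀ hq, ← zpow_add₀ hq]; ring_nf
    rw [show 2 * (a + k + 1 - 1) + 2 = 2 * (a + k + 1) by ring,
      show 2 * (d + k + 1 - 1) + 2 = 2 * (d + k + 1) by ring,
      show 2 * (b - k - 1) + 2 = 2 * (b - k) by ring, show 2 * b + 2 = 2 * (b + 1) by ring] at H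
    rw [e3]
    rw [e1, e2] at H ⊢
    linear_combination H

/-- At the Fock vacuum the entry 01 loses its off-diagonal term to the factor 1 − q⁰ and becomes a
two-term recurrence. At the anti-Fock vacuum the entry 10 retains an off-diagonal element, which
`r02m` at k = 0 expresses through the diagonal one. -/
theorem kerExt_vac_succ_left {a d : ℤ} (ha : a ∈ (Osc.bose (r 0)).spectrum)
    (ha' : a + 1 ∈ (Osc.bose (r 0)).spectrum) (hd : d ∈ (Osc.bose (r 2)).spectrum) :
    kerExt R (a + 1) (r 1).vac d (a + 1) (r 1).vac d =
      q ^ (match r 1 with | .fock => d | .antiFock => -(d + 1)) *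
        kerExt R a (r 1).vac d a (r 1).vac d := by
  have hq := norm_pos_iff.1 hq0
  have hv : (r 1).vac ∈ (Osc.bose (r 1)).spectrum := vac_mem _
  have hM := (midRels_lowerCoef hq0 hq1 h).r02m 0 a (r 1).vac d ha
    (mem_of_mem_of_eq ha' (by simp)) hv (mem_of_mem_of_eq hv (by simp)) hd
  cases hr : r 1 with
  | fock =>
    have hv' : (0 : ℤ) ∈ (cAAA r 1).spectrum := by
      rw [hr] at hv
      change _ ∈ (Osc.bose (r 1)).spectrum
      rwa [hr]
    have H := h.e01 (a + 1) 0 d a 0 d ⟨ha', hv', hd⟩ ⟨ha, hv', hd⟩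
    simp only [LData.bose, sel_zero, sel_one, sel_two] at H
    rw [add_sub_cancel_right, zero_sub, mul_neg_one, neg_add_cancel, zpow_zero, sub_self, mul_zero,
      zero_mul, zero_mul, add_zero, one_mul] at H
    have hE : 1 - q ^ (2 * a + 2) ≠ 0 := one_sub_zpow_ne_zero hq0 hq1 (by
      cases h6 : r 0 <;> rw [h6] at ha ha' <;>
        simp only [Osc.spectrum, Set.mem_ofPred_eq] at ha ha' <;> omega)
    refine mul_left_cancel₀ hE ?_
    simp only [BoseRep.vac]
    linear_combination -H
  | antiFock =>
    have hv' : (-1 : ℤ) ∈ (cAAA r 1).spectrum := by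
      rw [hr] at hv
      change _ ∈ (Osc.bose (r 1)).spectrum
      rwa [hr]
    rw [hr] at hM
    simp only [BoseRep.vac] at hM ⊢
    have H := h.e10 a (-1) d (a + 1) (-1) d ⟨ha, hv', hd⟩ ⟨ha', hv', hd⟩
    simp only [LData.bose, sel_zero, sel_one, sel_two] at H
    rw [add_sub_cancel_right] at H
    have hz : q ^ (-(d + 1)) = q * (q ^ (-2 - d)) := by
      rw [← zpow_one_add₀ hq]; ring_nf
    have hz1 : q ^ d * q ^ d = q ^ (2 * d) := by rw [two_mul, zpow_add₀ hq]
    rw [hz]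
    refine mul_left_cancel₀ (inv_ne_zero hq) ?_
    rw [← mul_assoc, ← mul_assoc, inv_mul_cancel₀ hq, one_mul]
    rw [zpow_neg_one] at H
    -- If the third site cannot be raised then `d = -1`, and the off-diagonal term disappears
    -- through its factor 1 − q^(2d+2).
    by_cases hd' : d + 1 ∈ (Osc.bose (r 2)).spectrum
    · have hM := hM (mem_of_mem_of_eq hd' (by simp))
      rw [kerExt_lower hq0 hq1 1 (a := a) (b := -1) (d := d) (by simp) (by simp) (by simp)] at H
      have e0 := kerExt_lower hq0 hq1 (R := R) 0 (a := a) (b := -1) (d := d) (x := a) (y := -1)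
        (z := d) (by simp) (by simp) (by simp)
      rw [boseE_zero, one_mul] at e0
      rw [← e0] at hM
      have hE : boseE q 1 (-1 - 1) = 1 - q ^ (-2 : ℤ) := by simp [boseE]
      have hM' : kerExt R a (-1) d a (-1) d =
          q ^ (3 + a + d) * (boseE q 1 (-1 - 1) * lowerCoef q (kerExt R) 1 a (-1) d) := by
        rw [hE]
        simp only [neg_add_cancel, mul_zero, zpow_zero, sub_self, zero_mul, Nat.cast_zero, add_zero,
          zero_add, sub_zero, mul_neg_one] at hM
        linear_combination hM
      have e4 : q ^ (a + 1) = q ^ (-2 - d) * q ^ (3 + a + d) := by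
        rw [← zpow_add₀ hq]; ring_nf
      have e5 : q ^ (-2 - d) * q ^ (2 * d + 2) = q ^ d := by rw [← zpow_add₀ hq]; ring_nf
      rw [e4] at H
      linear_combination H - q ^ (-2 - d) * (1 - q ^ (2 * d + 2)) * hM' -
        kerExt R a (-1) d a (-1) d * e5
    · obtain rfl : d = -1 := by
        cases h6 : r 2 <;> rw [h6] at hd hd' <;>
          simp only [Osc.spectrum, Set.mem_ofPred_eq] at hd hd' <;> omega
      simpa [hq] using H

theorem kerExt_vac_succ_right {a d : ℤ} (ha : a ∈ (Osc.bose (r 0)).spectrum)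
    (hd : d ∈ (Osc.bose (r 2)).spectrum) (hd' : d + 1 ∈ (Osc.bose (r 2)).spectrum) :
    kerExt R a (r 1).vac (d + 1) a (r 1).vac (d + 1) =
      q ^ (match r 1 with | .fock => a | .antiFock => -(a + 1)) *
        kerExt R a (r 1).vac d a (r 1).vac d := by
  have hq := norm_pos_iff.1 hq0
  have hv : (r 1).vac ∈ (Osc.bose (r 1)).spectrum := vac_mem _
  have hM := fun h' => (midRels_lowerCoef hq0 hq1 h).r02m 0 a (r 1).vac d ha h' hv
    (mem_of_mem_of_eq hv (by simp)) hd (mem_of_mem_of_eq hd' (by simp))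
  cases hr : r 1 with
  | fock =>
    have hv' : (0 : ℤ) ∈ (cAAA r 1).spectrum := by
      rw [hr] at hv
      change _ ∈ (Osc.bose (r 1)).spectrum
      rwa [hr]
    have H := h.e12 a 0 (d + 1) a 0 d ⟨ha, hv', hd'⟩ ⟨ha, hv', hd⟩
    simp only [LData.bose, sel_zero, sel_one, sel_two] at H
    rw [add_sub_cancel_right, zero_sub, mul_neg_one, neg_add_cancel, zpow_zero, sub_self, mul_zero,
      zero_mul, zero_mul, add_zero] at H
    have hE : 1 - q ^ (2 * d + 2) ≠ 0 := one_sub_zpow_ne_zero hq0 hq1 (by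
      cases h6 : r 2 <;> rw [h6] at hd hd' <;>
        simp only [Osc.spectrum, Set.mem_ofPred_eq] at hd hd' <;> omega)
    refine mul_left_cancel₀ (mul_ne_zero hq hE) ?_
    simp only [BoseRep.vac]
    linear_combination H
  | antiFock =>
    have hv' : (-1 : ℤ) ∈ (cAAA r 1).spectrum := by
      rw [hr] at hv
      change _ ∈ (Osc.bose (r 1)).spectrum
      rwa [hr]
    rw [hr] at hM
    simp only [BoseRep.vac] at hM ⊢
    have H := h.e21 a (-1) d a (-1) (d + 1) ⟨ha, hv', hd⟩ ⟨ha, hv', hd'⟩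
    simp only [LData.bose, sel_zero, sel_one, sel_two] at H
    rw [add_sub_cancel_right] at H
    have hz : q ^ (-(a + 1)) = q * (q ^ (-2 - a)) := by
      rw [← zpow_one_add₀ hq]; ring_nf
    rw [hz]
    rw [zpow_neg_one, mul_inv_cancel₀ hq] at H
    by_cases ha' : a + 1 ∈ (Osc.bose (r 0)).spectrum
    · have hM := hM (mem_of_mem_of_eq ha' (by simp))
      rw [kerExt_lower hq0 hq1 1 (a := a) (b := -1) (d := d) (by simp) (by simp) (by simp)] at H
      have e0 := kerExt_lower hq0 hq1 (R := R) 0 (a := a) (b := -1) (d := d) (x := a) (y := -1)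
        (z := d) (by simp) (by simp) (by simp)
      rw [boseE_zero, one_mul] at e0
      rw [← e0] at hM
      have hE : boseE q 1 (-1 - 1) = 1 - q ^ (-2 : ℤ) := by simp [boseE]
      have hM' : kerExt R a (-1) d a (-1) d =
          q ^ (3 + a + d) * (boseE q 1 (-1 - 1) * lowerCoef q (kerExt R) 1 a (-1) d) := by
        rw [hE]
        simp only [neg_add_cancel, mul_zero, zpow_zero, sub_self, zero_mul, Nat.cast_zero, add_zero,
          zero_add, sub_zero, mul_neg_one] at hM
        linear_combination hM
      have e4 : q ^ (d + 1) = q ^ (-2 - a) * q ^ (3 + a + d) := by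
        rw [← zpow_add₀ hq]; ring_nf
      have e5 : q ^ (-2 - a) * q ^ (2 * a + 2) = q ^ a := by rw [← zpow_add₀ hq]; ring_nf
      rw [e4] at H
      linear_combination -H - q * q ^ (-2 - a) * (1 - q ^ (2 * a + 2)) * hM' -
        q * kerExt R a (-1) d a (-1) d * e5
    · obtain rfl : a = -1 := by
        cases h6 : r 0 <;> rw [h6] at ha ha' <;>
          simp only [Osc.spectrum, Set.mem_ofPred_eq] at ha ha' <;> omega
      simpa [hq] using H

theorem exists_kerExt_vac : ∃ t : ℂ, ∀ a d, a ∈ (Osc.bose (r 0)).spectrum →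
    d ∈ (Osc.bose (r 2)).spectrum →
    kerExt R a (r 1).vac d a (r 1).vac d = t * normVal q (r 1) a d := by
  have hq := norm_pos_iff.1 hq0
  have hn0 : ∀ a d, normVal q (r 1) a d ≠ 0 := fun a d => by
    cases r 1
    · exact zpow_ne_zero _ hq
    · exact neg_ne_zero.2 (zpow_ne_zero _ hq)
  have hl : ∀ a d, normVal q (r 1) (a + 1) d =
      q ^ (match r 1 with | .fock => d | .antiFock => -(d + 1)) * normVal q (r 1) a d := by
    intro a d
    cases r 1 <;> simp only [normVal]
    · rw [← zpow_add₀ hq]; ring_nf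
    · rw [mul_neg, ← zpow_add₀ hq]; ring_nf
  refine ⟨kerExt R (r 0).vac (r 1).vac (r 2).vac (r 0).vac (r 1).vac (r 2).vac /
    normVal q (r 1) (r 0).vac (r 2).vac, fun a d ha hd => ?_⟩
  refine spectrum_induction (s := r 0) (P := fun a => kerExt R a (r 1).vac d a (r 1).vac d =
    _ * normVal q (r 1) a d) ?_ ?_ a ha
  · refine spectrum_induction (s := r 2) (P := fun d => kerExt R (r 0).vac (r 1).vac d (r 0).vac
      (r 1).vac d = _ * normVal q (r 1) (r 0).vac d) ?_ ?_ d hd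
    · rw [div_mul_cancel₀ _ (hn0 _ _)]
    · intro x hx hx'
      rw [kerExt_vac_succ_right hq0 hq1 h (vac_mem _) hx hx', normVal_comm q (r 1) _ (x + 1), hl,
        normVal_comm q (r 1) x, mul_left_comm, mul_right_inj' (zpow_ne_zero _ hq)]
  · intro x hx hx'
    rw [kerExt_vac_succ_left hq0 hq1 h hx hx' hd, hl, mul_left_comm,
      mul_right_inj' (zpow_ne_zero _ hq)]

/-- Both halves of the intertwiner satisfy `MidRels` and have the same diagonal, whose values at the
vacuum of the second site are `t` times the prescribed ones. Uniqueness gives the same multiple of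
the family `Rk` for both halves, and conservation excludes all other matrix elements. -/
theorem exists_eq_smul_kernelAAA {Rk : ℕ → State (cAAA r) → ℂ} (hR : GenFun₁ q Rk) :
    ∃ t : ℂ, R = t • kernelAAA q r Rk := by
  obtain ⟨t, ht⟩ := exists_kerExt_vac hq0 hq1 h
  have hs := coefSupp_coefExt Rk
  obtain ⟨hM, hn⟩ := (outerGen_iff hq0 hq1 hs).1 ((genFun₁_iff hq0 hq1 Rk).1 hR)
  have hs' : CoefSupp (r 0) (r 1) (r 2) (fun k a b d => t * coefExt Rk k a b d) :=
    fun k a b d h => by simp only [hs k a b d h, mul_zero]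
  have hl : lowerCoef q (kerExt R) = fun k a b d => t * coefExt Rk k a b d :=
    MidRels.ext hq0 hq1 (coefSupp_lowerCoef q R) hs' (midRels_lowerCoef hq0 hq1 h) (hM.smul t)
      fun a d ha hd => by
        rw [hn a d ha hd, ← ht a d ha hd]
        simp [lowerCoef]
  have hu : upperCoef q (kerExt R) = fun k a b d => t * coefExt Rk k a b d :=
    MidRels.ext hq0 hq1 (coefSupp_upperCoef q R) hs' (midRels_upperCoef hq0 hq1 h) (hM.smul t)
      fun a d ha hd => by
        rw [hn a d ha hd, ← ht a d ha hd]
        simp [upperCoef]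
  refine ⟨t, ?_⟩
  funext n m
  rw [Pi.smul_apply, Pi.smul_apply, smul_eq_mul, kernelAAA_eq_serKer, ← kerExt_state R]
  by_cases hc : m.1 0 - n.1 0 = n.1 1 - m.1 1 ∧ m.1 0 - n.1 0 = m.1 2 - n.1 2
  · rcases le_total (n.1 0) (m.1 0) with h1 | h1
    · obtain ⟨k, hk⟩ := Int.le.dest h1
      rw [serKer_lower q _ k (by omega) (by omega) (by omega),
        kerExt_lower hq0 hq1 k (by omega) (by omega) (by omega), hl]
      ring
    · obtain ⟨k, hk⟩ := Int.le.dest h1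
      rw [serKer_upper q _ k (by omega) (by omega) (by omega),
        kerExt_upper hq0 hq1 k (by omega) (by omega) (by omega), hu]
      ring
  · rw [serKer_eq_zero q _ hc, mul_zero]
    by_contra h0
    have := kerExt_conserves hq0 hq1 h h0
    omega

end

theorem XA_dress_iff {q : ℂ} {r : Fin 3 → BoseRep} {lam mu : Fin 3 → ℂ} (hl : ∀ j, lam j ≠ 0)
    (hm : ∀ j, mu j ≠ 0) (R : State (cAAA r) → State (cAAA r) → ℂ) :
    KernelIntertwines (XA q (lam 0) (mu 0) 0) (XA q (lam 1) (mu 1) 1) (XA q (lam 2) (mu 2) 2)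
      (dressKernel lam mu ![1, 1, 1] R) ↔
    Rels (.bose q 0) (.bose q 1) (.bose q 2) (Adm (cAAA r)) (kerExt R) := by
  rw [XA_eq q _ _ (j := 0) rfl, XA_eq q _ _ (j := 1) rfl, XA_eq q _ _ (j := 2) rfl]
  exact kernelIntertwines_dress_iff _ _ _ R hl hm _ rfl rfl rfl rfl rfl rfl

theorem XA'_dress_iff {q : ℂ} {r : Fin 3 → BoseRep} {lam mu : Fin 3 → ℂ} (hl : ∀ j, lam j ≠ 0)
    (hm : ∀ j, mu j ≠ 0) (R : State (cAAA r) → State (cAAA r) → ℂ) :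
    KernelIntertwines (XA' q (lam 0) (mu 0) 0) (XA' q (lam 1) (mu 1) 1) (XA' q (lam 2) (mu 2) 2)
      (dressKernel lam mu ![-1, -1, -1] R) ↔
    Rels (.boseInv q 0) (.boseInv q 1) (.boseInv q 2) (Adm (cAAA r)) (kerExt R) := by
  rw [XA'_eq q _ _ (j := 0) rfl, XA'_eq q _ _ (j := 1) rfl, XA'_eq q _ _ (j := 2) rfl]
  exact kernelIntertwines_dress_iff _ _ _ R hl hm _ rfl rfl rfl rfl rfl rfl

theorem kernelAAA_unique {q : ℂ} (hq0 : 0 < ‖q‖) (hq1 : ‖q‖ < 1) {r : Fin 3 → BoseRep}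
    {Rk : ℕ → State (cAAA r) → ℂ} (hR : GenFun₁ q Rk) {lam mu : Fin 3 → ℂ} (hl : ∀ j, lam j ≠ 0)
    (hm : ∀ j, mu j ≠ 0) (R' : State (cAAA r) → State (cAAA r) → ℂ)
    (h : KernelIntertwines (XA q (lam 0) (mu 0) 0) (XA q (lam 1) (mu 1) 1)
      (XA q (lam 2) (mu 2) 2) R') :
    ∃ a : ℂ, R' = a • dressKernel lam mu ![1, 1, 1] (kernelAAA q r Rk) := by
  obtain ⟨R, rfl⟩ := exists_eq_dressKernel hl hm ![1, 1, 1] R'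
  obtain ⟨t, rfl⟩ := exists_eq_smul_kernelAAA hq0 hq1 ((XA_dress_iff hl hm R).1 h) hR
  exact ⟨t, dressKernel_smul _ _ _ _ _⟩

/-! ### The transposition symmetry of the fermionic intertwining relations -/

/-- The matrices of one set of relations are, up to scalar factors, the transposed matrices of
another, with the two sides exchanged. -/
def TransposeRel (c : Fin 3 → Osc) (X Y Z X' Y' Z' : LData) : Prop :=
  ∀ i j : Fin 3, ∃ t : ℂ, t ≠ 0 ∧
    lhsX (X'.toMatrix 0) (Y'.toMatrix 1) (Z'.toMatrix 2) j i =
      t • (rhsX (X.toMatrix 0) (Y.toMatrix 1) (Z.toMatrix 2) i j : Op c) ∧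
    rhsX (X'.toMatrix 0) (Y'.toMatrix 1) (Z'.toMatrix 2) j i =
      t • (lhsX (X.toMatrix 0) (Y.toMatrix 1) (Z.toMatrix 2) i j : Op c)

theorem neg_one_zpow_succ (a : ℤ) : (-1 : ℂ) ^ (a + 1) = -(-1) ^ a := by
  rw [zpow_add_one₀ (by norm_num), mul_neg_one]

theorem neg_one_zpow_pred (a : ℤ) : (-1 : ℂ) ^ (a + -1) = -(-1) ^ a := by
  rw [zpow_add₀ (by norm_num)]; norm_num

/-- The scalars are read off by comparing the entries; their signs reflect the anticommutation of
the Fermi operators when the factors are reversed. -/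
theorem transposeRel_FFA {q : ℂ} (hq : q ≠ 0) :
    TransposeRel c (.fermiInv q 0 fun _ _ _ => 1) (.fermiInv q 1 fun a _ _ => (-1) ^ a) (.bose q 2)
      (.fermi q 0 fun _ _ _ => 1) (.fermi q 1 fun a _ _ => (-1) ^ a) (.boseInv q 2) := by
  intro i j
  refine ⟨(!![q ^ 2, q ^ 2, q; -q ^ 2, q ^ 2, q; -q, q, 1] : Matrix (Fin 3) (Fin 3) ℂ) i j, ?_, ?_⟩
  · fin_cases i <;> fin_cases j <;> simp [hq]
  rw [lhsX_eq, rhsX_eq, lhsX_eq, rhsX_eq]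
  fin_cases i <;> fin_cases j <;>
    simp [LData.toMatrix, LData.bose, LData.boseInv, LData.fermi, LData.fermiInv, mono_mul_mono,
      smul_mono, smul_add, neg_one_zpow_succ, neg_one_zpow_pred]
  all_goals try refine And.intro ?_ ?_
  all_goals first
    | with_reducible refine mono_congr fun a b d => ?_
    | with_reducible refine mono_add_congr' (fun a b d => ?_) (fun a b d => ?_)
  all_goals field_simp
  all_goals try ring

theorem transposeRel_AFF {q : ℂ} (hq : q ≠ 0) :
    TransposeRel c (.bose q 0) (.fermi q 1 fun _ _ _ => 1) (.fermi q 2 fun _ b _ => (-1) ^ b)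
      (.boseInv q 0) (.fermiInv q 1 fun _ _ _ => 1) (.fermiInv q 2 fun _ b _ => (-1) ^ b) := by
  intro i j
  refine ⟨(!![1, q⁻¹, -q⁻¹; q⁻¹, (q ^ 2)⁻¹, -(q ^ 2)⁻¹; q⁻¹, (q ^ 2)⁻¹, (q ^ 2)⁻¹] :
    Matrix (Fin 3) (Fin 3) ℂ) i j, ?_, ?_⟩
  · fin_cases i <;> fin_cases j <;> simp [hq]
  rw [lhsX_eq, rhsX_eq, lhsX_eq, rhsX_eq]
  fin_cases i <;> fin_cases j <;>
    simp [LData.toMatrix, LData.bose, LData.boseInv, LData.fermi, LData.fermiInv, mono_mul_mono,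
      smul_mono, smul_add, neg_one_zpow_succ, neg_one_zpow_pred]
  all_goals try refine And.intro ?_ ?_
  all_goals first
    | with_reducible refine mono_congr fun a b d => ?_
    | with_reducible refine mono_add_congr' (fun a b d => ?_) (fun a b d => ?_)
  all_goals field_simp
  all_goals try ring

theorem transposeRel_FAF {q : ℂ} (hq : q ≠ 0) :
    TransposeRel c (.fermi q 0 fun _ _ _ => 1) (.bose q 1) (.fermiInv q 2 fun a _ _ => (-1) ^ a)
      (.fermiInv q 0 fun _ _ _ => 1) (.boseInv q 1) (.fermi q 2 fun a _ _ => (-1) ^ a) := by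
  intro i j
  refine ⟨(!![1, -1, 1; 1, 1, 1; 1, -1, 1] : Matrix (Fin 3) (Fin 3) ℂ) i j, ?_, ?_⟩
  · fin_cases i <;> fin_cases j <;> simp
  rw [lhsX_eq, rhsX_eq, lhsX_eq, rhsX_eq]
  fin_cases i <;> fin_cases j <;>
    simp [LData.toMatrix, LData.bose, LData.boseInv, LData.fermi, LData.fermiInv, mono_mul_mono,
      smul_mono, smul_add, neg_one_zpow_succ, neg_one_zpow_pred]
  all_goals try refine And.intro ?_ ?_
  all_goals first
    | with_reducible refine mono_congr fun a b d => ?_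
    | with_reducible refine mono_add_congr' (fun a b d => ?_) (fun a b d => ?_)
  all_goals field_simp
  all_goals try ring

theorem mul_comm_of_involutive {A B R : Op c} (hR : R * R = 1) (h : A * R = R * B) :
    B * R = R * A :=
  calc B * R = R * (R * B) * R := by rw [← mul_assoc, hR, one_mul]
    _ = R * A * (R * R) := by rw [← h]; simp only [mul_assoc]
    _ = R * A := by rw [hR, mul_one]

/-- An involutive intertwiner also satisfies the transposed relations. -/
theorem TransposeRel.intertwines {X Y Z X' Y' Z' : LData} (h : TransposeRel c X Y Z X' Y' Z')
    {R : Op c} (hR : R * R = 1)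
    (hi : Intertwines (X.toMatrix 0) (Y.toMatrix 1) (Z.toMatrix 2) R) :
    Intertwines (X'.toMatrix 0) (Y'.toMatrix 1) (Z'.toMatrix 2) R := by
  intro j i
  obtain ⟨t, -, e1, e2⟩ := h i j
  rw [e1, e2, smul_mul_assoc, mul_smul_comm, mul_comm_of_involutive hR (hi i j)]

/-- The product of an intertwiner and an involutive one commutes with all matrix entries. -/
theorem commute_of_intertwines {x₁ x₂ x₃ : Matrix (Fin 2) (Fin 2) (Op c)} {R R' : Op c}
    (hR : R * R = 1) (hi : Intertwines x₁ x₂ x₃ R) (hi' : Intertwines x₁ x₂ x₃ R') (i j : Fin 3) :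
    Commute (R' * R) (lhsX x₁ x₂ x₃ i j) := by
  have h1 := mul_comm_of_involutive hR (hi i j)
  change R' * R * _ = _ * (R' * R)
  rw [mul_assoc, ← h1, ← mul_assoc, ← hi' i j, mul_assoc]

/-! ### The action of the oscillators on basis vectors -/

/-- The formula for the action also holds on inadmissible, hence zero, kets, unless it would produce
an admissible state with nonzero coefficient. Thus boundary states need no separate treatment in
most computations. -/
theorem mono_ket_of {d e g : ℤ} {f : ℤ → ℤ → ℤ → ℂ} {a b k : ℤ}
    (h : Adm c a b k ∨ f a b k = 0 ∨ ¬Adm c (a + d) (b + e) (k + g)) :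
    mono d e g f (ket a b k : FockSpace c) = f a b k • ket (a + d) (b + e) (k + g) := by
  by_cases h1 : Adm c a b k
  · exact mono_ket _ _ _ _ h1
  · rw [ket_of_not_adm h1, map_zero]
    rcases h with h | h | h
    · exact absurd h h1
    · rw [h, zero_smul]
    · rw [ket_of_not_adm h, smul_zero]

theorem mono_diag_ket (f : ℤ → ℤ → ℤ → ℂ) (a b k : ℤ) :
    mono 0 0 0 f (ket a b k : FockSpace c) = f a b k • ket a b k := by
  by_cases h1 : Adm c a b k
  · simpa using mono_ket 0 0 0 f h1
  · rw [ket_of_not_adm h1, map_zero, smul_zero]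

theorem fermi_mem {j : Fin 3} (hj : c j = .fermi) (x : ℤ) :
    x ∈ (c j).spectrum ↔ x = 0 ∨ x = 1 := by
  rw [hj]
  rfl

theorem bose_up_cond {r : BoseRep} {x : ℤ} (h : x + 1 ∈ (Osc.bose r).spectrum) :
    x ∈ (Osc.bose r).spectrum ∨ x = -1 := by
  cases r <;> simp only [Osc.spectrum, Set.mem_ofPred_eq] at * <;> omega

/-- The annihilation operator of the representation `r` acts on the formal state `x` without
dropping into the spectrum from outside. -/
def NoDrop (r : BoseRep) (x : ℤ) : Prop := x = 0 → r = .fock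

theorem bose_dn_cond {r : BoseRep} {x : ℤ} (h : x - 1 ∈ (Osc.bose r).spectrum)
    (hx : NoDrop r x) : x ∈ (Osc.bose r).spectrum := by
  cases r <;> simp only [Osc.spectrum, Set.mem_ofPred_eq] at * <;> [omega; skip]
  rcases lt_or_ge x 0 with h1 | h1
  · exact h1
  · exact absurd (hx (by omega)) (by simp)

/-- These lemmas, one group per site, are rewriting rules for the finite checks below. They hold for
all integers at the other sites, admissible or not. -/
theorem mono_fermi_up_ket_0 (hj : c 0 = .fermi) (f : ℤ → ℤ → ℤ → ℂ) (x y : ℤ) :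
    mono 1 0 0 f (ket 0 x y : FockSpace c) = f 0 x y • ket 1 x y := by
  rw [mono_ket_of]
  · norm_num
  · by_cases h : Adm c 0 x y
    · exact .inl h
    · refine .inr (.inr fun h2 => h ?_)
      norm_num [Adm, fermi_mem hj] at h2 ⊢
      tauto

theorem mono_fermi_up_ket_zero_0 (hj : c 0 = .fermi) (f : ℤ → ℤ → ℤ → ℂ) (x y : ℤ) :
    mono 1 0 0 f (ket 1 x y : FockSpace c) = 0 := by
  have h2 : ¬Adm c (1 + 1) (x + 0) (y + 0) := by
    norm_num [Adm, fermi_mem hj]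
  rw [mono_ket_of (.inr (.inr h2)), ket_of_not_adm h2, smul_zero]

theorem mono_fermi_dn_ket_0 (hj : c 0 = .fermi) (f : ℤ → ℤ → ℤ → ℂ) (x y : ℤ) :
    mono (-1) 0 0 f (ket 1 x y : FockSpace c) = f 1 x y • ket 0 x y := by
  rw [mono_ket_of]
  · norm_num
  · by_cases h : Adm c 1 x y
    · exact .inl h
    · refine .inr (.inr fun h2 => h ?_)
      norm_num [Adm, fermi_mem hj] at h2 ⊢
      tauto

theorem mono_fermi_dn_ket_zero_0 (hj : c 0 = .fermi) (f : ℤ → ℤ → ℤ → ℂ) (x y : ℤ) :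
    mono (-1) 0 0 f (ket 0 x y : FockSpace c) = 0 := by
  have h2 : ¬Adm c (0 + (-1)) (x + 0) (y + 0) := by
    norm_num [Adm, fermi_mem hj]
  rw [mono_ket_of (.inr (.inr h2)), ket_of_not_adm h2, smul_zero]

/-- The only inadmissible occupation number from which raising reaches the spectrum is −1, and there
the coefficient is assumed to vanish, as 1 − q^(2n+2) does. -/
theorem mono_bose_up_ket_0 {r : BoseRep} (hj : c 0 = .bose r) {f : ℤ → ℤ → ℤ → ℂ}
    (hf : ∀ x y, f (-1) x y = 0) (x y z : ℤ) :
    mono 1 0 0 f (ket z x y : FockSpace c) = f z x y • ket (z + 1) x y := by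
  rw [mono_ket_of]
  · simp
  · by_cases h : Adm c z x y
    · exact .inl h
    · by_cases h2 : Adm c (z + 1) (x + 0) (y + 0)
      · refine .inr (.inl ?_)
        simp only [Adm, hj, add_zero] at h h2
        rcases bose_up_cond (x := z) (by tauto) with h3 | rfl
        · tauto
        · exact hf _ _
      · exact .inr (.inr h2)

theorem mono_bose_dn_ket_0 {r : BoseRep} (hj : c 0 = .bose r) (f : ℤ → ℤ → ℤ → ℂ)
    (x y : ℤ) {z : ℤ} (hz : NoDrop r z) :
    mono (-1) 0 0 f (ket z x y : FockSpace c) = f z x y • ket (z - 1) x y := by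
  rw [mono_ket_of]
  · simp [sub_eq_add_neg]
  · by_cases h : Adm c z x y
    · exact .inl h
    · refine .inr (.inr fun h2 => h ?_)
      simp only [Adm, hj, add_zero, ← sub_eq_add_neg] at h2 ⊢
      have h3 := bose_dn_cond (x := z) (by tauto) hz
      tauto

theorem mono_fermi_up_ket_1 (hj : c 1 = .fermi) (f : ℤ → ℤ → ℤ → ℂ) (x y : ℤ) :
    mono 0 1 0 f (ket x 0 y : FockSpace c) = f x 0 y • ket x 1 y := by
  rw [mono_ket_of]
  · norm_num
  · by_cases h : Adm c x 0 y
    · exact .inl h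
    · refine .inr (.inr fun h2 => h ?_)
      norm_num [Adm, fermi_mem hj] at h2 ⊢
      tauto

theorem mono_fermi_up_ket_zero_1 (hj : c 1 = .fermi) (f : ℤ → ℤ → ℤ → ℂ) (x y : ℤ) :
    mono 0 1 0 f (ket x 1 y : FockSpace c) = 0 := by
  have h2 : ¬Adm c (x + 0) (1 + 1) (y + 0) := by
    norm_num [Adm, fermi_mem hj]
  rw [mono_ket_of (.inr (.inr h2)), ket_of_not_adm h2, smul_zero]

theorem mono_fermi_dn_ket_1 (hj : c 1 = .fermi) (f : ℤ → ℤ → ℤ → ℂ) (x y : ℤ) :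
    mono 0 (-1) 0 f (ket x 1 y : FockSpace c) = f x 1 y • ket x 0 y := by
  rw [mono_ket_of]
  · norm_num
  · by_cases h : Adm c x 1 y
    · exact .inl h
    · refine .inr (.inr fun h2 => h ?_)
      norm_num [Adm, fermi_mem hj] at h2 ⊢
      tauto

theorem mono_fermi_dn_ket_zero_1 (hj : c 1 = .fermi) (f : ℤ → ℤ → ℤ → ℂ) (x y : ℤ) :
    mono 0 (-1) 0 f (ket x 0 y : FockSpace c) = 0 := by
  have h2 : ¬Adm c (x + 0) (0 + (-1)) (y + 0) := by
    norm_num [Adm, fermi_mem hj]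
  rw [mono_ket_of (.inr (.inr h2)), ket_of_not_adm h2, smul_zero]

theorem mono_bose_up_ket_1 {r : BoseRep} (hj : c 1 = .bose r) {f : ℤ → ℤ → ℤ → ℂ}
    (hf : ∀ x y, f x (-1) y = 0) (x y z : ℤ) :
    mono 0 1 0 f (ket x z y : FockSpace c) = f x z y • ket x (z + 1) y := by
  rw [mono_ket_of]
  · simp
  · by_cases h : Adm c x z y
    · exact .inl h
    · by_cases h2 : Adm c (x + 0) (z + 1) (y + 0)
      · refine .inr (.inl ?_)
        simp only [Adm, hj, add_zero] at h h2
        rcases bose_up_cond (x := z) (by tauto) with h3 | rfl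
        · tauto
        · exact hf _ _
      · exact .inr (.inr h2)

theorem mono_bose_dn_ket_1 {r : BoseRep} (hj : c 1 = .bose r) (f : ℤ → ℤ → ℤ → ℂ)
    (x y : ℤ) {z : ℤ} (hz : NoDrop r z) :
    mono 0 (-1) 0 f (ket x z y : FockSpace c) = f x z y • ket x (z - 1) y := by
  rw [mono_ket_of]
  · simp [sub_eq_add_neg]
  · by_cases h : Adm c x z y
    · exact .inl h
    · refine .inr (.inr fun h2 => h ?_)
      simp only [Adm, hj, add_zero, ← sub_eq_add_neg] at h2 ⊢
      have h3 := bose_dn_cond (x := z) (by tauto) hz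
      tauto

theorem mono_fermi_up_ket_2 (hj : c 2 = .fermi) (f : ℤ → ℤ → ℤ → ℂ) (x y : ℤ) :
    mono 0 0 1 f (ket x y 0 : FockSpace c) = f x y 0 • ket x y 1 := by
  rw [mono_ket_of]
  · norm_num
  · by_cases h : Adm c x y 0
    · exact .inl h
    · refine .inr (.inr fun h2 => h ?_)
      norm_num [Adm, fermi_mem hj] at h2 ⊢
      tauto

theorem mono_fermi_up_ket_zero_2 (hj : c 2 = .fermi) (f : ℤ → ℤ → ℤ → ℂ) (x y : ℤ) :
    mono 0 0 1 f (ket x y 1 : FockSpace c) = 0 := by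
  have h2 : ¬Adm c (x + 0) (y + 0) (1 + 1) := by
    norm_num [Adm, fermi_mem hj]
  rw [mono_ket_of (.inr (.inr h2)), ket_of_not_adm h2, smul_zero]

theorem mono_fermi_dn_ket_2 (hj : c 2 = .fermi) (f : ℤ → ℤ → ℤ → ℂ) (x y : ℤ) :
    mono 0 0 (-1) f (ket x y 1 : FockSpace c) = f x y 1 • ket x y 0 := by
  rw [mono_ket_of]
  · norm_num
  · by_cases h : Adm c x y 1
    · exact .inl h
    · refine .inr (.inr fun h2 => h ?_)
      norm_num [Adm, fermi_mem hj] at h2 ⊢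
      tauto

theorem mono_fermi_dn_ket_zero_2 (hj : c 2 = .fermi) (f : ℤ → ℤ → ℤ → ℂ) (x y : ℤ) :
    mono 0 0 (-1) f (ket x y 0 : FockSpace c) = 0 := by
  have h2 : ¬Adm c (x + 0) (y + 0) (0 + (-1)) := by
    norm_num [Adm, fermi_mem hj]
  rw [mono_ket_of (.inr (.inr h2)), ket_of_not_adm h2, smul_zero]

theorem mono_bose_up_ket_2 {r : BoseRep} (hj : c 2 = .bose r) {f : ℤ → ℤ → ℤ → ℂ}
    (hf : ∀ x y, f x y (-1) = 0) (x y z : ℤ) :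
    mono 0 0 1 f (ket x y z : FockSpace c) = f x y z • ket x y (z + 1) := by
  rw [mono_ket_of]
  · simp
  · by_cases h : Adm c x y z
    · exact .inl h
    · by_cases h2 : Adm c (x + 0) (y + 0) (z + 1)
      · refine .inr (.inl ?_)
        simp only [Adm, hj, add_zero] at h h2
        rcases bose_up_cond (x := z) (by tauto) with h3 | rfl
        · tauto
        · exact hf _ _
      · exact .inr (.inr h2)

theorem mono_bose_dn_ket_2 {r : BoseRep} (hj : c 2 = .bose r) (f : ℤ → ℤ → ℤ → ℂ)
    (x y : ℤ) {z : ℤ} (hz : NoDrop r z) :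
    mono 0 0 (-1) f (ket x y z : FockSpace c) = f x y z • ket x y (z - 1) := by
  rw [mono_ket_of]
  · simp [sub_eq_add_neg]
  · by_cases h : Adm c x y z
    · exact .inl h
    · refine .inr (.inr fun h2 => h ?_)
      simp only [Adm, hj, add_zero, ← sub_eq_add_neg] at h2 ⊢
      have h3 := bose_dn_cond (x := z) (by tauto) hz
      tauto

/-! ### The oscillators in the fermionic patterns -/

theorem oddSign_zero {c : Fin 3 → Osc} (n : State c) : oddSign 0 n = 1 := by
  simp [oddSign]

theorem oddSign_FFA_one {b : BoseRep} (n : State (cFFA b)) : oddSign 1 n = (-1) ^ n.1 0 := by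
  simp [oddSign, Fin.prod_univ_three]

theorem oddSign_AFF_one {b : BoseRep} (n : State (cAFF b)) : oddSign 1 n = 1 := by
  simp [oddSign]

theorem oddSign_AFF_two {b : BoseRep} (n : State (cAFF b)) : oddSign 2 n = (-1) ^ n.1 1 := by
  simp [oddSign, Fin.prod_univ_three]

theorem oddSign_FAF_two {b : BoseRep} (n : State (cFAF b)) : oddSign 2 n = (-1) ^ n.1 0 := by
  simp [oddSign, Fin.prod_univ_three]

theorem FFA_up_0 (q : ℂ) (b : BoseRep) : (up q 0 : Op (cFFA b)) = mono 1 0 0 (fun _ _ _ => 1) :=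
  up_fermi_eq_mono (c := cFFA b) q (j := 0) rfl (ε := fun _ _ _ => 1) oddSign_zero

theorem FFA_dn_0 (q : ℂ) (b : BoseRep) :
    (dn q 0 : Op (cFFA b)) = mono (-1) 0 0 (fun _ _ _ => 1 * (1 - q ^ 2)) :=
  dn_fermi_eq_mono (c := cFFA b) q (j := 0) rfl (ε := fun _ _ _ => 1) oddSign_zero

theorem FFA_up_1 (q : ℂ) (b : BoseRep) : (up q 1 : Op (cFFA b)) = mono 0 1 0 (fun a _ _ => (-1) ^ a) :=
  up_fermi_eq_mono (c := cFFA b) q (j := 1) rfl (ε := fun a _ _ => (-1) ^ a) oddSign_FFA_one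

theorem FFA_dn_1 (q : ℂ) (b : BoseRep) :
    (dn q 1 : Op (cFFA b)) = mono 0 (-1) 0 (fun a _ _ => (-1) ^ a * (1 - q ^ 2)) :=
  dn_fermi_eq_mono (c := cFFA b) q (j := 1) rfl (ε := fun a _ _ => (-1) ^ a) oddSign_FFA_one

theorem FFA_up_2 (q : ℂ) (b : BoseRep) :
    (up q 2 : Op (cFFA b)) = mono 0 0 1 (fun _ _ d => 1 - q ^ (2 * d + 2)) :=
  up_bose_eq_mono (c := cFFA b) q (j := 2) rfl

theorem FFA_dn_2 (q : ℂ) (b : BoseRep) :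
    (dn q 2 : Op (cFFA b)) = mono 0 0 (-1) (fun _ _ _ => 1) :=
  dn_bose_eq_mono (c := cFFA b) q (j := 2) rfl

theorem AFF_up_0 (q : ℂ) (b : BoseRep) :
    (up q 0 : Op (cAFF b)) = mono 1 0 0 (fun a _ _ => 1 - q ^ (2 * a + 2)) :=
  up_bose_eq_mono (c := cAFF b) q (j := 0) rfl

theorem AFF_dn_0 (q : ℂ) (b : BoseRep) :
    (dn q 0 : Op (cAFF b)) = mono (-1) 0 0 (fun _ _ _ => 1) :=
  dn_bose_eq_mono (c := cAFF b) q (j := 0) rfl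

theorem AFF_up_1 (q : ℂ) (b : BoseRep) : (up q 1 : Op (cAFF b)) = mono 0 1 0 (fun _ _ _ => 1) :=
  up_fermi_eq_mono (c := cAFF b) q (j := 1) rfl (ε := fun _ _ _ => 1) oddSign_AFF_one

theorem AFF_dn_1 (q : ℂ) (b : BoseRep) :
    (dn q 1 : Op (cAFF b)) = mono 0 (-1) 0 (fun _ _ _ => 1 * (1 - q ^ 2)) :=
  dn_fermi_eq_mono (c := cAFF b) q (j := 1) rfl (ε := fun _ _ _ => 1) oddSign_AFF_one

theorem AFF_up_2 (q : ℂ) (b : BoseRep) : (up q 2 : Op (cAFF b)) = mono 0 0 1 (fun _ b _ => (-1) ^ b) :=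
  up_fermi_eq_mono (c := cAFF b) q (j := 2) rfl (ε := fun _ b _ => (-1) ^ b) oddSign_AFF_two

theorem AFF_dn_2 (q : ℂ) (b : BoseRep) :
    (dn q 2 : Op (cAFF b)) = mono 0 0 (-1) (fun _ b _ => (-1) ^ b * (1 - q ^ 2)) :=
  dn_fermi_eq_mono (c := cAFF b) q (j := 2) rfl (ε := fun _ b _ => (-1) ^ b) oddSign_AFF_two

theorem FAF_up_0 (q : ℂ) (b : BoseRep) : (up q 0 : Op (cFAF b)) = mono 1 0 0 (fun _ _ _ => 1) :=
  up_fermi_eq_mono (c := cFAF b) q (j := 0) rfl (ε := fun _ _ _ => 1) oddSign_zero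

theorem FAF_dn_0 (q : ℂ) (b : BoseRep) :
    (dn q 0 : Op (cFAF b)) = mono (-1) 0 0 (fun _ _ _ => 1 * (1 - q ^ 2)) :=
  dn_fermi_eq_mono (c := cFAF b) q (j := 0) rfl (ε := fun _ _ _ => 1) oddSign_zero

theorem FAF_up_1 (q : ℂ) (b : BoseRep) :
    (up q 1 : Op (cFAF b)) = mono 0 1 0 (fun _ b _ => 1 - q ^ (2 * b + 2)) :=
  up_bose_eq_mono (c := cFAF b) q (j := 1) rfl

theorem FAF_dn_1 (q : ℂ) (b : BoseRep) :
    (dn q 1 : Op (cFAF b)) = mono 0 (-1) 0 (fun _ _ _ => 1) :=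
  dn_bose_eq_mono (c := cFAF b) q (j := 1) rfl

theorem FAF_up_2 (q : ℂ) (b : BoseRep) : (up q 2 : Op (cFAF b)) = mono 0 0 1 (fun a _ _ => (-1) ^ a) :=
  up_fermi_eq_mono (c := cFAF b) q (j := 2) rfl (ε := fun a _ _ => (-1) ^ a) oddSign_FAF_two

theorem FAF_dn_2 (q : ℂ) (b : BoseRep) :
    (dn q 2 : Op (cFAF b)) = mono 0 0 (-1) (fun a _ _ => (-1) ^ a * (1 - q ^ 2)) :=
  dn_fermi_eq_mono (c := cFAF b) q (j := 2) rfl (ε := fun a _ _ => (-1) ^ a) oddSign_FAF_two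

/-- Conservation leaves subspaces of dimension at most two, spanned by `ket 0 1 z` and `ket 1 0 (z -
1)` or by a single ket. The condition `NoDrop` in place of membership allows the formulas to be
applied again to the shifted kets they produce. -/
theorem RFFA_ket {q : ℂ} {b : BoseRep} (hq2 : 1 - q ^ 2 ≠ 0) {z : ℤ} (hz : NoDrop b z) :
    RFFA q b (ket 0 0 z) = ket 0 0 z ∧
    RFFA q b (ket 0 1 z) = ket 1 0 (z - 1) - q ^ z • ket 0 1 z ∧
    RFFA q b (ket 1 0 z) = (q * q ^ z) • ket 1 0 z + (1 - q ^ (2 * z + 2)) • ket 0 1 (z + 1) ∧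
    RFFA q b (ket 1 1 z) = -ket 1 1 z := by
  refine ⟨?_, ?_, ?_, ?_⟩ <;>
    simp [RFFA, num_eq_mono, pw_eq_mono, FFA_up_0, FFA_dn_0, FFA_up_1, FFA_dn_1, FFA_up_2,
    FFA_dn_2, mono_diag_ket, mono_fermi_up_ket_0 (c := cFFA b) rfl,
    mono_fermi_up_ket_zero_0 (c := cFFA b) rfl, mono_fermi_dn_ket_0 (c := cFFA b) rfl,
    mono_fermi_dn_ket_zero_0 (c := cFFA b) rfl, mono_fermi_up_ket_1 (c := cFFA b) rfl,
    mono_fermi_up_ket_zero_1 (c := cFFA b) rfl, mono_fermi_dn_ket_1 (c := cFFA b) rfl,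
    mono_fermi_dn_ket_zero_1 (c := cFFA b) rfl, mono_bose_up_ket_2 (c := cFFA b) rfl,
    mono_bose_dn_ket_2 (c := cFFA b) rfl, hz, hq2, smul_smul]
  all_goals try match_scalars <;> field_simp

theorem RAFF_ket {q : ℂ} {b : BoseRep} (hq2 : 1 - q ^ 2 ≠ 0) {z : ℤ} (hz : NoDrop b z) :
    RAFF q b (ket z 0 0) = ket z 0 0 ∧
    RAFF q b (ket z 0 1) = ket (z - 1) 1 0 + q ^ z • ket z 0 1 ∧
    RAFF q b (ket z 1 0) = -(q * q ^ z) • ket z 1 0 + (1 - q ^ (2 * z + 2)) • ket (z + 1) 0 1 ∧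
    RAFF q b (ket z 1 1) = -ket z 1 1 := by
  refine ⟨?_, ?_, ?_, ?_⟩ <;>
    simp [RAFF, num_eq_mono, pw_eq_mono, AFF_up_0, AFF_dn_0, AFF_up_1, AFF_dn_1, AFF_up_2,
    AFF_dn_2, mono_diag_ket, mono_bose_up_ket_0 (c := cAFF b) rfl,
    mono_bose_dn_ket_0 (c := cAFF b) rfl, mono_fermi_up_ket_1 (c := cAFF b) rfl,
    mono_fermi_up_ket_zero_1 (c := cAFF b) rfl, mono_fermi_dn_ket_1 (c := cAFF b) rfl,
    mono_fermi_dn_ket_zero_1 (c := cAFF b) rfl, mono_fermi_up_ket_2 (c := cAFF b) rfl,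
    mono_fermi_up_ket_zero_2 (c := cAFF b) rfl, mono_fermi_dn_ket_2 (c := cAFF b) rfl,
    mono_fermi_dn_ket_zero_2 (c := cAFF b) rfl, hz, hq2, smul_smul]
  all_goals try match_scalars <;> field_simp

section FAF

variable {q : ℂ} (hq : q ≠ 0)

include hq

theorem neg_inv_zpow_add_one (n : ℤ) : (-q⁻¹) ^ (n + 1) = (-q⁻¹) ^ n * -q⁻¹ :=
  zpow_add_one₀ (neg_ne_zero.2 (inv_ne_zero hq)) n

theorem neg_inv_zpow_sub_one (n : ℤ) : (-q⁻¹) ^ (n - 1) = (-q⁻¹) ^ n * (-q⁻¹)⁻¹ :=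
  zpow_sub_one₀ (neg_ne_zero.2 (inv_ne_zero hq)) n

end FAF

theorem RFAF_ket {q : ℂ} {b : BoseRep} (hq : q ≠ 0) (hq2 : 1 - q ^ 2 ≠ 0) {z : ℤ} (hz : NoDrop b z) :
    RFAF q b (ket 0 z 0) = ((-q⁻¹) ^ z * q ^ z) • ket 0 z 0 ∧
    RFAF q b (ket 0 z 1) = (-q⁻¹) ^ z • ket 0 z 1 - (-q⁻¹) ^ z • ket 1 (z - 1) 0 ∧
    RFAF q b (ket 1 z 0) = ((-q⁻¹) ^ z * q⁻¹) • ket 1 z 0 -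
        ((-q⁻¹) ^ z * q⁻¹ * (1 - q ^ (2 * z + 2))) • ket 0 (z + 1) 1 ∧
    RFAF q b (ket 1 z 1) = ((-q⁻¹) ^ z * q ^ z) • ket 1 z 1 := by
  refine ⟨?_, ?_, ?_, ?_⟩ <;>
    simp [neg_inv_zpow_add_one hq, neg_inv_zpow_sub_one hq, RFAF, num_eq_mono, pw_eq_mono,
    FAF_up_0, FAF_dn_0, FAF_up_1, FAF_dn_1, FAF_up_2, FAF_dn_2, mono_diag_ket,
    mono_fermi_up_ket_0 (c := cFAF b) rfl, mono_fermi_up_ket_zero_0 (c := cFAF b) rfl,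
    mono_fermi_dn_ket_0 (c := cFAF b) rfl, mono_fermi_dn_ket_zero_0 (c := cFAF b) rfl,
    mono_bose_up_ket_1 (c := cFAF b) rfl, mono_bose_dn_ket_1 (c := cFAF b) rfl,
    mono_fermi_up_ket_2 (c := cFAF b) rfl, mono_fermi_up_ket_zero_2 (c := cFAF b) rfl,
    mono_fermi_dn_ket_2 (c := cFAF b) rfl, mono_fermi_dn_ket_zero_2 (c := cFAF b) rfl, hz, hq2,
    smul_smul]
  all_goals try match_scalars <;> field_simp

theorem noDrop_of_mem {r : BoseRep} {x : ℤ} (h : x ∈ (Osc.bose r).spectrum) : NoDrop r x := by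
  rintro rfl
  cases r
  · rfl
  · exact absurd h (lt_irrefl (0 : ℤ))

theorem noDrop_pred_of_mem {r : BoseRep} {x : ℤ} (h : x ∈ (Osc.bose r).spectrum) :
    NoDrop r (x - 1) := by
  intro hx
  cases r
  · rfl
  · have h1 : x < 0 := h
    omega

theorem eq_of_not_noDrop {r : BoseRep} {x : ℤ} (h : x ∈ (Osc.bose r).spectrum)
    (h' : ¬NoDrop r (x + 1)) : x = -1 ∧ r = .antiFock := by
  rw [NoDrop, Classical.not_imp] at h'
  exact ⟨by omega, by cases r <;> simp_all⟩

theorem zpow_two_mul_add_two {q : ℂ} (hq : q ≠ 0) (n : ℤ) :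
    q ^ (2 * n + 2) = q ^ n * q ^ n * q ^ 2 := by
  rw [zpow_add₀ hq, two_mul, zpow_add₀ hq]
  rfl

theorem RFFA_mul_self {q : ℂ} (hq : q ≠ 0) (hq2 : 1 - q ^ 2 ≠ 0) (b : BoseRep) :
    RFFA q b * RFFA q b = 1 := by
  refine Op.ext_ket fun x y z ⟨hx, hy, hz⟩ => ?_
  have z1 : NoDrop b z := noDrop_of_mem hz
  have z2 : NoDrop b (z - 1) := noDrop_pred_of_mem hz
  have z4 : NoDrop b (-2) := fun h => absurd h (by norm_num)
  -- The formulas fail at `z + 1` only for the anti-Fock state `z = -1`, where the ket with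
  -- occupation number 0 is itself zero.
  have z5 : NoDrop b (z + 1) ∨ z = -1 ∧ ∀ x y, (ket x y 0 : FockSpace (cFFA b)) = 0 := by
    refine or_iff_not_imp_left.2 fun h => ?_
    obtain ⟨h1, rfl⟩ := eq_of_not_noDrop hz h
    exact ⟨h1, fun x y => ket_of_not_adm fun h => absurd h.2.2 (lt_irrefl (0 : ℤ))⟩
  rcases hx with rfl | rfl <;> rcases hy with rfl | rfl <;> rcases z5 with z5 | ⟨rfl, z5⟩ <;>
    simp [RFFA_ket hq2, z1, z2, z4, z5, smul_sub, smul_add, smul_smul]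
  all_goals try simp only [zpow_two_mul_add_two hq, zpow_add_one₀ hq, zpow_sub_one₀ hq]
  all_goals try match_scalars <;> field_simp <;> ring

set_option maxHeartbeats 4000000 in
-- A finite check: four states of the Fermi pair, nine entries, and the exceptional boundary state
-- of the Bose site; each reduces to a polynomial identity in q and qᶻ.
theorem RFFA_intertwines {q : ℂ} (hq : q ≠ 0) (hq2 : 1 - q ^ 2 ≠ 0) (b : BoseRep) :
    Intertwines ((LData.fermiInv q 0 fun _ _ _ => 1).toMatrix 0) ((LData.fermiInv q 1 fun a _ _ => (-1) ^ a).toMatrix 1)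
      ((LData.bose q 2).toMatrix 2) (RFFA q b) := by
  intro i j
  refine Op.ext_ket fun x y z ⟨hx, hy, hz⟩ => ?_
  have z1 : NoDrop b z := noDrop_of_mem hz
  have z2 : NoDrop b (z - 1) := noDrop_pred_of_mem hz
  have z4 : NoDrop b (-2) := fun h => absurd h (by norm_num)
  have z5 : NoDrop b (z + 1) ∨ z = -1 ∧ ∀ x y, (ket x y 0 : FockSpace (cFFA b)) = 0 := by
    refine or_iff_not_imp_left.2 fun h => ?_
    obtain ⟨h1, rfl⟩ := eq_of_not_noDrop hz h
    exact ⟨h1, fun x y => ket_of_not_adm fun h => absurd h.2.2 (lt_irrefl (0 : ℤ))⟩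
  rw [lhsX_eq, rhsX_eq]
  rcases hx with rfl | rfl <;> rcases hy with rfl | rfl <;> rcases z5 with z5 | ⟨rfl, z5⟩ <;>
    fin_cases i <;> fin_cases j <;>
    simp [z1, z2, z4, z5, LData.toMatrix, LData.bose, LData.fermiInv, mono_diag_ket,
    RFFA_ket hq2, mono_fermi_up_ket_0 (c := cFFA b) rfl,
    mono_fermi_up_ket_zero_0 (c := cFFA b) rfl, mono_fermi_dn_ket_0 (c := cFFA b) rfl,
    mono_fermi_dn_ket_zero_0 (c := cFFA b) rfl, mono_fermi_up_ket_1 (c := cFFA b) rfl,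
    mono_fermi_up_ket_zero_1 (c := cFFA b) rfl, mono_fermi_dn_ket_1 (c := cFFA b) rfl,
    mono_fermi_dn_ket_zero_1 (c := cFFA b) rfl, mono_bose_up_ket_2 (c := cFFA b) rfl,
    mono_bose_dn_ket_2 (c := cFFA b) rfl, smul_sub, smul_add, smul_smul]
  all_goals try simp only [zpow_two_mul_add_two hq, zpow_add_one₀ hq, zpow_sub_one₀ hq]
  all_goals try match_scalars <;> field_simp <;> try ring

theorem RAFF_mul_self {q : ℂ} (hq : q ≠ 0) (hq2 : 1 - q ^ 2 ≠ 0) (b : BoseRep) :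
    RAFF q b * RAFF q b = 1 := by
  refine Op.ext_ket fun z x y ⟨hz, hx, hy⟩ => ?_
  have z1 : NoDrop b z := noDrop_of_mem hz
  have z2 : NoDrop b (z - 1) := noDrop_pred_of_mem hz
  have z4 : NoDrop b (-2) := fun h => absurd h (by norm_num)
  have z5 : NoDrop b (z + 1) ∨ z = -1 ∧ ∀ x y, (ket 0 x y : FockSpace (cAFF b)) = 0 := by
    refine or_iff_not_imp_left.2 fun h => ?_
    obtain ⟨h1, rfl⟩ := eq_of_not_noDrop hz h
    exact ⟨h1, fun x y => ket_of_not_adm fun h => absurd h.1 (lt_irrefl (0 : ℤ))⟩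
  rcases hx with rfl | rfl <;> rcases hy with rfl | rfl <;> rcases z5 with z5 | ⟨rfl, z5⟩ <;>
    simp [RAFF_ket hq2, z1, z2, z4, z5, smul_sub, smul_add, smul_smul]
  all_goals try simp only [zpow_two_mul_add_two hq, zpow_add_one₀ hq, zpow_sub_one₀ hq]
  all_goals try match_scalars <;> field_simp <;> ring

set_option maxHeartbeats 4000000 in
theorem RAFF_intertwines {q : ℂ} (hq : q ≠ 0) (hq2 : 1 - q ^ 2 ≠ 0) (b : BoseRep) :
    Intertwines ((LData.bose q 0).toMatrix 0) ((LData.fermi q 1 fun _ _ _ => 1).toMatrix 1)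
      ((LData.fermi q 2 fun _ b _ => (-1) ^ b).toMatrix 2) (RAFF q b) := by
  intro i j
  refine Op.ext_ket fun z x y ⟨hz, hx, hy⟩ => ?_
  have z1 : NoDrop b z := noDrop_of_mem hz
  have z2 : NoDrop b (z - 1) := noDrop_pred_of_mem hz
  have z4 : NoDrop b (-2) := fun h => absurd h (by norm_num)
  have z5 : NoDrop b (z + 1) ∨ z = -1 ∧ ∀ x y, (ket 0 x y : FockSpace (cAFF b)) = 0 := by
    refine or_iff_not_imp_left.2 fun h => ?_
    obtain ⟨h1, rfl⟩ := eq_of_not_noDrop hz h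
    exact ⟨h1, fun x y => ket_of_not_adm fun h => absurd h.1 (lt_irrefl (0 : ℤ))⟩
  rw [lhsX_eq, rhsX_eq]
  rcases hx with rfl | rfl <;> rcases hy with rfl | rfl <;> rcases z5 with z5 | ⟨rfl, z5⟩ <;>
    fin_cases i <;> fin_cases j <;>
    simp [z1, z2, z4, z5, LData.toMatrix, LData.bose, LData.fermi, mono_diag_ket, RAFF_ket hq2,
    mono_bose_up_ket_0 (c := cAFF b) rfl, mono_bose_dn_ket_0 (c := cAFF b) rfl,
    mono_fermi_up_ket_1 (c := cAFF b) rfl, mono_fermi_up_ket_zero_1 (c := cAFF b) rfl,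
    mono_fermi_dn_ket_1 (c := cAFF b) rfl, mono_fermi_dn_ket_zero_1 (c := cAFF b) rfl,
    mono_fermi_up_ket_2 (c := cAFF b) rfl, mono_fermi_up_ket_zero_2 (c := cAFF b) rfl,
    mono_fermi_dn_ket_2 (c := cAFF b) rfl, mono_fermi_dn_ket_zero_2 (c := cAFF b) rfl, smul_sub,
    smul_add, smul_smul]
  all_goals try simp only [zpow_two_mul_add_two hq, zpow_add_one₀ hq, zpow_sub_one₀ hq]
  all_goals try match_scalars <;> field_simp <;> try ring

theorem RFAF_mul_self {q : ℂ} (hq : q ≠ 0) (hq2 : 1 - q ^ 2 ≠ 0) (b : BoseRep) :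
    RFAF q b * RFAF q b = 1 := by
  refine Op.ext_ket fun x z y ⟨hx, hz, hy⟩ => ?_
  -- The product of the bases is −1, and the even exponent removes the sign; this is the only
  -- nonpolynomial fact about powers in the check.
  have z3 : ((-q⁻¹) ^ z) ^ 2 * (q ^ z) ^ 2 = 1 := by
    rw [← mul_pow, ← mul_zpow, neg_mul, inv_mul_cancel₀ hq, ← zpow_natCast, zpow_comm]
    norm_num
  have z1 : NoDrop b z := noDrop_of_mem hz
  have z2 : NoDrop b (z - 1) := noDrop_pred_of_mem hz
  have z4 : NoDrop b (-2) := fun h => absurd h (by norm_num)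
  have z5 : NoDrop b (z + 1) ∨ z = -1 ∧ ∀ x y, (ket x 0 y : FockSpace (cFAF b)) = 0 := by
    refine or_iff_not_imp_left.2 fun h => ?_
    obtain ⟨h1, rfl⟩ := eq_of_not_noDrop hz h
    exact ⟨h1, fun x y => ket_of_not_adm fun h => absurd h.2.1 (lt_irrefl (0 : ℤ))⟩
  rcases hx with rfl | rfl <;> rcases hy with rfl | rfl <;> rcases z5 with z5 | ⟨rfl, z5⟩ <;>
    simp [RFAF_ket hq hq2, z1, z2, z4, z5, smul_sub, smul_add, smul_smul]
  all_goals try simp only [zpow_two_mul_add_two hq, zpow_add_one₀ hq, zpow_sub_one₀ hq, neg_inv_zpow_add_one hq, neg_inv_zpow_sub_one hq]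
  all_goals try match_scalars <;> field_simp <;> try ring
  all_goals first | linear_combination z3 | linear_combination q ^ 2 * z3

set_option maxHeartbeats 4000000 in
theorem RFAF_intertwines {q : ℂ} (hq : q ≠ 0) (hq2 : 1 - q ^ 2 ≠ 0) (b : BoseRep) :
    Intertwines ((LData.fermi q 0 fun _ _ _ => 1).toMatrix 0) ((LData.bose q 1).toMatrix 1)
      ((LData.fermiInv q 2 fun a _ _ => (-1) ^ a).toMatrix 2) (RFAF q b) := by
  intro i j
  refine Op.ext_ket fun x z y ⟨hx, hz, hy⟩ => ?_
  have z1 : NoDrop b z := noDrop_of_mem hz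
  have z2 : NoDrop b (z - 1) := noDrop_pred_of_mem hz
  have z4 : NoDrop b (-2) := fun h => absurd h (by norm_num)
  have z5 : NoDrop b (z + 1) ∨ z = -1 ∧ ∀ x y, (ket x 0 y : FockSpace (cFAF b)) = 0 := by
    refine or_iff_not_imp_left.2 fun h => ?_
    obtain ⟨h1, rfl⟩ := eq_of_not_noDrop hz h
    exact ⟨h1, fun x y => ket_of_not_adm fun h => absurd h.2.1 (lt_irrefl (0 : ℤ))⟩
  rw [lhsX_eq, rhsX_eq]
  rcases hx with rfl | rfl <;> rcases hy with rfl | rfl <;> rcases z5 with z5 | ⟨rfl, z5⟩ <;>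
    fin_cases i <;> fin_cases j <;>
    simp [z1, z2, z4, z5, LData.toMatrix, LData.bose, LData.fermi, LData.fermiInv, mono_diag_ket,
    RFAF_ket hq hq2, mono_fermi_up_ket_0 (c := cFAF b) rfl,
    mono_fermi_up_ket_zero_0 (c := cFAF b) rfl, mono_fermi_dn_ket_0 (c := cFAF b) rfl,
    mono_fermi_dn_ket_zero_0 (c := cFAF b) rfl, mono_bose_up_ket_1 (c := cFAF b) rfl,
    mono_bose_dn_ket_1 (c := cFAF b) rfl, mono_fermi_up_ket_2 (c := cFAF b) rfl,
    mono_fermi_up_ket_zero_2 (c := cFAF b) rfl, mono_fermi_dn_ket_2 (c := cFAF b) rfl,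
    mono_fermi_dn_ket_zero_2 (c := cFAF b) rfl, smul_sub, smul_add, smul_smul]
  all_goals try simp only [zpow_two_mul_add_two hq, zpow_add_one₀ hq, zpow_sub_one₀ hq, neg_inv_zpow_add_one hq, neg_inv_zpow_sub_one hq]
  all_goals try match_scalars <;> field_simp <;> try ring

/-! ### Uniqueness of the intertwiners with Fermi oscillators -/

/-- An operator commuting with a monomial has the same eigenvalue on both ends of the arrow the
monomial draws between basis vectors. -/
theorem ket_smul_step {S : Op c} {d e g : ℤ} {f : ℤ → ℤ → ℤ → ℂ} (hc : Commute S (mono d e g f))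
    {t : ℂ} {a b k x y z : ℤ} (hS : S (ket a b k) = t • ket a b k) (h : Adm c a b k)
    (hf : f a b k ≠ 0) (h0 : x = a + d) (h1 : y = b + e) (h2 : z = k + g) :
    S (ket x y z) = t • ket x y z := by
  subst h0 h1 h2
  have h1 := LinearMap.congr_fun hc.eq (ket a b k)
  rw [Module.End.mul_apply, Module.End.mul_apply, hS, map_smul, mono_ket _ _ _ _ h, map_smul,
    smul_comm t] at h1
  exact smul_right_injective _ hf h1

theorem ket_ne_zero {a b d : ℤ} (h : Adm c a b d) : (ket a b d : FockSpace c) ≠ 0 := by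
  rw [ket_of_adm h]
  exact Finsupp.single_ne_zero.2 one_ne_zero

/-- Commuting with a diagonal operator means preserving its eigenspaces. -/
theorem apply_eq_of_commute_diag {S : Op c} {f : ℤ → ℤ → ℤ → ℂ} (hc : Commute S (mono 0 0 0 f))
    {a b d : ℤ} (h : Adm c a b d) (n : State c) (hn : S (ket a b d) n ≠ 0) :
    f (n.1 0) (n.1 1) (n.1 2) = f a b d := by
  have h1 := matEl_mul_mono S 0 0 0 f n (mkState a b d h)
  rw [hc.eq, matEl_mono_mul] at h1
  simp only [sub_zero, add_zero, kerExt_state] at h1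
  refine mul_right_cancel₀ ?_ h1
  rwa [matEl, ← ket_of_adm]

/-- A joint eigenvector of two diagonal operators that is determined by its eigenvalues is an
eigenvector of every operator commuting with both of them. -/
theorem exists_smul_of_commute_diag {S : Op c} {f g : ℤ → ℤ → ℤ → ℂ}
    (hf : Commute S (mono 0 0 0 f)) (hg : Commute S (mono 0 0 0 g)) {a b d : ℤ} (h : Adm c a b d)
    (hu : ∀ x y z, Adm c x y z → f x y z = f a b d → g x y z = g a b d → x = a ∧ y = b ∧ z = d) :
    ∃ t : ℂ, S (ket a b d) = t • ket a b d := by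
  classical
  refine ⟨S (ket a b d) (mkState a b d h), Finsupp.ext fun n => ?_⟩
  rw [Finsupp.smul_apply, ket_apply]
  by_cases hn : S (ket a b d) n = 0
  · rw [hn]
    split_ifs with h1
    · rw [(State.ext_iff' n (mkState a b d h)).2 h1] at hn
      rw [hn, zero_smul]
    · rw [smul_zero]
  · have h1 := hu _ _ _ (adm_state n) (apply_eq_of_commute_diag hf h n hn)
      (apply_eq_of_commute_diag hg h n hn)
    rw [if_pos h1, (State.ext_iff' n (mkState a b d h)).2 h1, smul_eq_mul, mul_one]

section

variable {q : ℂ} (hq0 : 0 < ‖q‖) (hq1 : ‖q‖ < 1) {b : BoseRep}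

include hq0 hq1

/-- A Schur argument. The states with both Fermi sites empty are separated from all others by the
eigenvalues of the diagonal entries 00 and 22, so they are eigenvectors of S. The monomial entries
21, 20 and 10 link these states to each other and to all remaining ones, forcing one common
eigenvalue. -/
theorem FFA_eq_smul_one {S : Op (cFFA b)} (h : ∀ i j, Commute S
    (lhsX ((LData.fermiInv q 0 fun _ _ _ => 1).toMatrix 0)
      ((LData.fermiInv q 1 fun a _ _ => (-1) ^ a).toMatrix 1) ((LData.bose q 2).toMatrix 2) i j)) :
    ∃ t : ℂ, S = t • 1 := by
  have hq := norm_pos_iff.1 hq0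
  have hz : ∀ n : ℤ, q ^ n ≠ 0 := fun n => zpow_ne_zero n hq
  have inj : ∀ {m n : ℤ}, q ^ m = q ^ n → m = n := fun h =>
    zpow_injective_of_norm_lt_one hq0 hq1 h
  have c00 := h 0 0
  have c22 := h 2 2
  have c10 := h 1 0
  have c20 := h 2 0
  have c21 := h 2 1
  simp [lhsX_eq, LData.toMatrix, LData.bose, LData.fermiInv, mono_mul_mono]
    at c00 c22 c10 c20 c21
  have m0 : (0 : ℤ) ∈ (Osc.fermi).spectrum := .inl rfl
  have start : ∀ d, Adm (cFFA b) 0 0 d → ∃ t : ℂ, S (ket 0 0 d) = t • ket 0 0 d := fun d hd => by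
    refine exists_smul_of_commute_diag c00 c22 hd fun x y z hxyz e0 e2 => ?_
    have i0 : x + y = 0 := inj <| by
      rw [zpow_add₀ hq]
      field_simp at e0
      simpa using e0
    have i2 : z - y = d := inj <| by
      rw [zpow_sub₀ hq]
      field_simp [hz] at e2 ⊢
      simpa using e2
    obtain ⟨hx, hy, -⟩ := hxyz
    change x = 0 ∨ x = 1 at hx
    change y = 0 ∨ y = 1 at hy
    omega
  obtain ⟨t, ht⟩ := start b.vac ⟨m0, m0, vac_mem b⟩
  have h00 : ∀ d, d ∈ (Osc.bose b).spectrum → S (ket 0 0 d) = t • ket 0 0 d := by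
    refine spectrum_induction ht fun d hd hd' => ?_
    -- The entry used only lowers the Bose site. To go upwards, the eigenvalue at `d + 1`, known to
    -- exist, is transported down to `d` and compared there.
    have s : ∀ s : ℂ, S (ket 0 0 (d + 1)) = s • ket 0 0 (d + 1) → S (ket 0 0 d) = s • ket 0 0 d :=
      fun s hs => ket_smul_step c21 hs ⟨m0, m0, hd'⟩ (by simp) rfl rfl (by ring)
    refine ⟨fun h0 => ?_, s t⟩
    obtain ⟨t', ht'⟩ := start (d + 1) ⟨m0, m0, hd'⟩
    rwa [smul_left_injective ℂ (ket_ne_zero (c := cFFA b) ⟨m0, m0, hd⟩)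
      (h0.symm.trans (s t' ht'))]
  have h01 : ∀ d, d ∈ (Osc.bose b).spectrum → S (ket 0 1 d) = t • ket 0 1 d := fun d hd =>
    ket_smul_step c20 (h00 d hd) ⟨m0, m0, hd⟩ (by simp [hq]) rfl rfl (by ring)
  have h1 : ∀ a d, S (ket 0 a d) = t • ket 0 a d → Adm (cFFA b) 0 a d →
      S (ket 1 a d) = t • ket 1 a d := fun a d ha hd =>
    ket_smul_step c10 ha hd (by simp [hq, hz]) rfl (by ring) (by ring)
  refine ⟨t, Op.ext_ket fun x y z hxyz => ?_⟩
  obtain ⟨hx, hy, hz⟩ := hxyz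
  have h2 : S (ket 0 y z) = t • ket 0 y z := by
    rcases hy with rfl | rfl
    exacts [h00 z hz, h01 z hz]
  rcases hx with rfl | rfl
  exacts [h2, h1 y z h2 ⟨m0, hy, hz⟩]

theorem AFF_eq_smul_one {S : Op (cAFF b)} (h : ∀ i j, Commute S
    (lhsX ((LData.bose q 0).toMatrix 0) ((LData.fermi q 1 fun _ _ _ => 1).toMatrix 1)
      ((LData.fermi q 2 fun _ b _ => (-1) ^ b).toMatrix 2) i j)) :
    ∃ t : ℂ, S = t • 1 := by
  have hq := norm_pos_iff.1 hq0
  have hq2 : 1 - q ^ 2 ≠ 0 := by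
    exact_mod_cast one_sub_zpow_ne_zero hq0 hq1 (two_ne_zero (α := ℤ))
  have hz : ∀ n : ℤ, q ^ n ≠ 0 := fun n => zpow_ne_zero n hq
  have inj : ∀ {m n : ℤ}, q ^ m = q ^ n → m = n := fun h =>
    zpow_injective_of_norm_lt_one hq0 hq1 h
  have c00 := h 0 0
  have c22 := h 2 2
  have c10 := h 1 0
  have c20 := h 2 0
  have c21 := h 2 1
  simp [lhsX_eq, LData.toMatrix, LData.bose, LData.fermi, mono_mul_mono]
    at c00 c22 c10 c20 c21
  have m1 : (1 : ℤ) ∈ (Osc.fermi).spectrum := .inr rfl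
  -- In this pattern the monomial entries lower the Fermi sites, so the argument starts from both
  -- being filled: N₂ + N₃ = 2 leaves no other choice.
  have start : ∀ d, Adm (cAFF b) d 1 1 → ∃ t : ℂ, S (ket d 1 1) = t • ket d 1 1 := fun d hd => by
    refine exists_smul_of_commute_diag c00 c22 hd fun x y z hxyz e0 e2 => ?_
    have i0 : x + y = d + 1 := inj <| by
      rw [zpow_add₀ hq, zpow_add₀ hq]
      exact e0
    have i2 : y + z = 2 := inj <| by
      rw [zpow_add₀ hq]
      field_simp [hz] at e2
      rw [← e2]
      simp
      try ring
    obtain ⟨-, hy, hz⟩ := hxyz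
    change y = 0 ∨ y = 1 at hy
    change z = 0 ∨ z = 1 at hz
    omega
  obtain ⟨t, ht⟩ := start b.vac ⟨vac_mem b, m1, m1⟩
  have h11 : ∀ d, d ∈ (Osc.bose b).spectrum → S (ket d 1 1) = t • ket d 1 1 := by
    refine spectrum_induction ht fun d hd hd' => ?_
    have s : ∀ s : ℂ, S (ket (d + 1) 1 1) = s • ket (d + 1) 1 1 → S (ket d 1 1) = s • ket d 1 1 :=
      fun s hs => ket_smul_step c10 hs ⟨hd', m1, m1⟩ (by simp [hq]) (by ring) rfl rfl
    refine ⟨fun h0 => ?_, s t⟩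
    obtain ⟨t', ht'⟩ := start (d + 1) ⟨hd', m1, m1⟩
    rwa [smul_left_injective ℂ (ket_ne_zero (c := cAFF b) ⟨hd, m1, m1⟩)
      (h0.symm.trans (s t' ht'))]
  have h01 : ∀ d, d ∈ (Osc.bose b).spectrum → S (ket d 0 1) = t • ket d 0 1 := fun d hd =>
    ket_smul_step c20 (h11 d hd) ⟨hd, m1, m1⟩ hq2 (by ring) rfl rfl
  have h1 : ∀ d a, S (ket d a 1) = t • ket d a 1 → Adm (cAFF b) d a 1 →
      S (ket d a 0) = t • ket d a 0 := fun d a ha hd =>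
    ket_smul_step c21 ha hd (by simp [hq, hq2, zpow_ne_zero]) (by ring) (by ring) rfl
  refine ⟨t, Op.ext_ket fun x y z hxyz => ?_⟩
  obtain ⟨hx, hy, hz⟩ := hxyz
  have h2 : S (ket x y 1) = t • ket x y 1 := by
    rcases hy with rfl | rfl
    exacts [h01 x hx, h11 x hx]
  rcases hz with rfl | rfl
  exacts [h1 x y h2 ⟨hx, hy, m1⟩, h2]

theorem FAF_eq_smul_one {S : Op (cFAF b)} (h : ∀ i j, Commute S
    (lhsX ((LData.fermi q 0 fun _ _ _ => 1).toMatrix 0) ((LData.bose q 1).toMatrix 1)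
      ((LData.fermiInv q 2 fun a _ _ => (-1) ^ a).toMatrix 2) i j)) :
    ∃ t : ℂ, S = t • 1 := by
  have hq := norm_pos_iff.1 hq0
  have hz : ∀ n : ℤ, q ^ n ≠ 0 := fun n => zpow_ne_zero n hq
  have inj : ∀ {m n : ℤ}, q ^ m = q ^ n → m = n := fun h =>
    zpow_injective_of_norm_lt_one hq0 hq1 h
  have c00 := h 0 0
  have c22 := h 2 2
  have c01 := h 0 1
  have c20 := h 2 0
  have c21 := h 2 1
  simp [lhsX_eq, LData.toMatrix, LData.bose, LData.fermi, LData.fermiInv, mono_mul_mono]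
    at c00 c22 c01 c20 c21
  have m0 : (0 : ℤ) ∈ (Osc.fermi).spectrum := .inl rfl
  have start : ∀ d, Adm (cFAF b) 0 d 0 → ∃ t : ℂ, S (ket 0 d 0) = t • ket 0 d 0 := fun d hd => by
    refine exists_smul_of_commute_diag c00 c22 hd fun x y z hxyz e0 e2 => ?_
    have i0 : x + y = d := inj <| by
      rw [zpow_add₀ hq]
      simpa using e0
    have i2 : y - z = d := inj <| by
      rw [zpow_sub₀ hq]
      field_simp [hz] at e2 ⊢
      simpa using e2
    obtain ⟨hx, -, hz⟩ := hxyz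
    change x = 0 ∨ x = 1 at hx
    change z = 0 ∨ z = 1 at hz
    omega
  obtain ⟨t, ht⟩ := start b.vac ⟨m0, vac_mem b, m0⟩
  have h00 : ∀ d, d ∈ (Osc.bose b).spectrum → S (ket 0 d 0) = t • ket 0 d 0 := by
    refine spectrum_induction ht fun d hd hd' => ?_
    have s : ∀ s : ℂ, S (ket 0 (d + 1) 0) = s • ket 0 (d + 1) 0 → S (ket 0 d 0) = s • ket 0 d 0 :=
      fun s hs => ket_smul_step c20 hs ⟨m0, hd', m0⟩ one_ne_zero rfl (by ring) rfl
    refine ⟨fun h0 => ?_, s t⟩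
    obtain ⟨t', ht'⟩ := start (d + 1) ⟨m0, hd', m0⟩
    rwa [smul_left_injective ℂ (ket_ne_zero (c := cFAF b) ⟨m0, hd, m0⟩)
      (h0.symm.trans (s t' ht'))]
  have h1 : ∀ a d, S (ket a d 0) = t • ket a d 0 → Adm (cFAF b) a d 0 →
      S (ket a d 1) = t • ket a d 1 := fun a d ha hd =>
    ket_smul_step c21 ha hd (by simp [hq, zpow_ne_zero]) (by ring) (by ring) rfl
  have h01 : ∀ d, S (ket 0 d 1) = t • ket 0 d 1 := fun d => by
    by_cases hd : Adm (cFAF b) 0 d 1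
    · exact h1 0 d (h00 d hd.2.1) ⟨m0, hd.2.1, m0⟩
    · rw [ket_of_not_adm hd, map_zero, smul_zero]
  -- The first site is raised only inside entries with two terms. The other term of the entry 01
  -- leads to `ket 0 (d + 1) 1`, where the eigenvalue is already known, so it cancels.
  have h10 : ∀ d, d ∈ (Osc.bose b).spectrum → S (ket 1 d 0) = t • ket 1 d 0 := fun d hd => by
    have e := LinearMap.congr_fun c01.eq (ket 0 d 0)
    rw [Module.End.mul_apply, Module.End.mul_apply, h00 d hd, map_smul, LinearMap.add_apply,
      mono_ket _ _ _ _ ⟨m0, hd, m0⟩, mono_ket _ _ _ _ ⟨m0, hd, m0⟩] at e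
    simp only [zero_add, add_zero, map_add, map_smul, h01, smul_add, smul_comm t] at e
    exact smul_right_injective _ (by simp [hq]) (add_right_cancel e)
  refine ⟨t, Op.ext_ket fun x y z hxyz => ?_⟩
  obtain ⟨hx, hy, hz⟩ := hxyz
  have h2 : S (ket x y 0) = t • ket x y 0 := by
    rcases hx with rfl | rfl
    exacts [h00 y hy, h10 y hy]
  rcases hz with rfl | rfl
  exacts [h2, h1 x y h2 ⟨hx, hy, m0⟩]

end

/-! ### The dressed operators -/

theorem pw_inv_mul {x : ℂ} (hx : x ≠ 0) (j : Fin 3) : (pw x⁻¹ j * pw x j : Op c) = 1 := by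
  refine Op.ext_ket fun a b d _ => ?_
  rw [pw_eq_mono, pw_eq_mono, Module.End.mul_apply, mono_diag_ket, map_smul, mono_diag_ket,
    smul_smul, ← mul_zpow, mul_inv_cancel₀ hx, one_zpow, one_smul, Module.End.one_apply]

theorem pw_mul_inv {x : ℂ} (hx : x ≠ 0) (j : Fin 3) : (pw x j * pw x⁻¹ j : Op c) = 1 := by
  simpa using pw_inv_mul (c := c) (inv_ne_zero hx) j

/-- The diagonal dressing operators are invertible, so an arbitrary intertwiner is the dressing of a
constant one. -/
theorem exists_eq_dress {lam mu : Fin 3 → ℂ} (hl : ∀ j, lam j ≠ 0) (hm : ∀ j, mu j ≠ 0)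
    (s : Fin 3 → ℤ) (R' : Op c) : ∃ R, R' = dress lam mu s R := by
  have hu := zpow_ne_zero (s 0) (div_ne_zero (hl 2) (hl 1))
  have hv := zpow_ne_zero (s 1) (mul_ne_zero (hl 0) (hm 2))
  have hw := zpow_ne_zero (s 2) (div_ne_zero (hm 0) (hm 1))
  refine ⟨pw ((lam 0 * mu 2) ^ s 1)⁻¹ 1 * R' * pw ((mu 0 / mu 1) ^ s 2)⁻¹ 2 *
    pw ((lam 2 / lam 1) ^ s 0)⁻¹ 0, ?_⟩
  calc R' = (pw ((lam 0 * mu 2) ^ s 1) 1 * pw ((lam 0 * mu 2) ^ s 1)⁻¹ 1) * R' *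
        (pw ((mu 0 / mu 1) ^ s 2)⁻¹ 2 * (pw ((lam 2 / lam 1) ^ s 0)⁻¹ 0 *
          pw ((lam 2 / lam 1) ^ s 0) 0) * pw ((mu 0 / mu 1) ^ s 2) 2) := by
        rw [pw_mul_inv hv, pw_inv_mul hu, mul_one, pw_inv_mul hw, one_mul, mul_one]
    _ = _ := by simp only [dress, mul_assoc]

theorem dress_smul (lam mu : Fin 3 → ℂ) (s : Fin 3 → ℤ) (t : ℂ) (R : Op c) :
    dress lam mu s (t • R) = t • dress lam mu s R := by
  simp only [dress, mul_smul_comm, smul_mul_assoc]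

theorem intertwines_dress_iff (X Y Z : LData) (R : Op c) {lam mu : Fin 3 → ℂ}
    (hl : ∀ j, lam j ≠ 0) (hm : ∀ j, mu j ≠ 0) (s : Fin 3 → ℤ) (h0 : s 0 = X.s) (h1 : s 1 = Y.s)
    (h2 : s 2 = Z.s) (hX : X.s * X.s = 1) (hY : Y.s * Y.s = 1) (hZ : Z.s * Z.s = 1) :
    Intertwines ((X.scale (lam 0) (mu 0)).toMatrix 0) ((Y.scale (lam 1) (mu 1)).toMatrix 1)
      ((Z.scale (lam 2) (mu 2)).toMatrix 2) (dress lam mu s R) ↔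
    Intertwines (X.toMatrix 0) (Y.toMatrix 1) (Z.toMatrix 2) R := by
  rw [intertwines_iff, matEl_dress, kernelIntertwines_dress_iff X Y Z _ hl hm s h0 h1 h2 hX hY hZ,
    intertwines_one_iff]

/-- If only scalars commute with the entries of the intertwining relation of an involutive
intertwiner, then it is unique up to a factor, also after dressing. -/
theorem dress_unique {X Y Z : LData} {R : Op c} (hR : R * R = 1)
    (hi : Intertwines (X.toMatrix 0) (Y.toMatrix 1) (Z.toMatrix 2) R)
    (hs : ∀ S : Op c, (∀ i j, Commute S (lhsX (X.toMatrix 0) (Y.toMatrix 1) (Z.toMatrix 2) i j)) →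
      ∃ t : ℂ, S = t • 1)
    {lam mu : Fin 3 → ℂ} (hl : ∀ j, lam j ≠ 0) (hm : ∀ j, mu j ≠ 0) (s : Fin 3 → ℤ)
    (h0 : s 0 = X.s) (h1 : s 1 = Y.s) (h2 : s 2 = Z.s) (hX : X.s * X.s = 1) (hY : Y.s * Y.s = 1)
    (hZ : Z.s * Z.s = 1) (R' : Op c)
    (h : Intertwines ((X.scale (lam 0) (mu 0)).toMatrix 0) ((Y.scale (lam 1) (mu 1)).toMatrix 1)
      ((Z.scale (lam 2) (mu 2)).toMatrix 2) R') :
    ∃ a : ℂ, R' = a • dress lam mu s R := by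
  obtain ⟨T, rfl⟩ := exists_eq_dress hl hm s R'
  rw [intertwines_dress_iff X Y Z T hl hm s h0 h1 h2 hX hY hZ] at h
  obtain ⟨t, ht⟩ := hs (T * R) (commute_of_intertwines hR hi h)
  refine ⟨t, ?_⟩
  rw [← dress_smul, ← mul_one T, ← hR, ← mul_assoc, ht, smul_mul_assoc, one_mul]

section

variable {q : ℂ} (hq0 : 0 < ‖q‖) (hq1 : ‖q‖ < 1) (b : BoseRep) {lam mu : Fin 3 → ℂ}
  (hl : ∀ j, lam j ≠ 0) (hm : ∀ j, mu j ≠ 0)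

include hq0 hq1 hl hm

theorem dress_RFFA :
    (Intertwines (XF' q (lam 0) (mu 0) 0) (XF' q (lam 1) (mu 1) 1) (XA q (lam 2) (mu 2) 2)
        (dress lam mu ![-1, -1, 1] (RFFA q b)) ∧
      ∀ R' : Op (cFFA b),
        Intertwines (XF' q (lam 0) (mu 0) 0) (XF' q (lam 1) (mu 1) 1) (XA q (lam 2) (mu 2) 2) R' →
        ∃ a : ℂ, R' = a • dress lam mu ![-1, -1, 1] (RFFA q b)) ∧
    Intertwines (XF q (lam 0) (mu 0) 0) (XF q (lam 1) (mu 1) 1) (XA' q (lam 2) (mu 2) 2)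
      (dress lam mu ![1, 1, -1] (RFFA q b)) := by
  have hq := norm_pos_iff.1 hq0
  have hq2 : 1 - q ^ 2 ≠ 0 := by
    exact_mod_cast one_sub_zpow_ne_zero hq0 hq1 (two_ne_zero (α := ℤ))
  have hR := RFFA_mul_self hq hq2 b
  have hi := RFFA_intertwines hq hq2 b
  have hi' := (transposeRel_FFA hq).intertwines hR hi
  rw [XF'_eq q _ _ (c := cFFA b) (j := 0) rfl (ε := fun _ _ _ => 1) oddSign_zero,
    XF'_eq q _ _ (c := cFFA b) (j := 1) rfl (ε := fun a _ _ => (-1) ^ a) oddSign_FFA_one,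
    XA_eq q _ _ (c := cFFA b) (j := 2) rfl,
    XF_eq q _ _ (c := cFFA b) (j := 0) rfl (ε := fun _ _ _ => 1) oddSign_zero,
    XF_eq q _ _ (c := cFFA b) (j := 1) rfl (ε := fun a _ _ => (-1) ^ a) oddSign_FFA_one,
    XA'_eq q _ _ (c := cFFA b) (j := 2) rfl]
  exact ⟨⟨(intertwines_dress_iff _ _ _ _ hl hm _ rfl rfl rfl rfl rfl rfl).2 hi,
    dress_unique hR hi (fun _ => FFA_eq_smul_one hq0 hq1) hl hm _ rfl rfl rfl rfl rfl rfl⟩,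
    (intertwines_dress_iff _ _ _ _ hl hm _ rfl rfl rfl rfl rfl rfl).2 hi'⟩

theorem dress_RAFF :
    (Intertwines (XA q (lam 0) (mu 0) 0) (XF q (lam 1) (mu 1) 1) (XF q (lam 2) (mu 2) 2)
        (dress lam mu ![1, 1, 1] (RAFF q b)) ∧
      ∀ R' : Op (cAFF b),
        Intertwines (XA q (lam 0) (mu 0) 0) (XF q (lam 1) (mu 1) 1) (XF q (lam 2) (mu 2) 2) R' →
        ∃ a : ℂ, R' = a • dress lam mu ![1, 1, 1] (RAFF q b)) ∧
    Intertwines (XA' q (lam 0) (mu 0) 0) (XF' q (lam 1) (mu 1) 1) (XF' q (lam 2) (mu 2) 2)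
      (dress lam mu ![-1, -1, -1] (RAFF q b)) := by
  have hq := norm_pos_iff.1 hq0
  have hq2 : 1 - q ^ 2 ≠ 0 := by
    exact_mod_cast one_sub_zpow_ne_zero hq0 hq1 (two_ne_zero (α := ℤ))
  have hR := RAFF_mul_self hq hq2 b
  have hi := RAFF_intertwines hq hq2 b
  have hi' := (transposeRel_AFF hq).intertwines hR hi
  rw [XA_eq q _ _ (c := cAFF b) (j := 0) rfl,
    XF_eq q _ _ (c := cAFF b) (j := 1) rfl (ε := fun _ _ _ => 1) oddSign_AFF_one,
    XF_eq q _ _ (c := cAFF b) (j := 2) rfl (ε := fun _ b _ => (-1) ^ b) oddSign_AFF_two,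
    XA'_eq q _ _ (c := cAFF b) (j := 0) rfl,
    XF'_eq q _ _ (c := cAFF b) (j := 1) rfl (ε := fun _ _ _ => 1) oddSign_AFF_one,
    XF'_eq q _ _ (c := cAFF b) (j := 2) rfl (ε := fun _ b _ => (-1) ^ b) oddSign_AFF_two]
  exact ⟨⟨(intertwines_dress_iff _ _ _ _ hl hm _ rfl rfl rfl rfl rfl rfl).2 hi,
    dress_unique hR hi (fun _ => AFF_eq_smul_one hq0 hq1) hl hm _ rfl rfl rfl rfl rfl rfl⟩,
    (intertwines_dress_iff _ _ _ _ hl hm _ rfl rfl rfl rfl rfl rfl).2 hi'⟩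

theorem dress_RFAF :
    (Intertwines (XF q (lam 0) (mu 0) 0) (XA q (lam 1) (mu 1) 1) (XF' q (lam 2) (mu 2) 2)
        (dress lam mu ![1, 1, -1] (RFAF q b)) ∧
      ∀ R' : Op (cFAF b),
        Intertwines (XF q (lam 0) (mu 0) 0) (XA q (lam 1) (mu 1) 1) (XF' q (lam 2) (mu 2) 2) R' →
        ∃ a : ℂ, R' = a • dress lam mu ![1, 1, -1] (RFAF q b)) ∧
    Intertwines (XF' q (lam 0) (mu 0) 0) (XA' q (lam 1) (mu 1) 1) (XF q (lam 2) (mu 2) 2)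
      (dress lam mu ![-1, -1, 1] (RFAF q b)) := by
  have hq := norm_pos_iff.1 hq0
  have hq2 : 1 - q ^ 2 ≠ 0 := by
    exact_mod_cast one_sub_zpow_ne_zero hq0 hq1 (two_ne_zero (α := ℤ))
  have hR := RFAF_mul_self hq hq2 b
  have hi := RFAF_intertwines hq hq2 b
  have hi' := (transposeRel_FAF hq).intertwines hR hi
  rw [XF_eq q _ _ (c := cFAF b) (j := 0) rfl (ε := fun _ _ _ => 1) oddSign_zero,
    XA_eq q _ _ (c := cFAF b) (j := 1) rfl,
    XF'_eq q _ _ (c := cFAF b) (j := 2) rfl (ε := fun a _ _ => (-1) ^ a) oddSign_FAF_two,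
    XF'_eq q _ _ (c := cFAF b) (j := 0) rfl (ε := fun _ _ _ => 1) oddSign_zero,
    XA'_eq q _ _ (c := cFAF b) (j := 1) rfl,
    XF_eq q _ _ (c := cFAF b) (j := 2) rfl (ε := fun a _ _ => (-1) ^ a) oddSign_FAF_two]
  exact ⟨⟨(intertwines_dress_iff _ _ _ _ hl hm _ rfl rfl rfl rfl rfl rfl).2 hi,
    dress_unique hR hi (fun _ => FAF_eq_smul_one hq0 hq1) hl hm _ rfl rfl rfl rfl rfl rfl⟩,
    (intertwines_dress_iff _ _ _ _ hl hm _ rfl rfl rfl rfl rfl rfl).2 hi'⟩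

end

end Tetra

end

/-! ### The theorem, assembled from the bosonic and the fermionic cases. -/

theorem mainTheorem3 (q : ℂ) (hq0 : 0 < ‖q‖) (hq1 : ‖q‖ < 1) :
    -- three Bose oscillators, in any choice of the two representations
    (∀ r : Fin 3 → BoseRep,
      (∃ Rk : ℕ → State (Tetra.cAAA r) → ℂ, Tetra.GenFun₁ q Rk) ∧
      ∀ Rk : ℕ → State (Tetra.cAAA r) → ℂ,
        (Tetra.GenFun₁ q Rk ↔ Tetra.GenFun₂ q Rk) ∧
        (Tetra.GenFun₂ q Rk ↔ Tetra.GenFun₃ q Rk) ∧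
        (Tetra.GenFun₁ q Rk →
          ((r 1 = r 0 ∨ r 1 = r 2) → Tetra.KernelSqOne (Tetra.kernelAAA q r Rk)) ∧
          ∀ lam mu : Fin 3 → ℂ, (∀ j, lam j ≠ 0) → (∀ j, mu j ≠ 0) →
            (Tetra.KernelIntertwines (Tetra.XA q (lam 0) (mu 0) 0)
                (Tetra.XA q (lam 1) (mu 1) 1) (Tetra.XA q (lam 2) (mu 2) 2)
                (Tetra.dressKernel lam mu ![1, 1, 1] (Tetra.kernelAAA q r Rk)) ∧
              ∀ R' : State (Tetra.cAAA r) → State (Tetra.cAAA r) → ℂ,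
                Tetra.KernelIntertwines (Tetra.XA q (lam 0) (mu 0) 0)
                  (Tetra.XA q (lam 1) (mu 1) 1) (Tetra.XA q (lam 2) (mu 2) 2) R' →
                ∃ a : ℂ, R' =
                  a • Tetra.dressKernel lam mu ![1, 1, 1] (Tetra.kernelAAA q r Rk)) ∧
            Tetra.KernelIntertwines (Tetra.XA' q (lam 0) (mu 0) 0)
              (Tetra.XA' q (lam 1) (mu 1) 1) (Tetra.XA' q (lam 2) (mu 2) 2)
              (Tetra.dressKernel lam mu ![-1, -1, -1] (Tetra.kernelAAA q r Rk)))) ∧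
    -- one Bose oscillator, in either representation, and two Fermi oscillators
    (∀ b : BoseRep,
      (Tetra.RFFA q b * Tetra.RFFA q b = 1 ∧ Tetra.RAFF q b * Tetra.RAFF q b = 1 ∧
        Tetra.RFAF q b * Tetra.RFAF q b = 1) ∧
      ∀ lam mu : Fin 3 → ℂ, (∀ j, lam j ≠ 0) → (∀ j, mu j ≠ 0) →
        (Tetra.Intertwines (Tetra.XF' q (lam 0) (mu 0) 0) (Tetra.XF' q (lam 1) (mu 1) 1)
            (Tetra.XA q (lam 2) (mu 2) 2)
            (Tetra.dress lam mu ![-1, -1, 1] (Tetra.RFFA q b)) ∧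
          ∀ R' : Op (Tetra.cFFA b),
            Tetra.Intertwines (Tetra.XF' q (lam 0) (mu 0) 0) (Tetra.XF' q (lam 1) (mu 1) 1)
              (Tetra.XA q (lam 2) (mu 2) 2) R' →
            ∃ a : ℂ, R' = a • Tetra.dress lam mu ![-1, -1, 1] (Tetra.RFFA q b)) ∧
        Tetra.Intertwines (Tetra.XF q (lam 0) (mu 0) 0) (Tetra.XF q (lam 1) (mu 1) 1)
          (Tetra.XA' q (lam 2) (mu 2) 2)
          (Tetra.dress lam mu ![1, 1, -1] (Tetra.RFFA q b)) ∧
        (Tetra.Intertwines (Tetra.XA q (lam 0) (mu 0) 0) (Tetra.XF q (lam 1) (mu 1) 1)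
            (Tetra.XF q (lam 2) (mu 2) 2)
            (Tetra.dress lam mu ![1, 1, 1] (Tetra.RAFF q b)) ∧
          ∀ R' : Op (Tetra.cAFF b),
            Tetra.Intertwines (Tetra.XA q (lam 0) (mu 0) 0) (Tetra.XF q (lam 1) (mu 1) 1)
              (Tetra.XF q (lam 2) (mu 2) 2) R' →
            ∃ a : ℂ, R' = a • Tetra.dress lam mu ![1, 1, 1] (Tetra.RAFF q b)) ∧
        Tetra.Intertwines (Tetra.XA' q (lam 0) (mu 0) 0) (Tetra.XF' q (lam 1) (mu 1) 1)
          (Tetra.XF' q (lam 2) (mu 2) 2)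
          (Tetra.dress lam mu ![-1, -1, -1] (Tetra.RAFF q b)) ∧
        (Tetra.Intertwines (Tetra.XF q (lam 0) (mu 0) 0) (Tetra.XA q (lam 1) (mu 1) 1)
            (Tetra.XF' q (lam 2) (mu 2) 2)
            (Tetra.dress lam mu ![1, 1, -1] (Tetra.RFAF q b)) ∧
          ∀ R' : Op (Tetra.cFAF b),
            Tetra.Intertwines (Tetra.XF q (lam 0) (mu 0) 0) (Tetra.XA q (lam 1) (mu 1) 1)
              (Tetra.XF' q (lam 2) (mu 2) 2) R' →
            ∃ a : ℂ, R' = a • Tetra.dress lam mu ![1, 1, -1] (Tetra.RFAF q b)) ∧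
        Tetra.Intertwines (Tetra.XF' q (lam 0) (mu 0) 0) (Tetra.XA' q (lam 1) (mu 1) 1)
          (Tetra.XF q (lam 2) (mu 2) 2)
          (Tetra.dress lam mu ![-1, -1, 1] (Tetra.RFAF q b))) := by
  refine ⟨fun r => ⟨Tetra.exists_genFun₁ hq0 hq1 r, fun Rk =>
    ⟨Tetra.genFun₁_iff_genFun₂ hq0 hq1 Rk, Tetra.genFun₂_iff_genFun₃ hq0 hq1 Rk, fun h =>
      ⟨Tetra.kernelSqOne_kernelAAA hq0 hq1 h, fun lam mu hl hm => ?_⟩⟩⟩, fun b => ?_⟩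
  · obtain ⟨h1, h2⟩ := Tetra.rels_of_genFun₁ hq0 hq1 h
    exact ⟨⟨(Tetra.XA_dress_iff hl hm _).2 h1, Tetra.kernelAAA_unique hq0 hq1 h hl hm⟩,
      (Tetra.XA'_dress_iff hl hm _).2 h2⟩
  · have hq := norm_pos_iff.1 hq0
    have hq2 : 1 - q ^ 2 ≠ 0 := by
      exact_mod_cast Tetra.one_sub_zpow_ne_zero hq0 hq1 (two_ne_zero (α := ℤ))
    refine ⟨⟨Tetra.RFFA_mul_self hq hq2 b, Tetra.RAFF_mul_self hq hq2 b,
      Tetra.RFAF_mul_self hq hq2 b⟩, fun lam mu hl hm => ?_⟩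
    obtain ⟨h1, h2⟩ := Tetra.dress_RFFA hq0 hq1 b hl hm
    obtain ⟨h3, h4⟩ := Tetra.dress_RAFF hq0 hq1 b hl hm
    obtain ⟨h5, h6⟩ := Tetra.dress_RFAF hq0 hq1 b hl hm
    exact ⟨h1, h2, h3, h4, h5, h6⟩
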